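/- Let $k$ be a perfect field with $\operatorname{char} k\neq 2$. Let $WCor_k$ be the category whose objects are the smooth affine $k$-varieties and whose morphisms are $WCor_k(X,Y)=W(\mathrm{Proj}(X,Y))$, the Witt group of the exact category with duality $\mathrm{Hom}_{k[X]}(-,k[X])$ of $k[X\times Y]$-modules that are finitely generated projective over $k[X]$; the composition is given by the tensor product, the identity of $X$ by the diagonal with the unit form. Let $PreWtr$ be the abelian category of presheaves of abelian groups on $WCor_k$ that are additive on disjoint unions, and let $D^-(PreWtr)$ be its derived category of bounded above complexes. Write $\mathbb Z(X)$ for the presheaf represented by $X$. For a presheaf $F$ let $p\colon F\to F(-\times\mathbb A^1)$ be induced by the projection and let $s_0,s_1\colon F(-\times\mathbb A^1)\to F$ be induced by the zero and unit sections; $F$ is homotopy invariant if $p$ is an isomorphism, and $\mathbb A^1$-contractible if there is $h\colon F\to F(-\times\mathbb A^1)$ with $s_0h=\mathrm{id}_F$, $s_1h=0$. Let $\Delta^i=\operatorname{Spec} k[x_0,\dots,x_i]/(x_0+\dots+x_i-1)$. For a complex $K$ let $C^*(K)$ be the Suslin complex, i.e. the direct sum total complex of the bicomplex $K^q(-\times\Delta^i)$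 ($F(-\times\Delta^i)$ is placed in cohomological degree $-i$, with the alternating sum of the faces as differential), and let $\epsilon_K\colon K\to C^*(K)$ be the canonical morphism given by $K^q\cong K^q(-\times\Delta^0)$. Let $D^-_{contr}\subset D^-(PreWtr)$ be the full subcategory of the objects isomorphic to bounded above complexes of $\mathbb A^1$-contractible presheaves, and $D^-_{inv}\subset D^-(PreWtr)$ the full subcategory of the complexes with homotopy invariant cohomology presheaves. 1. $D^-_{contr}$ and $D^-_{inv}$ are triangulated subcategories and form a semi-orthogonal decomposition of $D^-(PreWtr)$: $\mathrm{Hom}(B,A)=0$ for all $B\in D^-_{contr}$, $A\in D^-_{inv}$, and every object $C$ lies in a distinguished triangle $B\to C\to A\to B[1]$ with $B\in D^-_{contr}$ and $A\in D^-_{inv}$. 2. The projection to $D^-_{inv}$ is given by the Suslin complex: the inclusion $D^-_{inv}\to D^-(PreWtr)$ has a left adjoint $L$, the functors $K\mapsto L(K)$ and $K\mapsto C^*(K)$ on bounded above complexes (with values in the derived category) are naturally isomorphic, and this isomorphism identifies the unit $K\to L(K)$ of the adjunction with $\epsilon_K\colon K\to C^*(K)$. For every bounded above complex $K$ there is a distinguished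 triangle $B\to K\xrightarrow{\epsilon_K} C^*(K)\to B[1]$ with $B\in D^-_{contr}$. 3. $D^-_{inv}$ is generated by the homotopy invariant presheaves placed in degree $0$, in the following sense: the smallest strictly full triangulated subcategory of $D^-(PreWtr)$ containing them is the subcategory of the objects of $D^-_{inv}$ with bounded cohomology, and $D^-_{inv}$ is the smallest strictly full triangulated subcategory that contains them and is closed under all small products that exist in $D^-(PreWtr)$. 4. $D^-_{contr}$ is generated by the presheaves $\mathbb Z(\mathbb A^1\times X)/\mathbb Z(X)$ (cokernel of the zero section), $X$ smooth affine, placed in degree $0$: it is the smallest strictly full triangulated subcategory of $D^-(PreWtr)$ that contains them and is closed under all small direct sums that exist in $D^-(PreWtr)$. -/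

import Mathlib

universe u w

namespace WittMotives

open TensorProduct

/-- A quadratic space in `Proj(X, Y)`, where `X = Spec A` and `Y = Spec B`: a `k[X × Y]`-module `P`
(given by commuting actions of `A` and `B` which agree on `k`), finitely generated and projective
over `A`, with a `k[X × Y]`-linear symmetric isomorphism `P ≃ Hom_A(P, A)`, given by the
corresponding `A`-bilinear form. -/
structure QSpace (k A B : Type u) [Field k] [CommRing A] [CommRing B] [Algebra k A]
    [Algebra k B] where
  carrier : Type u
  [addCommGroup : AddCommGroup carrier]
  [modK : Module k carrier]
  [modA : Module A carrier]
  [modB : Module B carrier]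
  [towerA : IsScalarTower k A carrier]
  [towerB : IsScalarTower k B carrier]
  [smulComm : SMulCommClass A B carrier]
  [finite : Module.Finite A carrier]
  [projective : Module.Projective A carrier]
  form : carrier →ₗ[A] carrier →ₗ[A] A
  form_symm : ∀ x y, form x y = form y x
  form_smul : ∀ (b : B) (x y : carrier), form (b • x) y = form x (b • y)
  bijective : Function.Bijective form

namespace QSpace

instance (k A B : Type u) [Field k] [CommRing A] [CommRing B] [Algebra k A] [Algebra k B] :
    CoeSort (QSpace k A B) (Type u) := ⟨carrier⟩

attribute [instance] addCommGroup modK modA modB towerA towerB smulComm finite projective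

section

variable {k A B C D : Type u} [Field k] [CommRing A] [CommRing B] [CommRing C] [CommRing D]
  [Algebra k A] [Algebra k B] [Algebra k C] [Algebra k D]

theorem eq_zero_of_form (P : QSpace k A B) {x : P} (h : ∀ y, P.form x y = 0) : x = 0 :=
  P.bijective.1 (by ext y; simp [h y])

theorem exists_dual (P : QSpace k A B) :
    ∃ (n : ℕ) (e e' : Fin n → P), ∀ x, ∑ i, P.form x (e' i) • e i = x := by
  obtain ⟨n, f, hf⟩ := Module.Finite.exists_fin' A P
  obtain ⟨g, hg⟩ := Module.projective_lifting_property f LinearMap.id hf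
  choose e' he' using fun i => P.bijective.2 ((LinearMap.proj i).comp g)
  refine ⟨n, fun i => f (Pi.single i 1), e', fun x => ?_⟩
  have : ∀ i, P.form x (e' i) = g x i := fun i => by
    rw [P.form_symm, he']; rfl
  simp_rw [this]
  conv_rhs => rw [← LinearMap.id_apply (R := A) x, ← hg, LinearMap.comp_apply,
    pi_eq_sum_univ' (g x), map_sum]
  refine Finset.sum_congr rfl fun i _ => ?_
  rw [← map_smul]

theorem finite_of_dual {M : Type u} [AddCommGroup M] [Module A M] (form : M →ₗ[A] M →ₗ[A] A)
    {n : Type} [Fintype n] (e e' : n → M) (h : ∀ x, ∑ i, form x (e' i) • e i = x) :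
    Module.Finite A M := by
  refine Module.Finite.of_surjective
    (Fintype.linearCombination A e) fun x => ⟨fun i => form x (e' i), ?_⟩
  rw [Fintype.linearCombination_apply]
  exact h x

theorem projective_of_dual {M : Type u} [AddCommGroup M] [Module A M]
    (form : M →ₗ[A] M →ₗ[A] A)
    {n : Type} [Fintype n] (e e' : n → M) (h : ∀ x, ∑ i, form x (e' i) • e i = x) :
    Module.Projective A M := by
  refine Module.Projective.of_split
    (LinearMap.pi fun i => form.flip (e' i)) (Fintype.linearCombination A e) ?_
  ext x
  simp only [LinearMap.comp_apply, Fintype.linearCombination_apply, LinearMap.pi_apply,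
    LinearMap.flip_apply, LinearMap.id_apply]
  exact h x

theorem bijective_of_dual {M : Type u} [AddCommGroup M] [Module A M]
    (form : M →ₗ[A] M →ₗ[A] A) (hs : ∀ x y, form x y = form y x)
    {n : Type} [Fintype n] (e e' : n → M) (h : ∀ x, ∑ i, form x (e' i) • e i = x) :
    Function.Bijective form := by
  constructor
  · rw [injective_iff_map_eq_zero]
    intro x hx
    rw [← h x]
    simp [hx]
  · intro f
    refine ⟨∑ i, f (e i) • e' i, ?_⟩
    ext x
    conv_rhs => rw [← h x]
    simp only [map_sum, map_smul, LinearMap.sum_apply, LinearMap.smul_apply, smul_eq_mul]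
    refine Finset.sum_congr rfl fun i _ => ?_
    rw [hs x, mul_comm]

/-- `P` and `Q` are isometric: there is a `k[X × Y]`-linear isomorphism preserving the forms. -/
def Isometric (P Q : QSpace k A B) : Prop :=
  ∃ f : P ≃ₗ[A] Q, (∀ (b : B) (x : P), f (b • x) = b • f x) ∧
    ∀ x y, Q.form (f x) (f y) = P.form x y

theorem Isometric.of_surjective {P Q : QSpace k A B} (f : P →+ Q)
    (hA : ∀ (a : A) x, f (a • x) = a • f x) (hB : ∀ (b : B) x, f (b • x) = b • f x)
    (hf : ∀ x y, Q.form (f x) (f y) = P.form x y) (hs : Function.Surjective f) :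
    Isometric P Q := by
  let g : P →ₗ[A] Q := { f with map_smul' := hA }
  refine ⟨LinearEquiv.ofBijective g ⟨?_, hs⟩, hB, hf⟩
  rw [injective_iff_map_eq_zero]
  intro x hx
  refine P.eq_zero_of_form fun y => ?_
  rw [← hf]
  have : f x = 0 := hx
  simp [this]

theorem Isometric.refl (P : QSpace k A B) : Isometric P P :=
  ⟨LinearEquiv.refl A P, fun _ _ => rfl, fun _ _ => rfl⟩

theorem Isometric.symm {P Q : QSpace k A B} : Isometric P Q → Isometric Q P := by
  rintro ⟨f, h₁, h₂⟩
  refine ⟨f.symm, fun b x => ?_, fun x y => ?_⟩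
  · rw [LinearEquiv.symm_apply_eq, h₁, LinearEquiv.apply_symm_apply]
  · rw [← h₂, LinearEquiv.apply_symm_apply, LinearEquiv.apply_symm_apply]

theorem Isometric.trans {P Q R : QSpace k A B} : Isometric P Q → Isometric Q R →
    Isometric P R := by
  rintro ⟨f, h₁, h₂⟩ ⟨g, h₃, h₄⟩
  exact ⟨f.trans g, fun b x => by simp [h₁, h₃], fun x y => by simp [h₂, h₄]⟩

/-- The orthogonal sum. -/
def sum (P Q : QSpace k A B) : QSpace k A B where
  carrier := P × Q
  form := P.form.compl₁₂ (LinearMap.fst A P Q) (LinearMap.fst A P Q) +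
    Q.form.compl₁₂ (LinearMap.snd A P Q) (LinearMap.snd A P Q)
  form_symm x y := by
    simp [P.form_symm x.1, Q.form_symm x.2]
  form_smul b x y := by
    simp [P.form_smul, Q.form_smul]
  bijective := by
    constructor
    · rw [injective_iff_map_eq_zero]
      rintro ⟨x, y⟩ h
      ext
      · exact P.eq_zero_of_form fun z => by simpa using LinearMap.congr_fun h (z, 0)
      · exact Q.eq_zero_of_form fun z => by simpa using LinearMap.congr_fun h (0, z)
    · intro f
      obtain ⟨x, hx⟩ := P.bijective.2 (f.comp (LinearMap.inl A P Q))
      obtain ⟨y, hy⟩ := Q.bijective.2 (f.comp (LinearMap.inr A P Q))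
      refine ⟨(x, y), ?_⟩
      ext z <;> simp [hx, hy, Prod.mk_zero_zero]

@[simp] theorem sum_form (P Q : QSpace k A B) (x y : P × Q) :
    (P.sum Q).form x y = P.form x.1 y.1 + Q.form x.2 y.2 := rfl

/-- The zero space. -/
def zero : QSpace k A B where
  carrier := PUnit
  form := 0
  form_symm _ _ := rfl
  form_smul _ _ _ := rfl
  bijective := ⟨fun _ _ _ => rfl, fun f => ⟨PUnit.unit, by ext x; cases x; exact (map_zero f).symm⟩⟩

/-- The space with the opposite form. -/
def neg (P : QSpace k A B) : QSpace k A B where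
  carrier := P
  form := -P.form
  form_symm x y := by simp [P.form_symm x]
  form_smul b x y := by simp [P.form_smul]
  bijective := by
    constructor
    · intro x y h
      exact P.bijective.1 (neg_injective h)
    · intro f
      obtain ⟨x, hx⟩ := P.bijective.2 (-f)
      exact ⟨x, by simp [hx]⟩

@[simp] theorem neg_form (P : QSpace k A B) (x y : P) : P.neg.form x y = - P.form x y := rfl

/-- A Lagrangian of `P`: a `k[X × Y]`-submodule `L`, finitely generated and projective over `A`,
such that `L` is equal to its orthogonal and `0 ⟶ L ⟶ P ⟶ Hom_A(L, A) ⟶ 0` is exact. -/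
structure IsLagrangian (P : QSpace k A B) (L : Submodule A P) : Prop where
  smul_mem : ∀ (b : B), ∀ x ∈ L, b • x ∈ L
  finite : Module.Finite A L
  projective : Module.Projective A L
  mem_iff : ∀ x, x ∈ L ↔ ∀ y ∈ L, P.form x y = 0
  surjective : Function.Surjective fun x : P => (P.form x).comp L.subtype

/-- A space is metabolic if it has a Lagrangian. -/
def IsMetabolic (P : QSpace k A B) : Prop := ∃ L : Submodule A P, P.IsLagrangian L

theorem IsLagrangian.exists_dual {P : QSpace k A B} {L : Submodule A P} (h : P.IsLagrangian L) :
    ∃ (n : ℕ) (l p : Fin n → P), (∀ i, l i ∈ L) ∧ ∀ x, x - ∑ i, P.form x (l i) • p i ∈ L := by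
  have := h.finite
  have := h.projective
  obtain ⟨n, f, hf⟩ := Module.Finite.exists_fin' A L
  obtain ⟨g, hg⟩ := Module.projective_lifting_property f LinearMap.id hf
  choose p hp using fun i => h.surjective ((LinearMap.proj i).comp g)
  refine ⟨n, fun i => (f (Pi.single i 1) : L), p, fun i => Subtype.property _, fun x => ?_⟩
  rw [h.mem_iff]
  intro y hy
  have key : ∑ i, P.form (p i) y • f (Pi.single i 1) = ⟨y, hy⟩ := by
    have : ∀ i, P.form (p i) y = g ⟨y, hy⟩ i := fun i => LinearMap.congr_fun (hp i) ⟨y, hy⟩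
    simp_rw [this]
    conv_rhs => rw [← LinearMap.id_apply (R := A) (⟨y, hy⟩ : L), ← hg, LinearMap.comp_apply,
      pi_eq_sum_univ' (g ⟨y, hy⟩), map_sum]
    refine Finset.sum_congr rfl fun i _ => ?_
    rw [← map_smul]
  have key' : ∑ i, P.form (p i) y • ((f (Pi.single i 1) : L) : P) = y := by
    have := congrArg (Subtype.val) key
    simpa using this
  conv_lhs => rw [map_sub, LinearMap.sub_apply]; enter [1, 2]; rw [← key']
  simp [mul_comm]

theorem isMetabolic_of_dual {P : QSpace k A B} (L : Submodule A P)
    (hB : ∀ (b : B), ∀ x ∈ L, b • x ∈ L) (hi : ∀ x ∈ L, ∀ y ∈ L, P.form x y = 0)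
    {n : Type} [Fintype n] (l p : n → P) (hl : ∀ i, l i ∈ L)
    (h : ∀ x, ∃ c : n → A, (∀ i, P.form x (l i) = c i) ∧ x - ∑ i, c i • p i ∈ L) : P.IsMetabolic  := by
  replace h : ∀ x, x - ∑ i, P.form x (l i) • p i ∈ L := fun x => by
    obtain ⟨c, hc, hx⟩ := h x
    simpa only [hc] using hx
  have key : ∀ x ∈ L, ∑ i, P.form x (p i) • l i = x := by
    intro x hx
    rw [← sub_eq_zero, ← neg_eq_zero, neg_sub]
    refine P.eq_zero_of_form fun y => ?_
    have := hi x hx _ (h y)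
    simp only [map_sub, map_sum, map_smul, LinearMap.sub_apply, LinearMap.sum_apply,
      LinearMap.smul_apply, smul_eq_mul] at this ⊢
    rw [← this]
    congr 1
    refine Finset.sum_congr rfl fun i _ => ?_
    rw [P.form_symm y, mul_comm]
  refine ⟨L, hB, ?_, ?_, fun x => ⟨fun hx y hy => hi x hx y hy, fun hx => ?_⟩, fun f => ?_⟩
  · refine Module.Finite.of_surjective
      (Fintype.linearCombination A (fun i => (⟨l i, hl i⟩ : L)))
      fun x => ⟨fun i => P.form x (p i), ?_⟩
    rw [Fintype.linearCombination_apply]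
    ext
    simpa using key x x.2
  · refine Module.Projective.of_split
      (LinearMap.pi fun i => (P.form.flip (p i)).comp L.subtype)
      (Fintype.linearCombination A (fun i => (⟨l i, hl i⟩ : L))) ?_
    ext x
    simp only [LinearMap.comp_apply, Fintype.linearCombination_apply, LinearMap.pi_apply,
      LinearMap.flip_apply, LinearMap.id_apply]
    simpa using key x x.2
  · have := h x
    simpa [hx _ (hl _)] using this
  · refine ⟨∑ i, f ⟨l i, hl i⟩ • p i, ?_⟩
    ext y
    have := congrArg f (show ∑ i, P.form y (p i) • (⟨l i, hl i⟩ : L) = y from by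
      ext; simpa using key y y.2)
    simp only [map_sum, map_smul, smul_eq_mul] at this
    simp only [LinearMap.comp_apply, map_sum, map_smul, LinearMap.sum_apply,
      LinearMap.smul_apply, smul_eq_mul, Submodule.subtype_apply]
    rw [← this]
    refine Finset.sum_congr rfl fun i _ => ?_
    rw [P.form_symm, mul_comm]

theorem IsMetabolic.sum {P Q : QSpace k A B} : P.IsMetabolic → Q.IsMetabolic →
    (P.sum Q).IsMetabolic := by
  rintro ⟨L, hL⟩ ⟨M, hM⟩
  obtain ⟨n, l, p, hl, h⟩ := hL.exists_dual
  obtain ⟨m, l', p', hl', h'⟩ := hM.exists_dual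
  refine isMetabolic_of_dual (P := P.sum Q) (L.prod M) ?_ ?_ (n := Fin n ⊕ Fin m)
    (Sum.elim (fun i => (l i, 0)) (fun i => (0, l' i)))
    (Sum.elim (fun i => (p i, 0)) (fun i => (0, p' i))) ?_ ?_
  · rintro b ⟨x, y⟩ ⟨hx, hy⟩
    exact ⟨hL.smul_mem b x hx, hM.smul_mem b y hy⟩
  · rintro ⟨x, y⟩ ⟨hx, hy⟩ ⟨x', y'⟩ ⟨hx', hy'⟩
    rw [sum_form, (hL.mem_iff x).1 hx x' hx', (hM.mem_iff y).1 hy y' hy', add_zero]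
  · rintro (i | i)
    · exact ⟨hl i, M.zero_mem⟩
    · exact ⟨L.zero_mem, hl' i⟩
  · rintro ⟨x, y⟩
    refine ⟨Sum.elim (fun i => P.form x (l i)) (fun i => Q.form y (l' i)), ?_, ?_⟩
    · rintro (i | i)
      · exact (congrArg (P.form x (l i) + ·) (map_zero (Q.form y))).trans (add_zero _)
      · exact (congrArg (· + Q.form y (l' i)) (map_zero (P.form x))).trans (zero_add _)
    have : ((x, y) : P × Q) - ∑ i : Fin n ⊕ Fin m,
        Sum.elim (fun i => P.form x (l i)) (fun i => Q.form y (l' i)) i •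
        (Sum.elim (fun i => (p i, 0)) (fun i => (0, p' i)) i : P × Q) =
        (x - ∑ i, P.form x (l i) • p i, y - ∑ i, Q.form y (l' i) • p' i) := by
      rw [Fintype.sum_sum_type]
      ext <;> simp [Prod.fst_sum, Prod.snd_sum]
    exact (congrArg (· ∈ L.prod M) this).mpr ⟨h x, h' y⟩

theorem isMetabolic_zero : (zero : QSpace k A B).IsMetabolic :=
  isMetabolic_of_dual (P := zero) ⊤ (fun _ _ _ => trivial) (fun _ _ _ _ => rfl)
    (n := Empty) Empty.elim Empty.elim (fun i => i.elim) (fun _ => ⟨Empty.elim, fun i => i.elim, trivial⟩)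

theorem isMetabolic_sum_neg (P : QSpace k A B) : (P.sum P.neg).IsMetabolic := by
  obtain ⟨n, e, e', h⟩ := P.exists_dual
  refine isMetabolic_of_dual (P := P.sum P.neg)
    (LinearMap.range (LinearMap.prod (LinearMap.id (R := A) (M := P)) LinearMap.id)) ?_ ?_
    (fun i => (e' i, e' i)) (fun i => (e i, 0)) ?_ ?_
  · rintro b _ ⟨x, rfl⟩
    exact ⟨b • x, rfl⟩
  · rintro _ ⟨x, rfl⟩ _ ⟨y, rfl⟩
    exact add_neg_cancel (P.form x y)
  · exact fun i => ⟨e' i, rfl⟩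
  · rintro ⟨(x : P), (y : P)⟩
    refine ⟨fun i => P.form (x - y) (e' i), fun i => ?_, y, ?_⟩
    · change P.form x (e' i) + - P.form y (e' i) = P.form (x - y) (e' i)
      rw [map_sub, LinearMap.sub_apply, sub_eq_add_neg]
    have h1 : ((x, y) : P × P) - ∑ i, P.form (x - y) (e' i) • (e i, (0 : P)) = (y, y) := by
      have h2 : ∑ i, P.form (x - y) (e' i) • (e i, (0 : P)) = (x - y, 0) := by
        conv_rhs => rw [← h (x - y)]
        ext <;> simp [Prod.fst_sum, Prod.snd_sum]
      rw [h2]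
      ext <;> simp
    exact h1.symm


/-! ### Isometry classes and the Witt group -/

variable (k A B) in
instance setoid : Setoid (QSpace k A B) :=
  ⟨Isometric, Isometric.refl, Isometric.symm, Isometric.trans⟩

theorem Isometric.sum_congr {P P' Q Q' : QSpace k A B} :
    Isometric P P' → Isometric Q Q' → Isometric (P.sum Q) (P'.sum Q') := by
  rintro ⟨f, h₁, h₂⟩ ⟨g, h₃, h₄⟩
  refine ⟨f.prodCongr g, fun b x => ?_, fun x y => ?_⟩
  · exact Prod.ext (h₁ b x.1) (h₃ b x.2)
  · exact congrArg₂ (· + ·) (h₂ x.1 y.1) (h₄ x.2 y.2)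

theorem Isometric.sum_comm (P Q : QSpace k A B) : Isometric (P.sum Q) (Q.sum P) :=
  ⟨LinearEquiv.prodComm A P Q, fun _ _ => rfl, fun _ _ => add_comm _ _⟩

theorem Isometric.sum_assoc (P Q R : QSpace k A B) :
    Isometric ((P.sum Q).sum R) (P.sum (Q.sum R)) :=
  ⟨LinearEquiv.prodAssoc A P Q R, fun _ _ => rfl, fun _ _ => (add_assoc _ _ _).symm⟩

theorem Isometric.zero_sum (P : QSpace k A B) : Isometric (zero.sum P) P :=
  Isometric.of_surjective (P := zero.sum P) (AddMonoidHom.snd PUnit P) (fun _ _ => rfl)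
    (fun _ _ => rfl) (fun _ _ => (zero_add _).symm) (fun x => ⟨(PUnit.unit, x), rfl⟩)

theorem Isometric.neg_congr {P P' : QSpace k A B} :
    Isometric P P' → Isometric P.neg P'.neg := by
  rintro ⟨f, h₁, h₂⟩
  exact ⟨f, h₁, fun x y => congrArg (- ·) (h₂ x y)⟩

end

end QSpace

section

variable (k A B C D : Type u) [Field k] [CommRing A] [CommRing B] [CommRing C] [CommRing D]
  [Algebra k A] [Algebra k B] [Algebra k C] [Algebra k D]

/-- The monoid of isometry classes of quadratic spaces, for the orthogonal sum. -/
def IsoClass : Type (u + 1) := Quotient (QSpace.setoid k A B)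

instance : Add (IsoClass k A B) :=
  ⟨Quotient.map₂ QSpace.sum fun _ _ h _ _ h' => h.sum_congr h'⟩

instance : Zero (IsoClass k A B) := ⟨Quotient.mk _ QSpace.zero⟩

instance : AddCommMonoid (IsoClass k A B) where
  add_assoc := by
    rintro ⟨P⟩ ⟨Q⟩ ⟨R⟩
    exact Quotient.sound (QSpace.Isometric.sum_assoc P Q R)
  zero_add := by
    rintro ⟨P⟩
    exact Quotient.sound (QSpace.Isometric.zero_sum P)
  add_zero := by
    rintro ⟨P⟩
    exact Quotient.sound ((QSpace.Isometric.sum_comm _ _).trans (QSpace.Isometric.zero_sum P))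
  add_comm := by
    rintro ⟨P⟩ ⟨Q⟩
    exact Quotient.sound (QSpace.Isometric.sum_comm P Q)
  nsmul := nsmulRec

/-- The classes of metabolic spaces. -/
def metabolicClasses : AddSubmonoid (IsoClass k A B) where
  carrier := {x | ∃ P : QSpace k A B, P.IsMetabolic ∧ Quotient.mk _ P = x}
  zero_mem' := ⟨_, QSpace.isMetabolic_zero, rfl⟩
  add_mem' := by
    rintro _ _ ⟨P, hP, rfl⟩ ⟨Q, hQ, rfl⟩
    exact ⟨P.sum Q, hP.sum hQ, rfl⟩

/-- Witt equivalence: `P ⊥ M ≃ Q ⊥ N` for some metabolic spaces `M`, `N`. -/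
def wittCon : AddCon (IsoClass k A B) where
  r x y := ∃ m ∈ metabolicClasses k A B, ∃ n ∈ metabolicClasses k A B, x + m = y + n
  iseqv := by
    refine ⟨fun x => ⟨0, zero_mem _, 0, zero_mem _, rfl⟩, ?_, ?_⟩
    · rintro x y ⟨m, hm, n, hn, h⟩
      exact ⟨n, hn, m, hm, h.symm⟩
    · rintro x y z ⟨m, hm, n, hn, h⟩ ⟨m', hm', n', hn', h'⟩
      refine ⟨m + m', add_mem hm hm', n' + n, add_mem hn' hn, ?_⟩
      rw [← add_assoc, h, add_right_comm, h', add_assoc]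
  add' := by
    rintro w x y z ⟨m, hm, n, hn, h⟩ ⟨m', hm', n', hn', h'⟩
    refine ⟨m + m', add_mem hm hm', n + n', add_mem hn hn', ?_⟩
    rw [add_add_add_comm, h, h', add_add_add_comm]

/-- The Witt group: isometry classes of quadratic spaces modulo metabolic spaces. -/
def WittGroup : Type (u + 1) := (wittCon k A B).Quotient

instance : AddCommMonoid (WittGroup k A B) :=
  inferInstanceAs (AddCommMonoid (wittCon k A B).Quotient)

variable {k A B C D}

namespace WittGroup

/-- The class of a quadratic space -/
def mk (P : QSpace k A B) : WittGroup k A B :=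
  (wittCon k A B).mk' (Quotient.mk (QSpace.setoid k A B) P)

theorem mk_surjective (x : WittGroup k A B) : ∃ P, mk P = x := by
  obtain ⟨⟨P⟩, rfl⟩ := AddCon.mk'_surjective x
  exact ⟨P, rfl⟩

theorem mk_sum (P Q : QSpace k A B) : mk (P.sum Q) = mk P + mk Q := rfl

theorem mk_eq_of_isometric {P Q : QSpace k A B} (h : P.Isometric Q) : mk P = mk Q :=
  congrArg (wittCon k A B).mk' (Quotient.sound h)

theorem mk_eq_zero {P : QSpace k A B} (h : P.IsMetabolic) : mk P = 0 :=
  (AddCon.eq _).2 ⟨0, zero_mem _, _, ⟨P, h, rfl⟩, (add_zero (_ : IsoClass k A B)).trans (zero_add _).symm⟩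

/-- Universal property of the Witt group. -/
def lift {G : Type*} [AddCommMonoid G] (f : QSpace k A B → G)
    (h : ∀ P Q, P.Isometric Q → f P = f Q) (hs : ∀ P Q, f (P.sum Q) = f P + f Q)
    (hm : ∀ P : QSpace k A B, P.IsMetabolic → f P = 0) : WittGroup k A B →+ G :=
  (wittCon k A B).lift
    { toFun := Quotient.lift f h
      map_zero' := hm _ QSpace.isMetabolic_zero
      map_add' := by
        rintro ⟨P⟩ ⟨Q⟩
        exact hs P Q }
    (by
      rintro ⟨P⟩ ⟨Q⟩ ⟨_, ⟨M, hM, rfl⟩, _, ⟨N, hN, rfl⟩, e⟩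
      have := congrArg (Quotient.lift f h) e
      have : f (P.sum M) = f (Q.sum N) := this
      rw [hs, hs, hm M hM, hm N hN, add_zero, add_zero] at this
      exact this)

@[simp] theorem lift_mk {G : Type*} [AddCommMonoid G] (f : QSpace k A B → G)
    (h : ∀ P Q, P.Isometric Q → f P = f Q) (hs : ∀ P Q, f (P.sum Q) = f P + f Q)
    (hm : ∀ P : QSpace k A B, P.IsMetabolic → f P = 0) (P : QSpace k A B) :
    lift f h hs hm (mk P) = f P := rfl

theorem exists_neg (x : WittGroup k A B) : ∃ y, y + x = 0 := by
  obtain ⟨P, rfl⟩ := mk_surjective x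
  exact ⟨mk P.neg, by rw [add_comm, ← mk_sum, mk_eq_zero P.isMetabolic_sum_neg]⟩

noncomputable instance : Neg (WittGroup k A B) := ⟨fun x => (exists_neg x).choose⟩

noncomputable instance : AddCommGroup (WittGroup k A B) where
  zsmul := zsmulRec
  neg_add_cancel x := (exists_neg x).choose_spec

end WittGroup

end
/-! ### Composition -/

section

variable {k A B C D : Type u} [Field k] [CommRing A] [CommRing B] [CommRing C] [CommRing D]
  [Algebra k A] [Algebra k B] [Algebra k C] [Algebra k D]

/-- The action of `C` on the right factor of `M ⊗[B] N`. -/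
@[reducible]
def rightModule (B C M N : Type u) [CommRing B] [CommRing C] [AddCommGroup M] [AddCommGroup N]
    [Module B M] [Module B N] [Module C N] [SMulCommClass C B N] : Module C (M ⊗[B] N) where
  smul c x := LinearMap.lTensor M (DistribSMul.toLinearMap B N c) x
  one_smul x := by
    induction x with
    | zero => exact map_zero _
    | tmul m n => exact congrArg (m ⊗ₜ[B] ·) (one_smul C n)
    | add x y hx hy => exact (map_add _ x y).trans (congrArg₂ (· + ·) hx hy)
  mul_smul c d x := by
    induction x with
    | zero => exact (map_zero _).trans ((congrArg _ (map_zero _)).trans (map_zero _)).symm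
    | tmul m n => exact congrArg (m ⊗ₜ[B] ·) (mul_smul c d n)
    | add x y hx hy =>
      exact (map_add _ x y).trans ((congrArg₂ (· + ·) hx hy).trans
        ((congrArg _ (map_add _ x y)).trans (map_add _ _ _)).symm)
  smul_zero c := map_zero _
  smul_add c x y := map_add _ x y
  add_smul c d x := by
    induction x with
    | zero => exact (map_zero _).trans ((congrArg₂ (· + ·) (map_zero _) (map_zero _)).trans
        (add_zero _)).symm
    | tmul m n => exact (congrArg (m ⊗ₜ[B] ·) (add_smul c d n)).trans (tmul_add m _ _)
    | add x y hx hy =>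
      exact (map_add _ x y).trans ((congrArg₂ (· + ·) hx hy).trans
        ((add_add_add_comm _ _ _ _).trans
          (congrArg₂ (· + ·) (map_add _ x y).symm (map_add _ x y).symm)))
  zero_smul x := by
    induction x with
    | zero => exact map_zero _
    | tmul m n => exact (congrArg (m ⊗ₜ[B] ·) (zero_smul C n)).trans (tmul_zero _ _)
    | add x y hx hy => exact (map_add _ x y).trans ((congrArg₂ (· + ·) hx hy).trans (add_zero _))

theorem tensor_hom_ext {R M N G : Type*} [CommSemiring R] [AddCommMonoid M] [AddCommMonoid N]
    [Module R M] [Module R N] [AddCommMonoid G] {f g : M ⊗[R] N →+ G}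
    (h : ∀ m n, f (m ⊗ₜ n) = g (m ⊗ₜ n)) : f = g := by
  ext x
  induction x with
  | zero => rw [map_zero, map_zero]
  | tmul m n => exact h m n
  | add x y hx hy => rw [map_add, map_add, hx, hy]

namespace QSpace

instance (P : QSpace k A B) : SMulCommClass B A P := SMulCommClass.symm A B P

/-- `p' ⊗ q' ↦ ⟨⟨q, q'⟩ p, p'⟩` -/
def compForm₁ (P : QSpace k A B) (Q : QSpace k B C) (p : P) (q : Q) : P ⊗[B] Q →+ A :=
  liftAddHom
    (AddMonoidHom.mk' (fun p' => AddMonoidHom.mk' (fun q' => P.form (Q.form q q' • p) p')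
      (fun x y => by rw [map_add, add_smul, map_add, LinearMap.add_apply]))
      (fun x y => AddMonoidHom.ext fun q' => map_add (P.form (Q.form q q' • p)) x y))
    (fun b p' q' => by
      change P.form (Q.form q q' • p) (b • p') = P.form (Q.form q (b • q') • p) p'
      rw [← P.form_smul, map_smul (Q.form q), smul_eq_mul, mul_smul])

theorem compForm₁_tmul (P : QSpace k A B) (Q : QSpace k B C) (p : P) (q : Q) (p' : P) (q' : Q) :
    compForm₁ P Q p q (p' ⊗ₜ q') = P.form (Q.form q q' • p) p' := rfl

/-- The pairing `(p ⊗ q, p' ⊗ q') ↦ ⟨⟨q, q'⟩ p, p'⟩`, as a biadditive map. -/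
def compForm₂ (P : QSpace k A B) (Q : QSpace k B C) : P ⊗[B] Q →+ P ⊗[B] Q →+ A :=
  liftAddHom
    (AddMonoidHom.mk' (fun p => AddMonoidHom.mk' (fun q => compForm₁ P Q p q)
      (fun x y => tensor_hom_ext fun p' q' => by
        rw [AddMonoidHom.add_apply, compForm₁_tmul, compForm₁_tmul, compForm₁_tmul, map_add,
          LinearMap.add_apply, add_smul, map_add, LinearMap.add_apply]))
      (fun x y => AddMonoidHom.ext fun q => tensor_hom_ext fun p' q' => by
        change compForm₁ P Q (x + y) q (p' ⊗ₜ q') =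
          compForm₁ P Q x q (p' ⊗ₜ q') + compForm₁ P Q y q (p' ⊗ₜ q')
        rw [compForm₁_tmul, compForm₁_tmul, compForm₁_tmul, smul_add, map_add,
          LinearMap.add_apply]))
    (fun b p q => tensor_hom_ext fun p' q' => by
      change compForm₁ P Q (b • p) q (p' ⊗ₜ q') = compForm₁ P Q p (b • q) (p' ⊗ₜ q')
      rw [compForm₁_tmul, compForm₁_tmul, map_smul (Q.form), LinearMap.smul_apply, smul_smul,
        smul_eq_mul,
        mul_comm])

theorem compForm₂_tmul (P : QSpace k A B) (Q : QSpace k B C) (p p' : P) (q q' : Q) :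
    compForm₂ P Q (p ⊗ₜ q) (p' ⊗ₜ q') = P.form (Q.form q q' • p) p' := rfl

theorem compForm₂_symm (P : QSpace k A B) (Q : QSpace k B C) (x y : P ⊗[B] Q) :
    compForm₂ P Q x y = compForm₂ P Q y x := by
  induction x with
  | zero => simp
  | add x x' hx hx' => rw [map_add, map_add, AddMonoidHom.add_apply, hx, hx']
  | tmul p q =>
    induction y with
    | zero => simp
    | add y y' hy hy' => rw [map_add, map_add, AddMonoidHom.add_apply, hy, hy']
    | tmul p' q' =>
      rw [compForm₂_tmul, compForm₂_tmul, Q.form_symm q' q, P.form_symm _ p, P.form_smul,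
        P.form_symm]

theorem compForm₂_smul (P : QSpace k A B) (Q : QSpace k B C) (a : A) (x y : P ⊗[B] Q) :
    compForm₂ P Q (a • x) y = a * compForm₂ P Q x y := by
  induction x with
  | zero => simp
  | add x x' hx hx' => rw [smul_add, map_add, map_add, AddMonoidHom.add_apply, hx, hx',
      AddMonoidHom.add_apply, mul_add]
  | tmul p q =>
    induction y with
    | zero => simp
    | add y y' hy hy' => rw [map_add, map_add, hy, hy', mul_add]
    | tmul p' q' =>
      rw [smul_tmul', compForm₂_tmul, compForm₂_tmul, smul_comm, map_smul, LinearMap.smul_apply,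
        smul_eq_mul]

/-- The `A`-bilinear form `(p ⊗ q, p' ⊗ q') ↦ ⟨⟨q, q'⟩ p, p'⟩` on `P ⊗[B] Q`. -/
def compForm (P : QSpace k A B) (Q : QSpace k B C) : P ⊗[B] Q →ₗ[A] P ⊗[B] Q →ₗ[A] A :=
  LinearMap.mk₂ A (fun x y => compForm₂ P Q x y)
    (fun x y z => by simp) (fun a x y => compForm₂_smul P Q a x y)
    (fun x y z => by simp)
    (fun a x y => by rw [compForm₂_symm, compForm₂_smul, compForm₂_symm, smul_eq_mul])

theorem compForm_tmul (P : QSpace k A B) (Q : QSpace k B C) (p p' : P) (q q' : Q) :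
    compForm P Q (p ⊗ₜ q) (p' ⊗ₜ q') = P.form (Q.form q q' • p) p' := rfl

theorem compForm_dual (P : QSpace k A B) (Q : QSpace k B C) {n m : ℕ} {e e' : Fin n → P}
    {f f' : Fin m → Q} (he : ∀ x, ∑ i, P.form x (e' i) • e i = x)
    (hf : ∀ x, ∑ i, Q.form x (f' i) • f i = x) (x : P ⊗[B] Q) :
    ∑ i : Fin n × Fin m, compForm P Q x (e' i.1 ⊗ₜ f' i.2) • (e i.1 ⊗ₜ[B] f i.2) = x := by
  induction x with
  | zero => simp
  | add x y hx hy =>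
    simp only [map_add, LinearMap.add_apply, add_smul, Finset.sum_add_distrib]
    rw [hx, hy]
  | tmul p q =>
    rw [Fintype.sum_prod_type_right]
    simp only [compForm_tmul, smul_tmul', ← sum_tmul, he]
    simp only [smul_tmul, ← tmul_sum, hf]

/-- The composition of `P` in `Proj(X, Y)` and `Q` in `Proj(Y, Z)`: the tensor product over
`k[Y]`. -/
def comp (P : QSpace k A B) (Q : QSpace k B C) : QSpace k A C :=
  letI : Module C (P ⊗[B] Q) := rightModule B C P Q
  haveI hr : ∀ (c : C) (p : P) (q : Q), c • (p ⊗ₜ[B] q) = p ⊗ₜ (c • q) := fun _ _ _ => rfl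
  { carrier := P ⊗[B] Q
    towerB := ⟨fun a c x => by
      induction x with
      | zero => simp
      | tmul p q => rw [hr, hr, smul_assoc, tmul_smul]
      | add x y hx hy => rw [smul_add, smul_add, smul_add, hx, hy]⟩
    smulComm := ⟨fun a c x => by
      induction x with
      | zero => simp
      | tmul p q => rw [hr, smul_tmul', smul_tmul', hr]
      | add x y hx hy => simp only [smul_add, hx, hy]⟩
    finite := by
      obtain ⟨n, e, e', he⟩ := P.exists_dual
      obtain ⟨m, f, f', hf⟩ := Q.exists_dual
      exact finite_of_dual (compForm P Q) _ _ (compForm_dual P Q he hf)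
    projective := by
      obtain ⟨n, e, e', he⟩ := P.exists_dual
      obtain ⟨m, f, f', hf⟩ := Q.exists_dual
      exact projective_of_dual (compForm P Q) _ _ (compForm_dual P Q he hf)
    form := compForm P Q
    form_symm := compForm₂_symm P Q
    form_smul := fun c x y => by
      induction x with
      | zero => simp
      | add x x' hx hx' => rw [smul_add, map_add, map_add, LinearMap.add_apply, hx, hx',
          LinearMap.add_apply]
      | tmul p q =>
        induction y with
        | zero => simp
        | add y y' hy hy' => rw [smul_add, map_add, map_add, hy, hy']
        | tmul p' q' => rw [hr, hr, compForm_tmul, compForm_tmul, Q.form_smul]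
    bijective := by
      obtain ⟨n, e, e', he⟩ := P.exists_dual
      obtain ⟨m, f, f', hf⟩ := Q.exists_dual
      exact bijective_of_dual (compForm P Q) (compForm₂_symm P Q) _ _ (compForm_dual P Q he hf) }


/-- The pure tensors in `comp P Q`. -/
def tm (P : QSpace k A B) (Q : QSpace k B C) (p : P) (q : Q) : comp P Q := p ⊗ₜ[B] q

section tm

variable (P : QSpace k A B) (Q : QSpace k B C)

theorem tm_add_left (p p' : P) (q : Q) : tm P Q (p + p') q = tm P Q p q + tm P Q p' q :=
  add_tmul p p' q

theorem tm_add_right (p : P) (q q' : Q) : tm P Q p (q + q') = tm P Q p q + tm P Q p q' :=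
  tmul_add p q q'

theorem tm_smul_left (a : A) (p : P) (q : Q) : tm P Q (a • p) q = a • tm P Q p q := rfl

theorem tm_smul_right (c : C) (p : P) (q : Q) : tm P Q p (c • q) = c • tm P Q p q := rfl

theorem tm_smul (b : B) (p : P) (q : Q) : tm P Q (b • p) q = tm P Q p (b • q) :=
  smul_tmul b p q

theorem form_tm (p p' : P) (q q' : Q) :
    (comp P Q).form (tm P Q p q) (tm P Q p' q') = P.form (Q.form q q' • p) p' := rfl

variable {P Q} in
@[elab_as_elim]
theorem tm_induction {motive : comp P Q → Prop} (x : comp P Q) (zero : motive 0)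
    (tm : ∀ p q, motive (tm P Q p q)) (add : ∀ x y, motive x → motive y → motive (x + y)) :
    motive x :=
  TensorProduct.induction_on (motive := motive) x zero tm add

variable {P Q} in
@[elab_as_elim]
theorem tm_induction₂ {motive : comp P Q → comp P Q → Prop} (x y : comp P Q)
    (zero_left : ∀ y, motive 0 y) (zero_right : ∀ x, motive x 0)
    (tm : ∀ p q p' q', motive (tm P Q p q) (tm P Q p' q'))
    (add_left : ∀ x x' y, motive x y → motive x' y → motive (x + x') y)
    (add_right : ∀ x y y', motive x y → motive x y' → motive x (y + y')) :
    motive x y :=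
  tm_induction x (zero_left y)
    (fun p q => tm_induction y (zero_right _) (fun p' q' => tm p q p' q') fun _ _ => add_right _ _ _)
    (fun _ _ => add_left _ _ _)

/-- Additive maps out of `comp P Q`. -/
def compLift {G : Type*} [AddCommGroup G] (f : P → Q → G)
    (h₁ : ∀ p p' q, f (p + p') q = f p q + f p' q)
    (h₂ : ∀ p q q', f p (q + q') = f p q + f p q')
    (h₃ : ∀ (b : B) p q, f (b • p) q = f p (b • q)) : comp P Q →+ G :=
  liftAddHom (R := B) (AddMonoidHom.mk' (fun p => AddMonoidHom.mk' (f p) (h₂ p))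
    (fun p p' => AddMonoidHom.ext (h₁ p p'))) h₃

theorem compLift_tm {G : Type*} [AddCommGroup G] (f : P → Q → G)
    (h₁ : ∀ p p' q, f (p + p') q = f p q + f p' q)
    (h₂ : ∀ p q q', f p (q + q') = f p q + f p q')
    (h₃ : ∀ (b : B) p q, f (b • p) q = f p (b • q)) (p : P) (q : Q) :
    compLift P Q f h₁ h₂ h₃ (tm P Q p q) = f p q := rfl

variable {P Q} in
theorem Isometric.of_tm {R : QSpace k A C} (f : P → Q → R)
    (h₁ : ∀ p p' q, f (p + p') q = f p q + f p' q)
    (h₂ : ∀ p q q', f p (q + q') = f p q + f p q')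
    (h₃ : ∀ (b : B) p q, f (b • p) q = f p (b • q))
    (hA : ∀ (a : A) p q, f (a • p) q = a • f p q)
    (hC : ∀ (c : C) p q, f p (c • q) = c • f p q)
    (hf : ∀ p q p' q', R.form (f p q) (f p' q') = P.form (Q.form q q' • p) p')
    (hs : ∀ r, r ∈ AddSubmonoid.closure (Set.range fun x : P × Q => f x.1 x.2)) :
    Isometric (comp P Q) R := by
  refine Isometric.of_surjective (compLift P Q f h₁ h₂ h₃) (fun a x => ?_) (fun c x => ?_)
    (fun x y => ?_) (fun r => ?_)
  · refine tm_induction x ?_ (fun p q => ?_) (fun x y hx hy => ?_)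
    · rw [smul_zero, map_zero, smul_zero]
    · rw [← tm_smul_left, compLift_tm, compLift_tm, hA]
    · rw [smul_add, map_add, hx, hy, map_add, smul_add]
  · refine tm_induction x ?_ (fun p q => ?_) (fun x y hx hy => ?_)
    · rw [smul_zero, map_zero, smul_zero]
    · rw [← tm_smul_right, compLift_tm, compLift_tm, hC]
    · rw [smul_add, map_add, hx, hy, map_add, smul_add]
  · refine tm_induction₂ x y (fun y => ?_) (fun x => ?_) (fun p q p' q' => ?_)
      (fun x x' y hx hx' => ?_) (fun x y y' hy hy' => ?_)
    · rw [map_zero, map_zero, map_zero, LinearMap.zero_apply, LinearMap.zero_apply]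
    · rw [map_zero, map_zero, map_zero]
    · rw [compLift_tm, compLift_tm, form_tm, hf]
    · rw [map_add, map_add, map_add, LinearMap.add_apply, LinearMap.add_apply, hx, hx']
    · rw [map_add, map_add, map_add, hy, hy']
  · induction hs r using AddSubmonoid.closure_induction with
    | mem x hx =>
      obtain ⟨⟨p, q⟩, rfl⟩ := hx
      exact ⟨tm P Q p q, rfl⟩
    | zero => exact ⟨0, map_zero _⟩
    | add x y _ _ hx hy =>
      obtain ⟨x, rfl⟩ := hx
      obtain ⟨y, rfl⟩ := hy
      exact ⟨x + y, map_add _ _ _⟩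

end tm

theorem Isometric.comp_congr {P P' : QSpace k A B} {Q Q' : QSpace k B C} :
    Isometric P P' → Isometric Q Q' → Isometric (comp P Q) (comp P' Q') := by
  rintro ⟨f, h₁, h₂⟩ ⟨g, h₃, h₄⟩
  refine Isometric.of_tm (fun p q => tm P' Q' (f p) (g q)) (fun p p' q => ?_) (fun p q q' => ?_)
    (fun b p q => ?_) (fun a p q => ?_) (fun c p q => ?_) (fun p q p' q' => ?_) (fun r => ?_)
  · rw [map_add, tm_add_left]
  · rw [map_add, tm_add_right]
  · rw [h₁, tm_smul, map_smul]
  · rw [map_smul, tm_smul_left]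
  · rw [h₃, tm_smul_right]
  · rw [form_tm, h₄, ← h₁, h₂]
  · refine tm_induction r (zero_mem _) (fun p q => ?_) (fun x y hx hy => add_mem hx hy)
    exact AddSubmonoid.subset_closure ⟨(f.symm p, g.symm q), by simp⟩

theorem Isometric.comp_sum_left (P P' : QSpace k A B) (Q : QSpace k B C) :
    Isometric (comp (P.sum P') Q) ((comp P Q).sum (comp P' Q)) := by
  refine Isometric.of_tm (R := (comp P Q).sum (comp P' Q))
    (fun (p : P × P') q => (tm P Q p.1 q, tm P' Q p.2 q))
    (fun p p' q => ?_) (fun p q q' => ?_)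
    (fun b p q => ?_) (fun a p q => ?_) (fun c p q => ?_) (fun p q p' q' => ?_) (fun r => ?_)
  · exact Prod.ext (tm_add_left P Q _ _ _) (tm_add_left P' Q _ _ _)
  · exact Prod.ext (tm_add_right P Q _ _ _) (tm_add_right P' Q _ _ _)
  · exact Prod.ext (tm_smul P Q _ _ _) (tm_smul P' Q _ _ _)
  · rfl
  · rfl
  · rfl
  · obtain ⟨(x : comp P Q), (y : comp P' Q)⟩ := r
    have hx : ((x, 0) : comp P Q × comp P' Q) ∈ AddSubmonoid.closure (Set.range
        fun x : (P × P') × Q => ((tm P Q x.1.1 x.2, tm P' Q x.1.2 x.2) :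
          comp P Q × comp P' Q)) := by
      refine tm_induction x (zero_mem _) (fun p q => ?_) (fun x y hx hy => ?_)
      · exact AddSubmonoid.subset_closure ⟨((p, 0), q), Prod.ext rfl (zero_tmul _ _)⟩
      · have := add_mem hx hy
        rwa [Prod.mk_add_mk, add_zero] at this
    have hy : ((0, y) : comp P Q × comp P' Q) ∈ AddSubmonoid.closure (Set.range
        fun x : (P × P') × Q => ((tm P Q x.1.1 x.2, tm P' Q x.1.2 x.2) :
          comp P Q × comp P' Q)) := by
      refine tm_induction y (zero_mem _) (fun p q => ?_) (fun x y hx hy => ?_)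
      · exact AddSubmonoid.subset_closure ⟨((0, p), q), Prod.ext (zero_tmul _ _) rfl⟩
      · have := add_mem hx hy
        rwa [Prod.mk_add_mk, add_zero] at this
    have := add_mem hx hy
    rwa [Prod.mk_add_mk, add_zero, zero_add] at this

theorem Isometric.comp_sum_right (P : QSpace k A B) (Q Q' : QSpace k B C) :
    Isometric (comp P (Q.sum Q')) ((comp P Q).sum (comp P Q')) := by
  refine Isometric.of_tm (R := (comp P Q).sum (comp P Q'))
    (fun p (q : Q × Q') => (tm P Q p q.1, tm P Q' p q.2))
    (fun p p' q => ?_) (fun p q q' => ?_)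
    (fun b p q => ?_) (fun a p q => ?_) (fun c p q => ?_) (fun p q p' q' => ?_) (fun r => ?_)
  · exact Prod.ext (tm_add_left P Q _ _ _) (tm_add_left P Q' _ _ _)
  · exact Prod.ext (tm_add_right P Q _ _ _) (tm_add_right P Q' _ _ _)
  · exact Prod.ext (tm_smul P Q _ _ _) (tm_smul P Q' _ _ _)
  · rfl
  · rfl
  · obtain ⟨q₁, q₂⟩ := q
    obtain ⟨q₁', q₂'⟩ := q'
    change P.form (Q.form q₁ q₁' • p) p' + P.form (Q'.form q₂ q₂' • p) p' =
      P.form ((Q.form q₁ q₁' + Q'.form q₂ q₂') • p) p'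
    rw [add_smul, map_add, LinearMap.add_apply]
  · obtain ⟨(x : comp P Q), (y : comp P Q')⟩ := r
    have hx : ((x, 0) : comp P Q × comp P Q') ∈ AddSubmonoid.closure (Set.range
        fun x : P × (Q × Q') => ((tm P Q x.1 x.2.1, tm P Q' x.1 x.2.2) :
          comp P Q × comp P Q')) := by
      refine tm_induction x (zero_mem _) (fun p q => ?_) (fun x y hx hy => ?_)
      · exact AddSubmonoid.subset_closure ⟨(p, (q, 0)), Prod.ext rfl (tmul_zero _ _)⟩
      · have := add_mem hx hy
        rwa [Prod.mk_add_mk, add_zero] at this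
    have hy : ((0, y) : comp P Q × comp P Q') ∈ AddSubmonoid.closure (Set.range
        fun x : P × (Q × Q') => ((tm P Q x.1 x.2.1, tm P Q' x.1 x.2.2) :
          comp P Q × comp P Q')) := by
      refine tm_induction y (zero_mem _) (fun p q => ?_) (fun x y hx hy => ?_)
      · exact AddSubmonoid.subset_closure ⟨(p, (0, q)), Prod.ext (tmul_zero _ _) rfl⟩
      · have := add_mem hx hy
        rwa [Prod.mk_add_mk, add_zero] at this
    have := add_mem hx hy
    rwa [Prod.mk_add_mk, add_zero, zero_add] at this

theorem Isometric.comp_assoc (P : QSpace k A B) (Q : QSpace k B C) (R : QSpace k C D) :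
    Isometric (comp (comp P Q) R) (comp P (comp Q R)) := by
  let φ : R → comp P Q →+ comp P (comp Q R) := fun r =>
    compLift P Q (fun p q => tm P (comp Q R) p (tm Q R q r))
      (fun p p' q => tm_add_left _ _ _ _ _)
      (fun p q q' => by rw [tm_add_left, tm_add_right])
      (fun b p q => by rw [tm_smul, tm_smul_left])
  have hφ : ∀ p q r, φ r (tm P Q p q) = tm P (comp Q R) p (tm Q R q r) := fun _ _ _ => rfl
  refine Isometric.of_tm (fun x r => φ r x) (fun p p' q => map_add _ _ _) (fun x r r' => ?_)
    (fun c x r => ?_) (fun a x r => ?_) (fun d x r => ?_) (fun x r x' r' => ?_) (fun y => ?_)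
  · refine tm_induction x ?_ (fun p q => ?_) (fun x y hx hy => ?_)
    · simp only [map_zero, add_zero]
    · rw [hφ, hφ, hφ, tm_add_right, tm_add_right]
    · rw [map_add, hx, hy, map_add, map_add, add_add_add_comm]
  · refine tm_induction x ?_ (fun p q => ?_) (fun x y hx hy => ?_)
    · simp only [smul_zero, map_zero]
    · rw [← tm_smul_right, hφ, hφ, tm_smul]
    · rw [smul_add, map_add, hx, hy, map_add]
  · refine tm_induction x ?_ (fun p q => ?_) (fun x y hx hy => ?_)
    · simp only [smul_zero, map_zero]
    · rw [← tm_smul_left, hφ, hφ, tm_smul_left]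
    · rw [smul_add, map_add, hx, hy, map_add, smul_add]
  · refine tm_induction x ?_ (fun p q => ?_) (fun x y hx hy => ?_)
    · simp only [smul_zero, map_zero]
    · rw [hφ, hφ, tm_smul_right, tm_smul_right]
    · rw [map_add, hx, hy, map_add, smul_add]
  · refine tm_induction₂ x x' (fun y => ?_) (fun x => ?_) (fun p q p' q' => ?_)
      (fun x x' y hx hx' => ?_) (fun x y y' hy hy' => ?_)
    · simp only [smul_zero, map_zero, LinearMap.zero_apply]
    · simp only [map_zero]
    · rw [hφ, hφ, form_tm, form_tm, ← tm_smul_right, form_tm]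
    · rw [map_add, map_add, LinearMap.add_apply, hx, hx', smul_add, map_add, LinearMap.add_apply]
    · rw [map_add, map_add, map_add, hy, hy']
  · refine tm_induction y (zero_mem _) (fun p z => ?_) (fun x y hx hy => add_mem hx hy)
    refine tm_induction z ?_ (fun q r => ?_) (fun x y hx hy => ?_)
    · have : tm P (comp Q R) p 0 = 0 := tmul_zero _ _
      rw [this]
      exact zero_mem _
    · exact AddSubmonoid.subset_closure ⟨(tm P Q p q, r), rfl⟩
    · rw [tm_add_right]
      exact add_mem hx hy

theorem IsMetabolic.comp_left {P : QSpace k A B} (hP : P.IsMetabolic) (Q : QSpace k B C) :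
    (comp P Q).IsMetabolic := by
  obtain ⟨L, hL⟩ := hP
  obtain ⟨n, l, p, hl, h⟩ := hL.exists_dual
  obtain ⟨m, f, f', hf⟩ := Q.exists_dual
  refine isMetabolic_of_dual (P := comp P Q) (Submodule.span A {x | ∃ y ∈ L, ∃ q, tm P Q y q = x})
    (fun c x hx => ?_) (fun x hx y hy => ?_) (n := Fin n × Fin m)
    (fun i => tm P Q (l i.1) (f' i.2)) (fun i => tm P Q (p i.1) (f i.2))
    (fun i => Submodule.subset_span ⟨_, hl _, _, rfl⟩)
    (fun x => ⟨fun i => (comp P Q).form x (tm P Q (l i.1) (f' i.2)), fun _ => rfl, ?_⟩)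
  · induction hx using Submodule.span_induction with
    | mem x hx =>
      obtain ⟨y, hy, q, rfl⟩ := hx
      exact Submodule.subset_span ⟨y, hy, c • q, tm_smul_right _ _ _ _ _⟩
    | zero => rw [smul_zero]; exact zero_mem _
    | add x y _ _ hx hy => rw [smul_add]; exact add_mem hx hy
    | smul a x _ hx => rw [smul_comm]; exact Submodule.smul_mem _ a hx
  · induction hx using Submodule.span_induction with
    | zero => simp
    | add x x' _ _ hx hx' => rw [map_add, LinearMap.add_apply, hx, hx', add_zero]
    | smul a x _ hx => rw [map_smul, LinearMap.smul_apply, hx, smul_zero]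
    | mem x hx =>
      obtain ⟨x, hx, q, rfl⟩ := hx
      induction hy using Submodule.span_induction with
      | zero => simp
      | add y y' _ _ hy hy' => rw [map_add, hy, hy', add_zero]
      | smul a y _ hy => rw [map_smul, hy, smul_zero]
      | mem y hy =>
        obtain ⟨y, hy, q', rfl⟩ := hy
        rw [form_tm]
        exact (hL.mem_iff _).1 (hL.smul_mem _ _ hx) _ hy
  · refine tm_induction x ?_ (fun y q => ?_) (fun x y hx hy => ?_)
    · simp
    · have : tm P Q y q - ∑ i : Fin n × Fin m, (comp P Q).form (tm P Q y q)
          (tm P Q (l i.1) (f' i.2)) • tm P Q (p i.1) (f i.2) =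
          ∑ j, tm P Q (Q.form q (f' j) • y - ∑ i, P.form (Q.form q (f' j) • y) (l i) • p i)
            (f j) := by
        rw [Fintype.sum_prod_type_right]
        simp only [form_tm, ← tm_smul_left]
        have e1 : ∀ (s : Fin n → P) q, tm P Q (∑ i, s i) q = ∑ i, tm P Q (s i) q :=
          fun s q => sum_tmul Finset.univ s q
        have e2 : ∀ p (s : Fin m → Q), tm P Q p (∑ i, s i) = ∑ i, tm P Q p (s i) :=
          fun p s => tmul_sum p Finset.univ s
        have e3 : ∀ p p' q, tm P Q (p - p') q = tm P Q p q - tm P Q p' q :=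
          fun p p' q => sub_tmul p p' q
        simp only [e3, Finset.sum_sub_distrib, ← e1]
        simp only [tm_smul, ← e2, hf]
      rw [this]
      exact Submodule.sum_mem _ fun j _ => Submodule.subset_span ⟨_, h _, _, rfl⟩
    · simp only [map_add, LinearMap.add_apply, add_smul, Finset.sum_add_distrib]
      rw [add_sub_add_comm]
      exact add_mem hx hy

theorem IsMetabolic.comp_right (P : QSpace k A B) {Q : QSpace k B C} (hQ : Q.IsMetabolic) :
    (comp P Q).IsMetabolic := by
  obtain ⟨L, hL⟩ := hQ
  obtain ⟨n, l, q, hl, h⟩ := hL.exists_dual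
  obtain ⟨m, e, e', he⟩ := P.exists_dual
  refine isMetabolic_of_dual (P := comp P Q) (Submodule.span A {x | ∃ p, ∃ y ∈ L, tm P Q p y = x})
    (fun c x hx => ?_) (fun x hx y hy => ?_) (n := Fin m × Fin n)
    (fun i => tm P Q (e' i.1) (l i.2)) (fun i => tm P Q (e i.1) (q i.2))
    (fun i => Submodule.subset_span ⟨_, _, hl _, rfl⟩)
    (fun x => ⟨fun i => (comp P Q).form x (tm P Q (e' i.1) (l i.2)), fun _ => rfl, ?_⟩)
  · induction hx using Submodule.span_induction with
    | mem x hx =>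
      obtain ⟨p, y, hy, rfl⟩ := hx
      exact Submodule.subset_span ⟨p, c • y, hL.smul_mem c y hy, tm_smul_right _ _ _ _ _⟩
    | zero => rw [smul_zero]; exact zero_mem _
    | add x y _ _ hx hy => rw [smul_add]; exact add_mem hx hy
    | smul a x _ hx => rw [smul_comm]; exact Submodule.smul_mem _ a hx
  · induction hx using Submodule.span_induction with
    | zero => simp
    | add x x' _ _ hx hx' => rw [map_add, LinearMap.add_apply, hx, hx', add_zero]
    | smul a x _ hx => rw [map_smul, LinearMap.smul_apply, hx, smul_zero]
    | mem x hx =>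
      obtain ⟨p, x, hx, rfl⟩ := hx
      induction hy using Submodule.span_induction with
      | zero => simp
      | add y y' _ _ hy hy' => rw [map_add, hy, hy', add_zero]
      | smul a y _ hy => rw [map_smul, hy, smul_zero]
      | mem y hy =>
        obtain ⟨p', y, hy, rfl⟩ := hy
        rw [form_tm, (hL.mem_iff x).1 hx y hy, zero_smul, map_zero, LinearMap.zero_apply]
  · refine tm_induction x ?_ (fun p y => ?_) (fun x y hx hy => ?_)
    · simp
    · have : tm P Q p y - ∑ i : Fin m × Fin n, (comp P Q).form (tm P Q p y)
          (tm P Q (e' i.1) (l i.2)) • tm P Q (e i.1) (q i.2) =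
          tm P Q p (y - ∑ i, Q.form y (l i) • q i) := by
        rw [Fintype.sum_prod_type_right]
        simp only [form_tm, ← tm_smul_left]
        have e1 : ∀ (s : Fin m → P) q, tm P Q (∑ i, s i) q = ∑ i, tm P Q (s i) q :=
          fun s q => sum_tmul Finset.univ s q
        have e2 : ∀ p (s : Fin n → Q), tm P Q p (∑ i, s i) = ∑ i, tm P Q p (s i) :=
          fun p s => tmul_sum p Finset.univ s
        have e3 : ∀ p q q', tm P Q p (q - q') = tm P Q p q - tm P Q p q' :=
          fun p q q' => tmul_sub p q q'
        simp only [← e1, he, e3, e2, tm_smul]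
      rw [this]
      exact Submodule.subset_span ⟨_, _, h _, rfl⟩
    · simp only [map_add, LinearMap.add_apply, add_smul, Finset.sum_add_distrib]
      rw [add_sub_add_comm]
      exact add_mem hx hy

end QSpace

end


/-! ### Graphs and base change -/

section

variable {k A B C D E : Type u} [Field k] [CommRing A] [CommRing B] [CommRing C] [CommRing D]
  [CommRing E] [Algebra k A] [Algebra k B] [Algebra k C] [Algebra k D] [Algebra k E]

/-- The structure of `A ⊗[k] D`-module on `M ⊗[k] D`. -/
@[reducible]
def tensorModule (k A D M : Type u) [Field k] [CommRing A] [CommRing D] [Algebra k A] [Algebra k D]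
    [AddCommGroup M] [Module k M] [Module A M] [IsScalarTower k A M] :
    Module (A ⊗[k] D) (M ⊗[k] D) :=
  Module.compHom (M ⊗[k] D)
    ((Module.endTensorEndAlgHom (R := k) (S := k) (A := k) (M := M) (N := D)).comp
      (Algebra.TensorProduct.map (Algebra.lsmul k k M) (Algebra.lmul k D))).toRingHom

namespace QSpace

/-- Restriction along `g : C ⟶ B` (direct image along `Spec B ⟶ Spec C`). -/
def restr (P : QSpace k A B) (g : C →ₐ[k] B) : QSpace k A C :=
  letI : Module C P := Module.compHom P g.toRingHom
  haveI hr : ∀ (c : C) (p : P), c • p = g c • p := fun _ _ => rfl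
  { carrier := P
    towerB := ⟨fun a c x => by rw [hr, hr, map_smul, smul_assoc]⟩
    smulComm := ⟨fun a c x => by rw [hr, hr, smul_comm]⟩
    form := P.form
    form_symm := P.form_symm
    form_smul := fun c x y => P.form_smul (g c) x y
    bijective := P.bijective }

/-- The graph of `Spec A ⟶ Spec B`: the module `A`, where `B` acts through `f`, with the unit
form `(x, y) ↦ x * y`. For `f = id` this is the diagonal. -/
def graph (f : B →ₐ[k] A) : QSpace k A B :=
  letI : Module B A := Module.compHom A f.toRingHom
  haveI hr : ∀ (b : B) (a : A), b • a = f b * a := fun _ _ => rfl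
  { carrier := A
    towerB := ⟨fun c b x => by rw [hr, hr, map_smul, smul_mul_assoc]⟩
    smulComm := ⟨fun a c x => by rw [hr, hr, smul_eq_mul, smul_eq_mul, mul_left_comm]⟩
    form := LinearMap.mul A A
    form_symm := fun x y => mul_comm x y
    form_smul := fun b x y => by
      rw [hr, hr, LinearMap.mul_apply', LinearMap.mul_apply', mul_assoc, mul_left_comm]
    bijective := bijective_of_dual (LinearMap.mul A A) (fun x y => mul_comm x y) (n := Unit)
      (fun _ => 1) (fun _ => 1) (fun x => by simp) }

theorem Isometric.restr_graph (f : B →ₐ[k] A) (g : C →ₐ[k] B) :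
    Isometric (restr (graph f) g) (graph (f.comp g)) :=
  ⟨LinearEquiv.refl A A, fun _ _ => rfl, fun _ _ => rfl⟩

theorem Isometric.restr_id (P : QSpace k A B) : Isometric (restr P (AlgHom.id k B)) P :=
  ⟨LinearEquiv.refl A P, fun _ _ => rfl, fun _ _ => rfl⟩

theorem Isometric.comp_graph (P : QSpace k A B) (g : C →ₐ[k] B) :
    Isometric (comp P (graph g)) (restr P g) := by
  refine Isometric.of_tm (Q := graph g) (R := restr P g) (fun p (b : B) => (b • p : P))
    (fun (p p' : P) (q : B) => (smul_add q p p' : q • (p + p') = q • p + q • p'))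
    (fun (p : P) (q q' : B) => (add_smul q q' p : (q + q') • p = q • p + q' • p))
    (fun b p (q : B) => ?_) (fun a p (q : B) => ?_) (fun c p (q : B) => ?_)
    (fun p (q : B) p' (q' : B) => ?_) (fun (r : P) => AddSubmonoid.subset_closure ⟨(r, (1 : B)), ?_⟩)
  · change q • b • p = (b * q) • p
    rw [smul_smul, mul_comm]
  · exact smul_comm q a p
  · change (g c * q) • p = g c • q • p
    rw [mul_smul]
  · change P.form (q • p) (q' • p') = P.form ((q * q') • p) p'
    rw [← P.form_smul, smul_smul, mul_comm]
  · exact one_smul B r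

theorem Isometric.id_comp (P : QSpace k A B) :
    Isometric (comp (graph (AlgHom.id k A)) P) P := by
  refine Isometric.of_tm (P := graph (AlgHom.id k A)) (fun (a : A) p => (a • p : P))
    (fun p p' q => add_smul _ _ _) (fun p q q' => smul_add _ _ _)
    (fun b (p : A) q => ?_) (fun a (p : A) q => ?_) (fun c (p : A) q => ?_)
    (fun (p : A) q (p' : A) q' => ?_)
    (fun r => AddSubmonoid.subset_closure ⟨((1 : A), r), ?_⟩)
  · change (b * p) • q = p • b • q
    rw [smul_smul, mul_comm]
  · exact mul_smul a p q
  · exact smul_comm p c q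
  · change P.form (p • q) (p' • q') = P.form q q' * p * p'
    simp only [map_smul, LinearMap.smul_apply, smul_eq_mul]
    ring
  · exact one_smul A r

theorem Isometric.comp_id (P : QSpace k A B) :
    Isometric (comp P (graph (AlgHom.id k B))) P :=
  (Isometric.comp_graph P _).trans (Isometric.restr_id P)

/-- The form on the base change, as a `k`-bilinear map. -/
noncomputable def baseForm₀ (P : QSpace k A B) (D : Type u) [CommRing D] [Algebra k D] :
    P ⊗[k] D →ₗ[k] P ⊗[k] D →ₗ[k] A ⊗[k] D :=
  TensorProduct.map₂
    (LinearMap.mk₂ k (fun x y => P.form x y) (fun x y z => by simp)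
      (fun c x y => by
        rw [← algebraMap_smul A c x, map_smul, LinearMap.smul_apply, algebraMap_smul])
      (fun x y z => by simp)
      (fun c x y => by rw [← algebraMap_smul A c y, map_smul, algebraMap_smul]))
    (LinearMap.mul k D)

theorem baseForm₀_tmul (P : QSpace k A B) (p p' : P) (d d' : D) :
    baseForm₀ P D (p ⊗ₜ d) (p' ⊗ₜ d') = P.form p p' ⊗ₜ (d * d') := rfl

theorem baseForm₀_symm (P : QSpace k A B) (x y : P ⊗[k] D) :
    baseForm₀ P D x y = baseForm₀ P D y x := by
  induction x with
  | zero => simp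
  | add x x' hx hx' => rw [map_add, map_add, LinearMap.add_apply, hx, hx']
  | tmul p q =>
    induction y with
    | zero => simp
    | add y y' hy hy' => rw [map_add, map_add, LinearMap.add_apply, hy, hy']
    | tmul p' q' => rw [baseForm₀_tmul, baseForm₀_tmul, P.form_symm, mul_comm]

attribute [local instance] tensorModule in
theorem tensorModule_smul_tmul {M : Type u} [AddCommGroup M] [Module k M] [Module A M]
    [IsScalarTower k A M] (a : A) (d e : D) (m : M) :
    (a ⊗ₜ[k] d : A ⊗[k] D) • (m ⊗ₜ[k] e : M ⊗[k] D) = (a • m) ⊗ₜ (d * e) := rfl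

attribute [local instance] tensorModule in
theorem baseForm₀_smul (P : QSpace k A B) (a : A ⊗[k] D) (x y : P ⊗[k] D) :
    baseForm₀ P D (a • x) y = a * baseForm₀ P D x y := by
  induction a with
  | zero => simp
  | add a a' ha ha' => rw [add_smul, map_add, LinearMap.add_apply, ha, ha', add_mul]
  | tmul a d =>
    induction x with
    | zero => simp
    | add x x' hx hx' => rw [smul_add, map_add, map_add, LinearMap.add_apply, hx, hx',
        LinearMap.add_apply, mul_add]
    | tmul p q =>
      induction y with
      | zero => simp
      | add y y' hy hy' => rw [map_add, map_add, hy, hy', mul_add]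
      | tmul p' q' =>
        rw [tensorModule_smul_tmul, baseForm₀_tmul, baseForm₀_tmul, map_smul,
          LinearMap.smul_apply, smul_eq_mul, Algebra.TensorProduct.tmul_mul_tmul, mul_assoc]

attribute [local instance] tensorModule in
/-- The form on the base change. -/
noncomputable def baseForm (P : QSpace k A B) (D : Type u) [CommRing D] [Algebra k D] :
    P ⊗[k] D →ₗ[A ⊗[k] D] P ⊗[k] D →ₗ[A ⊗[k] D] A ⊗[k] D :=
  LinearMap.mk₂ (A ⊗[k] D) (fun x y => baseForm₀ P D x y)
    (fun x y z => by rw [map_add, LinearMap.add_apply]) (fun a x y => baseForm₀_smul P a x y)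
    (fun x y z => map_add _ _ _)
    (fun a x y => by rw [baseForm₀_symm, baseForm₀_smul, baseForm₀_symm, smul_eq_mul])

attribute [local instance] tensorModule in
theorem baseForm_dual (P : QSpace k A B) {n : ℕ} {e e' : Fin n → P}
    (he : ∀ x, ∑ i, P.form x (e' i) • e i = x) (x : P ⊗[k] D) :
    ∑ i, baseForm P D x (e' i ⊗ₜ 1) • (e i ⊗ₜ[k] (1 : D)) = x := by
  induction x with
  | zero => simp
  | add x y hx hy =>
    simp only [map_add, LinearMap.add_apply, add_smul, Finset.sum_add_distrib]
    rw [hx, hy]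
  | tmul p d =>
    have : ∀ i, baseForm P D (p ⊗ₜ d) (e' i ⊗ₜ 1) • (e i ⊗ₜ[k] (1 : D)) =
        (P.form p (e' i) • e i) ⊗ₜ d := fun i => by
      change (P.form p (e' i) ⊗ₜ[k] (d * 1) : A ⊗[k] D) • _ = _
      rw [tensorModule_smul_tmul, mul_one, mul_one]
    simp only [this, ← sum_tmul, he]

attribute [local instance] tensorModule in
/-- Base change: the space `P ⊗[k] D` in `Proj(X × Spec D, Y × Spec D)` over `A ⊗[k] D`, i.e. the
exterior product of `P` with the diagonal of `Spec D`. -/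
noncomputable def baseChange (P : QSpace k A B) (D : Type u) [CommRing D] [Algebra k D] :
    QSpace k (A ⊗[k] D) (B ⊗[k] D) where
  carrier := P ⊗[k] D
  modA := tensorModule k A D P
  modB := tensorModule k B D P
  towerA := ⟨fun c z x => by
    change (Module.endTensorEndAlgHom (R := k) (S := k) (A := k) (M := P) (N := D)).comp
      (Algebra.TensorProduct.map (Algebra.lsmul k k P) (Algebra.lmul k D)) (c • z) x = _
    rw [map_smul]
    rfl⟩
  towerB := ⟨fun c z x => by
    change (Module.endTensorEndAlgHom (R := k) (S := k) (A := k) (M := P) (N := D)).comp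
      (Algebra.TensorProduct.map (Algebra.lsmul k k P) (Algebra.lmul k D)) (c • z) x = _
    rw [map_smul]
    rfl⟩
  smulComm := ⟨fun a b x => by
    induction a with
    | zero => rw [zero_smul, zero_smul, smul_zero]
    | add a a' ha ha' => rw [add_smul, add_smul, smul_add, ha, ha']
    | tmul a d =>
      induction b with
      | zero => rw [zero_smul, zero_smul, smul_zero]
      | add b b' hb hb' => rw [add_smul, add_smul, smul_add, hb, hb']
      | tmul b d' =>
        induction x with
        | zero => simp only [smul_zero]
        | add x x' hx hx' => simp only [smul_add, hx, hx']
        | tmul p e =>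
          rw [tensorModule_smul_tmul, tensorModule_smul_tmul, tensorModule_smul_tmul,
            tensorModule_smul_tmul, smul_comm, mul_left_comm]⟩
  finite := by
    obtain ⟨n, e, e', he⟩ := P.exists_dual
    exact finite_of_dual (baseForm P D) _ _ (baseForm_dual P he)
  projective := by
    obtain ⟨n, e, e', he⟩ := P.exists_dual
    exact projective_of_dual (baseForm P D) _ _ (baseForm_dual P he)
  form := baseForm P D
  form_symm := baseForm₀_symm P
  form_smul := fun b x y => by
    change baseForm₀ P D _ _ = baseForm₀ P D _ _
    induction b with
    | zero => simp
    | add b b' hb hb' => rw [add_smul, add_smul, map_add, map_add, LinearMap.add_apply, hb, hb']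
    | tmul b d =>
      induction x with
      | zero => simp
      | add x x' hx hx' => rw [smul_add, map_add, map_add, LinearMap.add_apply, hx, hx',
          LinearMap.add_apply]
      | tmul p q =>
        induction y with
        | zero => simp
        | add y y' hy hy' => rw [smul_add, map_add, map_add, hy, hy']
        | tmul p' q' =>
          rw [tensorModule_smul_tmul, tensorModule_smul_tmul, baseForm₀_tmul, baseForm₀_tmul,
            P.form_smul, mul_assoc, mul_left_comm]
  bijective := by
    obtain ⟨n, e, e', he⟩ := P.exists_dual
    exact bijective_of_dual (baseForm P D) (baseForm₀_symm P) _ _ (baseForm_dual P he)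

/-- The pure tensors in `baseChange P D`. -/
def bt (P : QSpace k A B) (D : Type u) [CommRing D] [Algebra k D] (p : P) (d : D) :
    baseChange P D := p ⊗ₜ[k] d

section bt

variable (P : QSpace k A B)

theorem bt_add_left (p p' : P) (d : D) : bt P D (p + p') d = bt P D p d + bt P D p' d :=
  add_tmul p p' d

theorem bt_add_right (p : P) (d d' : D) : bt P D p (d + d') = bt P D p d + bt P D p d' :=
  tmul_add p d d'

theorem bt_smul (c : k) (p : P) (d : D) : bt P D (c • p) d = bt P D p (c • d) :=
  smul_tmul c p d

theorem smul_bt (a : A) (p : P) (d d' : D) :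
    (a ⊗ₜ[k] d : A ⊗[k] D) • bt P D p d' = bt P D (a • p) (d * d') := rfl

theorem smul_bt' (b : B) (p : P) (d d' : D) :
    (b ⊗ₜ[k] d : B ⊗[k] D) • bt P D p d' = bt P D (b • p) (d * d') := rfl

theorem form_bt (p p' : P) (d d' : D) :
    (baseChange P D).form (bt P D p d) (bt P D p' d') = P.form p p' ⊗ₜ (d * d') := rfl

variable {P} in
@[elab_as_elim]
theorem bt_induction {motive : baseChange P D → Prop} (x : baseChange P D) (zero : motive 0)
    (bt : ∀ p d, motive (bt P D p d)) (add : ∀ x y, motive x → motive y → motive (x + y)) :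
    motive x :=
  TensorProduct.induction_on (motive := motive) x zero bt add

variable {P} in
@[elab_as_elim]
theorem bt_induction₂ {motive : baseChange P D → baseChange P D → Prop} (x y : baseChange P D)
    (zero_left : ∀ y, motive 0 y) (zero_right : ∀ x, motive x 0)
    (bt : ∀ p d p' d', motive (bt P D p d) (bt P D p' d'))
    (add_left : ∀ x x' y, motive x y → motive x' y → motive (x + x') y)
    (add_right : ∀ x y y', motive x y → motive x y' → motive x (y + y')) :
    motive x y :=
  bt_induction x (zero_left y)
    (fun p q => bt_induction y (zero_right _) (fun p' q' => bt p q p' q') fun _ _ => add_right _ _ _)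
    (fun _ _ => add_left _ _ _)

/-- Additive maps out of `baseChange P D`. -/
def btLift {G : Type*} [AddCommGroup G] (f : P → D → G)
    (h₁ : ∀ p p' q, f (p + p') q = f p q + f p' q)
    (h₂ : ∀ p q q', f p (q + q') = f p q + f p q')
    (h₃ : ∀ (c : k) p q, f (c • p) q = f p (c • q)) : baseChange P D →+ G :=
  liftAddHom (R := k) (AddMonoidHom.mk' (fun p => AddMonoidHom.mk' (f p) (h₂ p))
    (fun p p' => AddMonoidHom.ext (h₁ p p'))) h₃

theorem btLift_bt {G : Type*} [AddCommGroup G] (f : P → D → G)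
    (h₁ : ∀ p p' q, f (p + p') q = f p q + f p' q)
    (h₂ : ∀ p q q', f p (q + q') = f p q + f p q')
    (h₃ : ∀ (c : k) p q, f (c • p) q = f p (c • q)) (p : P) (d : D) :
    btLift P f h₁ h₂ h₃ (bt P D p d) = f p d := rfl

variable {P} in
theorem Isometric.of_bt {R : QSpace k (A ⊗[k] D) (B ⊗[k] D)} (f : P → D → R)
    (h₁ : ∀ p p' q, f (p + p') q = f p q + f p' q)
    (h₂ : ∀ p q q', f p (q + q') = f p q + f p q')
    (h₃ : ∀ (c : k) p q, f (c • p) q = f p (c • q))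
    (hA : ∀ (a : A) (d : D) p q, f (a • p) (d * q) = (a ⊗ₜ[k] d : A ⊗[k] D) • f p q)
    (hB : ∀ (b : B) (d : D) p q, f (b • p) (d * q) = (b ⊗ₜ[k] d : B ⊗[k] D) • f p q)
    (hf : ∀ p q p' q', R.form (f p q) (f p' q') = P.form p p' ⊗ₜ (q * q'))
    (hs : ∀ r, r ∈ AddSubmonoid.closure (Set.range fun x : P × D => f x.1 x.2)) :
    Isometric (baseChange P D) R := by
  refine Isometric.of_surjective (btLift P f h₁ h₂ h₃) (fun a x => ?_) (fun c x => ?_)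
    (fun x y => ?_) (fun r => ?_)
  · refine bt_induction x ?_ (fun p q => ?_) (fun x y hx hy => ?_)
    · rw [smul_zero, map_zero, smul_zero]
    · induction a with
      | zero => rw [zero_smul, zero_smul, map_zero]
      | add a a' h h' => rw [add_smul, map_add, h, h', add_smul]
      | tmul a d => rw [smul_bt, btLift_bt, btLift_bt, hA]
    · rw [smul_add, map_add, hx, hy, map_add, smul_add]
  · refine bt_induction x ?_ (fun p q => ?_) (fun x y hx hy => ?_)
    · rw [smul_zero, map_zero, smul_zero]
    · induction c with
      | zero => rw [zero_smul, zero_smul, map_zero]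
      | add a a' h h' => rw [add_smul, map_add, h, h', add_smul]
      | tmul a d => rw [smul_bt', btLift_bt, btLift_bt, hB]
    · rw [smul_add, map_add, hx, hy, map_add, smul_add]
  · refine bt_induction₂ x y (fun y => ?_) (fun x => ?_) (fun p q p' q' => ?_)
      (fun x x' y hx hx' => ?_) (fun x y y' hy hy' => ?_)
    · rw [map_zero, map_zero, map_zero, LinearMap.zero_apply, LinearMap.zero_apply]
    · rw [map_zero, map_zero, map_zero]
    · rw [btLift_bt, btLift_bt, form_bt, hf]
    · rw [map_add, map_add, map_add, LinearMap.add_apply, LinearMap.add_apply, hx, hx']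
    · rw [map_add, map_add, map_add, hy, hy']
  · induction hs r using AddSubmonoid.closure_induction with
    | mem x hx =>
      obtain ⟨⟨p, q⟩, rfl⟩ := hx
      exact ⟨bt P D p q, rfl⟩
    | zero => exact ⟨0, map_zero _⟩
    | add x y _ _ hx hy =>
      obtain ⟨x, rfl⟩ := hx
      obtain ⟨y, rfl⟩ := hy
      exact ⟨x + y, map_add _ _ _⟩

end bt

theorem Isometric.baseChange_congr {P P' : QSpace k A B} (D : Type u) [CommRing D] [Algebra k D] :
    Isometric P P' → Isometric (baseChange P D) (baseChange P' D) := by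
  rintro ⟨f, h₁, h₂⟩
  have hk : ∀ (c : k) p, f (c • p) = c • f p := fun c p => by
    rw [← algebraMap_smul A c p, map_smul, algebraMap_smul]
  refine Isometric.of_bt (fun p d => bt P' D (f p) d) (fun p p' q => ?_) (fun p q q' => ?_)
    (fun b p q => ?_) (fun a d p q => ?_) (fun c d p q => ?_) (fun p q p' q' => ?_) (fun r => ?_)
  · rw [map_add, bt_add_left]
  · rw [bt_add_right]
  · rw [hk, bt_smul]
  · rw [map_smul, smul_bt]
  · rw [h₁, smul_bt']
  · rw [form_bt, h₂]
  · refine bt_induction r (zero_mem _) (fun p q => ?_) (fun x y hx hy => add_mem hx hy)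
    exact AddSubmonoid.subset_closure ⟨(f.symm p, q), by simp⟩

theorem Isometric.baseChange_sum (P P' : QSpace k A B) (D : Type u) [CommRing D] [Algebra k D] :
    Isometric (baseChange (P.sum P') D) ((baseChange P D).sum (baseChange P' D)) := by
  refine Isometric.of_bt (P := P.sum P') (R := (baseChange P D).sum (baseChange P' D))
    (fun (p : P × P') q => (bt P D p.1 q, bt P' D p.2 q))
    (fun p p' q => ?_) (fun p q q' => ?_)
    (fun b p q => ?_) (fun a d p q => ?_) (fun c d p q => ?_) (fun p q p' q' => ?_) (fun r => ?_)
  · exact Prod.ext (bt_add_left P _ _ _) (bt_add_left P' _ _ _)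
  · exact Prod.ext (bt_add_right P _ _ _) (bt_add_right P' _ _ _)
  · exact Prod.ext (bt_smul P _ _ _) (bt_smul P' _ _ _)
  · rfl
  · rfl
  · exact (add_tmul (P.form p.1 p'.1) (P'.form p.2 p'.2) (q * q')).symm
  · obtain ⟨(x : baseChange P D), (y : baseChange P' D)⟩ := r
    have hx : ((x, 0) : baseChange P D × baseChange P' D) ∈ AddSubmonoid.closure (Set.range
        fun x : (P × P') × D => ((bt P D x.1.1 x.2, bt P' D x.1.2 x.2) :
          baseChange P D × baseChange P' D)) := by
      refine bt_induction x (zero_mem _) (fun p q => ?_) (fun x y hx hy => ?_)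
      · exact AddSubmonoid.subset_closure ⟨((p, 0), q), Prod.ext rfl (zero_tmul _ _)⟩
      · have := add_mem hx hy
        rwa [Prod.mk_add_mk, add_zero] at this
    have hy : ((0, y) : baseChange P D × baseChange P' D) ∈ AddSubmonoid.closure (Set.range
        fun x : (P × P') × D => ((bt P D x.1.1 x.2, bt P' D x.1.2 x.2) :
          baseChange P D × baseChange P' D)) := by
      refine bt_induction y (zero_mem _) (fun p q => ?_) (fun x y hx hy => ?_)
      · exact AddSubmonoid.subset_closure ⟨((0, p), q), Prod.ext (zero_tmul _ _) rfl⟩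
      · have := add_mem hx hy
        rwa [Prod.mk_add_mk, add_zero] at this
    have := add_mem hx hy
    rwa [Prod.mk_add_mk, add_zero, zero_add] at this

theorem Isometric.baseChange_graph (f : B →ₐ[k] A) (D : Type u) [CommRing D] [Algebra k D] :
    Isometric (baseChange (graph f) D)
      (graph (Algebra.TensorProduct.map f (AlgHom.id k D))) := by
  refine Isometric.of_bt (P := graph f)
    (R := graph (Algebra.TensorProduct.map f (AlgHom.id k D)))
    (fun (a : A) (d : D) => (a ⊗ₜ[k] d : A ⊗[k] D))
    (fun p p' q => add_tmul _ _ _) (fun p q q' => tmul_add _ _ _)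
    (fun (b : k) (p : A) (q : D) => (smul_tmul b p q : (b • p) ⊗ₜ[k] q = p ⊗ₜ[k] (b • q))) (fun a d (p : A) q => ?_) (fun c d (p : A) q => ?_)
    (fun (p : A) q (p' : A) q' => ?_) (fun (r : A ⊗[k] D) => ?_)
  · exact (Algebra.TensorProduct.tmul_mul_tmul a p d q).symm
  · exact (Algebra.TensorProduct.tmul_mul_tmul (f c) p d q).symm
  · exact Algebra.TensorProduct.tmul_mul_tmul p p' q q'
  · exact TensorProduct.induction_on (motive := fun r : A ⊗[k] D => r ∈ AddSubmonoid.closure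
      (Set.range fun x : A × D => (x.1 ⊗ₜ[k] x.2 : A ⊗[k] D))) r (zero_mem _)
      (fun a d => AddSubmonoid.subset_closure ⟨(a, d), rfl⟩) (fun x y hx hy => add_mem hx hy)

theorem Isometric.baseChange_comp (P : QSpace k A B) (Q : QSpace k B C) (D : Type u) [CommRing D]
    [Algebra k D] :
    Isometric (baseChange (comp P Q) D) (comp (baseChange P D) (baseChange Q D)) := by
  let R := comp (baseChange P D) (baseChange Q D)
  let t : baseChange P D → baseChange Q D → R := tm (baseChange P D) (baseChange Q D)
  have tb : ∀ (b : B) (d d' : D) p q e, t (bt P D (b • p) (d * d')) (bt Q D q e) =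
      t (bt P D p d') (bt Q D (b • q) (d * e)) := fun b d d' p q e => by
    rw [← smul_bt', ← smul_bt]
    exact tm_smul _ _ _ _ _
  have tk : ∀ p q (d d' : D), t (bt P D p d) (bt Q D q d') =
      t (bt P D p 1) (bt Q D q (d * d')) := fun p q d d' => by
    have := tb 1 d 1 p q d'
    rwa [one_smul, one_smul, mul_one] at this
  have tkk : ∀ (c : k) p q (d : D), t (bt P D (c • p) 1) (bt Q D q d) =
      t (bt P D p 1) (bt Q D q (c • d)) := fun c p q d => by
    rw [bt_smul, tk, smul_mul_assoc, one_mul]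
  let φ : D → comp P Q →+ R := fun d => compLift P Q (fun p q => t (bt P D p 1) (bt Q D q d))
    (fun p p' q => by rw [bt_add_left]; exact tm_add_left _ _ _ _ _)
    (fun p q q' => by rw [bt_add_left]; exact tm_add_right _ _ _ _ _)
    (fun b p q => by
      have := tb b 1 1 p q d
      rwa [mul_one, one_mul] at this)
  have hφ : ∀ d p q, φ d (tm P Q p q) = t (bt P D p 1) (bt Q D q d) := fun _ _ _ => rfl
  refine Isometric.of_bt (P := comp P Q) (R := R) (fun x d => φ d x)
    (fun p p' q => map_add _ _ _) (fun x d d' => ?_)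
    (fun c x d => ?_) (fun a d x e => ?_) (fun c d x e => ?_) (fun x d x' d' => ?_) (fun y => ?_)
  · refine tm_induction x ?_ (fun p q => ?_) (fun x y hx hy => ?_)
    · simp only [map_zero, add_zero]
    · rw [hφ, hφ, hφ, bt_add_right]
      exact tm_add_right _ _ _ _ _
    · rw [map_add, hx, hy, map_add, map_add, add_add_add_comm]
  · refine tm_induction x ?_ (fun p q => ?_) (fun x y hx hy => ?_)
    · simp only [smul_zero, map_zero]
    · have : c • tm P Q p q = tm P Q (c • p) q := rfl
      rw [this, hφ, hφ, tkk]
    · rw [smul_add, map_add, hx, hy, map_add]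
  · refine tm_induction x ?_ (fun p q => ?_) (fun x y hx hy => ?_)
    · simp only [smul_zero, map_zero]
    · rw [← tm_smul_left, hφ, hφ, ← tk]
      have := smul_bt P a p d (1 : D)
      rw [mul_one] at this
      rw [← this]
      rfl
    · rw [smul_add, map_add, hx, hy, map_add, smul_add]
  · refine tm_induction x ?_ (fun p q => ?_) (fun x y hx hy => ?_)
    · simp only [smul_zero, map_zero]
    · rw [← tm_smul_right, hφ, hφ, ← smul_bt']
      rfl
    · rw [smul_add, map_add, hx, hy, map_add, smul_add]
  · refine tm_induction₂ x x' (fun y => ?_) (fun x => ?_) (fun p q p' q' => ?_)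
      (fun x x' y hx hx' => ?_) (fun x y y' hy hy' => ?_)
    · simp only [map_zero, LinearMap.zero_apply, zero_tmul]
    · simp only [map_zero, zero_tmul]
    · rw [hφ, hφ, form_tm, form_bt, smul_bt', form_bt, mul_one, mul_one, form_tm]
    · simp only [map_add, LinearMap.add_apply, add_tmul, hx, hx']
    · simp only [map_add, add_tmul, hy, hy']
  · refine tm_induction y (zero_mem _) (fun x z => ?_) (fun x y hx hy => add_mem hx hy)
    refine bt_induction x ?_ (fun p d => ?_) (fun x y hx hy => ?_)
    · have : tm (baseChange P D) (baseChange Q D) 0 z = 0 := zero_tmul _ _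
      rw [this]
      exact zero_mem _
    · refine bt_induction z ?_ (fun q e => ?_) (fun x y hx hy => ?_)
      · have : tm (baseChange P D) (baseChange Q D) (bt P D p d) 0 = 0 := tmul_zero _ _
        rw [this]
        exact zero_mem _
      · exact AddSubmonoid.subset_closure ⟨(tm P Q p q, d * e), (tk p q d e).symm⟩
      · rw [tm_add_right]
        exact add_mem hx hy
    · rw [tm_add_left]
      exact add_mem hx hy

theorem IsMetabolic.baseChange {P : QSpace k A B} (hP : P.IsMetabolic) (D : Type u) [CommRing D]
    [Algebra k D] : (baseChange P D).IsMetabolic := by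
  obtain ⟨L, hL⟩ := hP
  obtain ⟨n, l, p, hl, h⟩ := hL.exists_dual
  refine isMetabolic_of_dual (P := P.baseChange D)
    (Submodule.span (A ⊗[k] D) {x | ∃ y ∈ L, ∃ d, bt P D y d = x})
    (fun c x hx => ?_) (fun x hx y hy => ?_) (n := Fin n)
    (fun i => bt P D (l i) 1) (fun i => bt P D (p i) 1)
    (fun i => Submodule.subset_span ⟨_, hl _, _, rfl⟩)
    (fun x => ⟨fun i => (P.baseChange D).form x (bt P D (l i) 1), fun _ => rfl, ?_⟩)
  · induction hx using Submodule.span_induction with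
    | zero => rw [smul_zero]; exact zero_mem _
    | add x y _ _ hx hy => rw [smul_add]; exact add_mem hx hy
    | smul a x _ hx => rw [smul_comm]; exact Submodule.smul_mem _ a hx
    | mem x hx =>
      obtain ⟨y, hy, d, rfl⟩ := hx
      induction c with
      | zero => rw [zero_smul]; exact zero_mem _
      | add c c' h h' => rw [add_smul]; exact add_mem h h'
      | tmul b d' =>
        rw [smul_bt']
        exact Submodule.subset_span ⟨b • y, hL.smul_mem b y hy, _, rfl⟩
  · induction hx using Submodule.span_induction with
    | zero => simp
    | add x x' _ _ hx hx' => rw [map_add, LinearMap.add_apply, hx, hx', add_zero]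
    | smul a x _ hx => rw [map_smul, LinearMap.smul_apply, hx, smul_zero]
    | mem x hx =>
      obtain ⟨x, hx, d, rfl⟩ := hx
      induction hy using Submodule.span_induction with
      | zero => simp
      | add y y' _ _ hy hy' => rw [map_add, hy, hy', add_zero]
      | smul a y _ hy => rw [map_smul, hy, smul_zero]
      | mem y hy =>
        obtain ⟨y, hy, d', rfl⟩ := hy
        rw [form_bt, (hL.mem_iff x).1 hx y hy, zero_tmul]
  · refine bt_induction x ?_ (fun y d => ?_) (fun x y hx hy => ?_)
    · simp
    · have : bt P D y d - ∑ i : Fin n, (P.baseChange D).form (bt P D y d)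
          (bt P D (l i) 1) • bt P D (p i) 1 = bt P D (y - ∑ i, P.form y (l i) • p i) d := by
        have e1 : ∀ (s : Fin n → P) q, bt P D (∑ i, s i) q = ∑ i, bt P D (s i) q :=
          fun s q => sum_tmul Finset.univ s q
        have e3 : ∀ p p' q, bt P D (p - p') q = bt P D p q - bt P D p' q :=
          fun p p' q => sub_tmul p p' q
        simp only [e3, e1, form_bt, smul_bt, mul_one]
      rw [this]
      exact Submodule.subset_span ⟨_, h _, _, rfl⟩
    · simp only [map_add, LinearMap.add_apply, add_smul, Finset.sum_add_distrib]
      rw [add_sub_add_comm]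
      exact add_mem hx hy

/-- Base change is natural in the algebra of coefficients. -/
theorem Isometric.baseChange_natural (P : QSpace k A B) (f : D →ₐ[k] E) :
    Isometric (comp (graph (Algebra.TensorProduct.map (AlgHom.id k A) f)) (baseChange P D))
      (comp (baseChange P E) (graph (Algebra.TensorProduct.map (AlgHom.id k B) f))) := by
  refine Isometric.trans ?_ (Isometric.comp_graph _ _).symm
  let φ : baseChange P D →+ baseChange P E := btLift P (fun p d => bt P E p (f d))
    (fun p p' q => bt_add_left P p p' (f q))
    (fun p q q' => by rw [map_add, bt_add_right]) (fun c p d => by rw [map_smul, bt_smul])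
  have hφ : ∀ p d, φ (bt P D p d) = bt P E p (f d) := fun _ _ => rfl
  have hA : ∀ (a : A ⊗[k] D) x, φ (a • x) =
      Algebra.TensorProduct.map (AlgHom.id k A) f a • φ x := fun a x => by
    induction a with
    | zero => simp
    | add a a' h h' => rw [add_smul, map_add, h, h', map_add, add_smul]
    | tmul a d =>
      refine bt_induction x ?_ (fun y d => ?_) (fun x y hx hy => ?_)
      · simp
      · rw [smul_bt, hφ, hφ, Algebra.TensorProduct.map_tmul, smul_bt, map_mul]
        rfl
      · rw [smul_add, map_add, hx, hy, map_add, smul_add]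
  have hB : ∀ (b : B ⊗[k] D) x, φ (b • x) =
      Algebra.TensorProduct.map (AlgHom.id k B) f b • φ x := fun a x => by
    induction a with
    | zero => simp
    | add a a' h h' => rw [add_smul, map_add, h, h', map_add, add_smul]
    | tmul a d =>
      refine bt_induction x ?_ (fun y d => ?_) (fun x y hx hy => ?_)
      · simp
      · rw [smul_bt', hφ, hφ, Algebra.TensorProduct.map_tmul, smul_bt', map_mul]
        rfl
      · rw [smul_add, map_add, hx, hy, map_add, smul_add]
  have hf : ∀ x y, (baseChange P E).form (φ x) (φ y) =
      Algebra.TensorProduct.map (AlgHom.id k A) f ((baseChange P D).form x y) := fun x y => by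
    refine bt_induction₂ x y (fun y => ?_) (fun x => ?_) (fun p q p' q' => ?_)
      (fun x x' y hx hx' => ?_) (fun x y y' hy hy' => ?_)
    · simp
    · simp
    · rw [hφ, hφ, form_bt, form_bt, Algebra.TensorProduct.map_tmul, map_mul]
      rfl
    · simp only [map_add, LinearMap.add_apply, hx, hx']
    · simp only [map_add, hy, hy']
  refine Isometric.of_tm (P := graph (Algebra.TensorProduct.map (AlgHom.id k A) f))
    (Q := baseChange P D)
    (R := restr (baseChange P E) (Algebra.TensorProduct.map (AlgHom.id k B) f))
    (fun (z : A ⊗[k] E) x => (z • φ x : baseChange P E))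
    (fun (p p' : A ⊗[k] E) q =>
      (add_smul p p' (φ q) : (p + p') • φ q = p • φ q + p' • φ q))
    (fun (p : A ⊗[k] E) q q' => ?_)
    (fun b (p : A ⊗[k] E) q => ?_) (fun (a : A ⊗[k] E) (p : A ⊗[k] E) q => ?_)
    (fun c (p : A ⊗[k] E) q => ?_)
    (fun (p : A ⊗[k] E) q (p' : A ⊗[k] E) q' => ?_) (fun (r : baseChange P E) => ?_)
  · have : p • φ (q + q') = p • φ q + p • φ q' := by rw [map_add, smul_add]
    exact this
  · change (Algebra.TensorProduct.map (AlgHom.id k A) f b * p) • φ q = p • φ (b • q)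
    rw [hA, smul_smul, mul_comm]
  · exact mul_smul a p (φ q)
  · change p • φ (c • q) = Algebra.TensorProduct.map (AlgHom.id k B) f c • p • φ q
    rw [hB, smul_comm]
  · change (baseChange P E).form (p • φ q) (p' • φ q') =
      Algebra.TensorProduct.map (AlgHom.id k A) f ((baseChange P D).form q q') * p * p'
    rw [← hf]
    simp only [map_smul, LinearMap.smul_apply, smul_eq_mul]
    ring
  · refine bt_induction (motive := fun r => r ∈ AddSubmonoid.closure (Set.range
      fun x : (A ⊗[k] E) × baseChange P D => (x.1 • φ x.2 : baseChange P E))) r (zero_mem _)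
      (fun p d => ?_) (fun x y hx hy => add_mem hx hy)
    refine AddSubmonoid.subset_closure ⟨((1 : A) ⊗ₜ[k] d, bt P D p 1), ?_⟩
    change ((1 : A) ⊗ₜ[k] d : A ⊗[k] E) • φ (bt P D p 1) = _
    rw [hφ, smul_bt, one_smul, map_one, mul_one]

/-- Compatibility of base change with the projection `X × Spec D ⟶ X`. -/
theorem Isometric.graph_includeLeft_comp (P : QSpace k A B) (D : Type u) [CommRing D]
    [Algebra k D] :
    Isometric (comp (graph (Algebra.TensorProduct.includeLeft : A →ₐ[k] A ⊗[k] D)) P)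
      (comp (baseChange P D)
        (graph (Algebra.TensorProduct.includeLeft : B →ₐ[k] B ⊗[k] D))) := by
  refine Isometric.trans ?_ (Isometric.comp_graph _ _).symm
  refine Isometric.of_tm (P := graph (Algebra.TensorProduct.includeLeft : A →ₐ[k] A ⊗[k] D))
    (Q := P)
    (R := restr (baseChange P D) (Algebra.TensorProduct.includeLeft : B →ₐ[k] B ⊗[k] D))
    (fun (z : A ⊗[k] D) x => (z • bt P D x 1 : baseChange P D))
    (fun (p p' : A ⊗[k] D) q => (add_smul p p' (bt P D q 1) :
      (p + p') • bt P D q 1 = p • bt P D q 1 + p' • bt P D q 1))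
    (fun (p : A ⊗[k] D) q q' => ?_)
    (fun b (p : A ⊗[k] D) q => ?_) (fun (a : A ⊗[k] D) (p : A ⊗[k] D) q => ?_)
    (fun c (p : A ⊗[k] D) q => ?_)
    (fun (p : A ⊗[k] D) q (p' : A ⊗[k] D) q' => ?_) (fun (r : baseChange P D) => ?_)
  · have : p • bt P D (q + q') 1 = p • bt P D q 1 + p • bt P D q' 1 := by
      rw [bt_add_left, smul_add]
    exact this
  · change ((b ⊗ₜ[k] (1 : D)) * p) • bt P D q 1 = p • bt P D (b • q) 1
    have := smul_bt P b q (1 : D) (1 : D)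
    rw [mul_one] at this
    rw [← this, smul_smul, mul_comm]
  · exact mul_smul a p (bt P D q 1)
  · change p • bt P D (c • q) 1 = (c ⊗ₜ[k] (1 : D) : B ⊗[k] D) • p • bt P D q 1
    have := smul_bt' P c q (1 : D) (1 : D)
    rw [mul_one] at this
    rw [← this, smul_comm]
  · change (baseChange P D).form (p • bt P D q 1) (p' • bt P D q' 1) =
      (P.form q q' ⊗ₜ[k] (1 : D)) * p * p'
    simp only [map_smul, LinearMap.smul_apply, smul_eq_mul, form_bt, mul_one]
    ring
  · refine bt_induction (motive := fun r => r ∈ AddSubmonoid.closure (Set.range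
      fun x : (A ⊗[k] D) × P => (x.1 • bt P D x.2 1 : baseChange P D))) r (zero_mem _)
      (fun p d => ?_) (fun x y hx hy => add_mem hx hy)
    refine AddSubmonoid.subset_closure ⟨((1 : A) ⊗ₜ[k] d, p), ?_⟩
    change ((1 : A) ⊗ₜ[k] d : A ⊗[k] D) • bt P D p 1 = _
    rw [smul_bt, one_smul, mul_one]

end QSpace

end

/-! ### The category of Witt correspondences -/

section

variable {k A B C D E : Type u} [Field k] [CommRing A] [CommRing B] [CommRing C] [CommRing D]
  [CommRing E] [Algebra k A] [Algebra k B] [Algebra k C] [Algebra k D] [Algebra k E]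

namespace WittGroup

theorem hom_ext {G : Type*} [AddCommMonoid G] {f g : WittGroup k A B →+ G}
    (h : ∀ P, f (mk P) = g (mk P)) : f = g := by
  ext x
  obtain ⟨P, rfl⟩ := mk_surjective x
  exact h P

/-- The composition pairing of Witt groups, induced by the tensor product. -/
noncomputable def comp : WittGroup k A B →+ WittGroup k B C →+ WittGroup k A C :=
  lift (fun P => lift (fun Q => mk (P.comp Q))
      (fun _ _ h => mk_eq_of_isometric ((QSpace.Isometric.refl P).comp_congr h))
      (fun Q Q' => mk_eq_of_isometric (QSpace.Isometric.comp_sum_right P Q Q'))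
      (fun _ h => mk_eq_zero (h.comp_right P)))
    (fun _ _ h => hom_ext fun Q => mk_eq_of_isometric (h.comp_congr (QSpace.Isometric.refl Q)))
    (fun P P' => hom_ext fun Q => mk_eq_of_isometric (QSpace.Isometric.comp_sum_left P P' Q))
    (fun _ h => hom_ext fun Q => mk_eq_zero (h.comp_left Q))

@[simp] theorem comp_mk (P : QSpace k A B) (Q : QSpace k B C) :
    comp (mk P) (mk Q) = mk (P.comp Q) := rfl

theorem comp_assoc (x : WittGroup k A B) (y : WittGroup k B C) (z : WittGroup k C D) :
    comp (comp x y) z = comp x (comp y z) := by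
  obtain ⟨P, rfl⟩ := mk_surjective x
  obtain ⟨Q, rfl⟩ := mk_surjective y
  obtain ⟨R, rfl⟩ := mk_surjective z
  exact mk_eq_of_isometric (QSpace.Isometric.comp_assoc P Q R)

/-- The class of the graph of the morphism `Spec A ⟶ Spec B` given by `f`. -/
def graph (f : B →ₐ[k] A) : WittGroup k A B := mk (QSpace.graph f)

theorem id_comp (x : WittGroup k A B) : comp (graph (AlgHom.id k A)) x = x := by
  obtain ⟨P, rfl⟩ := mk_surjective x
  exact mk_eq_of_isometric (QSpace.Isometric.id_comp P)

theorem comp_id (x : WittGroup k A B) : comp x (graph (AlgHom.id k B)) = x := by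
  obtain ⟨P, rfl⟩ := mk_surjective x
  exact mk_eq_of_isometric (QSpace.Isometric.comp_id P)

theorem comp_graph (f : B →ₐ[k] A) (g : C →ₐ[k] B) :
    comp (graph f) (graph g) = graph (f.comp g) :=
  mk_eq_of_isometric ((QSpace.Isometric.comp_graph _ g).trans (QSpace.Isometric.restr_graph f g))

/-- The exterior product with the identity of `Spec D`. -/
noncomputable def baseChange (D : Type u) [CommRing D] [Algebra k D] :
    WittGroup k A B →+ WittGroup k (A ⊗[k] D) (B ⊗[k] D) :=
  lift (fun P => mk (P.baseChange D))
    (fun _ _ h => mk_eq_of_isometric (h.baseChange_congr D))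
    (fun P P' => mk_eq_of_isometric (QSpace.Isometric.baseChange_sum P P' D))
    (fun _ h => mk_eq_zero (h.baseChange D))

theorem baseChange_graph (f : B →ₐ[k] A) (D : Type u) [CommRing D] [Algebra k D] :
    baseChange D (graph f) = graph (Algebra.TensorProduct.map f (AlgHom.id k D)) :=
  mk_eq_of_isometric (QSpace.Isometric.baseChange_graph f D)

theorem baseChange_comp (x : WittGroup k A B) (y : WittGroup k B C) (D : Type u) [CommRing D]
    [Algebra k D] : baseChange D (comp x y) = comp (baseChange D x) (baseChange D y) := by
  obtain ⟨P, rfl⟩ := mk_surjective x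
  obtain ⟨Q, rfl⟩ := mk_surjective y
  exact mk_eq_of_isometric (QSpace.Isometric.baseChange_comp P Q D)

theorem baseChange_natural (x : WittGroup k A B) (f : D →ₐ[k] E) :
    comp (baseChange E x) (graph (Algebra.TensorProduct.map (AlgHom.id k B) f)) =
      comp (graph (Algebra.TensorProduct.map (AlgHom.id k A) f)) (baseChange D x) := by
  obtain ⟨P, rfl⟩ := mk_surjective x
  exact (mk_eq_of_isometric (QSpace.Isometric.baseChange_natural P f)).symm

theorem graph_includeLeft_comp (x : WittGroup k A B) (D : Type u) [CommRing D] [Algebra k D] :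
    comp (baseChange D x) (graph (Algebra.TensorProduct.includeLeft : B →ₐ[k] B ⊗[k] D)) =
      comp (graph (Algebra.TensorProduct.includeLeft : A →ₐ[k] A ⊗[k] D)) x := by
  obtain ⟨P, rfl⟩ := mk_surjective x
  exact (mk_eq_of_isometric (QSpace.Isometric.graph_includeLeft_comp P D)).symm

end WittGroup

end

open CategoryTheory CategoryTheory.Limits Opposite ZeroObject

/-- Smooth `k`-algebras. A smooth affine variety `X` over `k` is given by its algebra `k[X]`,
so the category of smooth affine varieties is the opposite of this category. -/
structure SmAlg (k : Type u) [Field k] where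
  carrier : Type u
  [commRing : CommRing carrier]
  [algebra : Algebra k carrier]
  [smooth : Algebra.Smooth k carrier]

namespace SmAlg

variable {k : Type u} [Field k]

instance : CoeSort (SmAlg k) (Type u) := ⟨carrier⟩

attribute [instance] commRing algebra smooth

instance : Category (SmAlg k) where
  Hom A B := A →ₐ[k] B
  id A := AlgHom.id k A
  comp f g := g.comp f

/-- The algebra of the product of two smooth affine varieties. -/
noncomputable def tensor (A D : SmAlg k) : SmAlg k where
  carrier := A ⊗[k] D
  smooth := Algebra.Smooth.comp k A (A ⊗[k] D)

/-- The algebra of the point. -/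
def point (k : Type u) [Field k] : SmAlg k where
  carrier := k
  smooth := {}

end SmAlg

/-- The category of Witt correspondences: its objects are the smooth affine varieties over `k`,
and the morphisms from `X` to `Y` form the Witt group of `Proj(X, Y)`. -/
structure WCor (k : Type u) [Field k] where
  alg : SmAlg k

namespace WCor

variable {k : Type u} [Field k]

noncomputable instance : Category (WCor k) where
  Hom X Y := WittGroup k X.alg Y.alg
  id X := WittGroup.graph (AlgHom.id k X.alg)
  comp f g := WittGroup.comp f g
  id_comp f := WittGroup.id_comp f
  comp_id f := WittGroup.comp_id f
  assoc f g h := WittGroup.comp_assoc f g h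

noncomputable instance (X Y : WCor k) : AddCommGroup (X ⟶ Y) :=
  inferInstanceAs (AddCommGroup (WittGroup k X.alg Y.alg))

noncomputable instance : Preadditive (WCor k) where
  add_comp X Y Z f f' g := by
    change WittGroup.comp (f + f') g = WittGroup.comp f g + WittGroup.comp f' g
    rw [map_add, AddMonoidHom.add_apply]
  comp_add X Y Z f g g' := map_add (WittGroup.comp f) g g'

/-- The correspondence given by the graph of a morphism of smooth affine varieties. -/
def graph {A B : SmAlg k} (f : A ⟶ B) : (⟨B⟩ : WCor k) ⟶ ⟨A⟩ := WittGroup.graph f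

theorem graph_id (A : SmAlg k) : graph (𝟙 A) = 𝟙 _ := rfl

theorem graph_comp {A B C : SmAlg k} (f : A ⟶ B) (g : B ⟶ C) :
    graph (f ≫ g) = graph g ≫ graph f :=
  (WittGroup.comp_graph g f).symm

/-- The functor `X ↦ X × Spec D`. -/
noncomputable def prod (D : SmAlg k) : WCor k ⥤ WCor k where
  obj X := ⟨X.alg.tensor D⟩
  map f := WittGroup.baseChange D f
  map_id X := by
    refine (WittGroup.baseChange_graph (AlgHom.id k X.alg) D).trans ?_
    rw [Algebra.TensorProduct.map_id]
    rfl
  map_comp f g := WittGroup.baseChange_comp f g D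

instance (D : SmAlg k) : (prod D).Additive where
  map_add {_ _ f g} := map_add (WittGroup.baseChange (D : Type u)) f g

/-- The morphism `X × Spec E ⟶ X × Spec D` induced by `D ⟶ E`. -/
noncomputable def prodMap {D E : SmAlg k} (f : D ⟶ E) : prod E ⟶ prod D where
  app X := WCor.graph (A := X.alg.tensor D) (B := X.alg.tensor E)
    (Algebra.TensorProduct.map (AlgHom.id k X.alg) f)
  naturality _ _ x := WittGroup.baseChange_natural x f

theorem prodMap_id (D : SmAlg k) : prodMap (𝟙 D) = 𝟙 _ := by
  ext X
  change WittGroup.graph (Algebra.TensorProduct.map (AlgHom.id k X.alg) (AlgHom.id k D)) = _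
  rw [Algebra.TensorProduct.map_id]
  rfl

theorem prodMap_comp {D E F : SmAlg k} (f : D ⟶ E) (g : E ⟶ F) :
    prodMap (f ≫ g) = prodMap g ≫ prodMap f := by
  ext X
  refine Eq.trans ?_ (WittGroup.comp_graph _ _).symm
  refine congrArg WittGroup.graph ?_
  exact Algebra.TensorProduct.map_comp (AlgHom.id k X.alg) (AlgHom.id k X.alg) g f

/-- The projection `X × Spec D ⟶ X`. -/
noncomputable def proj (D : SmAlg k) : prod D ⟶ 𝟭 (WCor k) where
  app X := WCor.graph (A := X.alg) (B := X.alg.tensor D) Algebra.TensorProduct.includeLeft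
  naturality _ _ x := WittGroup.graph_includeLeft_comp x D

/-- The isomorphism `X × pt ⟶ X`. -/
noncomputable def prodPointIso (k : Type u) [Field k] : prod (SmAlg.point k) ≅ 𝟭 (WCor k) :=
  haveI : ∀ X : WCor k, IsIso ((proj (SmAlg.point k)).app X) := fun X => by
    refine ⟨WCor.graph (A := X.alg.tensor (SmAlg.point k)) (B := X.alg)
      (Algebra.TensorProduct.rid k k X.alg).toAlgHom, ?_, ?_⟩
    · refine (WittGroup.comp_graph _ _).trans (congrArg WittGroup.graph (a₂ := AlgHom.id k _) ?_)
      exact Algebra.TensorProduct.ext (S := k) (C := X.alg ⊗[k] k) (AlgHom.ext fun a =>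
        congrArg (· ⊗ₜ[k] (1 : k)) (one_smul k a)) (Subsingleton.elim (α := k →ₐ[k] X.alg ⊗[k] k) _ _)
    · refine (WittGroup.comp_graph _ _).trans (congrArg WittGroup.graph (a₂ := AlgHom.id k _) ?_)
      exact AlgHom.ext fun a => one_smul k a
  NatIso.ofComponents (fun X => asIso ((proj (SmAlg.point k)).app X))
    fun x => (proj (SmAlg.point k)).naturality x

/-- The section `X ⟶ X × Spec D` given by a rational point of `Spec D`. -/
noncomputable def sec (D : SmAlg k) (x : D ⟶ SmAlg.point k) : 𝟭 (WCor k) ⟶ prod D :=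
  (prodPointIso k).inv ≫ prodMap x

end WCor

/-! ### Presheaves with Witt transfers -/

section

variable (C : Type*) [Category* C] [Preadditive C] (D : Type*) [Category* D] [Preadditive D]

instance isClosedUnderLimitsOfShape_additiveFunctor (J : Type*) [Category* J]
    [HasLimitsOfShape J D] : (additiveFunctor C D).IsClosedUnderLimitsOfShape J where
  limitsOfShape_le F := by
    rintro ⟨h⟩
    have := h.prop_diag_obj
    refine ⟨fun {X Y f g} => ?_⟩
    have hl := isLimitOfPreserves ((evaluation C D).obj Y) h.isLimit
    refine hl.hom_ext fun j => ?_
    have : (h.diag.obj j).Additive := h.prop_diag_obj j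
    change F.map (f + g) ≫ (h.π.app j).app Y = (F.map f + F.map g) ≫ (h.π.app j).app Y
    rw [Preadditive.add_comp, NatTrans.naturality, NatTrans.naturality, NatTrans.naturality]
    rw [Functor.map_add, Preadditive.comp_add]

instance isClosedUnderColimitsOfShape_additiveFunctor (J : Type*) [Category* J]
    [HasColimitsOfShape J D] : (additiveFunctor C D).IsClosedUnderColimitsOfShape J where
  colimitsOfShape_le F := by
    rintro ⟨h⟩
    refine ⟨fun {X Y f g} => ?_⟩
    have hl := isColimitOfPreserves ((evaluation C D).obj X) h.isColimit
    refine hl.hom_ext fun j => ?_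
    have : (h.diag.obj j).Additive := h.prop_diag_obj j
    change (h.ι.app j).app X ≫ F.map (f + g) = (h.ι.app j).app X ≫ (F.map f + F.map g)
    have n : ∀ g : X ⟶ Y, (h.ι.app j).app X ≫ F.map g = (h.diag.obj j).map g ≫ (h.ι.app j).app Y :=
      fun g => ((h.ι.app j).naturality g).symm
    rw [Preadditive.comp_add, n, n, n, Functor.map_add, Preadditive.add_comp]

instance [HasZeroObject D] : (additiveFunctor C D).ContainsZero where
  exists_zero := by
    have h : IsZero ((Functor.const C).obj (0 : D)) := Functor.isZero _ fun _ => isZero_zero D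
    exact ⟨_, h, Functor.Additive.of_isZero h⟩

instance [HasLimitsOfShape WalkingParallelPair D] :
    (additiveFunctor C D).IsClosedUnderKernels where
  kernels_le := by
    rintro _ ⟨f, c, hc, hf⟩
    refine (additiveFunctor C D).prop_of_isLimit hc ?_
    rintro (_ | _)
    · exact hf.1
    · exact hf.2

instance [HasColimitsOfShape WalkingParallelPair D] :
    (additiveFunctor C D).IsClosedUnderCokernels where
  cokernels_le := by
    rintro _ ⟨f, c, hc, hf⟩
    refine (additiveFunctor C D).prop_of_isColimit hc ?_
    rintro (_ | _)
    · exact hf.1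
    · exact hf.2

instance [HasFiniteProducts D] : (additiveFunctor C D).IsClosedUnderFiniteProducts where
  isClosedUnderLimitsOfShape J _ := by
    have : HasLimitsOfShape (Discrete J) D := hasLimitsOfShape_discrete D J
    infer_instance

end

variable (k : Type u) [Field k]

/-- Presheaves with Witt transfers: the additive functors from the opposite of the category of Witt
correspondences to abelian groups. -/
abbrev PreWtr : Type (u + 2) := (WCor k)ᵒᵖ ⥤+ AddCommGrpCat.{u + 1}

instance : HasColimitsOfSize.{u + 1, u + 1} (PreWtr k) where
  has_colimits_of_shape _ _ := inferInstance

noncomputable instance : Abelian (PreWtr k) := inferInstance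

namespace PreWtr

variable {k}

/-- The presheaf `X ↦ F (X × Spec D)`, i.e. the internal hom from `Spec D` to `F`. -/
noncomputable def shiftObj (D : SmAlg k) : PreWtr k ⥤ PreWtr k where
  obj F := ⟨(WCor.prod D).op ⋙ F.obj, inferInstanceAs ((WCor.prod D).op ⋙ F.obj).Additive⟩
  map α := ObjectProperty.homMk (Functor.whiskerLeft (WCor.prod D).op α.hom)

/-- The functor `(D, F) ↦ F (- × Spec D)`. -/
noncomputable def shift : SmAlg k ⥤ PreWtr k ⥤ PreWtr k where
  obj D := shiftObj D
  map f :=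
    { app F := ObjectProperty.homMk (Functor.whiskerRight (NatTrans.op (WCor.prodMap f)) F.obj)
      naturality F G α := by
        ext X : 3
        exact (α.hom.naturality _).symm }
  map_id D := by
    ext F X : 5
    change F.obj.map ((WCor.prodMap (𝟙 D)).app X.unop).op = 𝟙 _
    rw [WCor.prodMap_id]
    exact F.obj.map_id _
  map_comp f g := by
    ext F X : 5
    change F.obj.map ((WCor.prodMap (f ≫ g)).app X.unop).op = F.obj.map _ ≫ F.obj.map _
    rw [WCor.prodMap_comp, ← Functor.map_comp]
    rfl

instance (D : SmAlg k) : (shift.obj D).Additive where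
  map_add := rfl

/-- The morphism `F ⟶ F (- × Spec D)` given by the projections `X × Spec D ⟶ X`. -/
noncomputable def shiftProj (D : SmAlg k) : 𝟭 (PreWtr k) ⟶ shift.obj D where
  app F := ObjectProperty.homMk (Functor.whiskerRight (NatTrans.op (WCor.proj D)) F.obj)
  naturality F G α := by
    ext X : 3
    exact (α.hom.naturality _).symm

/-- The morphism `F (- × Spec D) ⟶ F` given by a rational point of `Spec D`. -/
noncomputable def shiftSec (D : SmAlg k) (x : D ⟶ SmAlg.point k) : shift.obj D ⟶ 𝟭 (PreWtr k) where
  app F := ObjectProperty.homMk (Functor.whiskerRight (NatTrans.op (WCor.sec D x)) F.obj)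
  naturality F G α := by
    ext X : 3
    exact (α.hom.naturality _).symm

end PreWtr

/-! ### The affine line and the algebraic simplices -/

/-- The algebra of the affine line. -/
noncomputable def affineLine : SmAlg k where
  carrier := Polynomial k
  smooth := {}

/-- The rational point of the affine line with coordinate `c`. -/
noncomputable def affineLinePoint (c : k) : affineLine k ⟶ SmAlg.point k :=
  (Polynomial.aeval c : Polynomial k →ₐ[k] k)

/-- The algebra `k[x₀, …, xₙ] / (x₀ + ⋯ + xₙ - 1)`. -/
abbrev SimplexAlg (n : ℕ) : Type u :=
  MvPolynomial (Fin (n + 1)) k ⧸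
    Ideal.span {∑ i, MvPolynomial.X i - (1 : MvPolynomial (Fin (n + 1)) k)}

namespace SimplexAlg

/-- The coordinates. -/
noncomputable def x {n : ℕ} (i : Fin (n + 1)) : SimplexAlg k n :=
  Ideal.Quotient.mkₐ k _ (MvPolynomial.X i)

theorem sum_x (n : ℕ) : ∑ i, x k i = (1 : SimplexAlg k n) := by
  have : Ideal.Quotient.mkₐ k (Ideal.span {∑ i, MvPolynomial.X i -
      (1 : MvPolynomial (Fin (n + 1)) k)}) (∑ i, MvPolynomial.X i - 1) = 0 :=
    Ideal.Quotient.eq_zero_iff_mem.2 (Ideal.subset_span rfl)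
  rw [map_sub, map_sum, map_one, sub_eq_zero] at this
  exact this

variable {k}

/-- The universal property of `SimplexAlg k n`. -/
noncomputable def lift {n : ℕ} {A : Type u} [CommRing A] [Algebra k A] (a : Fin (n + 1) → A)
    (h : ∑ i, a i = 1) : SimplexAlg k n →ₐ[k] A :=
  Ideal.Quotient.liftₐ _ (MvPolynomial.aeval a) (fun p hp => by
    have : Ideal.span {∑ i, MvPolynomial.X i - (1 : MvPolynomial (Fin (n + 1)) k)} ≤
        RingHom.ker (MvPolynomial.aeval a) := by
      rw [Ideal.span_le, Set.singleton_subset_iff]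
      simp [h]
    exact this hp)

theorem lift_x {n : ℕ} {A : Type u} [CommRing A] [Algebra k A] (a : Fin (n + 1) → A)
    (h : ∑ i, a i = 1) (i : Fin (n + 1)) : lift a h (x k i) = a i :=
  MvPolynomial.aeval_X a i

theorem hom_ext {n : ℕ} {A : Type u} [CommRing A] [Algebra k A] {f g : SimplexAlg k n →ₐ[k] A}
    (h : ∀ i, f (x k i) = g (x k i)) : f = g :=
  Ideal.Quotient.algHom_ext k (MvPolynomial.algHom_ext h)

variable (k) in
instance (n : ℕ) : Algebra.Smooth k (SimplexAlg k n) where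
  formallySmooth := by
    refine Algebra.FormallySmooth.of_comp_surjective fun B _ _ I _ f => ?_
    choose b hb using fun i => Ideal.Quotient.mk_surjective (I := I) (f (x k i))
    have h1 : ∑ i, Function.update b 0 (b 0 + (1 - ∑ i, b i)) i = 1 := by
      rw [Fin.sum_univ_succ, Fin.sum_univ_succ (f := b)]
      simp
      ring
    refine ⟨lift _ h1, hom_ext fun i => ?_⟩
    change Ideal.Quotient.mk I (lift _ h1 (x k i)) = f (x k i)
    rw [lift_x]
    by_cases hi : i = 0
    · subst hi
      rw [Function.update_self, map_add, hb, map_sub, map_sum]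
      simp only [hb, ← map_sum, sum_x, map_one, sub_self, add_zero]
    · rw [Function.update_of_ne hi, hb]
  finitePresentation := Algebra.FinitePresentation.quotient (Submodule.fg_span_singleton _)

/-- The morphism `Δᵐ ⟶ Δⁿ` induced by a map of vertices. -/
noncomputable def map {m n : ℕ} (φ : Fin (m + 1) → Fin (n + 1)) :
    SimplexAlg k n →ₐ[k] SimplexAlg k m :=
  lift (fun i => ∑ j with φ j = i, x k j) (by
    rw [Finset.sum_fiberwise, sum_x])

theorem map_x {m n : ℕ} (φ : Fin (m + 1) → Fin (n + 1)) (i : Fin (n + 1)) :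
    map φ (x k i) = ∑ j with φ j = i, x k j := lift_x _ _ i

theorem map_id (n : ℕ) : map (k := k) (id : Fin (n + 1) → Fin (n + 1)) = AlgHom.id k _ :=
  hom_ext fun i => by rw [map_x]; simp [Finset.filter_eq']

theorem map_comp {l m n : ℕ} (φ : Fin (l + 1) → Fin (m + 1)) (ψ : Fin (m + 1) → Fin (n + 1)) :
    map (k := k) (ψ ∘ φ) = (map φ).comp (map ψ) :=
  hom_ext fun i => by
    rw [AlgHom.comp_apply, map_x, map_x, map_sum]
    simp only [map_x]
    rw [Finset.sum_sigma']
    refine Finset.sum_bij' (fun t _ => ⟨φ t, t⟩) (fun t _ => t.2) ?_ ?_ ?_ ?_ ?_ <;> simp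
    · rintro ⟨a, b⟩ h h'
      exact (congrArg ψ h').trans h
    · rintro ⟨a, b⟩ _ h'
      obtain rfl : φ b = a := h'
      rfl

end SimplexAlg

/-- The cosimplicial scheme `Δ`, given by the algebras `k[Δⁿ]`. -/
noncomputable def simplices : SimplexCategoryᵒᵖ ⥤ SmAlg k where
  obj n := { carrier := SimplexAlg k n.unop.len }
  map φ := SimplexAlg.map φ.unop.toOrderHom
  map_id n := SimplexAlg.map_id n.unop.len
  map_comp φ ψ := SimplexAlg.map_comp ψ.unop.toOrderHom φ.unop.toOrderHom

section

variable {C : Type*} [Category* C] [Preadditive C] {K L : CochainComplex C ℤ}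
  {M N : HomologicalComplex₂ C (ComplexShape.up ℤ) (ComplexShape.up ℤ)}
  [M.HasTotal (ComplexShape.up ℤ)] [N.HasTotal (ComplexShape.up ℤ)]

variable (M) in
/-- The morphism `K ⟶ Tot M` given by a morphism from `K` to the column of index `0` of `M`
whose composition with the vertical differential is zero. -/
noncomputable def toTotal (a : ∀ q, K.X q ⟶ (M.X q).X 0)
    (h₁ : ∀ i j, K.d i j ≫ a j = a i ≫ (M.d i j).f 0) (h₂ : ∀ q, a q ≫ (M.X q).d 0 1 = 0) :
    K ⟶ M.total (ComplexShape.up ℤ) where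
  f q := a q ≫ M.ιTotal (ComplexShape.up ℤ) q 0 q (by simp)
  comm' i j hij := by
    rw [Category.assoc, HomologicalComplex₂.total_d, Preadditive.comp_add,
      HomologicalComplex₂.ι_D₁, HomologicalComplex₂.ι_D₂,
      HomologicalComplex₂.d₁_eq _ _ hij 0 j (by simp),
      HomologicalComplex₂.d₂_eq _ _ i (i₂ := 0) (i₂' := 1) (by simp) j (by simpa using hij), Preadditive.comp_add]
    simp [ComplexShape.ε₁_def, ← Category.assoc, ← h₁, h₂]

theorem toTotal_naturality (α : K ⟶ L) (φ : M ⟶ N) (a : ∀ q, K.X q ⟶ (M.X q).X 0)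
    (h₁ : ∀ i j, K.d i j ≫ a j = a i ≫ (M.d i j).f 0) (h₂ : ∀ q, a q ≫ (M.X q).d 0 1 = 0)
    (b : ∀ q, L.X q ⟶ (N.X q).X 0)
    (h₃ : ∀ i j, L.d i j ≫ b j = b i ≫ (N.d i j).f 0) (h₄ : ∀ q, b q ≫ (N.X q).d 0 1 = 0)
    (h : ∀ q, α.f q ≫ b q = a q ≫ (φ.f q).f 0) :
    α ≫ toTotal N b h₃ h₄ = toTotal M a h₁ h₂ ≫ HomologicalComplex₂.total.map φ _ := by
  ext q : 1
  simp only [HomologicalComplex.comp_f, toTotal, Category.assoc, HomologicalComplex₂.ιTotal_map]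
  rw [← Category.assoc, h, Category.assoc]

end

open scoped Simplicial

/-! ### The Suslin complex -/

instance : (simplices k ⋙ PreWtr.shift).flip.Additive where
  map_add := rfl

/-- The Suslin complex of a presheaf `F`, as a cochain complex: it is `F (- × Δⁱ)` in degree `-i`,
and the differential is the alternating sum of the maps given by the faces of `Δⁱ`. -/
noncomputable def suslinPresheaf : PreWtr k ⥤ CochainComplex (PreWtr k) ℤ :=
  (simplices k ⋙ PreWtr.shift).flip ⋙ AlgebraicTopology.alternatingFaceMapComplex (PreWtr k) ⋙
    ComplexShape.embeddingDownNat.extendFunctor (PreWtr k)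

instance : (suslinPresheaf k).Additive := by
  unfold suslinPresheaf
  infer_instance

instance : HasColimitsOfSize.{0, 0} (PreWtr k) :=
  hasColimitsOfSizeShrink.{0, 0, u + 1, u + 1} (PreWtr k)

instance (K : HomologicalComplex₂ (PreWtr k) (ComplexShape.up ℤ) (ComplexShape.up ℤ)) :
    K.HasTotal (ComplexShape.up ℤ) := fun _ => inferInstance

/-- The bicomplex `K ^ q (- × Δⁱ)`, in bidegree `(q, -i)`. -/
noncomputable def suslinBicomplex : CochainComplex (PreWtr k) ℤ ⥤
    HomologicalComplex₂ (PreWtr k) (ComplexShape.up ℤ) (ComplexShape.up ℤ) :=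
  (suslinPresheaf k).mapHomologicalComplex (ComplexShape.up ℤ)

/-- The Suslin complex `C^* K` of a complex `K` of presheaves: the total complex (with direct sums)
of the bicomplex `K ^ q (- × Δⁱ)`. -/
noncomputable def suslin : CochainComplex (PreWtr k) ℤ ⥤ CochainComplex (PreWtr k) ℤ :=
  suslinBicomplex k ⋙ HomologicalComplex₂.totalFunctor (PreWtr k) (ComplexShape.up ℤ)
    (ComplexShape.up ℤ) (ComplexShape.up ℤ)

variable {k}

/-- The canonical morphism from `F` to the degree `0` term `F (- × Δ⁰)` of its Suslin complex. -/
noncomputable def suslinUnitZero (F : PreWtr k) : F ⟶ ((suslinPresheaf k).obj F).X 0 :=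
  (PreWtr.shiftProj ((simplices k).obj (op ⦋0⦌))).app F ≫
    (((AlgebraicTopology.alternatingFaceMapComplex (PreWtr k)).obj
      ((simplices k ⋙ PreWtr.shift).flip.obj F)).extendXIso ComplexShape.embeddingDownNat
        (i := 0) (i' := 0) (by simp)).inv

theorem suslinUnitZero_naturality {F G : PreWtr k} (α : F ⟶ G) :
    α ≫ suslinUnitZero G = suslinUnitZero F ≫ ((suslinPresheaf k).map α).f 0 := by
  have h : ComplexShape.embeddingDownNat.f 0 = 0 := by simp
  have e : ((suslinPresheaf k).map α).f 0 = _ := HomologicalComplex.extendMap_f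
    ((AlgebraicTopology.alternatingFaceMapComplex (PreWtr k)).map
      ((simplices k ⋙ PreWtr.shift).flip.map α)) ComplexShape.embeddingDownNat h
  have n := (PreWtr.shiftProj ((simplices k).obj (op ⦋0⦌))).naturality α
  rw [e]
  dsimp only [suslinUnitZero]
  refine (Category.assoc _ _ _).symm.trans ((congrArg (· ≫ _) n).trans ?_)
  refine (Category.assoc _ _ _).trans ((congrArg (_ ≫ ·) ?_).trans (Category.assoc _ _ _).symm)
  exact (Iso.inv_hom_id_assoc _ _).symm

theorem suslinUnitZero_d (F : PreWtr k) (i : ℤ) (h : (ComplexShape.up ℤ).Rel 0 i) :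
    suslinUnitZero F ≫ ((suslinPresheaf k).obj F).d 0 i = 0 := by
  have : IsZero (((suslinPresheaf k).obj F).X i) :=
    HomologicalComplex.isZero_extend_X _ _ _ fun j hj => by
      simp at h hj
      lia
  exact this.eq_of_tgt _ _

variable (k) in
/-- The canonical morphism `K ⟶ C^* K`. -/
noncomputable def suslinUnit : 𝟭 (CochainComplex (PreWtr k) ℤ) ⟶ suslin k where
  app K := toTotal ((suslinBicomplex k).obj K) (fun q => suslinUnitZero (K.X q))
    (fun i j => suslinUnitZero_naturality (K.d i j))
    (fun q => suslinUnitZero_d (K.X q) 1 (by simp))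
  naturality K L α := toTotal_naturality α ((suslinBicomplex k).map α) _ _ _ _ _ _
    fun q => suslinUnitZero_naturality (α.f q)

variable (k)

/-! ### Homotopy invariant and contractible presheaves -/

section

variable {k}

/-- A presheaf `F` is homotopy invariant if the projection induces an isomorphism
`F ⟶ F (- × 𝔸¹)`. -/
def IsHomotopyInvariant (F : PreWtr k) : Prop :=
  IsIso ((PreWtr.shiftProj (affineLine k)).app F)

/-- A presheaf `F` is contractible if there is a morphism `h : F ⟶ F (- × 𝔸¹)` whose composition
with the zero section is the identity and whose composition with the unit section is zero. -/
def IsContractible (F : PreWtr k) : Prop :=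
  ∃ h : F ⟶ (PreWtr.shift.obj (affineLine k)).obj F,
    h ≫ (PreWtr.shiftSec (affineLine k) (affineLinePoint k 0)).app F = 𝟙 F ∧
    h ≫ (PreWtr.shiftSec (affineLine k) (affineLinePoint k 1)).app F = 0

/-- The presheaf `ℤ(X)` represented by `X`. -/
noncomputable def representable : WCor k ⥤ PreWtr k :=
  ObjectProperty.lift _ preadditiveYoneda fun X =>
    inferInstanceAs (preadditiveYoneda.obj X).Additive

/-- The presheaf `ℤ(𝔸¹ × X) / ℤ(X)`, the cokernel of the zero section. -/
noncomputable def reprQuotient (X : WCor k) : PreWtr k :=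
  cokernel (representable.map ((WCor.sec (affineLine k) (affineLinePoint k 0)).app X))

end

/-! ### Semi-orthogonal decompositions -/

section

variable {T : Type*} [Category* T] [HasZeroObject T] [HasShift T ℤ] [Preadditive T]
  [∀ n : ℤ, (shiftFunctor T n).Additive] [Pretriangulated T]

/-- Two full triangulated subcategories `A`, `B` of `T` form a semi-orthogonal decomposition
`⟨A, B⟩` if there is no nonzero morphism from `B` to `A` and any object `Z` of `T` is in a
distinguished triangle `Y ⟶ Z ⟶ X ⟶ Y⟦1⟧` with `Y` in `B` and `X` in `A`. -/
structure IsSemiorthogonalDecomposition (A B : ObjectProperty T) : Prop where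
  isTriangulated_left : A.IsTriangulated
  isTriangulated_right : B.IsTriangulated
  isClosedUnderIsomorphisms_left : A.IsClosedUnderIsomorphisms
  isClosedUnderIsomorphisms_right : B.IsClosedUnderIsomorphisms
  hom_eq_zero : ∀ ⦃Y X : T⦄, B Y → A X → ∀ f : Y ⟶ X, f = 0
  exists_triangle : ∀ Z : T, ∃ (Y X : T) (_ : B Y) (_ : A X) (f : Y ⟶ Z) (g : Z ⟶ X)
    (h : X ⟶ Y⟦(1 : ℤ)⟧), Pretriangulated.Triangle.mk f g h ∈ Pretriangulated.distinguishedTriangles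

end

/-! ### The derived category -/

section

variable [HasDerivedCategory.{w} (PreWtr k)]

/-- The derived category `D⁻` of bounded above complexes of presheaves with Witt transfers, as a
full subcategory of the unbounded derived category. -/
abbrev DMinus := DerivedCategory.Minus (PreWtr k)

/-- The bounded above complexes of presheaves. -/
def boundedAbove : ObjectProperty (CochainComplex (PreWtr k) ℤ) := fun K => ∃ n, K.IsStrictlyLE n

/-- The functor from bounded above complexes to `D⁻`. -/
noncomputable def QMinus : (boundedAbove k).FullSubcategory ⥤ DMinus k :=
  ObjectProperty.lift _ ((boundedAbove k).ι ⋙ DerivedCategory.Q) fun K => by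
    obtain ⟨n, hn⟩ := K.property
    exact ⟨n, inferInstanceAs (DerivedCategory.IsLE (DerivedCategory.Q.obj K.obj) n)⟩

/-- A presheaf as a complex concentrated in degree `0`. -/
noncomputable def singleMinus : PreWtr k ⥤ DMinus k :=
  ObjectProperty.lift _ (DerivedCategory.singleFunctor (PreWtr k) 0) fun F =>
    ⟨0, inferInstanceAs (DerivedCategory.IsLE ((DerivedCategory.singleFunctor _ 0).obj F) 0)⟩

/-- The objects of `D⁻` with homotopy invariant cohomology presheaves. -/
def invariantPart : ObjectProperty (DMinus k) := fun X =>
  ∀ n : ℤ, IsHomotopyInvariant ((DerivedCategory.homologyFunctor (PreWtr k) n).obj X.obj)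

/-- The objects of `D⁻` which are isomorphic to bounded above complexes of contractible
presheaves. -/
def contractiblePart : ObjectProperty (DMinus k) := fun X =>
  ∃ K : (boundedAbove k).FullSubcategory,
    (∀ n : ℤ, IsContractible (K.obj.X n)) ∧ Nonempty ((QMinus k).obj K ≅ X)

/-- The objects of `D⁻` whose cohomology is bounded. -/
def boundedPart : ObjectProperty (DMinus k) := fun X =>
  (DerivedCategory.TStructure.t (C := PreWtr k)).plus X.obj

end

end WittMotives

open CategoryTheory CategoryTheory.Pretriangulated WittMotives

-- Write `Q X` for `ℤ(𝔸¹ × X) / ℤ(X)`. By Yoneda, `Hom(Q X, F)` is the kernel of `s₀ : F(X × 𝔸¹) →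
-- F(X)`. Since `s₀` is a retraction of `p`, a presheaf is homotopy invariant exactly when it
-- receives no nonzero morphism from any `Q X` (`homZero_reprQuotient_iff`). The `Q X` are
-- projective, being direct summands of representable presheaves, and they are contractible through
-- the homotopy `(x, t) ↦ x (1 - t)` (`isContractible_reprQuotient`). So homotopy invariance is an
-- orthogonality condition against projectives, and it passes to the middle term of an exact
-- sequence.
--
-- Orthogonality. If `Y → Y(- × 𝔸¹)` is a quasi-isomorphism, the two sections `s₀`, `s₁` of `Y` are
-- both inverse to it in the derived category, hence equal there. A morphism to `Y` from a complex
-- with a contraction `h` then equals its composite with `s₀ h = 1`, hence with `s₁ h = 0`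
-- (`eq_zero_of_contraction`). A contraction of the terms of a complex need not commute with the
-- differentials, so this is applied to objects in a single degree. Splitting off top terms handles
-- the source, and `prop_of_homologyProp` handles the target.
--
-- Triangles. The prism decomposition of `Δ¹ × Δⁿ` gives a simplicial homotopy on `F(- × 𝔸¹ × Δ•)`
-- between the identity and the contraction to the zero section, so the cohomology of `C^*(F)` is
-- homotopy invariant. Peeling off the top term of a bounded above complex extends this to `C^*(K)`
-- (`prop_homology_totalOf`). The morphism `K → C^*(K)` factors through the complex of the constant
-- simplicial objects `F`. The first factor is a quasi-isomorphism, and the second is a degreewise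
-- split monomorphism whose cokernel is built from `F(- × Δⁿ) / F`, contractible because `Δⁿ`
-- contracts linearly to a vertex. The fibre of `K → C^*(K)` is therefore a complex of contractible
-- presheaves (`exists_distinguished_suslinUnit`).
--
-- These two facts give the semi-orthogonal decomposition formally. Each part is the orthogonal of
-- the other, hence triangulated and closed under the relevant sums or products, and `K → C^*(K)` is
-- universal among morphisms to the invariant part, which identifies it with the unit of any left
-- adjoint of the inclusion.
--
-- Generation. An invariant object with bounded cohomology is assembled from its cohomology by
-- truncation. The contractible part is the left orthogonal of the objects whose cohomology has no
-- morphism from the `Q X`. For such a `B`, sums of shifts of the `Q X` can be mapped onto its top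
-- cohomology, and iterating gives a tower from `B` whose cones are generated and whose terms go to
-- degree `-∞` (`prop_of_leftOrthogonal`). For an arbitrary invariant `X`, the truncations `τ^{< -i}
-- X` form a tower over `X` (`prop_of_homologyProp`). In both cases the homotopy (co)limit of the
-- tower vanishes, and comparing with the constant tower places the object in the subcategory
-- (`prop_of_sum_telescope`, `prop_of_prod_telescope`). The sums and products this needs are
-- computed degreewise, since those of abelian groups are exact.

universe v

namespace WittMotives

open Limits

/-! ### Coproducts and products in derived categories -/

section Coproducts

variable {C : Type u} [Category.{v} C] [Abelian C] {J : Type*}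

/-- A family of complexes as a complex of families. -/
@[simps]
def familyComplex (K : J → CochainComplex C ℤ) : CochainComplex (Discrete J ⥤ C) ℤ where
  X n := Discrete.functor fun j => (K j).X n
  d n m := Discrete.natTrans fun j => (K j.as).d n m
  shape n m h := by
    ext j
    exact (K j.as).shape n m h
  d_comp_d' n m l _ _ := by
    ext j
    exact (K j.as).d_comp_d n m l

/-- A family of morphisms of complexes as a morphism of complexes of families. -/
@[simps]
def familyMap {K L : J → CochainComplex C ℤ} (f : ∀ j, K j ⟶ L j) :
    familyComplex K ⟶ familyComplex L where
  f n := Discrete.natTrans fun j => (f j.as).f n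
  comm' n m _ := by
    ext j
    exact (f j.as).comm n m

/-- Homology in a functor category is computed pointwise. Applying the exact functors `colim` and
`lim` then shows that degreewise sums and products preserve quasi-isomorphisms. -/
theorem quasiIso_familyMap {K L : J → CochainComplex C ℤ} (f : ∀ j, K j ⟶ L j)
    (hf : ∀ j, QuasiIso (f j)) : QuasiIso (familyMap f) := by
  rw [HomologicalComplex.quasiIso_iff_evaluation]
  exact fun j => hf j.as

section

variable [HasColimitsOfShape (Discrete J) C]

instance : (colim (J := Discrete J) (C := C)).Additive where
  map_add {X Y f g} := colimit.hom_ext fun j => by simp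

/-- The degreewise coproduct of a family of complexes. -/
noncomputable def sumComplex (K : J → CochainComplex C ℤ) : CochainComplex C ℤ :=
  ((colim (J := Discrete J) (C := C)).mapHomologicalComplex _).obj (familyComplex K)

namespace sumComplex

variable {K L : J → CochainComplex C ℤ} {M : CochainComplex C ℤ}

variable (K) in
/-- The inclusions into the coproduct. -/
noncomputable def ι (j : J) : K j ⟶ sumComplex K where
  f n := colimit.ι ((familyComplex K).X n) ⟨j⟩
  comm' n m _ := ι_colimMap ((familyComplex K).d n m) ⟨j⟩

theorem hom_ext' {n : ℤ} {A : C} {f g : (sumComplex K).X n ⟶ A}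
    (h : ∀ j, (ι K j).f n ≫ f = (ι K j).f n ≫ g) : f = g :=
  colimit.hom_ext fun j => h j.as

/-- The degreewise universal property of the coproduct. -/
noncomputable def desc' {n : ℤ} {A : C} (f : ∀ j, (K j).X n ⟶ A) : (sumComplex K).X n ⟶ A :=
  colimit.desc ((familyComplex K).X n) ⟨A, Discrete.natTrans fun j => f j.as⟩

theorem ι_desc' {n : ℤ} {A : C} (f : ∀ j, (K j).X n ⟶ A) (j : J) :
    (ι K j).f n ≫ desc' f = f j :=
  colimit.ι_desc (F := (familyComplex K).X n) _ _

/-- The universal property of the coproduct. -/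
noncomputable def desc (f : ∀ j, K j ⟶ M) : sumComplex K ⟶ M where
  f n := desc' (A := M.X n) fun j => (f j).f n
  comm' n m _ := hom_ext' fun j => by
    rw [← Category.assoc, ι_desc', HomologicalComplex.Hom.comm, ← Category.assoc,
      HomologicalComplex.Hom.comm, Category.assoc, ι_desc']

theorem ι_desc (f : ∀ j, K j ⟶ M) (j : J) : ι K j ≫ desc f = f j := by
  ext n
  exact ι_desc' (fun j => (f j).f n) j

/-- The functoriality of the coproduct. -/
noncomputable def map (f : ∀ j, K j ⟶ L j) : sumComplex K ⟶ sumComplex L :=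
  ((colim (J := Discrete J) (C := C)).mapHomologicalComplex _).map (familyMap f)

theorem ι_map (f : ∀ j, K j ⟶ L j) (j : J) : ι K j ≫ map f = f j ≫ ι L j := by
  ext n
  exact ι_colimMap ((familyMap f).f n) ⟨j⟩

theorem quasiIso_map [HasExactColimitsOfShape (Discrete J) C] (f : ∀ j, K j ⟶ L j)
    (hf : ∀ j, QuasiIso (f j)) : QuasiIso (map f) := by
  have := quasiIso_familyMap f hf
  exact HomologicalComplex.quasiIso_map_of_preservesHomology (familyMap f) colim

theorem isStrictlyLE (n : ℤ) (h : ∀ j, (K j).IsStrictlyLE n) :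
    (sumComplex K).IsStrictlyLE n := by
  rw [CochainComplex.isStrictlyLE_iff]
  intro i hi
  rw [IsZero.iff_id_eq_zero]
  exact hom_ext' fun j => ((K j).isZero_of_isStrictlyLE n i hi).eq_of_src _ _

/-- A family of homotopies to zero induces a homotopy to zero on the coproduct. -/
noncomputable def homotopyZero (f : sumComplex K ⟶ M) (h : ∀ j, Homotopy (ι K j ≫ f) 0) :
    Homotopy f 0 where
  hom n m := desc' fun j => (h j).hom n m
  zero n m hnm := hom_ext' fun j => by
    rw [ι_desc', (h j).zero n m hnm, comp_zero]
  comm n := hom_ext' fun j => by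
    rw [← HomologicalComplex.comp_f, (h j).comm n]
    simp only [dNext, prevD, AddMonoidHom.mk'_apply, Preadditive.comp_add, ι_desc',
      HomologicalComplex.zero_f, add_zero, ← Category.assoc,
      HomologicalComplex.Hom.comm]
    simp only [Category.assoc, ι_desc']

variable [HasExactColimitsOfShape (Discrete J) C] [HasDerivedCategory.{w} C]

open DerivedCategory

/-- The derived category is obtained from the homotopy category by a calculus of fractions, so two
morphisms with the same image are equalized by a quasi-isomorphism. -/
theorem exists_homotopy_of_Q_map_eq_zero {K L : CochainComplex C ℤ} (f : K ⟶ L)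
    (h : Q.map f = 0) : ∃ (K' : CochainComplex C ℤ) (s : K' ⟶ K) (_ : QuasiIso s),
      Nonempty (Homotopy (s ≫ f) 0) := by
  have h' : Qh.map ((HomotopyCategory.quotient C (ComplexShape.up ℤ)).map f) = Qh.map 0 := by
    rw [Functor.map_zero]
    exact h
  rw [MorphismProperty.map_eq_iff_precomp Qh
    (HomotopyCategory.quasiIso C (ComplexShape.up ℤ))] at h'
  obtain ⟨K', s, hs, h'⟩ := h'
  obtain ⟨K', rfl⟩ := HomotopyCategory.quotient_obj_surjective K'
  obtain ⟨s, rfl⟩ := (HomotopyCategory.quotient _ _).map_surjective s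
  rw [HomotopyCategory.quotient_map_mem_quasiIso_iff,
    HomologicalComplex.mem_quasiIso_iff] at hs
  refine ⟨K', s, hs, ⟨HomotopyCategory.homotopyOfEq _ _ ?_⟩⟩
  rw [Functor.map_comp, h', comp_zero, Functor.map_zero]

/-- Together with `exists_Q_desc` this makes the degreewise sum a coproduct in the derived category.
A morphism is written as a left fraction. Each restriction of its numerator becomes null-homotopic
after a quasi-isomorphism `t j`, the sum of the `t j` is again a quasi-isomorphism, and the
homotopies assemble. -/
theorem Q_hom_ext {X : DerivedCategory C} {f g : Q.obj (sumComplex K) ⟶ X}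
    (h : ∀ j, Q.map (ι K j) ≫ f = Q.map (ι K j) ≫ g) : f = g := by
  suffices ∀ (M : CochainComplex C ℤ) (f : Q.obj (sumComplex K) ⟶ Q.obj M)
      (_ : ∀ j, Q.map (ι K j) ≫ f = 0), f = 0 by
    rw [← cancel_mono (Q.objObjPreimageIso X).inv, ← sub_eq_zero, ← Preadditive.sub_comp]
    refine this _ _ fun j => ?_
    rw [← Category.assoc, Preadditive.comp_sub, h, sub_self, zero_comp]
  intro M f hf
  obtain ⟨M', g, s, _, rfl⟩ := left_fac f
  have hg (j : J) : Q.map (ι K j ≫ g) = 0 := by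
    have := hf j
    rwa [← Category.assoc, ← Q.map_comp, ← cancel_mono (Q.map s), Category.assoc,
      IsIso.inv_hom_id, Category.comp_id, zero_comp] at this
  choose K' t ht ho using fun j => exists_homotopy_of_Q_map_eq_zero _ (hg j)
  have hq := quasiIso_map t ht
  have : Homotopy (map t ≫ g) 0 := homotopyZero _ fun j =>
    (Homotopy.ofEq (by rw [← Category.assoc, ι_map, Category.assoc])).trans (ho j).some
  have h0 : Q.map (map t ≫ g) = 0 := by
    rw [DerivedCategory.Q_map_eq_of_homotopy C this, Functor.map_zero]
  rw [Functor.map_comp] at h0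
  have : IsIso (Q.map (map t)) := (isIso_Q_map_iff_quasiIso C _).2 hq
  have h1 : Q.map g = 0 := by rwa [← cancel_epi (Q.map (map t)), comp_zero]
  rw [h1, zero_comp]

/-- Right fractions are the useful ones here: their denominators point into the `K j`, so the sum of
the denominators is an invertible morphism to `sumComplex K` and the numerators descend from its
source. -/
theorem exists_Q_desc {X : DerivedCategory C} (φ : ∀ j, Q.obj (K j) ⟶ X) :
    ∃ f : Q.obj (sumComplex K) ⟶ X, ∀ j, Q.map (ι K j) ≫ f = φ j := by
  suffices ∀ (M : CochainComplex C ℤ) (φ : ∀ j, Q.obj (K j) ⟶ Q.obj M),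
      ∃ f : Q.obj (sumComplex K) ⟶ Q.obj M, ∀ j, Q.map (ι K j) ≫ f = φ j by
    obtain ⟨f, hf⟩ := this _ fun j => φ j ≫ (Q.objObjPreimageIso X).inv
    exact ⟨f ≫ (Q.objObjPreimageIso X).hom, fun j => by
      rw [← Category.assoc, hf, Category.assoc, Iso.inv_hom_id, Category.comp_id]⟩
  intro M φ
  choose K' s hs g hφ using fun j => right_fac (φ j)
  have hq := quasiIso_map s fun j => (isIso_Q_map_iff_quasiIso C _).1 (hs j)
  have : IsIso (Q.map (map s)) := (isIso_Q_map_iff_quasiIso C _).2 hq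
  refine ⟨inv (Q.map (map s)) ≫ Q.map (desc g), fun j => ?_⟩
  have := hs j
  rw [hφ, ← cancel_epi (Q.map (s j)), IsIso.hom_inv_id_assoc, ← Category.assoc, ← Q.map_comp,
    ← ι_map, Q.map_comp, Category.assoc, IsIso.hom_inv_id_assoc, ← Q.map_comp, ι_desc]

end sumComplex

end

section

variable [HasLimitsOfShape (Discrete J) C]

instance : (lim (J := Discrete J) (C := C)).Additive where
  map_add {X Y f g} := limit.hom_ext fun j => by simp

/-- The degreewise product of a family of complexes. -/
noncomputable def prodComplex (K : J → CochainComplex C ℤ) : CochainComplex C ℤ :=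
  ((lim (J := Discrete J) (C := C)).mapHomologicalComplex _).obj (familyComplex K)

namespace prodComplex

variable {K L : J → CochainComplex C ℤ} {M : CochainComplex C ℤ}

variable (K) in
/-- The projections from the product. -/
noncomputable def π (j : J) : prodComplex K ⟶ K j where
  f n := limit.π ((familyComplex K).X n) ⟨j⟩
  comm' n m _ := (limMap_π ((familyComplex K).d n m) ⟨j⟩).symm

theorem hom_ext' {n : ℤ} {A : C} {f g : A ⟶ (prodComplex K).X n}
    (h : ∀ j, f ≫ (π K j).f n = g ≫ (π K j).f n) : f = g :=
  limit.hom_ext fun j => h j.as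

/-- The degreewise universal property of the product. -/
noncomputable def lift' {n : ℤ} {A : C} (f : ∀ j, A ⟶ (K j).X n) : A ⟶ (prodComplex K).X n :=
  limit.lift ((familyComplex K).X n) ⟨A, Discrete.natTrans fun j => f j.as⟩

theorem lift'_π {n : ℤ} {A : C} (f : ∀ j, A ⟶ (K j).X n) (j : J) :
    lift' f ≫ (π K j).f n = f j :=
  limit.lift_π (F := (familyComplex K).X n) _ _

/-- The universal property of the product. -/
noncomputable def lift (f : ∀ j, M ⟶ K j) : M ⟶ prodComplex K where
  f n := lift' (A := M.X n) fun j => (f j).f n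
  comm' n m _ := hom_ext' fun j => by
    rw [Category.assoc, Category.assoc, lift'_π, ← HomologicalComplex.Hom.comm, ← Category.assoc,
      ← HomologicalComplex.Hom.comm, lift'_π]

theorem lift_π (f : ∀ j, M ⟶ K j) (j : J) : lift f ≫ π K j = f j := by
  ext n
  exact lift'_π (fun j => (f j).f n) j

/-- The functoriality of the product. -/
noncomputable def map (f : ∀ j, K j ⟶ L j) : prodComplex K ⟶ prodComplex L :=
  ((lim (J := Discrete J) (C := C)).mapHomologicalComplex _).map (familyMap f)

theorem map_π (f : ∀ j, K j ⟶ L j) (j : J) : map f ≫ π L j = π K j ≫ f j := by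
  ext n
  exact limMap_π ((familyMap f).f n) ⟨j⟩

theorem quasiIso_map [HasExactLimitsOfShape (Discrete J) C] (f : ∀ j, K j ⟶ L j)
    (hf : ∀ j, QuasiIso (f j)) : QuasiIso (map f) := by
  have := quasiIso_familyMap f hf
  exact HomologicalComplex.quasiIso_map_of_preservesHomology (familyMap f) lim

theorem isStrictlyLE (n : ℤ) (h : ∀ j, (K j).IsStrictlyLE n) :
    (prodComplex K).IsStrictlyLE n := by
  rw [CochainComplex.isStrictlyLE_iff]
  intro i hi
  rw [IsZero.iff_id_eq_zero]
  exact hom_ext' fun j => ((K j).isZero_of_isStrictlyLE n i hi).eq_of_tgt _ _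

/-- A family of homotopies to zero induces a homotopy to zero on the product. -/
noncomputable def homotopyZero (f : M ⟶ prodComplex K) (h : ∀ j, Homotopy (f ≫ π K j) 0) :
    Homotopy f 0 where
  hom n m := lift' fun j => (h j).hom n m
  zero n m hnm := hom_ext' fun j => by
    rw [lift'_π, (h j).zero n m hnm, zero_comp]
  comm n := hom_ext' fun j => by
    rw [← HomologicalComplex.comp_f, (h j).comm n]
    simp only [dNext, prevD, AddMonoidHom.mk'_apply, Preadditive.add_comp, lift'_π,
      HomologicalComplex.zero_f, add_zero, Category.assoc,
      ← HomologicalComplex.Hom.comm]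
    simp only [← Category.assoc, lift'_π]

variable [HasExactLimitsOfShape (Discrete J) C] [HasDerivedCategory.{w} C]

open DerivedCategory

theorem exists_homotopy_of_Q_map_eq_zero {K L : CochainComplex C ℤ} (f : K ⟶ L)
    (h : Q.map f = 0) : ∃ (L' : CochainComplex C ℤ) (s : L ⟶ L') (_ : QuasiIso s),
      Nonempty (Homotopy (f ≫ s) 0) := by
  have h' : Qh.map ((HomotopyCategory.quotient C (ComplexShape.up ℤ)).map f) = Qh.map 0 := by
    rw [Functor.map_zero]
    exact h
  rw [MorphismProperty.map_eq_iff_postcomp Qh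
    (HomotopyCategory.quasiIso C (ComplexShape.up ℤ))] at h'
  obtain ⟨L', s, hs, h'⟩ := h'
  obtain ⟨L', rfl⟩ := HomotopyCategory.quotient_obj_surjective L'
  obtain ⟨s, rfl⟩ := (HomotopyCategory.quotient _ _).map_surjective s
  rw [HomotopyCategory.quotient_map_mem_quasiIso_iff,
    HomologicalComplex.mem_quasiIso_iff] at hs
  refine ⟨L', s, hs, ⟨HomotopyCategory.homotopyOfEq _ _ ?_⟩⟩
  rw [Functor.map_comp, h', zero_comp, Functor.map_zero]

theorem Q_hom_ext {X : DerivedCategory C} {f g : X ⟶ Q.obj (prodComplex K)}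
    (h : ∀ j, f ≫ Q.map (π K j) = g ≫ Q.map (π K j)) : f = g := by
  suffices ∀ (M : CochainComplex C ℤ) (f : Q.obj M ⟶ Q.obj (prodComplex K))
      (_ : ∀ j, f ≫ Q.map (π K j) = 0), f = 0 by
    rw [← cancel_epi (Q.objObjPreimageIso X).hom, ← sub_eq_zero, ← Preadditive.comp_sub]
    refine this _ _ fun j => ?_
    rw [Category.assoc, Preadditive.sub_comp, h, sub_self, comp_zero]
  intro M f hf
  obtain ⟨M', s, _, g, rfl⟩ := right_fac f
  have hg (j : J) : Q.map (g ≫ π K j) = 0 := by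
    have := hf j
    rwa [Category.assoc, ← Q.map_comp, ← cancel_epi (Q.map s), IsIso.hom_inv_id_assoc,
      comp_zero] at this
  choose L' t ht ho using fun j => exists_homotopy_of_Q_map_eq_zero _ (hg j)
  have hq := quasiIso_map t ht
  have : Homotopy (g ≫ map t) 0 := homotopyZero _ fun j =>
    (Homotopy.ofEq (by rw [Category.assoc, map_π, Category.assoc])).trans (ho j).some
  have h0 : Q.map (g ≫ map t) = 0 := by
    rw [DerivedCategory.Q_map_eq_of_homotopy C this, Functor.map_zero]
  rw [Functor.map_comp] at h0
  have : IsIso (Q.map (map t)) := (isIso_Q_map_iff_quasiIso C _).2 hq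
  have h1 : Q.map g = 0 := by rwa [← cancel_mono (Q.map (map t)), zero_comp]
  rw [h1, comp_zero]

theorem exists_Q_lift {X : DerivedCategory C} (φ : ∀ j, X ⟶ Q.obj (K j)) :
    ∃ f : X ⟶ Q.obj (prodComplex K), ∀ j, f ≫ Q.map (π K j) = φ j := by
  suffices ∀ (M : CochainComplex C ℤ) (φ : ∀ j, Q.obj M ⟶ Q.obj (K j)),
      ∃ f : Q.obj M ⟶ Q.obj (prodComplex K), ∀ j, f ≫ Q.map (π K j) = φ j by
    obtain ⟨f, hf⟩ := this _ fun j => (Q.objObjPreimageIso X).hom ≫ φ j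
    exact ⟨(Q.objObjPreimageIso X).inv ≫ f, fun j => by
      rw [Category.assoc, hf, Iso.inv_hom_id_assoc]⟩
  intro M φ
  choose K' g s hs hφ using fun j => left_fac (φ j)
  have hq := quasiIso_map s fun j => (isIso_Q_map_iff_quasiIso C _).1 (hs j)
  have : IsIso (Q.map (map s)) := (isIso_Q_map_iff_quasiIso C _).2 hq
  refine ⟨Q.map (lift g) ≫ inv (Q.map (map s)), fun j => ?_⟩
  have := hs j
  rw [hφ, ← cancel_mono (Q.map (s j)), Category.assoc, Category.assoc, Category.assoc,
    IsIso.inv_hom_id, Category.comp_id, ← Q.map_comp, ← map_π, Q.map_comp,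
    IsIso.inv_hom_id_assoc, ← Q.map_comp, lift_π]

end prodComplex

end

/-! ### Sums and products of uniformly bounded families in `D⁻` -/

section Minus

variable [HasDerivedCategory.{w} C]

open DerivedCategory DerivedCategory.TStructure

/-- The common bound `n` provides representatives vanishing above `n`, so that their degreewise sum
stays in `D⁻`. The families met below are all of this kind. -/
theorem hasCoproduct_minus [HasColimitsOfShape (Discrete J) C]
    [HasExactColimitsOfShape (Discrete J) C] (X : J → Minus C) (n : ℤ)
    (h : ∀ j, IsLE (X j).obj n) :
    ∃ (Y : Minus C) (ι : ∀ j, X j ⟶ Y), IsLE Y.obj n ∧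
      Nonempty (IsColimit (Cofan.mk Y ι)) := by
  choose K hK e using fun j => (X j).obj.exists_iso_Q_obj_of_isLE n
  have hs := sumComplex.isStrictlyLE n hK
  have hle : IsLE (Q.obj (sumComplex K)) n := inferInstance
  let Y : Minus C := ⟨Q.obj (sumComplex K), n, hle⟩
  let ι (j : J) : X j ⟶ Y := ObjectProperty.homMk ((e j).some.hom ≫ Q.map (sumComplex.ι K j))
  refine ⟨Y, ι, hle, ⟨Cofan.IsColimit.mk _ (fun s => ObjectProperty.homMk
    (sumComplex.exists_Q_desc fun j => (e j).some.inv ≫ (s.inj j).hom).choose) ?_ ?_⟩⟩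
  · intro s j
    ext
    have := (sumComplex.exists_Q_desc fun j => (e j).some.inv ≫ (s.inj j).hom).choose_spec j
    change ((e j).some.hom ≫ _) ≫ Exists.choose _ = _
    rw [Category.assoc, this, Iso.hom_inv_id_assoc]
  · intro s m hm
    ext
    refine sumComplex.Q_hom_ext fun j => ?_
    rw [← cancel_epi (e j).some.hom]
    have := (sumComplex.exists_Q_desc fun j => (e j).some.inv ≫ (s.inj j).hom).choose_spec j
    change _ = _ ≫ _ ≫ Exists.choose _
    rw [this, Iso.hom_inv_id_assoc, ← Category.assoc]
    exact congrArg InducedCategory.Hom.hom (hm j)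

theorem hasProduct_minus [HasLimitsOfShape (Discrete J) C]
    [HasExactLimitsOfShape (Discrete J) C] (X : J → Minus C) (n : ℤ)
    (h : ∀ j, IsLE (X j).obj n) :
    ∃ (Y : Minus C) (π : ∀ j, Y ⟶ X j), IsLE Y.obj n ∧
      Nonempty (IsLimit (Fan.mk Y π)) := by
  choose K hK e using fun j => (X j).obj.exists_iso_Q_obj_of_isLE n
  have hs := prodComplex.isStrictlyLE n hK
  have hle : IsLE (Q.obj (prodComplex K)) n := inferInstance
  let Y : Minus C := ⟨Q.obj (prodComplex K), n, hle⟩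
  let π (j : J) : Y ⟶ X j := ObjectProperty.homMk (Q.map (prodComplex.π K j) ≫ (e j).some.inv)
  refine ⟨Y, π, hle, ⟨Fan.IsLimit.mk _ (fun s => ObjectProperty.homMk
    (prodComplex.exists_Q_lift fun j => (s.proj j).hom ≫ (e j).some.hom).choose) ?_ ?_⟩⟩
  · intro s j
    ext
    have := (prodComplex.exists_Q_lift fun j => (s.proj j).hom ≫ (e j).some.hom).choose_spec j
    change Exists.choose _ ≫ _ ≫ (e j).some.inv = _
    rw [← Category.assoc, this, Category.assoc, Iso.hom_inv_id, Category.comp_id]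
  · intro s m hm
    ext
    refine prodComplex.Q_hom_ext fun j => ?_
    rw [← cancel_mono (e j).some.inv]
    have := (prodComplex.exists_Q_lift fun j => (s.proj j).hom ≫ (e j).some.hom).choose_spec j
    change _ = (Exists.choose _ ≫ _) ≫ _
    rw [this, Category.assoc, Category.assoc, Iso.hom_inv_id, Category.comp_id]
    exact congrArg InducedCategory.Hom.hom (hm j)

end Minus

end Coproducts
end WittMotives

namespace WittMotives

open Limits

/-! ### Sums and products of families -/

section Families

variable {C : Type*} [Category* C] {J : Type*} {X : J → C} {Z : C}

/-- The morphisms `ι j : X j ⟶ Z` exhibit `Z` as the coproduct of the `X j`. -/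
def IsSum (ι : ∀ j, X j ⟶ Z) : Prop :=
  ∀ ⦃A : C⦄ (f : ∀ j, X j ⟶ A), ∃! g : Z ⟶ A, ∀ j, ι j ≫ g = f j

/-- The morphisms `π j : Z ⟶ X j` exhibit `Z` as the product of the `X j`. -/
def IsProd (π : ∀ j, Z ⟶ X j) : Prop :=
  ∀ ⦃A : C⦄ (f : ∀ j, A ⟶ X j), ∃! g : A ⟶ Z, ∀ j, g ≫ π j = f j

theorem IsSum.of_isColimit {ι : ∀ j, X j ⟶ Z} (h : IsColimit (Cofan.mk Z ι)) : IsSum ι :=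
  fun _ f => ⟨Cofan.IsColimit.desc h f, Cofan.IsColimit.fac h f,
    fun _ hg => Cofan.IsColimit.hom_ext h _ _ fun j =>
      (hg j).trans (Cofan.IsColimit.fac h f j).symm⟩

theorem IsProd.of_isLimit {π : ∀ j, Z ⟶ X j} (h : IsLimit (Fan.mk Z π)) : IsProd π :=
  fun _ f => ⟨Fan.IsLimit.lift h f, Fan.IsLimit.fac h f,
    fun _ hg => Fan.IsLimit.hom_ext h _ _ fun j =>
      (hg j).trans (Fan.IsLimit.fac h f j).symm⟩

theorem IsSum.exists_desc {ι : ∀ j, X j ⟶ Z} (h : IsSum ι) {A : C} (f : ∀ j, X j ⟶ A) :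
    ∃ g : Z ⟶ A, ∀ j, ι j ≫ g = f j :=
  (h f).exists

theorem IsProd.exists_lift {π : ∀ j, Z ⟶ X j} (h : IsProd π) {A : C} (f : ∀ j, A ⟶ X j) :
    ∃ g : A ⟶ Z, ∀ j, g ≫ π j = f j :=
  (h f).exists

theorem IsSum.hom_ext {ι : ∀ j, X j ⟶ Z} (h : IsSum ι) {A : C} {f g : Z ⟶ A}
    (e : ∀ j, ι j ≫ f = ι j ≫ g) : f = g :=
  (h fun j => ι j ≫ g).unique e fun _ => rfl

theorem IsProd.hom_ext {π : ∀ j, Z ⟶ X j} (h : IsProd π) {A : C} {f g : A ⟶ Z}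
    (e : ∀ j, f ≫ π j = g ≫ π j) : f = g :=
  (h fun j => g ≫ π j).unique e fun _ => rfl

theorem IsSum.prop {ι : ∀ j, X j ⟶ Z} (h : IsSum ι) (P : ObjectProperty C)
    [P.IsClosedUnderColimitsOfShape (Discrete J)] (hP : ∀ j, P (X j)) : P Z :=
  P.prop_of_isColimit (Cofan.IsColimit.mk (Cofan.mk Z ι) (fun s => (h s.inj).choose)
    (fun s => (h s.inj).choose_spec.1) fun s m hm => (h s.inj).choose_spec.2 m hm)
    fun j => hP j.as

theorem IsProd.prop {π : ∀ j, Z ⟶ X j} (h : IsProd π) (P : ObjectProperty C)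
    [P.IsClosedUnderLimitsOfShape (Discrete J)] (hP : ∀ j, P (X j)) : P Z :=
  P.prop_of_isLimit (Fan.IsLimit.mk (Fan.mk Z π) (fun s => (h s.proj).choose)
    (fun s => (h s.proj).choose_spec.1) fun s m hm => (h s.proj).choose_spec.2 m hm)
    fun j => hP j.as

/-- Needed for the shift functor, in order to use the universal property at the third morphism of a
triangle. -/
theorem IsSum.map_of_isEquivalence {ι : ∀ j, X j ⟶ Z} (h : IsSum ι) {D : Type*} [Category* D]
    (F : C ⥤ D) [F.IsEquivalence] : IsSum fun j => F.map (ι j) := fun A f => by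
  let e := F.objObjPreimageIso A
  choose f' hf' using fun j => F.map_surjective (f j ≫ e.inv)
  obtain ⟨g, hg, hu⟩ := h f'
  refine ⟨F.map g ≫ e.hom, fun j => ?_, fun g' hg' => ?_⟩
  · dsimp only
    rw [← Category.assoc, ← F.map_comp, hg, hf', Category.assoc, e.inv_hom_id, Category.comp_id]
  · obtain ⟨d, hd⟩ := F.map_surjective (g' ≫ e.inv)
    rw [← hu d fun j => F.map_injective (by rw [F.map_comp, hd, hf', ← Category.assoc, hg']), hd,
      Category.assoc, e.inv_hom_id, Category.comp_id]

theorem IsProd.map_of_isEquivalence {π : ∀ j, Z ⟶ X j} (h : IsProd π) {D : Type*} [Category* D]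
    (F : C ⥤ D) [F.IsEquivalence] : IsProd fun j => F.map (π j) := fun A f => by
  let e := F.objObjPreimageIso A
  choose f' hf' using fun j => F.map_surjective (e.hom ≫ f j)
  obtain ⟨g, hg, hu⟩ := h f'
  refine ⟨e.inv ≫ F.map g, fun j => ?_, fun g' hg' => ?_⟩
  · dsimp only
    rw [Category.assoc, ← F.map_comp, hg, hf', e.inv_hom_id_assoc]
  · obtain ⟨d, hd⟩ := F.map_surjective (e.hom ≫ g')
    rw [← hu d fun j => F.map_injective (by rw [F.map_comp, hd, hf', Category.assoc, hg']), hd,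
      e.inv_hom_id_assoc]

end Families

/-! ### Difference equations in a tower that is eventually zero -/

section Recursion

/-- The equations are solved downwards from `N`: `f i = y i + φ i (f (i + 1))`. With the uniqueness
in `eq_zero_of_sub_eq` this is the elementary form of the vanishing of `lim` and `lim¹` for a tower
that is zero from some point on. -/
theorem exists_sub_eq (N : ℕ) : ∀ (G : ℕ → Type v) [∀ i, AddCommGroup (G i)]
    (φ : ∀ i, G (i + 1) →+ G i) (_ : ∀ i, N ≤ i → Subsingleton (G i)) (y : ∀ i, G i),
    ∃ f : ∀ i, G i, ∀ i, f i - φ i (f (i + 1)) = y i := by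
  induction N with
  | zero => exact fun G _ φ h y => ⟨fun _ => 0, fun i => (h i i.zero_le).elim _ _⟩
  | succ N ih =>
    intro G _ φ h y
    obtain ⟨f, hf⟩ := ih (fun i => G (i + 1)) (fun i => φ (i + 1))
      (fun i hi => h _ (Nat.succ_le_succ hi)) fun i => y (i + 1)
    refine ⟨fun i => i.casesOn (y 0 + φ 0 (f 0)) f, fun i => ?_⟩
    cases i with
    | zero => exact add_sub_cancel_right _ _
    | succ i => exact hf i

theorem eq_zero_of_sub_eq (N : ℕ) (G : ℕ → Type v) [∀ i, AddCommGroup (G i)]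
    (φ : ∀ i, G (i + 1) →+ G i) (h : ∀ i, N ≤ i → Subsingleton (G i)) (f : ∀ i, G i)
    (hf : ∀ i, f i - φ i (f (i + 1)) = 0) (i : ℕ) : f i = 0 := by
  by_cases hi : N ≤ i
  · exact (h i hi).elim _ _
  · rw [sub_eq_zero.1 (hf i), eq_zero_of_sub_eq N G φ h f hf (i + 1), map_zero]
termination_by N - i

end Recursion

/-! ### Telescopes in triangulated categories -/

section Telescope

variable {T : Type*} [Category* T] [HasZeroObject T] [HasShift T ℤ] [Preadditive T]
  [∀ n : ℤ, (shiftFunctor T n).Additive] [Pretriangulated T]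

section

variable (P : ObjectProperty T)

/-- The octahedral axiom places the three cones in a triangle, and two of them in `P` force the
third. Composition being known, this and `trW_of_comp_left` complete two-out-of-three for morphisms
with cone in `P`. -/
theorem trW_of_comp_right [IsTriangulated T] [P.IsTriangulated] [P.IsClosedUnderIsomorphisms]
    {A B C : T} (f : A ⟶ B) (g : B ⟶ C) (hg : P.trW g) (hfg : P.trW (f ≫ g)) : P.trW f := by
  obtain ⟨Z₁, v₁, w₁, h₁⟩ := distinguished_cocone_triangle f
  obtain ⟨Z₂, v₂, w₂, h₂, m₂⟩ := hg
  obtain ⟨Z₃, v₃, w₃, h₃, m₃⟩ := hfg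
  exact ⟨_, _, _, h₁, P.ext_of_isTriangulatedClosed₁ _ (Triangulated.someOctahedron rfl h₁ h₂ h₃).mem m₃ m₂⟩

theorem trW_of_comp_left [IsTriangulated T] [P.IsTriangulated] [P.IsClosedUnderIsomorphisms]
    {A B C : T} (f : A ⟶ B) (g : B ⟶ C) (hf : P.trW f) (hfg : P.trW (f ≫ g)) : P.trW g := by
  obtain ⟨Z₁, v₁, w₁, h₁, m₁⟩ := hf
  obtain ⟨Z₂, v₂, w₂, h₂⟩ := distinguished_cocone_triangle g
  obtain ⟨Z₃, v₃, w₃, h₃, m₃⟩ := hfg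
  exact ⟨_, _, _, h₂, P.ext_of_isTriangulatedClosed₃ _ (Triangulated.someOctahedron rfl h₁ h₂ h₃).mem m₁ m₃⟩

end

section

variable {X Y Z : T} {f : X ⟶ Y} {g : Y ⟶ Z} {h : Z ⟶ X⟦(1 : ℤ)⟧}
theorem exists_eq_mor₂_comp (hT : Triangle.mk f g h ∈ distTriang T) {A : T}
    (a : Y ⟶ A) (ha : f ≫ a = 0) : ∃ b : Z ⟶ A, a = g ≫ b :=
  Triangle.yoneda_exact₂ _ hT a ha

theorem exists_eq_mor₃_comp (hT : Triangle.mk f g h ∈ distTriang T) {A : T}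
    (a : Z ⟶ A) (ha : g ≫ a = 0) :
    ∃ b : X⟦(1 : ℤ)⟧ ⟶ A, a = h ≫ b :=
  Triangle.yoneda_exact₃ _ hT a ha

theorem exists_eq_shift_mor₁_comp (hT : Triangle.mk f g h ∈ distTriang T) {A : T}
    (a : X⟦(1 : ℤ)⟧ ⟶ A) (ha : h ≫ a = 0) :
    ∃ b : Y⟦(1 : ℤ)⟧ ⟶ A, a = f⟦(1 : ℤ)⟧' ≫ b := by
  obtain ⟨b, hb⟩ := Triangle.yoneda_exact₃ _ (rot_of_distTriang _ hT) a ha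
  exact ⟨-b, hb.trans ((Preadditive.neg_comp _ _).trans (Preadditive.comp_neg _ _).symm)⟩

theorem exists_eq_comp_mor₁ (hT : Triangle.mk f g h ∈ distTriang T) {A : T}
    (a : A ⟶ Y) (ha : a ≫ g = 0) : ∃ b : A ⟶ X, a = b ≫ f :=
  Triangle.coyoneda_exact₂ _ hT a ha

theorem exists_eq_comp_mor₂ (hT : Triangle.mk f g h ∈ distTriang T) {A : T}
    (a : A ⟶ Z) (ha : a ≫ h = 0) : ∃ b : A ⟶ Y, a = b ≫ g :=
  Triangle.coyoneda_exact₃ _ hT a ha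

theorem exists_eq_comp_mor₃ (hT : Triangle.mk f g h ∈ distTriang T) {A : T}
    (a : A ⟶ X⟦(1 : ℤ)⟧) (ha : a ≫ f⟦(1 : ℤ)⟧' = 0) :
    ∃ b : A ⟶ Z, a = b ≫ h :=
  Triangle.coyoneda_exact₁ _ hT a ha

end

variable {J : Type*}

/-- The cone of a sum of morphisms is the sum of the cones. The family `Z j` is not assumed to have
a sum: the universal property is proved directly for the cone `W` of `F`, by a five-lemma chase on
morphisms to a test object. -/
theorem trW_of_isSum (P : ObjectProperty T) [P.IsClosedUnderIsomorphisms]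
    [P.IsClosedUnderColimitsOfShape (Discrete J)] {X Y : J → T} {A B : T} {ι : ∀ j, X j ⟶ A}
    (hι : IsSum ι) {κ : ∀ j, Y j ⟶ B} (hκ : IsSum κ) (f : ∀ j, X j ⟶ Y j) (hf : ∀ j, P.trW (f j))
    (F : A ⟶ B) (hF : ∀ j, ι j ≫ F = f j ≫ κ j) : P.trW F := by
  choose Z g h hT hZ using hf
  obtain ⟨W, G, H, hW⟩ := distinguished_cocone_triangle F
  have hc (j : J) : ∃ c : Z j ⟶ W, g j ≫ c = κ j ≫ G ∧
      h j ≫ (ι j)⟦(1 : ℤ)⟧' = c ≫ H := complete_distinguished_triangle_morphism _ _ (hT j) hW (ι j) (κ j) (hF j).symm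
  choose u hu₁ hu₂ using hc
  have zero₁ (j : J) : f j ≫ g j = 0 := comp_distTriang_mor_zero₁₂ _ (hT j)
  have zero₂ (j : J) : h j ≫ (f j)⟦(1 : ℤ)⟧' = 0 := comp_distTriang_mor_zero₃₁ _ (hT j)
  have zero₃ : H ≫ F⟦(1 : ℤ)⟧' = 0 := comp_distTriang_mor_zero₃₁ _ hW
  have hF' (j : J) : (ι j)⟦(1 : ℤ)⟧' ≫ F⟦(1 : ℤ)⟧' = (f j)⟦(1 : ℤ)⟧' ≫ (κ j)⟦(1 : ℤ)⟧' := by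
    rw [← Functor.map_comp, hF, Functor.map_comp]
  have hι' := hι.map_of_isEquivalence (shiftFunctor T (1 : ℤ))
  have hκ' := hκ.map_of_isEquivalence (shiftFunctor T (1 : ℤ))
  have key : IsSum u := by
    intro E z
    -- Existence: the restrictions `g j ≫ z j` extend over `B` and descend to a first approximation
    -- `w` on the cone. The defects `u j ≫ w - z j` come from the shifted `X j`, and `H ≫ x'`
    -- removes them all at once.
    obtain ⟨y, hy⟩ := hκ.exists_desc fun j => g j ≫ z j
    obtain ⟨w, hw⟩ : ∃ w, y = G ≫ w := exists_eq_mor₂_comp hW y (hι.hom_ext fun j => by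
      rw [← Category.assoc, hF, Category.assoc, hy, ← Category.assoc, zero₁, zero_comp, comp_zero])
    have hx (j : J) : ∃ x, u j ≫ w - z j = h j ≫ x :=
      exists_eq_mor₃_comp (hT j) (u j ≫ w - z j) (by
        rw [Preadditive.comp_sub, ← Category.assoc, hu₁, Category.assoc, ← hw, hy, sub_self])
    choose x hx using hx
    obtain ⟨x', hx'⟩ := hι'.exists_desc x
    refine ⟨w - H ≫ x', fun j => ?_, fun w' hw' => ?_⟩
    · rw [Preadditive.comp_sub, ← Category.assoc (u j) H, ← hu₂, Category.assoc, hx', ← hx,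
        sub_sub_cancel]
    -- Uniqueness: the difference `d` dies on every `u j`. It factors as `H ≫ e`, where `e` factors
    -- through the shift of `F`, and `H` kills that shift.
    · rw [← sub_eq_zero]
      set d := w' - (w - H ≫ x') with hd
      have hud (j : J) : u j ≫ d = 0 := by
        rw [hd, Preadditive.comp_sub, hw', Preadditive.comp_sub, ← Category.assoc (u j) H, ← hu₂,
          Category.assoc, hx', ← hx, sub_sub_cancel, sub_self]
      obtain ⟨e, he⟩ : ∃ e, d = H ≫ e := exists_eq_mor₃_comp hW d (hκ.hom_ext fun j => by
        rw [← Category.assoc, ← hu₁, Category.assoc, hud, comp_zero, comp_zero])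
      have hy' (j : J) : ∃ y', (ι j)⟦(1 : ℤ)⟧' ≫ e = (f j)⟦(1 : ℤ)⟧' ≫ y' := by
        exact exists_eq_shift_mor₁_comp (hT j) _ (by
          rw [← Category.assoc, hu₂, Category.assoc, ← he, hud])
      choose y' hy' using hy'
      obtain ⟨e', he'⟩ := hκ'.exists_desc y'
      have : F⟦(1 : ℤ)⟧' ≫ e' = e := hι'.hom_ext fun j => by
        rw [← Category.assoc, hF', Category.assoc, he', hy']
      rw [he, ← this, ← Category.assoc, zero₃, zero_comp]
  exact ⟨W, G, H, hW, key.prop P hZ⟩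

/-- The dual chase, on morphisms from a test object to the cone. It begins at the third morphism of
the triangles, since morphisms to the cone are first detected in the shift of `A`. -/
theorem trW_of_isProd (P : ObjectProperty T) [P.IsClosedUnderIsomorphisms]
    [P.IsClosedUnderLimitsOfShape (Discrete J)] {X Y : J → T} {A B : T} {π : ∀ j, A ⟶ X j}
    (hπ : IsProd π) {ρ : ∀ j, B ⟶ Y j} (hρ : IsProd ρ) (f : ∀ j, X j ⟶ Y j)
    (hf : ∀ j, P.trW (f j)) (F : A ⟶ B) (hF : ∀ j, F ≫ ρ j = π j ≫ f j) : P.trW F := by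
  choose Z g h hT hZ using hf
  obtain ⟨W, G, H, hW⟩ := distinguished_cocone_triangle F
  have hc (j : J) : ∃ c : W ⟶ Z j, G ≫ c = ρ j ≫ g j ∧
      H ≫ (π j)⟦(1 : ℤ)⟧' = c ≫ h j := complete_distinguished_triangle_morphism _ _ hW (hT j) (π j) (ρ j) (hF j)
  choose u hu₁ hu₂ using hc
  have zero₂ (j : J) : h j ≫ (f j)⟦(1 : ℤ)⟧' = 0 := comp_distTriang_mor_zero₃₁ _ (hT j)
  have zero₁ : F ≫ G = 0 := comp_distTriang_mor_zero₁₂ _ hW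
  have hF' (j : J) : F⟦(1 : ℤ)⟧' ≫ (ρ j)⟦(1 : ℤ)⟧' = (π j)⟦(1 : ℤ)⟧' ≫ (f j)⟦(1 : ℤ)⟧' := by
    rw [← Functor.map_comp, hF, Functor.map_comp]
  have hπ' := hπ.map_of_isEquivalence (shiftFunctor T (1 : ℤ))
  have hρ' := hρ.map_of_isEquivalence (shiftFunctor T (1 : ℤ))
  have key : IsProd u := by
    intro E z
    obtain ⟨x, hx⟩ := hπ'.exists_lift fun j => z j ≫ h j
    obtain ⟨w, hw⟩ : ∃ w, x = w ≫ H := exists_eq_comp_mor₃ hW x (hρ'.hom_ext fun j => by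
      rw [Category.assoc, hF', ← Category.assoc, hx, Category.assoc, zero₂, zero_comp, comp_zero])
    have hy (j : J) : ∃ y, w ≫ u j - z j = y ≫ g j :=
      exists_eq_comp_mor₂ (hT j) (w ≫ u j - z j) (by
        rw [Preadditive.sub_comp, Category.assoc, ← hu₂, ← Category.assoc, ← hw, hx, sub_self])
    choose y hy using hy
    obtain ⟨y', hy'⟩ := hρ.exists_lift y
    refine ⟨w - y' ≫ G, fun j => ?_, fun w' hw' => ?_⟩
    · rw [Preadditive.sub_comp, Category.assoc, hu₁, ← Category.assoc, hy', ← hy,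
        sub_sub_cancel]
    · rw [← sub_eq_zero]
      set d := w' - (w - y' ≫ G) with hd
      have hud (j : J) : d ≫ u j = 0 := by
        rw [hd, Preadditive.sub_comp, hw', Preadditive.sub_comp, Category.assoc, hu₁,
          ← Category.assoc, hy', ← hy, sub_sub_cancel, sub_self]
      obtain ⟨e, he⟩ : ∃ e, d = e ≫ G := exists_eq_comp_mor₂ hW d (hπ'.hom_ext fun j => by
        rw [Category.assoc, hu₂, ← Category.assoc, hud, zero_comp, zero_comp])
      have hx' (j : J) : ∃ x', e ≫ ρ j = x' ≫ f j :=
        exists_eq_comp_mor₁ (hT j) (e ≫ ρ j) (by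
            rw [Category.assoc, ← hu₁, ← Category.assoc, ← he, hud])
      choose x' hx' using hx'
      obtain ⟨e', he'⟩ := hπ.exists_lift x'
      have : e' ≫ F = e := hρ.hom_ext fun j => by
        rw [Category.assoc, hF, ← Category.assoc, he', hx']
      rw [he, ← this, Category.assoc, zero₁, comp_zero]
  exact ⟨W, G, H, hW, key.prop P hZ⟩

section

variable (P : ObjectProperty T) [P.IsClosedUnderIsomorphisms]

/-- The cone of the difference of the identity and the shift on a countable sum of copies of `B`
is `B`. -/
theorem prop_of_trW_sum {B Z : T} {ι : ℕ → (B ⟶ Z)} (hι : IsSum ι) (b : Z ⟶ Z)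
    (hb : ∀ i, ι i ≫ b = ι i - ι (i + 1)) (h : P.trW b) : P B := by
  -- The partial sums in `r` telescope, so `r` is a retraction of `b`. The complementary idempotent
  -- is `fold ≫ ι 0`, and `fold` has the section `ι 0`; hence `b` is a split monomorphism with
  -- cokernel `B`, and the cone is this cokernel.
  obtain ⟨fold, hfold⟩ := hι.exists_desc fun _ => 𝟙 B
  obtain ⟨r, hr⟩ := hι.exists_desc fun i => -∑ l ∈ Finset.range i, ι l
  obtain ⟨X, g, δ, hT, hX⟩ := h
  have hbr : b ≫ r = 𝟙 Z := hι.hom_ext fun i => by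
    rw [← Category.assoc, hb, Preadditive.sub_comp, hr, hr, Finset.sum_range_succ, Category.comp_id]
    abel
  have hrb : r ≫ b = 𝟙 Z - fold ≫ ι 0 := hι.hom_ext fun i => by
    rw [← Category.assoc, hr, Preadditive.neg_comp, Preadditive.sum_comp, Preadditive.comp_sub,
      ← Category.assoc, hfold, Category.comp_id, Category.id_comp]
    simp only [hb]
    rw [Finset.sum_range_sub', neg_sub]
  have hbf : b ≫ fold = 0 := hι.hom_ext fun i => by
    rw [← Category.assoc, hb, Preadditive.sub_comp, hfold, hfold, sub_self, comp_zero]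
  have hbg : b ≫ g = 0 := comp_distTriang_mor_zero₁₂ _ hT
  have hδ : δ = 0 := by
    have : δ ≫ b⟦(1 : ℤ)⟧' = 0 := comp_distTriang_mor_zero₃₁ _ hT
    rw [← Category.comp_id δ, ← (shiftFunctor T (1 : ℤ)).map_id, ← hbr, Functor.map_comp, ← Category.assoc, this,
      zero_comp]
  have hg : Epi g := Triangle.epi₂ _ hT hδ
  obtain ⟨t, ht⟩ : ∃ t, fold = g ≫ t := exists_eq_mor₂_comp hT fold hbf
  refine P.prop_of_iso ⟨t, ι 0 ≫ g, ?_, ?_⟩ hX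
  · rw [← cancel_epi g, ← Category.assoc, ← ht, ← Category.assoc,
      ← sub_sub_cancel (𝟙 Z) (fold ≫ ι 0), ← hrb, Preadditive.sub_comp, Category.assoc, hbg,
      comp_zero, sub_zero, Category.id_comp, Category.comp_id]
  · rw [Category.assoc, ← ht, hfold]

theorem prop_of_trW_prod [P.IsStableUnderShift ℤ] {B Z : T} {π : ℕ → (Z ⟶ B)} (hπ : IsProd π)
    (b : Z ⟶ Z) (hb : ∀ i, b ≫ π i = π i - π (i + 1)) (h : P.trW b) : P B := by
  obtain ⟨diag, hdiag⟩ := hπ.exists_lift fun _ => 𝟙 B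
  obtain ⟨r, hr⟩ := hπ.exists_lift fun i => -∑ l ∈ Finset.range i, π l
  -- Dually `b` is now a split epimorphism. The triangle is taken with the object of `P` in first
  -- position, because it is the kernel of `b` that has to be identified with `B`.
  rw [ObjectProperty.trW_iff'] at h
  obtain ⟨X, g, δ, hT, hX⟩ := h
  have hrb : r ≫ b = 𝟙 Z := hπ.hom_ext fun i => by
    rw [Category.assoc, hb, Preadditive.comp_sub, hr, hr, Finset.sum_range_succ, Category.id_comp]
    abel
  have hbr : b ≫ r = 𝟙 Z - π 0 ≫ diag := hπ.hom_ext fun i => by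
    rw [Category.assoc, hr, Preadditive.comp_neg, Preadditive.comp_sum, Preadditive.sub_comp,
      Category.assoc, hdiag, Category.comp_id, Category.id_comp]
    simp only [hb]
    rw [Finset.sum_range_sub', neg_sub]
  have hdb : diag ≫ b = 0 := hπ.hom_ext fun i => by
    rw [Category.assoc, hb, Preadditive.comp_sub, hdiag, hdiag, sub_self, zero_comp]
  have hgb : g ≫ b = 0 := comp_distTriang_mor_zero₁₂ _ hT
  have hδ : δ = 0 := by
    have : b ≫ δ = 0 := comp_distTriang_mor_zero₂₃ _ hT
    rw [← Category.id_comp δ, ← hrb, Category.assoc, this, comp_zero]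
  have hg : Mono g := Triangle.mono₁ _ hT hδ
  obtain ⟨t, ht⟩ : ∃ t, diag = t ≫ g := exists_eq_comp_mor₁ hT diag hdb
  refine P.prop_of_iso ⟨g ≫ π 0, t, ?_, ?_⟩ hX
  · rw [← cancel_mono g, Category.assoc, ← ht, Category.assoc,
      ← sub_sub_cancel (𝟙 Z) (π 0 ≫ diag), ← hbr, Preadditive.comp_sub, ← Category.assoc, hgb,
      zero_comp, sub_zero, Category.id_comp, Category.comp_id]
  · rw [← Category.assoc, ← ht, hdiag]

end

/-- For `A` in `S`, applying `Hom(-, A)` turns `a` into the difference operator of the tower `Hom(B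
i, A)`, which is zero from some point on, so it is bijective by the recursion lemmas. As `S` is
stable under shifts, the cone of `a` has no morphism to `S`, hence is zero. In other words the
homotopy colimit of the `B i` vanishes. -/
theorem isIso_of_sum_telescope (S : ObjectProperty T) [S.IsStableUnderShift ℤ]
    (hS : ∀ W : T, (∀ A, S A → ∀ f : W ⟶ A, f = 0) → IsZero W)
    {B : ℕ → T} (s : ∀ i, B i ⟶ B (i + 1))
    (hB : ∀ A, S A → ∃ N : ℕ, ∀ i, N ≤ i → ∀ f : B i ⟶ A, f = 0)
    {Z : T} {ι : ∀ i, B i ⟶ Z} (hι : IsSum ι) (a : Z ⟶ Z)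
    (ha : ∀ i, ι i ≫ a = ι i - s i ≫ ι (i + 1)) : IsIso a := by
  have inj (A : T) (hA : S A) (f : Z ⟶ A) (hf : a ≫ f = 0) : f = 0 := by
    obtain ⟨N, hN⟩ := hB A hA
    refine hι.hom_ext fun i => ?_
    rw [comp_zero]
    refine eq_zero_of_sub_eq N (fun i => B i ⟶ A) (fun i => Preadditive.leftComp A (s i))
      (fun i hi => ⟨fun f g => (hN i hi f).trans (hN i hi g).symm⟩) (fun i => ι i ≫ f)
      (fun i => ?_) i
    have : ι i ≫ a ≫ f = 0 := by rw [hf, comp_zero]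
    rwa [← Category.assoc, ha, Preadditive.sub_comp, Category.assoc] at this
  have surj (A : T) (hA : S A) (g : Z ⟶ A) : ∃ f, a ≫ f = g := by
    obtain ⟨N, hN⟩ := hB A hA
    obtain ⟨f, hf⟩ := exists_sub_eq N (fun i => B i ⟶ A) (fun i => Preadditive.leftComp A (s i))
      (fun i hi => ⟨fun f g => (hN i hi f).trans (hN i hi g).symm⟩) fun i => ι i ≫ g
    obtain ⟨f', hf'⟩ := hι.exists_desc f
    refine ⟨f', hι.hom_ext fun i => ?_⟩
    rw [← Category.assoc, ha, Preadditive.sub_comp, Category.assoc, hf', hf', ← hf]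
    rfl
  obtain ⟨W, g, h, hT⟩ := distinguished_cocone_triangle a
  refine (Triangle.isZero₃_iff_isIso₁ _ hT).1 (hS W fun A hA f => ?_)
  have hag : a ≫ g = 0 := comp_distTriang_mor_zero₁₂ _ hT
  have hha : h ≫ a⟦(1 : ℤ)⟧' = 0 := comp_distTriang_mor_zero₃₁ _ hT
  obtain ⟨x, hx⟩ : ∃ x, f = h ≫ x := exists_eq_mor₃_comp hT f
    (inj A hA _ (by rw [← Category.assoc]; exact (congrArg (· ≫ f) hag).trans zero_comp))
  -- The morphism `x` starts at the shift of `Z`. Replacing `A` by `A⟦-1⟧` turns it into a morphism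
  -- from `Z`, to which `surj` applies.
  obtain ⟨x', hx'⟩ := (shiftFunctor T (1 : ℤ)).map_surjective (x ≫ (shiftNegShift A (1 : ℤ)).inv)
  obtain ⟨y, hy⟩ := surj _ (S.le_shift (-1 : ℤ) _ hA) x'
  rw [hx, ← cancel_mono (shiftNegShift A (1 : ℤ)).inv, Category.assoc, ← hx', ← hy,
    Functor.map_comp, ← Category.assoc, hha, zero_comp, zero_comp]

theorem isIso_of_prod_telescope (S : ObjectProperty T) [S.IsStableUnderShift ℤ]
    (hS : ∀ W : T, (∀ A, S A → ∀ f : A ⟶ W, f = 0) → IsZero W)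
    {B : ℕ → T} (s : ∀ i, B (i + 1) ⟶ B i)
    (hB : ∀ A, S A → ∃ N : ℕ, ∀ i, N ≤ i → ∀ f : A ⟶ B i, f = 0)
    {Z : T} {π : ∀ i, Z ⟶ B i} (hπ : IsProd π) (a : Z ⟶ Z)
    (ha : ∀ i, a ≫ π i = π i - π (i + 1) ≫ s i) : IsIso a := by
  have inj (A : T) (hA : S A) (f : A ⟶ Z) (hf : f ≫ a = 0) : f = 0 := by
    obtain ⟨N, hN⟩ := hB A hA
    refine hπ.hom_ext fun i => ?_
    rw [zero_comp]
    refine eq_zero_of_sub_eq N (fun i => A ⟶ B i) (fun i => Preadditive.rightComp A (s i))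
      (fun i hi => ⟨fun f g => (hN i hi f).trans (hN i hi g).symm⟩) (fun i => f ≫ π i)
      (fun i => ?_) i
    have : (f ≫ a) ≫ π i = 0 := by rw [hf, zero_comp]
    rwa [Category.assoc, ha, Preadditive.comp_sub, ← Category.assoc] at this
  have surj (A : T) (hA : S A) (g : A ⟶ Z) : ∃ f, f ≫ a = g := by
    obtain ⟨N, hN⟩ := hB A hA
    obtain ⟨f, hf⟩ := exists_sub_eq N (fun i => A ⟶ B i) (fun i => Preadditive.rightComp A (s i))
      (fun i hi => ⟨fun f g => (hN i hi f).trans (hN i hi g).symm⟩) fun i => g ≫ π i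
    obtain ⟨f', hf'⟩ := hπ.exists_lift f
    refine ⟨f', hπ.hom_ext fun i => ?_⟩
    rw [Category.assoc, ha, Preadditive.comp_sub, ← Category.assoc, hf', hf', ← hf]
    rfl
  obtain ⟨W, g, h, hT⟩ := distinguished_cocone_triangle a
  refine (Triangle.isZero₃_iff_isIso₁ _ hT).1 (hS W fun A hA f => ?_)
  have hag : a ≫ g = 0 := comp_distTriang_mor_zero₁₂ _ hT
  have hha : h ≫ a⟦(1 : ℤ)⟧' = 0 := comp_distTriang_mor_zero₃₁ _ hT
  have hfh : f ≫ h = 0 := by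
    obtain ⟨x, hx⟩ := (shiftFunctor T (1 : ℤ)).map_surjective
      ((shiftNegShift A (1 : ℤ)).hom ≫ f ≫ h)
    have := inj _ (S.le_shift (-1 : ℤ) _ hA) x ((shiftFunctor T (1 : ℤ)).map_injective (by
      rw [Functor.map_comp, hx, Category.assoc, Category.assoc, hha, comp_zero, comp_zero,
        Functor.map_zero]))
    rw [this, Functor.map_zero] at hx
    rw [← cancel_epi (shiftNegShift A (1 : ℤ)).hom, ← hx, comp_zero]
  obtain ⟨x, hx⟩ : ∃ x, f = x ≫ g := exists_eq_comp_mor₂ hT f hfh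
  obtain ⟨y, hy⟩ := surj A hA x
  rw [hx, ← hy, Category.assoc, hag, comp_zero]

variable [IsTriangulated T] (P : ObjectProperty T) [P.IsTriangulated]
  [P.IsClosedUnderIsomorphisms]

/-- The tower is compared with the constant tower on `B 0`. The map `V` between the two sums has
cone in `P` and intertwines the difference operators, and the operator of the tower `B` is
invertible. Two-out-of-three shows that the operator on the copies of `B 0` has cone in `P`, and
this cone is `B 0`. -/
theorem prop_of_sum_telescope [P.IsClosedUnderColimitsOfShape (Discrete ℕ)]
    {B : ℕ → T} (s : ∀ i, B i ⟶ B (i + 1)) (hs : ∀ i, P.trW (s i))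
    {Z Z₀ : T} {ι : ∀ i, B i ⟶ Z} (hι : IsSum ι) {ι₀ : ℕ → (B 0 ⟶ Z₀)} (hι₀ : IsSum ι₀)
    (hiso : ∀ a : Z ⟶ Z, (∀ i, ι i ≫ a = ι i - s i ≫ ι (i + 1)) → IsIso a) : P (B 0) := by
  let v (i : ℕ) : B 0 ⟶ B i := Nat.rec (𝟙 _) (fun i f => f ≫ s i) i
  have hv (i : ℕ) : P.trW (v i) := by
    induction i with
    | zero => exact P.trW_of_isIso (𝟙 _)
    | succ i ih => exact P.trW.comp_mem _ _ ih (hs i)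
  obtain ⟨V, hV⟩ := hι₀.exists_desc fun i => v i ≫ ι i
  obtain ⟨a, ha⟩ := hι.exists_desc fun i => ι i - s i ≫ ι (i + 1)
  obtain ⟨b, hb⟩ := hι₀.exists_desc fun i => ι₀ i - ι₀ (i + 1)
  have hVW : P.trW V := trW_of_isSum P hι₀ hι v hv V hV
  have := hiso a ha
  refine prop_of_trW_sum P hι₀ b hb (trW_of_comp_right P b V hVW ?_)
  have e : b ≫ V = V ≫ a := hι₀.hom_ext fun i => by
    rw [← Category.assoc, hb, ← Category.assoc, hV, Category.assoc, ha, Preadditive.sub_comp, hV,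
      hV, Preadditive.comp_sub, ← Category.assoc]
  rw [e]
  exact P.trW.comp_mem _ _ hVW (P.trW_of_isIso a)

/-- Dual argument for a tower lying over the constant tower on `X`: the homotopy limit of the `B i`
vanishes, that of the constant tower is `X`, and the comparison has cone in `P`. -/
theorem prop_of_prod_telescope [P.IsClosedUnderLimitsOfShape (Discrete ℕ)]
    {B : ℕ → T} {X : T} (s : ∀ i, B (i + 1) ⟶ B i) (v : ∀ i, B i ⟶ X)
    (hsv : ∀ i, s i ≫ v i = v (i + 1)) (hv : ∀ i, P.trW (v i))
    {Z Z₀ : T} {π : ∀ i, Z ⟶ B i} (hπ : IsProd π) {π₀ : ℕ → (Z₀ ⟶ X)} (hπ₀ : IsProd π₀)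
    (hiso : ∀ a : Z ⟶ Z, (∀ i, a ≫ π i = π i - π (i + 1) ≫ s i) → IsIso a) : P X := by
  obtain ⟨V, hV⟩ := hπ₀.exists_lift fun i => π i ≫ v i
  obtain ⟨a, ha⟩ := hπ.exists_lift fun i => π i - π (i + 1) ≫ s i
  obtain ⟨b, hb⟩ := hπ₀.exists_lift fun i => π₀ i - π₀ (i + 1)
  have hVW : P.trW V := trW_of_isProd P hπ hπ₀ v hv V hV
  have := hiso a ha
  refine prop_of_trW_prod P hπ₀ b hb (trW_of_comp_left P V b hVW ?_)
  have e : V ≫ b = a ≫ V := hπ₀.hom_ext fun i => by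
    rw [Category.assoc, hb, Category.assoc, hV, ← Category.assoc, ha, Preadditive.comp_sub, hV,
      hV, Preadditive.sub_comp, Category.assoc, hsv]
  rw [e]
  exact P.trW.comp_mem _ _ (P.trW_of_isIso a) hVW

end Telescope

end WittMotives

namespace WittMotives

open Limits

/-! ### Morphisms from projective objects in the derived category -/

section Projective

variable {C : Type u} [Category.{v} C] [Abelian C]

open DerivedCategory

/-- A homotopy out of a complex concentrated in degree `n` has only one component, and its equation
is the lifting condition `hl`. -/
theorem nonempty_homotopy_single {P : C} {n : ℤ} {K : CochainComplex C ℤ}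
    (f : (CochainComplex.singleFunctor C n).obj P ⟶ K) (l : P ⟶ K.X (n - 1))
    (hl : l ≫ K.d (n - 1) n =
      (HomologicalComplex.singleObjXSelf (ComplexShape.up ℤ) n P).inv ≫ f.f n) :
    Nonempty (Homotopy f 0) := by
  refine ⟨(CochainComplex.HomComplex.Cochain.equivHomotopy f 0).symm
    ⟨CochainComplex.HomComplex.Cochain.fromSingleMk l (by lia), ?_⟩⟩
  rw [CochainComplex.HomComplex.Cochain.δ_fromSingleMk l _ 0 n (by lia), hl,
    CochainComplex.HomComplex.Cochain.ofHom_zero, add_zero]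
  refine (CochainComplex.HomComplex.Cochain.fromSingleEquiv (q := n) (by lia)).injective ?_
  rw [CochainComplex.HomComplex.Cochain.fromSingleEquiv_fromSingleMk]
  exact congrArg (_ ≫ ·) (CochainComplex.HomComplex.Cochain.ofHom_v f n)

/-- Since `f` vanishes on homology, its degree `n` component takes values in the boundaries, and
projectivity of `P` lifts it along the differential. -/
theorem nonempty_homotopy_of_homologyMap_eq_zero {P : C} [Projective P] {n : ℤ}
    {K : CochainComplex C ℤ} (f : (HomologicalComplex.single C (ComplexShape.up ℤ) n).obj P ⟶ K)
    (hf : HomologicalComplex.homologyMap f n = 0) : Nonempty (Homotopy f 0) := by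
  let e := HomologicalComplex.singleObjXSelf (ComplexShape.up ℤ) n P
  let φ := e.inv ≫ f.f n
  have hφ : φ ≫ K.d n (n + 1) = 0 := by
    rw [Category.assoc, f.comm, HomologicalComplex.single_obj_d, zero_comp, comp_zero]
  have h0 : K.liftCycles φ (n + 1) (by simp) hφ ≫ K.homologyπ n = 0 := by
    have : K.liftCycles φ (n + 1) (by simp) hφ =
        (HomologicalComplex.singleObjCyclesSelfIso (ComplexShape.up ℤ) n P).inv ≫
          HomologicalComplex.cyclesMap f n := by
      rw [← cancel_mono (K.iCycles n)]
      simp [φ, e]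
    rw [this, Category.assoc, ← HomologicalComplex.homologyπ_naturality, hf, comp_zero, comp_zero]
  have hex : (ShortComplex.mk _ _ (K.toCycles_comp_homologyπ (n - 1) n)).Exact :=
    ShortComplex.exact_of_g_is_cokernel _ (K.homologyIsCokernel (n - 1) n (by simp))
  let l := hex.liftFromProjective _ h0
  have hl : l ≫ K.d (n - 1) n = φ := by
    rw [← K.toCycles_i, ← Category.assoc, hex.liftFromProjective_comp, K.liftCycles_i]
  exact nonempty_homotopy_single f l hl

instance isKProjective_single (P : C) [Projective P] (n : ℤ) :
    CochainComplex.IsKProjective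
      ((HomologicalComplex.single C (ComplexShape.up ℤ) n).obj P) := by
  have (i : ℤ) : Projective
      (((HomologicalComplex.single C (ComplexShape.up ℤ) n).obj P).X i) := by
    by_cases hi : i = n
    · subst hi
      exact Projective.of_iso (HomologicalComplex.singleObjXSelf (ComplexShape.up ℤ) i P).symm
        inferInstance
    · have := HomologicalComplex.isZero_single_obj_X (ComplexShape.up ℤ) n P i hi
      exact ⟨fun f g _ => ⟨0, this.eq_of_src _ _⟩⟩
  have : CochainComplex.IsStrictlyLE
      ((HomologicalComplex.single C (ComplexShape.up ℤ) n).obj P) n := inferInstance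
  exact CochainComplex.isKProjective_of_projective _ n

variable [HasDerivedCategory.{w} C]

variable (C) in
theorem Q_map_surjective_of_isKProjective {K L : CochainComplex C ℤ} [K.IsKProjective]
    (f : Q.obj K ⟶ Q.obj L) : ∃ g : K ⟶ L, Q.map g = f := by
  obtain ⟨g, hg⟩ := (CochainComplex.IsKProjective.Qh_map_bijective K
    ((HomotopyCategory.quotient C (ComplexShape.up ℤ)).obj L)).surjective f
  obtain ⟨g, rfl⟩ := (HomotopyCategory.quotient _ _).map_surjective g
  exact ⟨g, hg⟩

/-- With `exists_homology_map_eq` this computes the morphisms from a projective `P` in degree `n` to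
`X` as the morphisms from `P` to the cohomology of `X` in degree `n`. K-projectivity allows `f` to
be represented by a morphism of complexes. -/
theorem eq_zero_of_homology_map_eq_zero {P : C} [Projective P] {n : ℤ} {X : DerivedCategory C}
    (f : (singleFunctor C n).obj P ⟶ X) (hf : (homologyFunctor C n).map f = 0) : f = 0 := by
  suffices ∀ (K : CochainComplex C ℤ)
      (f : Q.obj ((HomologicalComplex.single C (ComplexShape.up ℤ) n).obj P) ⟶ Q.obj K)
      (_ : (homologyFunctor C n).map f = 0), f = 0 by
    have h := this (Q.objPreimage X) (f ≫ (Q.objObjPreimageIso X).inv)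
      (((homologyFunctor C n).map_comp f _).trans ((congrArg (· ≫ _) hf).trans zero_comp))
    rwa [← cancel_mono (Q.objObjPreimageIso X).inv, zero_comp]
  intro K f hf
  obtain ⟨g, rfl⟩ := Q_map_surjective_of_isKProjective C f
  have hg : HomologicalComplex.homologyMap g n = 0 := by
    have := homologyFunctorFactors_hom_naturality g n
    rw [hf, zero_comp] at this
    exact (cancel_epi ((homologyFunctorFactors C n).hom.app _)).1 (this.symm.trans comp_zero.symm)
  obtain ⟨h⟩ := nonempty_homotopy_of_homologyMap_eq_zero g hg
  rw [Q_map_eq_of_homotopy C h, Functor.map_zero]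

theorem assoc₅ {X₁ X₂ X₃ X₄ X₅ X₆ : C} (a : X₁ ⟶ X₂) (b : X₂ ⟶ X₃) (c : X₃ ⟶ X₄) (d : X₄ ⟶ X₅)
    (e : X₅ ⟶ X₆) : a ≫ b ≫ c ≫ d ≫ e = ((a ≫ b ≫ c) ≫ d) ≫ e := by
  simp

theorem exists_homology_map_eq {P : C} [Projective P] (n : ℤ) {X : DerivedCategory C}
    (φ : P ⟶ (homologyFunctor C n).obj X) :
    ∃ (f : (singleFunctor C n).obj P ⟶ X)
      (e : (homologyFunctor C n).obj ((singleFunctor C n).obj P) ≅ P),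
      (homologyFunctor C n).map f = e.hom ≫ φ := by
  suffices ∀ (K : CochainComplex C ℤ) (φ : P ⟶ K.homology n),
      ∃ f : (HomologicalComplex.single C (ComplexShape.up ℤ) n).obj P ⟶ K,
        HomologicalComplex.homologyMap f n =
          (HomologicalComplex.singleObjHomologySelfIso (ComplexShape.up ℤ) n P).hom ≫ φ by
    obtain ⟨f, hf⟩ := this (Q.objPreimage X) (φ ≫ (homologyFunctor C n).map
      (Q.objObjPreimageIso X).inv ≫ (homologyFunctorFactors C n).hom.app _)
    refine ⟨Q.map f ≫ (Q.objObjPreimageIso X).hom, (homologyFunctorFactors C n).app _ ≪≫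
      HomologicalComplex.singleObjHomologySelfIso (ComplexShape.up ℤ) n P, ?_⟩
    refine ((homologyFunctor C n).map_comp _ _).trans ?_
    have h := homologyFunctorFactors_hom_naturality f n
    rw [hf] at h
    have h' : (homologyFunctor C n).map (Q.map f) = ((homologyFunctorFactors C n).hom.app _ ≫
        (HomologicalComplex.singleObjHomologySelfIso (ComplexShape.up ℤ) n P).hom ≫ φ) ≫
          (homologyFunctor C n).map (Q.objObjPreimageIso X).inv := by
      refine (cancel_mono ((homologyFunctorFactors C n).hom.app _)).1 (h.trans ?_)
      exact assoc₅ _ _ _ _ _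
    have hi : (homologyFunctor C n).map (Q.objObjPreimageIso X).inv ≫
        (homologyFunctor C n).map (Q.objObjPreimageIso X).hom = 𝟙 _ := by
      rw [← Functor.map_comp, Iso.inv_hom_id, CategoryTheory.Functor.map_id]
    exact ((congrArg (· ≫ _) h').trans (Category.assoc _ _ _)).trans
      (((congrArg (_ ≫ ·) hi).trans (Category.comp_id _)).trans (Category.assoc _ _ _).symm)
  intro K φ
  -- A morphism to homology lifts to the cycles because `P` is projective, and a morphism to the
  -- cycles is a morphism of complexes from `P` in degree `n`.
  let c := Projective.factorThru φ (K.homologyπ n)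
  refine ⟨HomologicalComplex.mkHomFromSingle (c ≫ K.iCycles n) (by simp), ?_⟩
  rw [← cancel_epi (HomologicalComplex.homologyπ _ n),
    HomologicalComplex.homologyπ_naturality,
    ← cancel_epi (HomologicalComplex.singleObjCyclesSelfIso (ComplexShape.up ℤ) n P).inv,
    ← Category.assoc]
  have : (HomologicalComplex.singleObjCyclesSelfIso (ComplexShape.up ℤ) n P).inv ≫
      HomologicalComplex.cyclesMap (HomologicalComplex.mkHomFromSingle (K := K)
        (c ≫ K.iCycles n) (by simp)) n = c := by
    rw [← cancel_mono (K.iCycles n)]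
    simp
  rw [this]
  simp [c]

end Projective

end WittMotives

namespace WittMotives

open Limits

/-! ### Bounded above derived categories -/

section Minus

variable {C : Type u} [Category.{v} C] [Abelian C] [HasDerivedCategory.{w} C]

open DerivedCategory DerivedCategory.TStructure ZeroObject

/-- The objects of an abelian category as complexes concentrated in degree `n`. -/
noncomputable def minusSingle (n : ℤ) : C ⥤ Minus C :=
  ObjectProperty.lift _ (singleFunctor C n) fun F =>
    ⟨n, inferInstanceAs (DerivedCategory.IsLE ((singleFunctor _ n).obj F) n)⟩

/-- Triangles in `D⁻` can be found in the unbounded derived category: only the third morphism has to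
be carried across the compatibility of the inclusion with the shift. -/
theorem exists_distinguished_minus {X Y Z : Minus C} (f : X ⟶ Y) (g : Y ⟶ Z)
    (h : Z.obj ⟶ X.obj⟦(1 : ℤ)⟧) (hT : Triangle.mk f.hom g.hom h ∈ distTriang _) :
    ∃ h' : Z ⟶ X⟦(1 : ℤ)⟧, Triangle.mk f g h' ∈ distTriang (Minus C) := by
  refine ⟨ObjectProperty.homMk (h ≫ (Minus.ι.commShiftIso (1 : ℤ)).inv.app X), ?_⟩
  refine isomorphic_distinguished _ hT _ (Triangle.isoMk _ _ (Iso.refl _) (Iso.refl _)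
    (Iso.refl _) ?_ ?_ ?_)
  · exact (Category.comp_id _).trans (Category.id_comp _).symm
  · exact (Category.comp_id _).trans (Category.id_comp _).symm
  · refine Eq.trans (b := h) ?_ (Category.id_comp _).symm
    change ((h ≫ (Minus.ι.commShiftIso (1 : ℤ)).inv.app X) ≫
      (Minus.ι.commShiftIso (1 : ℤ)).hom.app X) ≫ (𝟙 X.obj)⟦(1 : ℤ)⟧' = h
    refine (congrArg (_ ≫ ·) ((shiftFunctor (DerivedCategory C) (1 : ℤ)).map_id X.obj)).trans
      ((Category.comp_id _).trans ((Category.assoc _ _ _).trans ?_))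
    exact (congrArg (h ≫ ·) (Iso.inv_hom_id_app _ X)).trans (Category.comp_id _)

theorem exists_distinguished_of_minus {X Y Z : Minus C} {f : X ⟶ Y} {g : Y ⟶ Z}
    {h : Z ⟶ X⟦(1 : ℤ)⟧} (hT : Triangle.mk f g h ∈ distTriang (Minus C)) :
    ∃ h' : Z.obj ⟶ X.obj⟦(1 : ℤ)⟧, Triangle.mk f.hom g.hom h' ∈ distTriang (DerivedCategory C) :=
  ⟨_, Minus.ι.map_distinguished _ hT⟩

theorem isZero_of_isZero_homology {X : DerivedCategory C}
    (h : ∀ n, IsZero ((homologyFunctor C n).obj X)) : IsZero X := by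
  have hZ : IsZero (0 : DerivedCategory C) := isZero_zero _
  have : IsIso (0 : X ⟶ (0 : DerivedCategory C)) := by
    rw [isIso_iff]
    intro n
    have e := ((h n).iso ((homologyFunctor C n).map_isZero hZ)).isIso_hom
    rwa [(h n).eq_of_src ((homologyFunctor C n).map (0 : X ⟶ (0 : DerivedCategory C))) _]
  exact hZ.of_iso (asIso (0 : X ⟶ (0 : DerivedCategory C)))

theorem isZero_homology_single (F : C) {n m : ℤ} (h : m ≠ n) :
    IsZero ((homologyFunctor C m).obj ((singleFunctor C n).obj F)) := by
  rcases h.lt_or_gt with h | h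
  · exact isZero_of_isGE _ n m h
  · exact isZero_of_isLE _ n m h

/-- The objects bounded below in the bounded above derived category. -/
def minusPlus : ObjectProperty (Minus C) := fun X => t.plus X.obj

end Minus

end WittMotives

namespace WittMotives

open Limits

/-! ### Top cohomology and truncations in `D⁻` -/

section Minus

variable {C : Type u} [Category.{v} C] [Abelian C] [HasDerivedCategory.{w} C]

open DerivedCategory DerivedCategory.TStructure ZeroObject

theorem nonempty_minusSingle_shift (F : C) (n a a' : ℤ) (h : n + a = a') :
    Nonempty (((minusSingle a').obj F)⟦n⟧ ≅ (minusSingle a).obj F) :=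
  ⟨Minus.ι.preimageIso ((Minus.ι.commShiftIso n).app _ ≪≫
    ((singleFunctors C).shiftIso n a a' h).app F)⟩

theorem nonempty_homology_single_iso (F : C) (n : ℤ) :
    Nonempty ((homologyFunctor C n).obj ((singleFunctor C n).obj F) ≅ F) :=
  ⟨(homologyFunctorFactors C n).app _ ≪≫
    HomologicalComplex.singleObjHomologySelfIso (ComplexShape.up ℤ) n F⟩

theorem nonempty_homology_shift_iso (X : DerivedCategory C) (n a a' : ℤ) (h : n + a = a') :
    Nonempty ((homologyFunctor C a).obj (X⟦n⟧) ≅ (homologyFunctor C a').obj X) :=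
  ⟨((homologyFunctor C 0).shiftIso n a a' h).app X⟩

/-- On a representative that vanishes above `n`, the cohomology in degree `n` is the object of
opcycles. A morphism out of it is therefore a morphism from the degree `n` term that kills
boundaries, that is, a morphism of complexes to an object in degree `n`. -/
theorem exists_single_homology_map_eq {X : DerivedCategory C} {n : ℤ} (hX : IsLE X n) {K : C}
    (φ : (homologyFunctor C n).obj X ⟶ K) :
    ∃ (f : X ⟶ (singleFunctor C n).obj K)
      (e : (homologyFunctor C n).obj ((singleFunctor C n).obj K) ≅ K),
      (homologyFunctor C n).map f ≫ e.hom = φ := by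
  obtain ⟨L, hL, ⟨i⟩⟩ := exists_iso_Q_obj_of_isLE X n
  have hd : L.d n (n + 1) = 0 := (L.isZero_of_isStrictlyLE n (n + 1)).eq_of_tgt _ _
  have : IsIso (L.homologyι n) := L.isIso_homologyι n (n + 1) (by simp) hd
  let ψ : L.homology n ⟶ K := (homologyFunctorFactors C n).inv.app L ≫
    (homologyFunctor C n).map i.inv ≫ φ
  let g : L ⟶ (HomologicalComplex.single C (ComplexShape.up ℤ) n).obj K :=
    HomologicalComplex.mkHomToSingle (L.pOpcycles n ≫ inv (L.homologyι n) ≫ ψ) (by simp)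
  have hg : HomologicalComplex.homologyMap g n ≫
      (HomologicalComplex.singleObjHomologySelfIso (ComplexShape.up ℤ) n K).hom = ψ := by
    rw [← cancel_epi (inv (L.homologyι n)), ← cancel_epi (L.pOpcycles n)]
    have h1 : (L.pOpcycles n ≫ inv (L.homologyι n)) ≫ HomologicalComplex.homologyMap g n ≫
        HomologicalComplex.homologyι _ n = L.pOpcycles n ≫ HomologicalComplex.opcyclesMap g n := by
      rw [HomologicalComplex.homologyι_naturality]
      simp
    have h2 : (HomologicalComplex.singleObjHomologySelfIso (ComplexShape.up ℤ) n K).hom =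
        HomologicalComplex.homologyι _ n ≫
          (HomologicalComplex.singleObjOpcyclesSelfIso (ComplexShape.up ℤ) n K).inv := by
      simp
    rw [h2, ← Category.assoc, ← Category.assoc]
    rw [Category.assoc] at h1
    simp only [Category.assoc]
    rw [reassoc_of% h1]
    simp [g]
  refine ⟨i.hom ≫ Q.map g, (homologyFunctorFactors C n).app _ ≪≫
      HomologicalComplex.singleObjHomologySelfIso (ComplexShape.up ℤ) n K, ?_⟩
  have h := homologyFunctorFactors_hom_naturality g n
  have h3 : (homologyFunctor C n).map (Q.map g) ≫ (homologyFunctorFactors C n).hom.app _ ≫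
      (HomologicalComplex.singleObjHomologySelfIso (ComplexShape.up ℤ) n K).hom =
      (homologyFunctor C n).map i.inv ≫ φ := by
    refine (Category.assoc _ _ _).symm.trans ((congrArg (· ≫ _) h).trans ?_)
    refine (Category.assoc _ _ _).trans ((congrArg (_ ≫ ·) hg).trans ?_)
    exact Iso.hom_inv_id_app_assoc _ _ _
  refine (congrArg (· ≫ _) ((homologyFunctor C n).map_comp _ _)).trans
    ((Category.assoc _ _ _).trans ((congrArg (_ ≫ ·) h3).trans ?_))
  rw [← Category.assoc, ← Functor.map_comp, i.hom_inv_id, CategoryTheory.Functor.map_id]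
  exact Category.id_comp _

theorem isIso_homology_map_truncLTι (X : DerivedCategory C) {n i : ℤ} (h : i < n) :
    IsIso ((homologyFunctor C i).map ((t.truncLTι n).app X)) := by
  have hT := t.triangleLTGE_distinguished n X
  have z : ∀ j < n, IsZero ((homologyFunctor C j).obj ((t.truncGE n).obj X)) :=
    fun j hj => isZero_of_isGE _ n j hj
  have h₁ : Mono ((homologyFunctor C i).map ((t.truncLTι n).app X)) :=
    (HomologySequence.mono_homologyMap_mor₁_iff _ hT (i - 1) i (by lia)).2
      ((z _ (by lia)).eq_of_src _ _)
  have h₂ : Epi ((homologyFunctor C i).map ((t.truncLTι n).app X)) :=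
    (HomologySequence.epi_homologyMap_mor₁_iff _ hT i).2 ((z _ h).eq_of_tgt _ _)
  exact isIso_of_mono_of_epi _

theorem isIso_homology_map_truncGEπ (X : DerivedCategory C) {n i : ℤ} (h : n ≤ i) :
    IsIso ((homologyFunctor C i).map ((t.truncGEπ n).app X)) := by
  have hT := t.triangleLTGE_distinguished n X
  have z : ∀ j, n ≤ j → IsZero ((homologyFunctor C j).obj ((t.truncLT n).obj X)) :=
    fun j hj => isZero_of_isLE _ (n - 1) j (by lia)
  have h₁ : Mono ((homologyFunctor C i).map ((t.truncGEπ n).app X)) :=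
    (HomologySequence.mono_homologyMap_mor₂_iff _ hT i).2 ((z _ h).eq_of_src _ _)
  have h₂ : Epi ((homologyFunctor C i).map ((t.truncGEπ n).app X)) :=
    (HomologySequence.epi_homologyMap_mor₂_iff _ hT i (i + 1) rfl).2
      ((z _ (by lia)).eq_of_tgt _ _)
  exact isIso_of_mono_of_epi _

theorem exists_isLE (X : Minus C) : ∃ n, IsLE X.obj n := by
  exact X.property

/-- The truncation `τ^{< n} X`. -/
noncomputable def minusTruncLT (n : ℤ) (X : Minus C) : Minus C :=
  ⟨(t.truncLT n).obj X.obj, n - 1, inferInstanceAs (t.IsLE ((t.truncLT n).obj X.obj) (n - 1))⟩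

/-- The truncation `τ^{≥ n} X`. -/
noncomputable def minusTruncGE (n : ℤ) (X : Minus C) : Minus C :=
  ⟨(t.truncGE n).obj X.obj, (exists_isLE X).choose, by
    have := (exists_isLE X).choose_spec
    exact inferInstanceAs (t.IsLE ((t.truncGE n).obj X.obj) _)⟩

/-- The morphism `τ^{< n} X ⟶ X`. -/
noncomputable def minusTruncLTι (n : ℤ) (X : Minus C) : minusTruncLT n X ⟶ X :=
  ObjectProperty.homMk ((t.truncLTι n).app X.obj)

/-- The morphism `X ⟶ τ^{≥ n} X`. -/
noncomputable def minusTruncGEπ (n : ℤ) (X : Minus C) : X ⟶ minusTruncGE n X :=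
  ObjectProperty.homMk ((t.truncGEπ n).app X.obj)

theorem exists_minusTrunc_distinguished (n : ℤ) (X : Minus C) :
    ∃ h, Triangle.mk (minusTruncLTι n X) (minusTruncGEπ n X) h ∈ distTriang (Minus C) :=
  exists_distinguished_minus _ _ _ (t.triangleLTGE_distinguished n X.obj)

theorem isZero_minus_iff {X : Minus C} : IsZero X.obj → IsZero X := fun h =>
  ⟨fun Y => ⟨⟨⟨0⟩, fun f => by ext; exact h.eq_of_src _ _⟩⟩,
    fun Y => ⟨⟨⟨0⟩, fun f => by ext; exact h.eq_of_tgt _ _⟩⟩⟩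

end Minus

end WittMotives

namespace WittMotives

open Limits

/-! ### Subcategories of `D⁻` defined by conditions on cohomology -/

section Minus

variable {C : Type u} [Category.{v} C] [Abelian C] [HasDerivedCategory.{w} C]

open DerivedCategory DerivedCategory.TStructure ZeroObject

/-- The objects of `D⁻` whose cohomology objects belong to `R`. -/
def homologyProp (R : ObjectProperty C) : ObjectProperty (Minus C) := fun X =>
  ∀ n : ℤ, R ((homologyFunctor C n).obj X.obj)

instance (R : ObjectProperty C) [R.IsClosedUnderIsomorphisms] :
    (homologyProp R).IsClosedUnderIsomorphisms where
  of_iso e h n := R.prop_of_iso ((homologyFunctor C n).mapIso (Minus.ι.mapIso e)) (h n)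

instance (R : ObjectProperty C) [R.IsClosedUnderIsomorphisms] :
    (homologyProp R).IsStableUnderShift ℤ where
  isStableUnderShiftBy a := ⟨fun X h n => by
    obtain ⟨e⟩ := nonempty_homology_shift_iso X.obj a n (a + n) rfl
    exact R.prop_of_iso (e.symm ≪≫ (homologyFunctor C n).mapIso
      ((Minus.ι.commShiftIso a).symm.app X)) (h _)⟩

instance : (minusPlus (C := C)).IsStableUnderShift ℤ :=
  inferInstanceAs ((t.plus.inverseImage (Minus.ι (C := C))).IsStableUnderShift ℤ)

/-- The truncation `W → τ^{≥ m} W` is an isomorphism on cohomology in degree `m`. If it is zero then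
this cohomology vanishes, so the bounded below objects can serve as test objects for telescopes of
sums. -/
theorem isZero_of_minusPlus (W : Minus C)
    (h : ∀ A, minusPlus A → ∀ f : W ⟶ A, f = 0) : IsZero W := by
  refine isZero_minus_iff (isZero_of_isZero_homology fun m => ?_)
  have h0 := h (minusTruncGE m W) ⟨m, inferInstanceAs (t.IsGE ((t.truncGE m).obj W.obj) m)⟩
    (minusTruncGEπ m W)
  have h1 : (t.truncGEπ m).app W.obj = 0 := congrArg (Minus.ι.map ·) h0
  have h2 := isIso_homology_map_truncGEπ W.obj (le_refl m)
  exact IsZero.of_mono_eq_zero ((homologyFunctor C m).map ((t.truncGEπ m).app W.obj))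
    (by rw [h1, Functor.map_zero])

/-! ### Left orthogonals generated by projectives -/

section Generators

variable {I : Type v} (Q : I → C)

/-- The objects without nonzero morphisms from the objects `Q i`. -/
def homZero : ObjectProperty C := fun F => ∀ i (f : Q i ⟶ F), f = 0

instance : (homZero Q).IsClosedUnderIsomorphisms where
  of_iso e h i f := by
    rw [← cancel_mono e.inv, h i (f ≫ e.inv), zero_comp]

variable [∀ i, Projective (Q i)]

/-- A morphism from `Q i` in degree `n` is determined by its effect on cohomology in that degree,
where the target has no morphism from `Q i`. -/
theorem leftOrthogonal_minusSingle (n : ℤ) (i : I) :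
    (homologyProp (homZero Q)).leftOrthogonal ((minusSingle n).obj (Q i)) := fun A f hA => by
  ext
  refine eq_zero_of_homology_map_eq_zero _ ?_
  obtain ⟨e⟩ := nonempty_homology_single_iso (Q i) n
  rw [← cancel_epi e.inv, comp_zero]
  exact hA n i _

/-- By projectivity every morphism from `Q i` to the cokernel of `p` lifts to the top cohomology of
`B`, hence factors through `p` and dies. So the cokernel, placed in degree `n`, is an object to
which `B` is orthogonal. The quotient map extends to a morphism from `B` because `n` is the top
degree, and it must be zero. -/
theorem epi_homology_map {n : ℤ} {B : Minus C} (hB : IsLE B.obj n)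
    (hB' : (homologyProp (homZero Q)).leftOrthogonal B) {Z : C} (p : Z ⟶ (homologyFunctor C n).obj B.obj)
    (hp : ∀ i (φ : Q i ⟶ (homologyFunctor C n).obj B.obj), ∃ ψ, φ = ψ ≫ p) : Epi p := by
  rw [Preadditive.epi_iff_isZero_cokernel]
  have hK : homZero Q (cokernel p) := fun i f => by
    obtain ⟨ψ, hψ⟩ := hp i (Projective.factorThru f (cokernel.π p))
    rw [← Projective.factorThru_comp f (cokernel.π p), hψ, Category.assoc, cokernel.condition,
      comp_zero]
  obtain ⟨f, e, hf⟩ := exists_single_homology_map_eq hB (cokernel.π p)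
  have h0 : (ObjectProperty.homMk f : B ⟶ (minusSingle n).obj (cokernel p)) = 0 := hB' _ (by
    intro m i g
    by_cases hm : m = n
    · subst hm
      exact (cancel_mono e.hom).1 ((hK i _).trans zero_comp.symm)
    · exact (isZero_homology_single _ hm).eq_of_tgt _ _)
  have h1 : f = 0 := congrArg (Minus.ι.map ·) h0
  rw [h1, Functor.map_zero, zero_comp] at hf
  exact IsZero.of_epi_eq_zero _ hf.symm

variable [∀ J : Type v, HasColimitsOfShape (Discrete J) C]
  [∀ J : Type v, HasExactColimitsOfShape (Discrete J) C]

/-- The top cohomology of `B` is killed by the cone of a morphism from the sum of one copy of `Q i`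
in degree `n` for each morphism `Q i ⟶ Hⁿ(B)`. The surjectivity on `Hⁿ` is `epi_homology_map`, and
it is here that the orthogonality of `B` is used. -/
theorem exists_trW_isLE_sub_one (P : ObjectProperty (Minus C)) [P.IsTriangulated]
    [P.IsClosedUnderIsomorphisms] [∀ J : Type v, P.IsClosedUnderColimitsOfShape (Discrete J)]
    (hP : ∀ i, P ((minusSingle 0).obj (Q i))) {n : ℤ} {B : Minus C} (hB : IsLE B.obj n)
    (hB' : (homologyProp (homZero Q)).leftOrthogonal B) :
    ∃ (B' : Minus C) (s : B ⟶ B'), IsLE B'.obj (n - 1) ∧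
      (homologyProp (homZero Q)).leftOrthogonal B' ∧ P.trW s := by
  let J := Σ i, Q i ⟶ (homologyFunctor C n).obj B.obj
  obtain ⟨G, ι, hG, ⟨hι⟩⟩ := hasCoproduct_minus (fun j : J => (minusSingle n).obj (Q j.1)) n
    fun j => inferInstanceAs (IsLE ((singleFunctor C n).obj (Q j.1)) n)
  have hι := IsSum.of_isColimit hι
  choose f e hf using fun j : J => exists_homology_map_eq n j.2
  obtain ⟨F, hF⟩ := hι.exists_desc (A := B) fun j => ObjectProperty.homMk (f j)
  have hF' (j : J) : (ι j).hom ≫ F.hom = f j := congrArg (Minus.ι.map ·) (hF j)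
  have hGD : (homologyProp (homZero Q)).leftOrthogonal G := fun A a hA => hι.hom_ext fun j => by
    rw [leftOrthogonal_minusSingle Q n j.1 (ι j ≫ a) hA, comp_zero]
  obtain ⟨B', g, h, hT⟩ := distinguished_cocone_triangle F
  obtain ⟨h', hT'⟩ := exists_distinguished_of_minus hT
  have hepi : Epi ((homologyFunctor C n).map F.hom) := epi_homology_map Q hB hB' _ fun i φ => by
    refine ⟨(e ⟨i, φ⟩).inv ≫ (homologyFunctor C n).map (ι ⟨i, φ⟩).hom, ?_⟩
    rw [Category.assoc]
    refine Eq.symm ((congrArg (_ ≫ ·) (((homologyFunctor C n).map_comp _ _).symm.trans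
      ((congrArg _ (hF' ⟨i, φ⟩)).trans (hf ⟨i, φ⟩)))).trans ?_)
    exact Iso.inv_hom_id_assoc _ _
  refine ⟨B', g, ?_, ?_, ?_⟩
  · rw [isLE_iff]
    intro i hi
    -- The cohomology of `B` in a degree `i ≥ n` surjects onto that of the cone, since `G` has none
    -- in degree `i + 1`. This surjection is zero: for `i = n` because `G` already hits all of
    -- `Hⁿ(B)`, for `i > n` because its source is zero.
    have hepi' : Epi ((homologyFunctor C i).map g.hom) :=
      (HomologySequence.epi_homologyMap_mor₂_iff _ hT' i (i + 1) rfl).2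
        ((isZero_of_isLE G.obj n (i + 1) (by lia)).eq_of_tgt _ _)
    refine IsZero.of_epi_eq_zero ((homologyFunctor C i).map g.hom) ?_
    by_cases hin : i = n
    · subst hin
      exact (HomologySequence.epi_homologyMap_mor₁_iff _ hT' i).1 hepi
    · exact (isZero_of_isLE B.obj n i (by lia)).eq_of_src _ _
  · exact ObjectProperty.ext_of_isTriangulatedClosed₃ _ _ hT hGD hB'
  · refine ObjectProperty.trW.mk' P hT (hι.prop P fun j => ?_)
    obtain ⟨i⟩ := nonempty_minusSingle_shift (Q j.1) (-n) n 0 (by lia)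
    exact P.prop_of_iso i (P.le_shift (-n) _ (hP j.1))

/-- Iterating `exists_trW_isLE_sub_one` gives a tower starting at `B`, whose transition morphisms
have cones in `P` and whose terms are concentrated in degrees going to `-∞`. A bounded below object
eventually receives no morphism from it, so its telescope vanishes and `prop_of_sum_telescope`
applies. -/
theorem prop_of_leftOrthogonal (P : ObjectProperty (Minus C)) [P.IsTriangulated]
    [P.IsClosedUnderIsomorphisms] [∀ J : Type v, P.IsClosedUnderColimitsOfShape (Discrete J)]
    [P.IsClosedUnderColimitsOfShape (Discrete ℕ)] [HasColimitsOfShape (Discrete ℕ) C]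
    [HasExactColimitsOfShape (Discrete ℕ) C]
    (hP : ∀ i, P ((minusSingle 0).obj (Q i))) {B : Minus C}
    (hB : (homologyProp (homZero Q)).leftOrthogonal B) : P B := by
  obtain ⟨n, hn⟩ := exists_isLE B
  let S (i : ℕ) := {B : Minus C // IsLE B.obj (n - i) ∧ (homologyProp (homZero Q)).leftOrthogonal B}
  have step (i : ℕ) (X : S i) : ∃ (Y : S (i + 1)) (s : X.1 ⟶ Y.1), P.trW s := by
    obtain ⟨B', s, h₁, h₂, h₃⟩ := exists_trW_isLE_sub_one Q P hP X.2.1 X.2.2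
    exact ⟨⟨B', by rwa [Nat.cast_add, Nat.cast_one, ← sub_sub], h₂⟩, s, h₃⟩
  choose next s hs using step
  let X (i : ℕ) : S i := Nat.rec ⟨B, by simpa using hn, hB⟩ next i
  have hX (i : ℕ) : IsLE (X i).1.obj n := by
    have := (X i).2.1
    exact t.isLE_of_le _ (n - i) n (by lia)
  obtain ⟨Z, ι, _, ⟨hι⟩⟩ := hasCoproduct_minus (fun i => (X i).1) n hX
  obtain ⟨Z₀, ι₀, _, ⟨hι₀⟩⟩ := hasCoproduct_minus (fun _ : ℕ => B) n fun _ => hn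
  refine prop_of_sum_telescope P (B := fun i => (X i).1) (fun i => s i (X i)) (fun i => hs i (X i))
    (.of_isColimit hι) (.of_isColimit hι₀) fun a ha => ?_
  refine isIso_of_sum_telescope minusPlus isZero_of_minusPlus _ (fun A hA => ?_)
    (.of_isColimit hι) a ha
  obtain ⟨m, hm⟩ := hA
  -- From this index on `n - i < m`, and the t-structure leaves no morphism from `X i` to `A`.
  refine ⟨(n - m + 1).toNat, fun i hi f => ?_⟩
  ext
  have := (X i).2.1
  exact t.zero_of_isLE_of_isGE f.hom (n - i) m (by lia) this hm

end Generators

/-! ### Objects with bounded cohomology -/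

section Bounded

variable (R : ObjectProperty C) [R.IsClosedUnderIsomorphisms] [R.ContainsZero]

theorem homologyProp_minusTruncGE {X : Minus C} (hX : homologyProp R X) (n : ℤ) :
    homologyProp R (minusTruncGE n X) := fun i => by
  by_cases h : n ≤ i
  · have := isIso_homology_map_truncGEπ X.obj h
    exact R.prop_of_iso (@asIso _ _ _ _ _ this) (hX i)
  · exact R.prop_of_isZero (isZero_of_isGE ((t.truncGE n).obj X.obj) n i (by lia))

theorem homologyProp_minusTruncLT {X : Minus C} (hX : homologyProp R X) (n : ℤ) :
    homologyProp R (minusTruncLT n X) := fun i => by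
  by_cases h : i < n
  · have := isIso_homology_map_truncLTι X.obj h
    exact R.prop_of_iso (@asIso _ _ _ _ _ this).symm (hX i)
  · exact R.prop_of_isZero (isZero_of_isLE ((t.truncLT n).obj X.obj) (n - 1) i (by lia))

variable (P : ObjectProperty (Minus C)) [P.IsTriangulated] [P.IsClosedUnderIsomorphisms]

/-- Induction on the number `m` of degrees in which cohomology is allowed; the interval `[a, a + m -
1]` is empty for `m = 0`. Truncating splits off the top degree, which is a shift of an object of
`R`. -/
theorem prop_of_isGE_of_isLE (hP : ∀ F, R F → P ((minusSingle 0).obj F))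
    (a : ℤ) (m : ℕ) : ∀ (X : Minus C), IsGE X.obj a →
    IsLE X.obj (a + m - 1) → homologyProp R X → P X := by
  induction m with
  | zero =>
    intro X h₁ h₂ _
    refine P.prop_of_isZero (isZero_minus_iff (isZero_of_isZero_homology fun n => ?_))
    rcases lt_or_ge n a with h | h
    · exact isZero_of_isGE X.obj a n h
    · exact isZero_of_isLE X.obj (a + (0 : ℕ) - 1) n (by simp; lia)
  | succ m ih =>
    intro X h₁ h₂ hX
    obtain ⟨h, hT⟩ := exists_minusTrunc_distinguished (a + m) X
    refine P.ext_of_isTriangulatedClosed₂ _ hT (ih _ ?_ ?_ (homologyProp_minusTruncLT R hX _)) ?_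
    · exact inferInstanceAs (t.IsGE ((t.truncLT (a + m)).obj X.obj) a)
    · exact inferInstanceAs (t.IsLE ((t.truncLT (a + m)).obj X.obj) (a + m - 1))
    · have i₁ : IsGE (minusTruncGE (a + m) X).obj (a + m) :=
        inferInstanceAs (t.IsGE ((t.truncGE (a + m)).obj X.obj) (a + m))
      have i₂ : IsLE (minusTruncGE (a + m) X).obj (a + m) := by
        have : t.IsLE X.obj (a + m) := t.isLE_of_le _ (a + (m + 1 : ℕ) - 1) _ (by push_cast; lia)
        exact inferInstanceAs (t.IsLE ((t.truncGE (a + m)).obj X.obj) (a + m))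
      obtain ⟨Y, ⟨e⟩⟩ := exists_iso_singleFunctor_obj_of_isGE_of_isLE
        (minusTruncGE (a + m) X).obj (a + m)
      obtain ⟨e'⟩ := nonempty_homology_single_iso Y (a + m)
      have hY : R Y := R.prop_of_iso ((homologyFunctor C (a + m)).mapIso e ≪≫ e')
        (homologyProp_minusTruncGE R hX (a + m) (a + m))
      obtain ⟨i⟩ := nonempty_minusSingle_shift Y (-(a + m)) (a + m) 0 (by lia)
      have hY' : P ((minusSingle (a + m)).obj Y) :=
        P.prop_of_iso i (P.le_shift (-(a + m)) _ (hP Y hY))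
      exact P.prop_of_iso (Minus.ι.preimageIso (X := (minusSingle (a + m)).obj Y)
        (Y := minusTruncGE (a + m) X) e.symm) hY'

theorem prop_of_minusPlus (hP : ∀ F, R F → P ((minusSingle 0).obj F))
    {X : Minus C} (hX : homologyProp R X) (hX' : minusPlus X) : P X := by
  obtain ⟨a, ha⟩ := hX'
  obtain ⟨b, hb⟩ := exists_isLE X
  -- When `b < a` the count is `0` and the resulting upper bound `a - 1` is still at least `b`.
  refine prop_of_isGE_of_isLE R P hP a (b - a + 1).toNat X ha ?_ hX
  exact t.isLE_of_le _ b _ (by lia)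

end Bounded

/-! ### Objects with unbounded cohomology as homotopy limits -/

section Products

variable [EnoughProjectives C]

variable (C) in
/-- The objects of `D⁻` given by a projective object in some degree. -/
def shiftedProjectives : ObjectProperty (Minus C) := fun X =>
  ∃ (n : ℤ) (F : C), Projective F ∧ Nonempty ((minusSingle n).obj F ≅ X)

instance : (shiftedProjectives C).IsStableUnderShift ℤ where
  isStableUnderShiftBy a := ⟨fun X ⟨n, F, h, ⟨e⟩⟩ => by
    obtain ⟨i⟩ := nonempty_minusSingle_shift F a (n - a) n (by lia)
    exact ⟨n - a, F, h, ⟨i.symm ≪≫ (shiftFunctor (Minus C) a).mapIso e⟩⟩⟩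

/-- A projective covering of the cohomology of `W` in degree `m` is realized by a morphism to `W`
from a projective in degree `m`. If this morphism is zero, so is the cohomology. -/
theorem isZero_of_shiftedProjectives (W : Minus C)
    (h : ∀ A, shiftedProjectives C A → ∀ f : A ⟶ W, f = 0) : IsZero W := by
  refine isZero_minus_iff (isZero_of_isZero_homology fun m => ?_)
  obtain ⟨f, e, hf⟩ := exists_homology_map_eq m (Projective.π ((homologyFunctor C m).obj W.obj))
  have h0 : (ObjectProperty.homMk f : (minusSingle m).obj _ ⟶ W) = 0 :=
    h _ ⟨m, _, inferInstance, ⟨Iso.refl _⟩⟩ _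
  have h1 : f = 0 := congrArg (Minus.ι.map ·) h0
  rw [h1, Functor.map_zero] at hf
  refine IsZero.of_epi_eq_zero (Projective.π ((homologyFunctor C m).obj W.obj)) ?_
  rw [← cancel_epi e.hom, ← hf, comp_zero]

/-- The truncations `τ^{< -i} X` form a tower over `X`, and the cone of each morphism to `X` is
`τ^{≥ -i} X`, which is in `P` by the bounded case. A projective in a fixed degree eventually has no
morphism to the tower, so its homotopy limit vanishes and `prop_of_prod_telescope` gives `X`.
Besides triangles, only countable products of objects of `P` are used. -/
theorem prop_of_homologyProp (R : ObjectProperty C) [R.IsClosedUnderIsomorphisms] [R.ContainsZero]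
    (P : ObjectProperty (Minus C)) [P.IsTriangulated] [P.IsClosedUnderIsomorphisms]
    [P.IsClosedUnderLimitsOfShape (Discrete ℕ)] [HasLimitsOfShape (Discrete ℕ) C]
    [HasExactLimitsOfShape (Discrete ℕ) C]
    (hP : ∀ F, R F → P ((minusSingle 0).obj F)) {X : Minus C} (hX : homologyProp R X) : P X := by
  obtain ⟨n, hn⟩ := exists_isLE X
  let Y (i : ℕ) : Minus C := minusTruncLT (-i) X
  have hY (i : ℕ) : IsLE (Y i).obj n :=
    inferInstanceAs (t.IsLE ((t.truncLT (-i : ℤ)).obj X.obj) n)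
  obtain ⟨Z, π, _, ⟨hπ⟩⟩ := hasProduct_minus Y n hY
  obtain ⟨Z₀, π₀, _, ⟨hπ₀⟩⟩ := hasProduct_minus (fun _ : ℕ => X) n fun _ => hn
  let s (i : ℕ) : Y (i + 1) ⟶ Y i := ObjectProperty.homMk
    ((t.natTransTruncLTOfLE (-(i + 1 : ℕ) : ℤ) (-i) (by lia)).app X.obj)
  refine prop_of_prod_telescope P s (fun i => minusTruncLTι (-i) X) (fun i => ?_) (fun i => ?_)
    (.of_isLimit hπ) (.of_isLimit hπ₀) fun a ha => ?_
  · ext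
    exact t.natTransTruncLTOfLE_ι_app _ _ (by lia) _
  · obtain ⟨h, hT⟩ := exists_minusTrunc_distinguished (-i : ℤ) X
    exact ObjectProperty.trW.mk P hT (prop_of_minusPlus R P hP (homologyProp_minusTruncGE R hX _)
      ⟨-i, inferInstanceAs (t.IsGE ((t.truncGE (-i : ℤ)).obj X.obj) (-i))⟩)
  · refine isIso_of_prod_telescope (shiftedProjectives C) isZero_of_shiftedProjectives s
      (fun A hA => ?_) (.of_isLimit hπ) a ha
    obtain ⟨j, F, hF, ⟨e⟩⟩ := hA
    -- From this index on `-i ≤ j`, so the truncation `τ^{< -i} X` has no cohomology in degree `j`.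
    refine ⟨(-j).toNat, fun i hi f => ?_⟩
    rw [← cancel_epi e.hom, comp_zero]
    ext
    refine eq_zero_of_homology_map_eq_zero _ (IsZero.eq_of_tgt ?_ _ _)
    exact isZero_of_isLE ((t.truncLT (-i : ℤ)).obj X.obj) (-i - 1) j (by lia)

end Products

end Minus

end WittMotives

namespace WittMotives

open Limits Opposite

/-! ### Exactness, Yoneda and projectives for presheaves with Witt transfers -/

namespace PreWtr

variable {k : Type u} [Field k]

/-- The inclusion of `PreWtr k` in the category of functors. -/
noncomputable abbrev toFunctor : PreWtr k ⥤ ((WCor k)ᵒᵖ ⥤ AddCommGrpCat.{u + 1}) :=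
  ObjectProperty.ι _

instance : PreservesFiniteLimits (toFunctor (k := k)) := ⟨fun _ _ _ => inferInstance⟩
instance : PreservesFiniteColimits (toFunctor (k := k)) := ⟨fun _ _ _ => inferInstance⟩

/-- Exactness is tested after the inclusion in the category of all functors, where it is pointwise
and comes from abelian groups. -/
instance (J : Type (u + 1)) : HasExactColimitsOfShape (Discrete J) (PreWtr k) :=
  .domain_of_functor _ toFunctor

instance (J : Type (u + 1)) : HasExactLimitsOfShape (Discrete J) (PreWtr k) :=
  .domain_of_functor _ toFunctor

/-- Countable families are indexed by the large natural numbers. -/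
def discreteULiftEquiv : Discrete (ULift.{u + 1} ℕ) ≌ Discrete ℕ := Discrete.equivalence Equiv.ulift

instance : HasLimitsOfShape (Discrete ℕ) (PreWtr k) :=
  have : HasLimitsOfShape (Discrete (ULift.{u + 1, 0} ℕ)) (PreWtr k) :=
    (inferInstance : ∀ J : Type (u + 1), HasLimitsOfShape (Discrete J) (PreWtr k)) _
  hasLimitsOfShape_of_equivalence discreteULiftEquiv.{u}

instance : HasExactColimitsOfShape (Discrete ℕ) (PreWtr k) :=
  HasExactColimitsOfShape.of_domain_equivalence _ discreteULiftEquiv.{u}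

instance : HasExactLimitsOfShape (Discrete ℕ) (PreWtr k) :=
  have : HasLimitsOfShape (Discrete (ULift.{u + 1, 0} ℕ)) (PreWtr k) :=
    (inferInstance : ∀ J : Type (u + 1), HasLimitsOfShape (Discrete J) (PreWtr k)) _
  HasExactLimitsOfShape.of_domain_equivalence _ discreteULiftEquiv.{u}

/-- The value of a presheaf at `X`. -/
noncomputable abbrev ev (X : WCor k) : PreWtr k ⥤ AddCommGrpCat.{u + 1} :=
  toFunctor ⋙ (evaluation _ _).obj (op X)

instance (X : WCor k) : (ev X).Additive where
  map_add := rfl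

instance (X : WCor k) : PreservesFiniteLimits (ev X) := inferInstance
instance (X : WCor k) : PreservesFiniteColimits (ev X) := inferInstance

theorem epi_iff_ev {F G : PreWtr k} (f : F ⟶ G) : Epi f ↔ ∀ X, Function.Surjective ((ev X).map f) := by
  simp only [← AddCommGrpCat.epi_iff_surjective]
  refine ⟨fun _ _ => inferInstance, fun h => ?_⟩
  have (X : (WCor k)ᵒᵖ) : Epi ((toFunctor.map f).app X) := h X.unop
  have := NatTrans.epi_of_epi_app (toFunctor.map f)
  exact (toFunctor (k := k)).epi_of_epi_map this

theorem hom_ext {F G : PreWtr k} {f g : F ⟶ G} (h : ∀ X, (ev X).map f = (ev X).map g) : f = g := by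
  ext X : 3
  exact h X.unop

/-- Yoneda: morphisms from a representable presheaf. -/
noncomputable def fromRepr {X : WCor k} {F : PreWtr k} (a : F.obj.obj (op X)) :
    representable.obj X ⟶ F :=
  ObjectProperty.homMk
    { app Y := AddCommGrpCat.ofHom (Y := F.obj.obj Y)
        { toFun := fun f : Y.unop ⟶ X => F.obj.map f.op a
          map_zero' := by
            have := F.property
            change F.obj.map (0 : op X ⟶ Y) a = 0
            rw [Functor.map_zero]; rfl
          map_add' := fun f g => by
            have := F.property
            change F.obj.map (f.op + g.op) a = _
            rw [Functor.map_add]; rfl }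
      naturality Y Z g := by
        ext f
        exact ConcreteCategory.congr_hom (F.obj.map_comp (f : Y.unop ⟶ X).op g) a }

theorem fromRepr_id {X : WCor k} {F : PreWtr k} (a : F.obj.obj (op X)) :
    (ev X).map (fromRepr a) (𝟙 X) = a :=
  ConcreteCategory.congr_hom (F.obj.map_id (op X)) a

theorem repr_hom_ext {X : WCor k} {F : PreWtr k} {f g : representable.obj X ⟶ F}
    (h : (ev X).map f (𝟙 X) = (ev X).map g (𝟙 X)) : f = g := by
  refine hom_ext fun Y => ?_
  ext (a : Y ⟶ X)
  have key (f : representable.obj X ⟶ F) :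
      (ev Y).map f a = F.obj.map a.op ((ev X).map f (𝟙 X)) := by
    have := ConcreteCategory.congr_hom (f.hom.naturality a.op) (𝟙 X)
    refine Eq.trans ?_ this
    exact congrArg ((ev Y).map f) (Category.comp_id a).symm
  rw [key, key, h]

/-- Morphisms from `ℤ(X)` are sections over `X`, and epimorphisms of presheaves are surjective on
sections. -/
instance (X : WCor k) : Projective (representable.obj X) where
  factors {E F} f e he := by
    obtain ⟨a, ha⟩ := (epi_iff_ev e).1 he X ((ev X).map f (𝟙 X))
    refine ⟨fromRepr a, repr_hom_ext ?_⟩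
    rw [(ev X).map_comp]
    exact (congrArg _ (fromRepr_id a)).trans ha

instance : EnoughProjectives (PreWtr k) where
  presentation F := by
    -- One copy of `ℤ(X)` for each section over `X`.
    let J := Σ X : WCor k, F.obj.obj (op X)
    let p : (∐ fun j : J => representable.obj j.1) ⟶ F := Sigma.desc fun j => fromRepr j.2
    suffices Epi p from ⟨⟨∐ fun j : J => representable.obj j.1, p⟩⟩
    rw [epi_iff_ev]
    intro X a
    let i : representable.obj X ⟶ ∐ fun j : J => representable.obj j.1 :=
      Sigma.ι (fun j : J => representable.obj j.1) ⟨X, a⟩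
    have h : i ≫ p = fromRepr a := Sigma.ι_desc _ _
    refine ⟨(ev X).map i (𝟙 X), ?_⟩
    exact (congrArg (fun t : representable.obj X ⟶ F => (ev X).map t (𝟙 X)) h).trans (fromRepr_id a)

end PreWtr
end WittMotives

namespace WittMotives

open Limits Opposite TensorProduct

variable {k : Type u} [Field k]

/-! ### Products of affine schemes and functions on them -/

namespace SmAlg

/-- The first coprojection. -/
noncomputable def inl (A D : SmAlg k) : A ⟶ A.tensor D :=
  (Algebra.TensorProduct.includeLeft : A →ₐ[k] A ⊗[k] D)

/-- The second coprojection. -/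
noncomputable def inr (A D : SmAlg k) : D ⟶ A.tensor D :=
  (Algebra.TensorProduct.includeRight : D →ₐ[k] A ⊗[k] D)

/-- The universal property of the tensor product. -/
noncomputable def desc {A D E : SmAlg k} (f : A ⟶ E) (g : D ⟶ E) : A.tensor D ⟶ E :=
  Algebra.TensorProduct.lift (A := A) (B := D) (C := E) (S := k) f g fun _ _ => Commute.all _ _

@[simp]
theorem inl_desc {A D E : SmAlg k} (f : A ⟶ E) (g : D ⟶ E) : inl A D ≫ desc f g = f :=
  Algebra.TensorProduct.lift_comp_includeLeft (A := A) (B := D) (C := E) (S := k) f g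
    fun _ _ => Commute.all _ _

@[simp]
theorem inr_desc {A D E : SmAlg k} (f : A ⟶ E) (g : D ⟶ E) : inr A D ≫ desc f g = g :=
  Algebra.TensorProduct.lift_comp_includeRight (A := A) (B := D) (C := E) (S := k) f g
    fun _ _ => Commute.all _ _

@[simp]
theorem inl_desc_assoc {A D E F : SmAlg k} (f : A ⟶ E) (g : D ⟶ E) (h : E ⟶ F) :
    inl A D ≫ desc f g ≫ h = f ≫ h := by
  rw [← Category.assoc, inl_desc]

@[simp]
theorem inr_desc_assoc {A D E F : SmAlg k} (f : A ⟶ E) (g : D ⟶ E) (h : E ⟶ F) :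
    inr A D ≫ desc f g ≫ h = g ≫ h := by
  rw [← Category.assoc, inr_desc]

theorem coprod_hom_ext {A D E : SmAlg k} {f g : A.tensor D ⟶ E} (h₁ : inl A D ≫ f = inl A D ≫ g)
    (h₂ : inr A D ≫ f = inr A D ≫ g) : f = g :=
  Algebra.TensorProduct.ext (S := k) (A := A) (B := D) (C := E) h₁ h₂

/-- The functoriality of the tensor product. -/
noncomputable def tensorMap {A B D E : SmAlg k} (f : A ⟶ B) (g : D ⟶ E) :
    A.tensor D ⟶ B.tensor E :=
  (Algebra.TensorProduct.map f g : A ⊗[k] D →ₐ[k] B ⊗[k] E)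

theorem tensorMap_eq {A B D E : SmAlg k} (f : A ⟶ B) (g : D ⟶ E) :
    tensorMap f g = desc (f ≫ inl B E) (g ≫ inr B E) := by
  apply coprod_hom_ext
  · rw [inl_desc]
    exact Algebra.TensorProduct.map_comp_includeLeft (S := k) f g
  · rw [inr_desc]
    exact Algebra.TensorProduct.map_comp_includeRight f g

/-- The homomorphism of algebras given by a morphism. -/
def toAlgHom {A B : SmAlg k} (f : A ⟶ B) : A →ₐ[k] B := f

/-- The structure morphism of an algebra. -/
def unit (A : SmAlg k) : point k ⟶ A := Algebra.ofId k A

theorem point_hom_ext {A : SmAlg k} (f g : point k ⟶ A) : f = g :=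
  Subsingleton.elim (α := k →ₐ[k] A) f g

/-- The morphism from the algebra of the affine line given by an element. -/
noncomputable def ofElem {A : SmAlg k} (a : A) : affineLine k ⟶ A :=
  (Polynomial.aeval a : Polynomial k →ₐ[k] A)

/-- The coordinate of the affine line. -/
noncomputable def coord (k : Type u) [Field k] : affineLine k := (Polynomial.X : Polynomial k)

@[simp] theorem toAlgHom_ofElem {A : SmAlg k} (a : A) : toAlgHom (ofElem a) (coord k) = a :=
  Polynomial.aeval_X a

theorem ofElem_comp {A B : SmAlg k} (a : A) (f : A ⟶ B) :
    ofElem a ≫ f = ofElem (toAlgHom f a) :=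
  Polynomial.algHom_ext (R := k) (B := B) (f := toAlgHom (ofElem a ≫ f))
    (g := Polynomial.aeval (toAlgHom f a))
    ((congrArg (toAlgHom f) (Polynomial.aeval_X a)).trans (Polynomial.aeval_X _).symm)

theorem ofElem_eq {A : SmAlg k} (f : affineLine k ⟶ A) : f = ofElem (toAlgHom f (coord k)) :=
  Polynomial.algHom_ext (R := k) (B := A) (Polynomial.aeval_X _).symm

theorem affineLinePoint_unit (c : k) (A : SmAlg k) :
    affineLinePoint k c ≫ unit A = ofElem (algebraMap k A c) :=
  Polynomial.algHom_ext (R := k) (B := A) (f := toAlgHom (affineLinePoint k c ≫ unit A))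
    (g := Polynomial.aeval (algebraMap k A c))
    ((congrArg (algebraMap k A) (Polynomial.aeval_X c)).trans (Polynomial.aeval_X _).symm)

end SmAlg

/-! ### Product correspondences as graphs -/

namespace WCor

open SmAlg

/-- Expressing the structural correspondences as graphs of morphisms `desc f g` reduces identities
between them to identities of algebra homomorphisms, checked on the two coprojections. -/
theorem prodMap_app {D E : SmAlg k} (f : D ⟶ E) (A : SmAlg k) :
    (prodMap f).app ⟨A⟩ = graph (desc (inl A E) (f ≫ inr A E)) :=
  congrArg graph ((tensorMap_eq (𝟙 A) f).trans (by rw [Category.id_comp]))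

theorem prod_map_graph {A B : SmAlg k} (f : A ⟶ B) (D : SmAlg k) :
    (prod D).map (graph f) = graph (desc (f ≫ inl B D) (inr B D)) :=
  (WittGroup.baseChange_graph f D).trans
    (congrArg graph ((tensorMap_eq f (𝟙 D)).trans (by rw [Category.id_comp])))

theorem sec_app (D : SmAlg k) (x : D ⟶ point k) (A : SmAlg k) :
    (sec D x).app ⟨A⟩ = graph (desc (𝟙 A) (x ≫ unit A)) := by
  let i : (⟨A⟩ : WCor k) ⟶ ⟨A.tensor (point k)⟩ := (prodPointIso k).inv.app ⟨A⟩
  have h : i = graph (desc (𝟙 A) (unit A)) := by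
    have h1 : i ≫ graph (inl A (point k)) = 𝟙 _ := (prodPointIso k).inv_hom_id_app ⟨A⟩
    have h2 : graph (inl A (point k)) ≫ i = 𝟙 _ := (prodPointIso k).hom_inv_id_app ⟨A⟩
    -- The inverse `i` of the projection from `X × pt` is identified by uniqueness: the graph built
    -- from the unit is another section of that projection.
    rw [← Category.comp_id (graph _), ← h2, ← Category.assoc, ← graph_comp, inl_desc, graph_id,
      Category.id_comp]
  refine (congrArg (· ≫ (prodMap x).app ⟨A⟩) h).trans ((congrArg (_ ≫ ·) (prodMap_app x A)).trans
    ((graph_comp _ _).symm.trans (congrArg graph ?_)))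
  refine coprod_hom_ext ?_ ?_ <;> simp

theorem sec_proj_app (D : SmAlg k) (x : D ⟶ point k) (X : WCor k) :
    (sec D x).app X ≫ (proj D).app X = 𝟙 X := by
  refine (congrArg (· ≫ (proj D).app X) (sec_app D x X.alg)).trans ?_
  refine (graph_comp (inl X.alg D) _).symm.trans ?_
  rw [inl_desc]
  rfl

end WCor

end WittMotives

namespace WittMotives

open Limits Opposite

variable {k : Type u} [Field k]

/-! ### Homotopy invariance and the quotients `ℤ(𝔸¹ × X) / ℤ(X)` -/

namespace PreWtr

theorem shiftProj_shiftSec_app (D : SmAlg k) (x : D ⟶ SmAlg.point k) (F : PreWtr k) :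
    (shiftProj D).app F ≫ (shiftSec D x).app F = 𝟙 F := by
  refine hom_ext fun X => ?_
  refine (F.obj.map_comp _ _).symm.trans ?_
  refine (congrArg (fun f => F.obj.map f) (congrArg Quiver.Hom.op (WCor.sec_proj_app D x X))).trans ?_
  exact F.obj.map_id _

theorem mono_iff_ev {F G : PreWtr k} (f : F ⟶ G) :
    Mono f ↔ ∀ X, Function.Injective ((ev X).map f) := by
  simp only [← AddCommGrpCat.mono_iff_injective]
  refine ⟨fun _ _ => inferInstance, fun h => ?_⟩
  have (X : (WCor k)ᵒᵖ) : Mono ((toFunctor.map f).app X) := h X.unop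
  have := NatTrans.mono_of_mono_app (toFunctor.map f)
  exact (toFunctor (k := k)).mono_of_mono_map this

/-- The zero section is always a retraction of the projection `p`, so `p` is invertible as soon as
this retraction is a monomorphism. -/
theorem isHomotopyInvariant_iff_mono (F : PreWtr k) : IsHomotopyInvariant F ↔
    Mono ((shiftSec (affineLine k) (affineLinePoint k 0)).app F) := by
  have h := shiftProj_shiftSec_app (affineLine k) (affineLinePoint k 0) F
  refine ⟨fun hF => ?_, fun _ => ?_⟩
  · rw [IsHomotopyInvariant] at hF
    have : (shiftSec (affineLine k) (affineLinePoint k 0)).app F =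
        inv ((shiftProj (affineLine k)).app F) := by
      rw [← cancel_epi ((shiftProj (affineLine k)).app F), h]
      exact (IsIso.hom_inv_id _).symm
    rw [this]
    infer_instance
  · refine ⟨(shiftSec (affineLine k) (affineLinePoint k 0)).app F, h, ?_⟩
    rw [← cancel_mono ((shiftSec (affineLine k) (affineLinePoint k 0)).app F), Category.assoc, h]
    exact (Category.comp_id _).trans (Category.id_comp _).symm

theorem map_fromRepr {X Y : WCor k} {F : PreWtr k} (a : F.obj.obj (op X)) (f : Y ⟶ X) :
    representable.map f ≫ fromRepr a = fromRepr (F.obj.map f.op a) := by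
  refine repr_hom_ext ?_
  refine Eq.trans ?_ (fromRepr_id (F.obj.map f.op a)).symm
  exact congrArg (fun f : Y ⟶ X => F.obj.map f.op a) (Category.id_comp f)

theorem fromRepr_injective {X : WCor k} {F : PreWtr k} {a b : F.obj.obj (op X)}
    (h : fromRepr a = fromRepr b) : a = b := by
  rw [← fromRepr_id a, h]
  exact fromRepr_id b

theorem exists_eq_fromRepr {X : WCor k} {F : PreWtr k} (f : representable.obj X ⟶ F) :
    ∃ a, f = fromRepr a :=
  ⟨(ev X).map f (𝟙 X), repr_hom_ext (fromRepr_id _).symm⟩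

theorem fromRepr_zero {X : WCor k} {F : PreWtr k} : (fromRepr 0 : representable.obj X ⟶ F) = 0 := by
  obtain ⟨a, ha⟩ := exists_eq_fromRepr (0 : representable.obj X ⟶ F)
  have : a = 0 := (fromRepr_id a).symm.trans
    (congrArg (fun f : representable.obj X ⟶ F => (ev X).map f (𝟙 X)) ha.symm)
  rw [ha, this]

end PreWtr

open PreWtr

/-- The zero section, as a morphism of representable presheaves. -/
noncomputable def reprSec (X : WCor k) :
    representable.obj X ⟶ representable.obj ((WCor.prod (affineLine k)).obj X) :=
  representable.map ((WCor.sec (affineLine k) (affineLinePoint k 0)).app X)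

/-- The projection to the quotient by the zero section. -/
noncomputable def reprQuotientπ (X : WCor k) :
    representable.obj ((WCor.prod (affineLine k)).obj X) ⟶ reprQuotient X :=
  cokernel.π (reprSec X)

instance (X : WCor k) : Epi (reprQuotientπ X) := inferInstanceAs (Epi (cokernel.π (reprSec X)))

theorem reprSec_reprQuotientπ (X : WCor k) : reprSec X ≫ reprQuotientπ X = 0 :=
  cokernel.condition (reprSec X)

theorem exists_reprQuotient_desc {X : WCor k} {F : PreWtr k}
    (f : representable.obj ((WCor.prod (affineLine k)).obj X) ⟶ F) (h : reprSec X ≫ f = 0) :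
    ∃ g : reprQuotient X ⟶ F, reprQuotientπ X ≫ g = f :=
  ⟨cokernel.desc (reprSec X) f h, cokernel.π_desc (reprSec X) f h⟩

/-- A morphism from the quotient is a section over `X × 𝔸¹` that vanishes on the zero section, and
by `isHomotopyInvariant_iff_mono` homotopy invariance forbids nonzero ones. This turns homotopy
invariance into the orthogonality condition required by the generation results. -/
theorem homZero_reprQuotient_iff (F : PreWtr k) :
    homZero (reprQuotient (k := k)) F ↔ IsHomotopyInvariant F := by
  rw [isHomotopyInvariant_iff_mono, mono_iff_ev]
  simp only [injective_iff_map_eq_zero]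
  refine ⟨fun h X a ha => ?_, fun h X f => ?_⟩
  · obtain ⟨g, hg⟩ := exists_reprQuotient_desc (F := F) (fromRepr a)
      ((map_fromRepr _ _).trans ((congrArg fromRepr ha).trans fromRepr_zero))
    rw [h X g, comp_zero] at hg
    exact fromRepr_injective (hg.symm.trans fromRepr_zero.symm)
  · obtain ⟨a, ha⟩ := exists_eq_fromRepr (reprQuotientπ X ≫ f)
    have h₀ : fromRepr _ = fromRepr 0 := (map_fromRepr a
      ((WCor.sec (affineLine k) (affineLinePoint k 0)).app X)).symm.trans
        ((congrArg (_ ≫ ·) ha.symm).trans (((Category.assoc _ _ _).symm.trans (congrArg (· ≫ f) (reprSec_reprQuotientπ X))).trans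
          (zero_comp.trans fromRepr_zero.symm)))
    have ha₀ : a = 0 := h X a (fromRepr_injective h₀)
    rw [← cancel_epi (reprQuotientπ X), ha, ha₀, comp_zero]
    exact fromRepr_zero

instance (X : WCor k) : Projective (reprQuotient X) := by
  let p : representable.obj ((WCor.prod (affineLine k)).obj X) ⟶ representable.obj X :=
    representable.map ((WCor.proj (affineLine k)).app X)
  have hsp : reprSec X ≫ p = 𝟙 _ := by
    refine (representable.map_comp _ _).symm.trans ((congrArg _ (WCor.sec_proj_app _ _ X)).trans ?_)
    exact representable.map_id X
  -- The projection splits the zero section, so this idempotent vanishes on `ℤ(X)` and exhibits the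
  -- quotient as a direct summand of `ℤ(𝔸¹ × X)`.
  obtain ⟨i, hi⟩ := exists_reprQuotient_desc (𝟙 _ - p ≫ reprSec X) (by
    rw [Preadditive.comp_sub, ← Category.assoc, hsp, Category.comp_id, Category.id_comp, sub_self])
  refine Retract.projective (Y := representable.obj ((WCor.prod (affineLine k)).obj X))
    ⟨i, reprQuotientπ X, ?_⟩
  rw [← cancel_epi (reprQuotientπ X), ← Category.assoc, hi, Preadditive.sub_comp, Category.assoc,
    reprSec_reprQuotientπ, comp_zero, sub_zero, Category.id_comp, Category.comp_id]

/-- The homotopy `𝔸¹ × 𝔸¹ ⟶ 𝔸¹`, `(x, t) ↦ x (1 - t)`, relative to `A`. -/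
noncomputable def SmAlg.contract (A : SmAlg k) :
    A.tensor (affineLine k) ⟶ (A.tensor (affineLine k)).tensor (affineLine k) :=
  SmAlg.desc (SmAlg.inl _ _ ≫ SmAlg.inl _ _) (SmAlg.ofElem
    (A := (A.tensor (affineLine k)).tensor (affineLine k))
    (SmAlg.toAlgHom (SmAlg.inr _ _ ≫ SmAlg.inl _ _) (SmAlg.coord k) *
      (1 - SmAlg.toAlgHom (SmAlg.inr _ _) (SmAlg.coord k))))

theorem SmAlg.toAlgHom_comp {A B D : SmAlg k} (f : A ⟶ B) (g : B ⟶ D) (a : A) :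
    SmAlg.toAlgHom (f ≫ g) a = SmAlg.toAlgHom g (SmAlg.toAlgHom f a) := rfl

theorem SmAlg.contract_zero (A : SmAlg k) : SmAlg.contract A ≫
    SmAlg.desc (𝟙 _) (affineLinePoint k 0 ≫ SmAlg.unit _) = 𝟙 _ := by
  refine SmAlg.coprod_hom_ext (by simp [contract]) ?_
  rw [SmAlg.contract, SmAlg.affineLinePoint_unit, SmAlg.inr_desc_assoc, SmAlg.ofElem_comp,
    Category.comp_id]
  refine Eq.trans (congrArg SmAlg.ofElem ?_) (SmAlg.ofElem_eq _).symm
  rw [map_mul, map_sub, map_one, ← SmAlg.toAlgHom_comp, ← SmAlg.toAlgHom_comp, Category.assoc,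
    SmAlg.inl_desc, SmAlg.inr_desc, SmAlg.toAlgHom_ofElem, map_zero,
    sub_zero, mul_one, Category.comp_id]

theorem SmAlg.contract_one (A : SmAlg k) : SmAlg.contract A ≫
    SmAlg.desc (𝟙 _) (affineLinePoint k 1 ≫ SmAlg.unit _) =
      SmAlg.desc (𝟙 _) (affineLinePoint k 0 ≫ SmAlg.unit _) ≫ SmAlg.inl _ _ := by
  refine SmAlg.coprod_hom_ext (by simp [contract]) ?_
  rw [SmAlg.contract, SmAlg.affineLinePoint_unit, SmAlg.affineLinePoint_unit, SmAlg.inr_desc_assoc,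
    SmAlg.ofElem_comp, SmAlg.inr_desc_assoc, SmAlg.ofElem_comp]
  refine congrArg SmAlg.ofElem ?_
  rw [map_mul, map_sub, map_one, ← SmAlg.toAlgHom_comp, ← SmAlg.toAlgHom_comp,
    SmAlg.inr_desc, SmAlg.toAlgHom_ofElem, map_one, sub_self, mul_zero, map_zero, map_zero]

/-- The homotopy leaves the zero section in place at every time, which is what lets it pass to the
quotient by `ℤ(X)`. -/
theorem SmAlg.sec_contract (A : SmAlg k) : SmAlg.contract A ≫
    SmAlg.desc (SmAlg.desc (𝟙 _) (affineLinePoint k 0 ≫ SmAlg.unit _) ≫ SmAlg.inl _ _)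
      (SmAlg.inr _ _) =
      SmAlg.desc (𝟙 _) (affineLinePoint k 0 ≫ SmAlg.unit _) ≫ SmAlg.inl _ _ := by
  refine SmAlg.coprod_hom_ext (by simp [contract]) ?_
  rw [SmAlg.contract, SmAlg.affineLinePoint_unit, SmAlg.inr_desc_assoc, SmAlg.ofElem_comp,
    SmAlg.inr_desc_assoc, SmAlg.ofElem_comp]
  refine congrArg SmAlg.ofElem ?_
  rw [map_mul, ← SmAlg.toAlgHom_comp, Category.assoc,
    SmAlg.inl_desc, SmAlg.inr_desc_assoc, SmAlg.ofElem_comp,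
    SmAlg.toAlgHom_ofElem, map_zero, map_zero, zero_mul]

/-- The universal section `q` of the quotient is pulled back along `(x, t) ↦ x (1 - t)`. At `t = 0`
it is unchanged; at `t = 1` it factors through the zero section, where the quotient map vanishes. -/
theorem isContractible_reprQuotient (X : WCor k) : IsContractible (reprQuotient X) := by
  obtain ⟨A⟩ := X
  let Y : WCor k := ⟨A.tensor (affineLine k)⟩
  let Y' : WCor k := ⟨(A.tensor (affineLine k)).tensor (affineLine k)⟩
  let Q := reprQuotient (⟨A⟩ : WCor k)
  let π : representable.obj Y ⟶ Q := reprQuotientπ ⟨A⟩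
  let m : Y' ⟶ Y := WCor.graph (SmAlg.contract A)
  let q : Q.obj.obj (op Y) := (ev Y).map π (𝟙 Y)
  have hq {Z : WCor k} (f : Z ⟶ Y) : Q.obj.map f.op q = (ev Z).map π f :=
    (ConcreteCategory.congr_hom (π.hom.naturality f.op) (𝟙 Y)).symm.trans
      (congrArg ((ev Z).map π) (Category.comp_id f))
  have hq₀ {Z : WCor k} (f : Z ⟶ ⟨A⟩) :
      Q.obj.map (f ≫ WCor.graph (SmAlg.desc (𝟙 A) (affineLinePoint k 0 ≫ SmAlg.unit A))).op q = 0 := by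
    rw [hq]
    have := congrArg (fun t : representable.obj ⟨A⟩ ⟶ Q => (ev Z).map t f)
      (reprSec_reprQuotientπ (k := k) ⟨A⟩)
    refine Eq.trans ?_ this
    exact congrArg (fun s => (ev Z).map π (f ≫ s)) (WCor.sec_app _ _ A).symm
  let F := (PreWtr.shift.obj (affineLine k)).obj Q
  let a : F.obj.obj (op Y) := Q.obj.map m.op q
  have ha {Z : WCor k} (f : Z ⟶ Y') : Q.obj.map f.op (Q.obj.map m.op q) = Q.obj.map (f ≫ m).op q :=
    (ConcreteCategory.congr_hom (Q.obj.map_comp m.op f.op) q).symm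
  -- On the zero section the pulled back section still factors through the zero section, so it
  -- vanishes and the morphism defined by `a` descends to the quotient.
  have h₀ : reprSec (⟨A⟩ : WCor k) ≫ (fromRepr a : representable.obj Y ⟶ F) = 0 := by
    refine (map_fromRepr a _).trans ((congrArg fromRepr ?_).trans fromRepr_zero)
    refine (ha _).trans (Eq.trans ?_ (hq₀ (WCor.graph (SmAlg.inl A (affineLine k)))))
    refine congrArg (fun t : (⟨A.tensor (affineLine k)⟩ : WCor k) ⟶ Y => Q.obj.map t.op q) ?_
    refine (congrArg (fun t => (WCor.prod (affineLine k)).map t ≫ m) (WCor.sec_app _ _ A)).trans ?_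
    refine (congrArg (· ≫ m) (WCor.prod_map_graph _ _)).trans ((WCor.graph_comp _ _).symm.trans ?_)
    exact (congrArg WCor.graph (SmAlg.sec_contract A)).trans (WCor.graph_comp _ _)
  obtain ⟨h, hh⟩ := exists_reprQuotient_desc _ h₀
  have key (c : k) : reprQuotientπ ⟨A⟩ ≫ h ≫ (shiftSec (affineLine k) (affineLinePoint k c)).app Q =
      fromRepr (Q.obj.map (WCor.graph (SmAlg.contract A ≫
        SmAlg.desc (𝟙 _) (affineLinePoint k c ≫ SmAlg.unit _))).op q) := by
    rw [← Category.assoc, hh]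
    refine repr_hom_ext (Eq.trans ?_ (fromRepr_id _).symm)
    refine (congrArg ((ev Y).map ((shiftSec (affineLine k) (affineLinePoint k c)).app Q))
      (fromRepr_id a)).trans ((ha _).trans ?_)
    refine congrArg (fun t : Y ⟶ Y => Q.obj.map t.op q) ?_
    refine (congrArg (· ≫ m) (WCor.sec_app _ _ _)).trans (WCor.graph_comp _ _).symm
  refine ⟨h, ?_, ?_⟩ <;> rw [← cancel_epi (reprQuotientπ _), key]
  · rw [SmAlg.contract_zero]
    refine Eq.trans ?_ (Category.comp_id _).symm
    refine repr_hom_ext ((fromRepr_id _).trans ?_)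
    exact (hq _)
  · rw [SmAlg.contract_one, WCor.graph_comp, comp_zero]
    exact (congrArg fromRepr (hq₀ _)).trans fromRepr_zero

end WittMotives

/-! ### Total complexes and induction on the top term -/

namespace WittMotives

open Limits HomologicalComplex

variable {C : Type u} [Category.{v} C] [Abelian C]

/-- The class of degreewise split short complexes of complexes. -/
def DegreewiseSplit {ι : Type*} {c : ComplexShape ι} (S : ShortComplex (HomologicalComplex C c)) :
    Prop := ∀ i, Nonempty (S.map (eval C c i)).Splitting

theorem DegreewiseSplit.shortExact {ι : Type*} {c : ComplexShape ι}
    {S : ShortComplex (HomologicalComplex C c)} (h : DegreewiseSplit S) : S.ShortExact :=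
  shortExact_of_degreewise_shortExact S fun i => (h i).some.shortExact

/-- A bounded above complex is an extension of a complex with a smaller bound by its top term. -/
theorem exists_degreewiseSplit_top (K : CochainComplex C ℤ) (b : ℤ) [K.IsStrictlyLE b] :
    ∃ (L : CochainComplex C ℤ) (f : (single C (ComplexShape.up ℤ) b).obj (K.X b) ⟶ K) (g : K ⟶ L)
      (w : f ≫ g = 0), L.IsStrictlyLE (b - 1) ∧ DegreewiseSplit (ShortComplex.mk f g w) := by
  have hK (i : ℤ) (hi : b < i) : IsZero (K.X i) := K.isZero_of_isStrictlyLE b i hi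
  let f : (single C (ComplexShape.up ℤ) b).obj (K.X b) ⟶ K := mkHomFromSingle (𝟙 _) fun i hi =>
    (hK i (by simp at hi; lia)).eq_of_tgt _ _
  have hfb : IsIso (f.f b) := by
    rw [mkHomFromSingle_f]
    infer_instance
  -- In degree `b` the inclusion of the top term is an isomorphism, and elsewhere its source is
  -- zero.
  have hr (i : ℤ) : ∃ r, f.f i ≫ r = 𝟙 _ := by
    by_cases hi : i = b
    · subst hi
      exact ⟨inv (f.f i), by simp⟩
    · exact ⟨0, (isZero_single_obj_X _ _ _ _ hi).eq_of_src _ _⟩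
  have (i : ℤ) : Mono (f.f i) := by
    obtain ⟨r, hr⟩ := hr i
    exact mono_of_mono_fac hr
  have : Mono f := mono_of_mono_f f this
  have hS : (ShortComplex.mk f (cokernel.π f) (cokernel.condition f)).ShortExact :=
    { exact := ShortComplex.exact_of_g_is_cokernel _ (cokernelIsCokernel f) }
  have hSi := (shortExact_iff_degreewise_shortExact _).1 hS
  refine ⟨cokernel f, f, cokernel.π f, cokernel.condition f, ?_, fun i => ?_⟩
  · rw [CochainComplex.isStrictlyLE_iff]
    intro i hi
    have hepi : Epi ((cokernel.π f).f i) := (hSi i).epi_g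
    rw [IsZero.iff_id_eq_zero, ← cancel_epi ((cokernel.π f).f i), comp_zero, Category.comp_id]
    by_cases h : i = b
    · subst h
      rw [← cancel_epi (f.f i), comp_zero, ← comp_f, cokernel.condition]
      rfl
    · exact (hK i (by lia)).eq_of_src _ _
  · obtain ⟨r, hr⟩ := hr i
    have := (hSi i).epi_g
    exact ⟨ShortComplex.Splitting.ofExactOfRetraction _ (hSi i).exact r hr this⟩

variable [∀ K : HomologicalComplex₂ C (ComplexShape.up ℤ) (ComplexShape.up ℤ),
  K.HasTotal (ComplexShape.up ℤ)]

instance : (HomologicalComplex₂.totalFunctor C (ComplexShape.up ℤ) (ComplexShape.up ℤ)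
    (ComplexShape.up ℤ)).PreservesZeroMorphisms where
  map_zero K L := by
    ext n : 1
    refine HomologicalComplex₂.total.hom_ext _ fun p q hpq => ?_
    exact (HomologicalComplex₂.ιTotal_map _ _ _ _ _ _ _ hpq).trans (zero_comp.trans comp_zero.symm)

/-- A degreewise split short complex of bicomplexes induces a degreewise split short complex of
total complexes. -/
theorem degreewiseSplit_total
    (S : ShortComplex (HomologicalComplex₂ C (ComplexShape.up ℤ) (ComplexShape.up ℤ)))
    (h : ∀ p, DegreewiseSplit (S.map (eval _ _ p))) :
    DegreewiseSplit (S.map (HomologicalComplex₂.totalFunctor C (ComplexShape.up ℤ)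
      (ComplexShape.up ℤ) (ComplexShape.up ℤ))) := by
  intro n
  let s (p q : ℤ) := (h p q).some
  let r (p q : ℤ) : (S.X₂.X p).X q ⟶ (S.X₁.X p).X q := (s p q).r
  let t (p q : ℤ) : (S.X₃.X p).X q ⟶ (S.X₂.X p).X q := (s p q).s
  let r' : (S.X₂.total (ComplexShape.up ℤ)).X n ⟶ (S.X₁.total (ComplexShape.up ℤ)).X n :=
    HomologicalComplex₂.totalDesc _ fun p q hpq => r p q ≫ S.X₁.ιTotal _ p q n hpq
  let t' : (S.X₃.total (ComplexShape.up ℤ)).X n ⟶ (S.X₂.total (ComplexShape.up ℤ)).X n :=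
    HomologicalComplex₂.totalDesc _ fun p q hpq => t p q ≫ S.X₂.ιTotal _ p q n hpq
  have h₁ : (HomologicalComplex₂.total.map S.f (ComplexShape.up ℤ)).f n ≫ r' = 𝟙 _ := by
    refine HomologicalComplex₂.total.hom_ext _ fun p q hpq => ?_
    have : (S.f.f p).f q ≫ r p q = 𝟙 _ := (s p q).f_r
    rw [HomologicalComplex₂.ιTotal_map_assoc, HomologicalComplex₂.ι_totalDesc,
      reassoc_of% this, Category.comp_id]
  have h₂ : t' ≫ (HomologicalComplex₂.total.map S.g (ComplexShape.up ℤ)).f n = 𝟙 _ := by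
    refine HomologicalComplex₂.total.hom_ext _ fun p q hpq => ?_
    have : t p q ≫ (S.g.f p).f q = 𝟙 _ := (s p q).s_g
    rw [HomologicalComplex₂.ι_totalDesc_assoc, Category.assoc, HomologicalComplex₂.ιTotal_map,
      reassoc_of% this, Category.comp_id]
  have h₃ : r' ≫ (HomologicalComplex₂.total.map S.f (ComplexShape.up ℤ)).f n +
      (HomologicalComplex₂.total.map S.g (ComplexShape.up ℤ)).f n ≫ t' = 𝟙 _ := by
    refine HomologicalComplex₂.total.hom_ext _ fun p q hpq => ?_
    have : r p q ≫ (S.f.f p).f q + (S.g.f p).f q ≫ t p q = 𝟙 _ := (s p q).id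
    rw [Preadditive.comp_add, HomologicalComplex₂.ι_totalDesc_assoc, Category.assoc,
      HomologicalComplex₂.ιTotal_map, HomologicalComplex₂.ιTotal_map_assoc,
      HomologicalComplex₂.ι_totalDesc, ← Category.assoc, ← Category.assoc, ← Preadditive.add_comp,
      this, Category.comp_id, Category.id_comp]
  exact ⟨⟨r', t', h₁, h₂, h₃⟩⟩

section

variable (G : C ⥤ CochainComplex C ℤ) [G.Additive]

/-- The functor sending a complex `K` to the total complex of the bicomplex `G (K ^ p) ^ q`. -/
noncomputable def totalOf : CochainComplex C ℤ ⥤ CochainComplex C ℤ :=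
  G.mapHomologicalComplex (ComplexShape.up ℤ) ⋙ HomologicalComplex₂.totalFunctor C
    (ComplexShape.up ℤ) (ComplexShape.up ℤ) (ComplexShape.up ℤ)

instance : (totalOf G).PreservesZeroMorphisms := by
  unfold totalOf
  infer_instance

theorem degreewiseSplit_totalOf {S : ShortComplex (CochainComplex C ℤ)} (h : DegreewiseSplit S) :
    DegreewiseSplit (S.map (totalOf G)) :=
  degreewiseSplit_total (S.map (G.mapHomologicalComplex (ComplexShape.up ℤ)))
    fun p q => ⟨(h p).some.map (G ⋙ eval C (ComplexShape.up ℤ) q)⟩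

theorem isStrictlyLE_totalOf (hG : ∀ F, (G.obj F).IsStrictlyLE 0) (K : CochainComplex C ℤ) (n : ℤ)
    [K.IsStrictlyLE n] : ((totalOf G).obj K).IsStrictlyLE n := by
  rw [CochainComplex.isStrictlyLE_iff]
  intro i hi
  rw [IsZero.iff_id_eq_zero]
  refine HomologicalComplex₂.total.hom_ext _ fun p q hpq => ?_
  have hpq' : p + q = i := hpq
  refine IsZero.eq_of_src ?_ _ _
  by_cases hp : n < p
  · exact Functor.map_isZero (G ⋙ eval C (ComplexShape.up ℤ) q) (K.isZero_of_isStrictlyLE n p hp)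
  · exact (G.obj (K.X p)).isZero_of_isStrictlyLE 0 q (by lia)

/-- The value of `totalOf G` on a complex concentrated in one degree. -/
theorem nonempty_totalOf_single_iso (F : C) (b : ℤ) :
    Nonempty ((totalOf G).obj ((single C (ComplexShape.up ℤ) b).obj F) ≅ (G.obj F)⟦-b⟧) := by
  let M : HomologicalComplex₂ C (ComplexShape.up ℤ) (ComplexShape.up ℤ) :=
    (G.mapHomologicalComplex (ComplexShape.up ℤ)).obj ((single C (ComplexShape.up ℤ) b).obj F)
  let e : M.X b ≅ G.obj F := G.mapIso (singleObjXSelf (ComplexShape.up ℤ) b F)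
  have hM (p : ℤ) (hp : p ≠ b) (q : ℤ) : IsZero ((M.X p).X q) :=
    Functor.map_isZero (G ⋙ eval C (ComplexShape.up ℤ) q) (isZero_single_obj_X _ _ _ _ hp)
  let φ (n : ℤ) : (G.obj F).X (n + -b) ⟶ (M.total (ComplexShape.up ℤ)).X n :=
    e.inv.f (n + -b) ≫ M.ιTotal (ComplexShape.up ℤ) b (n + -b) n
      (show b + (n + -b) = n by lia)
  let ψ (n : ℤ) : (M.total (ComplexShape.up ℤ)).X n ⟶ (G.obj F).X (n + -b) :=
    HomologicalComplex₂.totalDesc _ fun p q hpq =>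
      if h : p = b then (M.XXIsoOfEq _ _ _ h (show q = n + -b by
        have : p + q = n := hpq
        lia)).hom ≫ e.hom.f (n + -b) else 0
  have h₁ (n : ℤ) : φ n ≫ ψ n = 𝟙 _ := by
    dsimp only [φ, ψ]
    rw [Category.assoc, HomologicalComplex₂.ι_totalDesc, dif_pos rfl]
    simp [← comp_f]
  have h₂ (n : ℤ) : ψ n ≫ φ n = 𝟙 _ := by
    refine HomologicalComplex₂.total.hom_ext _ fun p q hpq => ?_
    by_cases hp : p = b
    · subst hp
      obtain rfl : q = n + -p := by
        have : p + q = n := hpq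
        lia
      dsimp only [φ, ψ]
      rw [HomologicalComplex₂.ι_totalDesc_assoc, dif_pos rfl, Category.comp_id]
      simp [← comp_f_assoc]
    · exact (hM p hp q).eq_of_src _ _
  -- With a single nonzero column only the vertical differential survives. Its sign in the total
  -- complex is the parity of `b`, which agrees with the sign in the differential of the shift by
  -- `-b`.
  have h₃ (i j : ℤ) (hij : i + 1 = j) : φ i ≫ (M.total (ComplexShape.up ℤ)).d i j =
      ((-b).negOnePow • (G.obj F).d (i + -b) (j + -b)) ≫ φ j := by
    have h0 : M.d b (b + 1) = 0 := G.map_zero _ _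
    dsimp only [φ]
    rw [Category.assoc, HomologicalComplex₂.total_d, Preadditive.comp_add,
      HomologicalComplex₂.ι_D₁, HomologicalComplex₂.ι_D₂,
      HomologicalComplex₂.d₁_eq _ _ (i₁ := b) (i₁' := b + 1) rfl (i + -b) j
        (show b + 1 + (i + -b) = j by lia),
      HomologicalComplex₂.d₂_eq _ _ b (i₂ := i + -b) (i₂' := j + -b)
        (show i + -b + 1 = j + -b by lia) j (show b + (j + -b) = j by lia), h0]
    simp [ComplexShape.ε₂_def]
  exact ⟨(Hom.isoOfComponents (fun n => ⟨φ n, ψ n, h₁ n, h₂ n⟩) h₃).symm⟩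

/-- If the homology of `G F` belongs to a class of objects that is closed under extensions of
subquotients, so does the homology of `totalOf G` on bounded above complexes. -/
theorem prop_homology_totalOf (hG : ∀ F, (G.obj F).IsStrictlyLE 0) (R : ObjectProperty C)
    [R.IsClosedUnderIsomorphisms] (hR₀ : ∀ F, IsZero F → R F)
    (hR : ∀ S : ShortComplex C, S.Exact → R S.X₁ → R S.X₃ → R S.X₂)
    (hGR : ∀ F i, R ((G.obj F).homology i)) (K : CochainComplex C ℤ) (n : ℤ) (hK : K.IsStrictlyLE n)
    (i : ℤ) : R (((totalOf G).obj K).homology i) := by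
  -- The degree `i` stays fixed and the bound on `K` is counted from `i - 1`. For `m = 0` the total
  -- complex vanishes in degree `i`, and each further step splits off one top term.
  suffices ∀ (m : ℕ) (K : CochainComplex C ℤ) (_ : K.IsStrictlyLE (i - 1 + m)),
      R (((totalOf G).obj K).homology i) by
    exact this (n - i + 1).toNat K (K.isStrictlyLE_of_le n _ (by lia))
  intro m
  induction m with
  | zero =>
    intro K hK
    have := isStrictlyLE_totalOf G hG K (i - 1 + (0 : ℕ))
    exact hR₀ _ (((totalOf G).obj K).isZero_of_isLE (i - 1 + (0 : ℕ)) i)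
  | succ m hm =>
    intro K hK
    obtain ⟨L, f, g, w, hL, hS⟩ := exists_degreewiseSplit_top K (i - 1 + (m + 1 : ℕ))
    have hT := (degreewiseSplit_totalOf G hS).shortExact
    refine hR _ (hT.homology_exact₂ i) ?_ (hm L ?_)
    · refine R.prop_of_iso ((homologyFunctor C _ i).mapIso
        (nonempty_totalOf_single_iso G _ _).some.symm) ?_
      exact R.prop_of_iso ((CochainComplex.ShiftSequence.shiftIso C _ _ _ rfl).app (G.obj _)).symm (hGR _ _)
    · convert hL using 1
      push_cast
      lia

end

end WittMotives

/-! ### Prisms and the homotopy invariance of the cohomology of the Suslin complex -/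

namespace WittMotives

open Limits Opposite Simplicial

variable {k : Type u} [Field k]

namespace SimplexAlg

theorem map_sum_x {m n : ℕ} (φ : Fin (m + 1) → Fin (n + 1)) (S : Finset (Fin (n + 1))) :
    map φ (∑ i ∈ S, x k i) = ∑ j with φ j ∈ S, x k j := by
  rw [map_sum]
  simp only [map_x]
  exact Finset.sum_fiberwise_eq_sum_filter _ _ _ _

end SimplexAlg

/-- The simplicial algebra `A ⊗ k[Δⁿ]`. -/
noncomputable def tensorSimplices : SmAlg k ⥤ SimplicialObject (SmAlg k) where
  obj A :=
    { obj n := A.tensor ((simplices k).obj n)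
      map φ := SmAlg.desc (SmAlg.inl _ _) ((simplices k).map φ ≫ SmAlg.inr _ _)
      map_id n := SmAlg.coprod_hom_ext (by simp) (by simp)
      map_comp φ ψ := SmAlg.coprod_hom_ext (by simp) (by simp) }
  map f :=
    { app n := SmAlg.desc (f ≫ SmAlg.inl _ _) (SmAlg.inr _ _)
      naturality m n φ := SmAlg.coprod_hom_ext (by simp) (by simp) }
  map_id A := by
    ext n
    exact SmAlg.coprod_hom_ext (by simp) (by simp)
  map_comp f g := by
    ext n
    exact SmAlg.coprod_hom_ext (by simp) (by simp)

/-- The sum of the coordinates of `Δⁿ` which belong to a given set. -/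
noncomputable def partialSum (k : Type u) [Field k] {n : ℕ} (S : Finset (Fin (n + 1))) :
    (simplices k).obj (op ⦋n⦌) :=
  (∑ i ∈ S, SimplexAlg.x k i : SimplexAlg k n)

theorem toAlgHom_simplices_map {m n : ℕ} (φ : ⦋m⦌ ⟶ ⦋n⦌) (S : Finset (Fin (n + 1))) :
    SmAlg.toAlgHom ((simplices k).map φ.op) (partialSum k S) =
      partialSum k {j | φ j ∈ S} :=
  SimplexAlg.map_sum_x _ S

/-- The morphism `𝔸¹ × Δᵐ ⟶ 𝔸¹ × Δⁿ` over `A` given by multiplication of the coordinate of `𝔸¹`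
with a partial sum of coordinates and by a map of simplices. -/
noncomputable def prism (A : SmAlg k) {m n : ℕ} (φ : ⦋m⦌ ⟶ ⦋n⦌) (S : Finset (Fin (m + 1))) :
    ((tensorSimplices.obj (A.tensor (affineLine k))).obj (op ⦋n⦌)) ⟶
      ((tensorSimplices.obj (A.tensor (affineLine k))).obj (op ⦋m⦌)) :=
  SmAlg.desc (SmAlg.desc (SmAlg.inl _ _ ≫ SmAlg.inl _ _) (SmAlg.ofElem
    (A := (A.tensor (affineLine k)).tensor ((simplices k).obj (op ⦋m⦌)))
      (SmAlg.toAlgHom (SmAlg.inr _ _ ≫ SmAlg.inl _ _) (SmAlg.coord k) *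
        SmAlg.toAlgHom (SmAlg.inr _ _) (partialSum k S))))
    ((simplices k).map φ.op ≫ SmAlg.inr _ _)

/-- A map of simplices pulls a partial sum of coordinates back to the partial sum over the preimage.
With `map_comp_prism` this reduces the identities of a simplicial homotopy to identities between
maps of ordinals and subsets of vertices. -/
theorem prism_comp_map (A : SmAlg k) {l m n : ℕ} (φ : ⦋m⦌ ⟶ ⦋n⦌) (S : Finset (Fin (m + 1)))
    (ψ : ⦋l⦌ ⟶ ⦋m⦌) :
    prism A φ S ≫ (tensorSimplices.obj (A.tensor (affineLine k))).map ψ.op =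
      prism A (ψ ≫ φ) {j | ψ j ∈ S} := by
  refine SmAlg.coprod_hom_ext (SmAlg.coprod_hom_ext ?_ ?_) ?_
  · simp [prism, tensorSimplices]
  · dsimp only [prism, tensorSimplices]
    simp only [SmAlg.inl_desc_assoc, SmAlg.inl_desc, SmAlg.inr_desc_assoc, SmAlg.inr_desc]
    rw [SmAlg.ofElem_comp]
    refine congrArg SmAlg.ofElem ?_
    rw [map_mul, ← SmAlg.toAlgHom_comp, ← SmAlg.toAlgHom_comp, Category.assoc, SmAlg.inl_desc,
      SmAlg.inr_desc, SmAlg.toAlgHom_comp ((simplices k).map ψ.op), toAlgHom_simplices_map]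
  · simp [prism, tensorSimplices]

theorem map_comp_prism (A : SmAlg k) {l m n : ℕ} (φ : ⦋m⦌ ⟶ ⦋n⦌) (S : Finset (Fin (m + 1)))
    (ψ : ⦋n⦌ ⟶ ⦋l⦌) :
    (tensorSimplices.obj (A.tensor (affineLine k))).map ψ.op ≫ prism A φ S =
      prism A (φ ≫ ψ) S := by
  refine SmAlg.coprod_hom_ext ?_ ?_ <;> simp [prism, tensorSimplices]

/-- The coordinates of a simplex sum to one, so the full set gives multiplication by `1`. The empty
set gives multiplication by `0` in `prism_id_empty`, and the prisms interpolate between the identity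
and the contraction to the zero section. -/
theorem prism_id_univ (A : SmAlg k) (n : ℕ) :
    prism A (𝟙 ⦋n⦌) Finset.univ = 𝟙 _ := by
  have h : partialSum k (Finset.univ (α := Fin (n + 1))) = 1 := SimplexAlg.sum_x k n
  let B := A.tensor (affineLine k)
  let S := (simplices k).obj (op ⦋n⦌)
  have key : SmAlg.desc (SmAlg.desc (SmAlg.inl _ _ ≫ SmAlg.inl B S) (SmAlg.ofElem
      (A := B.tensor S) (SmAlg.toAlgHom (SmAlg.inr _ _ ≫ SmAlg.inl B S) (SmAlg.coord k) *
        SmAlg.toAlgHom (SmAlg.inr B S) (partialSum k Finset.univ)))) (SmAlg.inr B S) =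
      𝟙 (B.tensor S) := by
    rw [h, map_one, mul_one, ← SmAlg.ofElem_eq]
    refine SmAlg.coprod_hom_ext (SmAlg.coprod_hom_ext ?_ ?_) ?_
    · rw [SmAlg.inl_desc, Category.comp_id, SmAlg.inl_desc]
    · rw [SmAlg.inl_desc, Category.comp_id, SmAlg.inr_desc]
    · rw [SmAlg.inr_desc, Category.comp_id]
  refine Eq.trans (congrArg (SmAlg.desc _) ?_) key
  exact (congrArg (· ≫ SmAlg.inr _ _) ((simplices k).map_id _)).trans (Category.id_comp _)

theorem prism_id_empty (A : SmAlg k) (n : ℕ) :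
    prism A (𝟙 ⦋n⦌) ∅ = (tensorSimplices.map
      (SmAlg.desc (𝟙 A) (affineLinePoint k 0 ≫ SmAlg.unit A) ≫ SmAlg.inl A _)).app (op ⦋n⦌) := by
  have h : partialSum k (∅ : Finset (Fin (n + 1))) = 0 := rfl
  refine SmAlg.coprod_hom_ext (SmAlg.coprod_hom_ext ?_ ?_) ?_
  · simp [prism, tensorSimplices]
  · dsimp only [prism, tensorSimplices]
    rw [SmAlg.inl_desc, SmAlg.inr_desc, h, map_zero, mul_zero, SmAlg.affineLinePoint_unit,
      SmAlg.inl_desc, Category.assoc, SmAlg.inr_desc_assoc, SmAlg.ofElem_comp]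
    simp
  · simp [prism, tensorSimplices]

/-- The simplicial homotopy given by the decomposition of the prisms `Δ¹ × Δⁿ`. -/
noncomputable def prismHomotopy (A : SmAlg k) :
    SimplicialObject.Homotopy (𝟙 (tensorSimplices.obj (A.tensor (affineLine k))))
      (tensorSimplices.map
        (SmAlg.desc (𝟙 A) (affineLinePoint k 0 ≫ SmAlg.unit A) ≫ SmAlg.inl A _)) where
  -- On the prism of index `i` the coordinate of `𝔸¹` is multiplied by the sum of the coordinates
  -- `0, …, i` of the larger simplex. The face `0` pulls this set back to the empty set for `i = 0`,
  -- and the last face pulls it back to everything for the last `i`.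
  h i := prism A (SimplexCategory.σ i) {j | j ≤ i.castSucc}
  h_zero_comp_δ_zero n := by
    rw [← prism_id_empty]
    refine (prism_comp_map _ _ _ _).trans ?_
    rw [show SimplexCategory.δ 0 ≫ SimplexCategory.σ (0 : Fin (n + 1)) = 𝟙 _ from
      SimplexCategory.δ_comp_σ_self]
    congr 1
    ext j
    have : SimplexCategory.δ (0 : Fin (n + 2)) j = Fin.succAbove 0 j := rfl
    simp [this]
  h_last_comp_δ_last n := by
    refine Eq.trans ?_ (prism_id_univ A n)
    refine (prism_comp_map _ _ _ _).trans ?_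
    rw [show SimplexCategory.δ (Fin.last _) ≫ SimplexCategory.σ (Fin.last n) = 𝟙 _ from
      SimplexCategory.δ_comp_σ_succ]
    congr 1
    ext j
    have : SimplexCategory.δ (Fin.last (n + 1)) j = Fin.succAbove (Fin.last _) j := rfl
    simp [this, Fin.le_last]
  h_succ_comp_δ_castSucc_of_lt i j hij := by
    refine (prism_comp_map _ _ _ _).trans (Eq.trans ?_ (map_comp_prism _ _ _ _).symm)
    rw [SimplexCategory.δ_comp_σ_of_le hij]
    congr 1
    ext l
    have : SimplexCategory.δ i.castSucc l = Fin.succAbove i.castSucc l := rfl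
    simp only [Finset.mem_filter_univ, this, Fin.le_def, Fin.lt_def, Fin.succAbove] at hij ⊢
    split_ifs <;> simp at * <;> lia
  h_succ_comp_δ_castSucc_succ j := by
    refine (prism_comp_map _ _ _ _).trans (Eq.trans ?_ (prism_comp_map _ _ _ _).symm)
    rw [show SimplexCategory.δ j.castSucc.succ ≫ SimplexCategory.σ j.castSucc = 𝟙 _ from
      SimplexCategory.δ_comp_σ_succ, show SimplexCategory.δ j.castSucc.succ ≫
        SimplexCategory.σ j.succ = 𝟙 _ from SimplexCategory.δ_comp_σ_self]
    congr 1
    ext l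
    have : SimplexCategory.δ j.castSucc.succ l = Fin.succAbove j.castSucc.succ l := rfl
    simp only [Finset.mem_filter_univ, this, Fin.le_def, Fin.lt_def, Fin.succAbove]
    split_ifs <;> simp at * <;> lia
  h_castSucc_comp_δ_succ_of_lt i j hji := by
    refine (prism_comp_map _ _ _ _).trans (Eq.trans ?_ (map_comp_prism _ _ _ _).symm)
    rw [SimplexCategory.δ_comp_σ_of_gt hji]
    congr 1
    ext l
    have : SimplexCategory.δ i.succ l = Fin.succAbove i.succ l := rfl
    simp only [Finset.mem_filter_univ, this, Fin.le_def, Fin.lt_def, Fin.succAbove] at hji ⊢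
    split_ifs <;> simp at * <;> lia
  h_comp_σ_castSucc_of_le i j hij := by
    refine (prism_comp_map _ _ _ _).trans (Eq.trans ?_ (map_comp_prism _ _ _ _).symm)
    rw [SimplexCategory.σ_comp_σ hij]
    congr 1
    ext l
    have : SimplexCategory.σ i.castSucc l = Fin.predAbove i.castSucc l := rfl
    simp only [Finset.mem_filter_univ, this, Fin.le_def, Fin.lt_def, Fin.predAbove]
    have h₁ : (i.castSucc.castSucc : ℕ) = i := rfl
    have h₂ : (i : ℕ) ≤ j := hij
    split_ifs <;> simp <;> lia
  h_comp_σ_succ_of_lt i j hji := by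
    refine (prism_comp_map _ _ _ _).trans (Eq.trans ?_ (map_comp_prism _ _ _ _).symm)
    rw [← SimplexCategory.σ_comp_σ hji]
    congr 1
    ext l
    have : SimplexCategory.σ i.succ l = Fin.predAbove i.succ l := rfl
    simp only [Finset.mem_filter_univ, this, Fin.le_def, Fin.lt_def, Fin.predAbove]
    have h₁ : (i.succ.castSucc : ℕ) = i + 1 := rfl
    have h₂ : (j : ℕ) ≤ i := hji
    split_ifs <;> simp <;> lia

open PreWtr

/-- The values of a presheaf, as a covariant functor on algebras. -/
noncomputable def PreWtr.onAlg (F : PreWtr k) : SmAlg k ⥤ AddCommGrpCat.{u + 1} where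
  obj A := F.obj.obj (op ⟨A⟩)
  map f := F.obj.map (WCor.graph f).op
  map_id A := F.obj.map_id _
  map_comp f g := (congrArg (fun t : (_ : WCor k) ⟶ _ => F.obj.map t.op) (WCor.graph_comp f g)).trans
    (F.obj.map_comp _ _)

/-- The simplicial presheaf `F (- × Δⁿ)`. -/
noncomputable def shiftSimplices (F : PreWtr k) : SimplicialObject (PreWtr k) :=
  (simplices k ⋙ PreWtr.shift).flip.obj F

/-- The simplicial abelian group `F (Spec A × Δⁿ)`. -/
noncomputable def onTensorSimplices (F : PreWtr k) (A : SmAlg k) :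
    SimplicialObject AddCommGrpCat.{u + 1} :=
  ((SimplicialObject.whiskering _ _).obj F.onAlg).obj (tensorSimplices.obj A)

theorem ev_map_shiftSimplices (F : PreWtr k) (A : SmAlg k) {m n : SimplexCategoryᵒᵖ} (φ : m ⟶ n) :
    (ev ⟨A⟩).map ((shiftSimplices F).map φ) = (onTensorSimplices F A).map φ :=
  congrArg (fun t : (_ : WCor k) ⟶ _ => F.obj.map t.op) (WCor.prodMap_app ((simplices k).map φ) A)

/-- The evaluation of the complex associated to `F (- × Δⁿ)`. -/
noncomputable def evShiftSimplicesIso (F : PreWtr k) (A : SmAlg k) :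
    ((ev ⟨A⟩).mapHomologicalComplex (ComplexShape.down ℕ)).obj
      ((AlgebraicTopology.alternatingFaceMapComplex _).obj (shiftSimplices F)) ≅
      (AlgebraicTopology.alternatingFaceMapComplex _).obj (onTensorSimplices F A) :=
  HomologicalComplex.Hom.isoOfComponents (fun _ => Iso.refl _) (by
    rintro i j (rfl : j + 1 = i)
    refine (Category.id_comp _).trans (Eq.trans ?_ (Category.comp_id _).symm)
    refine (AlgebraicTopology.alternatingFaceMapComplex_obj_d _ _).trans ?_
    refine Eq.trans ?_ (congrArg (ev ⟨A⟩).map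
      (AlgebraicTopology.alternatingFaceMapComplex_obj_d (shiftSimplices F) j).symm)
    dsimp only [AlgebraicTopology.AlternatingFaceMapComplex.objD]
    rw [Functor.map_sum]
    refine Finset.sum_congr rfl fun i _ => ?_
    rw [Functor.map_zsmul]
    exact congrArg _ (ev_map_shiftSimplices F A _).symm)

/-- The restriction along a morphism, as a natural transformation. -/
noncomputable def evGraph {A B : SmAlg k} (f : A ⟶ B) : ev (⟨A⟩ : WCor k) ⟶ ev ⟨B⟩ where
  app F := F.obj.map (WCor.graph f).op
  naturality F G α := (α.hom.naturality _).symm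

theorem evShiftSimplicesIso_naturality (F : PreWtr k) {A B : SmAlg k} (f : A ⟶ B) :
    (NatTrans.mapHomologicalComplex (evGraph f) (ComplexShape.down ℕ)).app _ ≫
      (evShiftSimplicesIso F B).hom = (evShiftSimplicesIso F A).hom ≫
        (AlgebraicTopology.alternatingFaceMapComplex _).map
          (((SimplicialObject.whiskering _ _).obj F.onAlg).map (tensorSimplices.map f)) := by
  ext n : 1
  refine (Category.comp_id _).trans (Eq.trans ?_ (Category.id_comp _).symm)
  exact congrArg (fun t : (_ : WCor k) ⟶ _ => F.obj.map t.op) (WCor.prod_map_graph f _)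

/-- By `isHomotopyInvariant_iff_mono` it suffices that restriction to the zero section is injective
on the homology of `F(X × 𝔸¹ × Δ•)`. The prism homotopy shows that following it by pullback along
the projection is the identity on homology. -/
theorem isHomotopyInvariant_homology_shiftSimplices (F : PreWtr k) (n : ℕ) :
    IsHomotopyInvariant (((AlgebraicTopology.alternatingFaceMapComplex _).obj
      (shiftSimplices F)).homology n) := by
  rw [isHomotopyInvariant_iff_mono, mono_iff_ev]
  rintro ⟨A⟩
  rw [← AddCommGrpCat.mono_iff_injective]
  let K := (AlgebraicTopology.alternatingFaceMapComplex _).obj (shiftSimplices F)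
  let s : A.tensor (affineLine k) ⟶ A := SmAlg.desc (𝟙 A) (affineLinePoint k 0 ≫ SmAlg.unit A)
  have e : (ev ⟨A⟩).map ((shiftSec (affineLine k) (affineLinePoint k 0)).app (K.homology n)) =
      (evGraph s).app (K.homology n) :=
    congrArg (fun t : (_ : WCor k) ⟶ _ => (K.homology n).obj.map t.op) (WCor.sec_app _ _ A)
  -- Evaluation at a scheme is exact, so the restriction map on the homology presheaf is computed by
  -- the complexes of abelian groups.
  have e' := NatTrans.app_homology (evGraph s) (K.sc n)
  let N := AlgebraicTopology.alternatingFaceMapComplex AddCommGrpCat.{u + 1}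
  let W := (SimplicialObject.whiskering _ _).obj F.onAlg
  let Φ := W ⋙ N ⋙ HomologicalComplex.homologyFunctor _ _ n
  have h₁ : Mono (Φ.map (tensorSimplices.map s)) := by
    have h : Φ.map (𝟙 _) = Φ.map (tensorSimplices.map (s ≫ SmAlg.inl A (affineLine k))) :=
      ((prismHomotopy A).whiskerRight F.onAlg).map_homology_eq n
    refine mono_of_mono_fac (f := Φ.map (tensorSimplices.map (SmAlg.inl A (affineLine k))))
      (h := 𝟙 _) ?_
    rw [← Φ.map_comp, ← Functor.map_comp, ← h, CategoryTheory.Functor.map_id]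
  have h₂ : Mono (HomologicalComplex.homologyMap
      ((NatTrans.mapHomologicalComplex (evGraph s) (ComplexShape.down ℕ)).app K) n) := by
    have h := (((HomologicalComplex.homologyFunctor _ _ n).map_comp _ _).symm.trans
      (congrArg ((HomologicalComplex.homologyFunctor _ _ n).map)
        (evShiftSimplicesIso_naturality F s))).trans
          ((HomologicalComplex.homologyFunctor _ _ n).map_comp _ _)
    exact @mono_of_mono_fac _ _ _ _ _ _ _ _ (mono_comp' (@IsIso.mono_of_iso _ _ _ _ _
      ((HomologicalComplex.homologyFunctor _ _ n).mapIso (evShiftSimplicesIso F _)).isIso_hom) h₁) h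
  have h₃ : Mono (ShortComplex.homologyMap ((K.sc n).mapNatTrans (evGraph s))) := h₂
  rw [e]
  refine Eq.mpr (congrArg Mono e') ?_
  exact mono_comp' (@IsIso.mono_of_iso _ _ _ _ _ (Iso.isIso_inv _))
    (mono_comp' h₃ (@IsIso.mono_of_iso _ _ _ _ _ (Iso.isIso_hom _)))

theorem isHomotopyInvariant_of_iso {F G : PreWtr k} (e : F ≅ G) (h : IsHomotopyInvariant F) :
    IsHomotopyInvariant G := by
  rw [← homZero_reprQuotient_iff] at h ⊢
  exact ObjectProperty.prop_of_iso _ e h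

theorem isHomotopyInvariant_of_isZero {F : PreWtr k} (h : IsZero F) : IsHomotopyInvariant F := by
  rw [← homZero_reprQuotient_iff]
  exact fun X f => h.eq_of_tgt _ _

/-- The class of homotopy invariant presheaves is closed under extensions of subquotients. -/
theorem isHomotopyInvariant_of_exact (S : ShortComplex (PreWtr k)) (hS : S.Exact)
    (h₁ : IsHomotopyInvariant S.X₁) (h₃ : IsHomotopyInvariant S.X₃) : IsHomotopyInvariant S.X₂ := by
  rw [← homZero_reprQuotient_iff] at h₁ h₃ ⊢
  intro X f
  -- This is exactness of morphisms from a projective: `f` lands in the cycles, lifts to `S.X₁`, and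
  -- vanishes there.
  have := hS.epi_toCycles
  obtain ⟨g, hg⟩ := Projective.factors (S.liftCycles f (h₃ X _)) S.toCycles
  rw [← S.liftCycles_i f (h₃ X _), ← hg, h₁ X g, zero_comp, zero_comp]

theorem isHomotopyInvariant_homology_suslinPresheaf (F : PreWtr k) (i : ℤ) :
    IsHomotopyInvariant (((suslinPresheaf k).obj F).homology i) := by
  by_cases hi : ∃ n, ComplexShape.embeddingDownNat.f n = i
  · obtain ⟨n, hn⟩ := hi
    exact isHomotopyInvariant_of_iso
      (((AlgebraicTopology.alternatingFaceMapComplex _).obj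
        (shiftSimplices F)).extendHomologyIso ComplexShape.embeddingDownNat hn).symm
      (isHomotopyInvariant_homology_shiftSimplices F n)
  · refine isHomotopyInvariant_of_isZero (HomologicalComplex.ExactAt.isZero_homology ?_)
    exact HomologicalComplex.extend_exactAt _ _ _ (by simpa using hi)

theorem isStrictlyLE_extend {C : Type*} [Category* C] [HasZeroObject C] [HasZeroMorphisms C]
    (K : ChainComplex C ℕ) :
    CochainComplex.IsStrictlyLE (K.extend ComplexShape.embeddingDownNat) 0 := by
  rw [CochainComplex.isStrictlyLE_iff]
  intro i hi
  exact K.isZero_extend_X _ _ fun n => by simp; lia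

/-- The Suslin complex is an instance of `totalOf`, so the induction on top terms reduces it to a
single presheaf. Homotopy invariance enters as `homZero`, for which the closure under exact
sequences is available. -/
theorem isHomotopyInvariant_homology_suslin (K : CochainComplex (PreWtr k) ℤ) (n : ℤ)
    (hK : K.IsStrictlyLE n) (i : ℤ) : IsHomotopyInvariant (((suslin k).obj K).homology i) := by
  have := prop_homology_totalOf (suslinPresheaf k) (fun F => isStrictlyLE_extend _)
    (homZero (reprQuotient (k := k))) (fun F hF X f => hF.eq_of_tgt _ _)
    (by simpa only [homZero_reprQuotient_iff] using isHomotopyInvariant_of_exact)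
    (by simpa only [homZero_reprQuotient_iff] using isHomotopyInvariant_homology_suslinPresheaf)
    K n hK i
  exact (homZero_reprQuotient_iff _).1 this

end WittMotives

/-! ### Associativity of products with Witt correspondences -/

namespace WittMotives

open Limits Opposite TensorProduct

section

variable {k A B A' B' V D : Type u} [Field k] [CommRing A] [CommRing B] [CommRing A'] [CommRing B']
  [CommRing V] [CommRing D] [Algebra k A] [Algebra k B] [Algebra k A'] [Algebra k B'] [Algebra k V]
  [Algebra k D]

namespace QSpace

/-- An isometry given by a semilinear map with generating image. -/
theorem Isometric.graph_comp_of_semilinear {P : QSpace k A B} {R : QSpace k A' B'} (α : A →ₐ[k] A')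
    (β : B →ₐ[k] B') (φ : P →+ R) (hA : ∀ (a : A) x, φ (a • x) = α a • φ x)
    (hB : ∀ (b : B) x, φ (b • x) = β b • φ x)
    (hf : ∀ x y, R.form (φ x) (φ y) = α (P.form x y))
    (hs : ∀ r, r ∈ AddSubmonoid.closure (Set.range fun x : A' × P => x.1 • φ x.2)) :
    Isometric (comp (graph α) P) (comp R (graph β)) := by
  refine Isometric.trans ?_ (Isometric.comp_graph _ _).symm
  refine Isometric.of_tm (P := graph α) (Q := P) (R := restr R β)
    (fun (z : A') x => (z • φ x : R))
    (fun (p p' : A') q => (add_smul p p' (φ q) : (p + p') • φ q = p • φ q + p' • φ q))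
    (fun (p : A') q q' => ?_)
    (fun b (p : A') q => ?_) (fun (a : A') (p : A') q => ?_) (fun c (p : A') q => ?_)
    (fun (p : A') q (p' : A') q' => ?_) hs
  · have : p • φ (q + q') = p • φ q + p • φ q' := by rw [map_add, smul_add]
    exact this
  · change (α b * p) • φ q = p • φ (b • q)
    rw [hA, smul_smul, mul_comm]
  · exact mul_smul a p (φ q)
  · change p • φ (c • q) = β c • p • φ q
    rw [hB, smul_comm]
  · change R.form (p • φ q) (p' • φ q') = α (P.form q q') * p * p'
    rw [← hf]
    simp only [map_smul, LinearMap.smul_apply, smul_eq_mul]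
    ring

variable (A V D) in
/-- The associativity isomorphism, as a homomorphism of algebras. -/
noncomputable def assocHom : A ⊗[k] (V ⊗[k] D) →ₐ[k] (A ⊗[k] V) ⊗[k] D :=
  (Algebra.TensorProduct.assoc k k k A V D).symm.toAlgHom

theorem assocHom_tmul (a : A) (v : V) (d : D) :
    assocHom A V D (a ⊗ₜ[k] (v ⊗ₜ[k] d)) = (a ⊗ₜ[k] v) ⊗ₜ[k] d := rfl

/-- Base change along a tensor product is iterated base change. -/
theorem Isometric.baseChange_assoc (P : QSpace k A B) :
    Isometric (comp (graph (assocHom A V D)) (baseChange P (V ⊗[k] D)))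
      (comp (baseChange (baseChange P V) D) (graph (assocHom B V D))) := by
  -- The associativity of the tensor product of the underlying spaces is semilinear over both
  -- associativity homomorphisms of the algebras and respects the forms; since it is bijective, its
  -- image generates.
  let φ : baseChange P (V ⊗[k] D) →+ baseChange (baseChange P V) D :=
    (TensorProduct.assoc k P V D).symm.toLinearMap.toAddMonoidHom
  have hφ (p : P) (v : V) (d : D) : φ (bt P (V ⊗[k] D) p (v ⊗ₜ d)) =
    bt (baseChange P V) D (bt P V p v) d := rfl
  have hind {motive : baseChange P (V ⊗[k] D) → Prop} (x) (zero : motive 0)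
      (h : ∀ p v d, motive (bt P (V ⊗[k] D) p (v ⊗ₜ d)))
      (add : ∀ x y, motive x → motive y → motive (x + y)) : motive x := by
    refine bt_induction x zero (fun p w => ?_) add
    induction w with
    | zero =>
      have : bt P (V ⊗[k] D) p 0 = 0 := tmul_zero _ _
      rwa [this]
    | tmul v d => exact h p v d
    | add w w' hw hw' =>
      rw [bt_add_right]
      exact add _ _ hw hw'
  have h₀ (y) : φ ((0 : A ⊗[k] (V ⊗[k] D)) • y) = (0 : (A ⊗[k] V) ⊗[k] D) • φ y :=
    (congrArg φ (zero_smul (A ⊗[k] (V ⊗[k] D)) y)).trans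
      ((map_zero φ).trans (zero_smul ((A ⊗[k] V) ⊗[k] D) (φ y)).symm)
  have hA (a : A ⊗[k] (V ⊗[k] D)) (x) : φ (a • x) = assocHom A V D a • φ x := by
    refine hind (motive := fun x => φ (a • x) = assocHom A V D a • φ x) x ?_ (fun p v d => ?_)
      (fun x y hx hy => ?_)
    · rw [smul_zero, map_zero, smul_zero]
    · induction a with
      | zero =>
        rw [map_zero]
        exact h₀ _
      | add a a' h h' => rw [add_smul, map_add, h, h', map_add, add_smul]
      | tmul a w =>
        induction w with
        | zero =>
          have : a ⊗ₜ[k] (0 : V ⊗[k] D) = 0 := tmul_zero _ _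
          rw [this, map_zero]
          exact h₀ _
        | add a a' h h' => rw [tmul_add, add_smul, map_add, h, h', map_add, add_smul]
        | tmul v' d' =>
          rw [smul_bt, Algebra.TensorProduct.tmul_mul_tmul, hφ, hφ, assocHom_tmul, smul_bt, smul_bt]
    · rw [smul_add, map_add, hx, hy, map_add, smul_add]
  have h₀ (y) : φ ((0 : B ⊗[k] (V ⊗[k] D)) • y) = (0 : (B ⊗[k] V) ⊗[k] D) • φ y :=
    (congrArg φ (zero_smul (B ⊗[k] (V ⊗[k] D)) y)).trans
      ((map_zero φ).trans (zero_smul ((B ⊗[k] V) ⊗[k] D) (φ y)).symm)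
  have hB (a : B ⊗[k] (V ⊗[k] D)) (x) : φ (a • x) = assocHom B V D a • φ x := by
    refine hind (motive := fun x => φ (a • x) = assocHom B V D a • φ x) x ?_ (fun p v d => ?_)
      (fun x y hx hy => ?_)
    · rw [smul_zero, map_zero, smul_zero]
    · induction a with
      | zero =>
        rw [map_zero]
        exact h₀ _
      | add a a' h h' => rw [add_smul, map_add, h, h', map_add, add_smul]
      | tmul a w =>
        induction w with
        | zero =>
          have : a ⊗ₜ[k] (0 : V ⊗[k] D) = 0 := tmul_zero _ _
          rw [this, map_zero]
          exact h₀ _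
        | add a a' h h' => rw [tmul_add, add_smul, map_add, h, h', map_add, add_smul]
        | tmul v' d' =>
          rw [smul_bt', Algebra.TensorProduct.tmul_mul_tmul, hφ, hφ, assocHom_tmul, smul_bt',
            smul_bt']
    · rw [smul_add, map_add, hx, hy, map_add, smul_add]
  refine graph_comp_of_semilinear _ _ φ hA hB (fun x y => ?_) (fun r => ?_)
  · refine hind (motive := fun x => (baseChange (baseChange P V) D).form (φ x) (φ y) =
      assocHom A V D ((baseChange P (V ⊗[k] D)).form x y)) x ?_ (fun p v d => ?_)
      (fun x x' hx hx' => ?_)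
    · simp only [map_zero, LinearMap.zero_apply]
    · refine hind (motive := fun y => (baseChange (baseChange P V) D).form (φ (bt P _ p (v ⊗ₜ d)))
        (φ y) = assocHom A V D ((baseChange P (V ⊗[k] D)).form (bt P _ p (v ⊗ₜ d)) y)) y ?_
        (fun p' v' d' => ?_) (fun y y' hy hy' => ?_)
      · simp only [map_zero]
      · rw [hφ, hφ, form_bt, form_bt, form_bt, Algebra.TensorProduct.tmul_mul_tmul, assocHom_tmul]
      · simp only [map_add, hy, hy']
    · simp only [map_add, LinearMap.add_apply, hx, hx']
  · refine AddSubmonoid.subset_closure ⟨(1, (TensorProduct.assoc k P V D) r), ?_⟩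
    exact (one_smul _ _).trans ((TensorProduct.assoc k P V D).symm_apply_apply r)

end QSpace

/-- Naturality in all correspondences, not just in graphs: it makes a homotopy `𝔸¹ × Spec D ⟶ Spec
D` act on presheaves with Witt transfers. -/
theorem WittGroup.baseChange_assoc (x : WittGroup k A B) :
    comp (baseChange D (baseChange V x)) (graph (QSpace.assocHom B V D)) =
      comp (graph (QSpace.assocHom A V D)) (baseChange (V ⊗[k] D) x) := by
  obtain ⟨P, rfl⟩ := mk_surjective x
  exact (mk_eq_of_isometric (QSpace.Isometric.baseChange_assoc P)).symm

end

variable {k : Type u} [Field k]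

namespace SmAlg

/-- The associativity isomorphism. -/
noncomputable def assoc (A V D : SmAlg k) : A.tensor (V.tensor D) ⟶ (A.tensor V).tensor D :=
  QSpace.assocHom (k := k) A V D

theorem assoc_eq (A V D : SmAlg k) : assoc A V D =
    desc (inl _ _ ≫ inl _ _) (desc (inr _ _ ≫ inl _ _) (inr _ _)) := by
  refine coprod_hom_ext ?_ (coprod_hom_ext ?_ ?_)
  · rw [inl_desc]
    rfl
  · rw [inr_desc, inl_desc]
    rfl
  · rw [inr_desc, inr_desc]
    rfl

end SmAlg

/-- The associativity isomorphism of products. -/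
noncomputable def WCor.prodAssoc (V D : SmAlg k) :
    WCor.prod V ⋙ WCor.prod D ⟶ WCor.prod (V.tensor D) where
  app X := WCor.graph (SmAlg.assoc X.alg V D)
  naturality _ _ x := WittGroup.baseChange_assoc (V := V) (D := D) x

/-- The morphism `(X × Spec V) × Spec D ⟶ X × Spec E` given by `E ⟶ V ⊗ D`. -/
noncomputable def WCor.prodProdMap {V D E : SmAlg k} (c : E ⟶ V.tensor D) :
    WCor.prod V ⋙ WCor.prod D ⟶ WCor.prod E :=
  WCor.prodAssoc V D ≫ WCor.prodMap c

theorem WCor.prodProdMap_app {V D E : SmAlg k} (c : E ⟶ V.tensor D) (A : SmAlg k) :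
    (WCor.prodProdMap c).app ⟨A⟩ = WCor.graph (SmAlg.desc (SmAlg.inl A V ≫ SmAlg.inl _ D)
      (c ≫ SmAlg.desc (SmAlg.inr A V ≫ SmAlg.inl _ D) (SmAlg.inr _ D))) := by
  refine (congrArg (WCor.graph (SmAlg.assoc A V D) ≫ ·) (WCor.prodMap_app c A)).trans
    ((WCor.graph_comp _ _).symm.trans (congrArg WCor.graph ?_))
  rw [SmAlg.assoc_eq]
  exact SmAlg.coprod_hom_ext (by simp) (by simp)

end WittMotives

/-! ### Contraction of the simplices and contractible presheaves -/

namespace WittMotives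

open Limits Opposite Simplicial PreWtr

variable {k : Type u} [Field k]

section

variable {D : SmAlg k} (c : D ⟶ (affineLine k).tensor D)

/-- The morphism `F (- × Spec D) ⟶ F (- × 𝔸¹ × Spec D)` given by `D ⟶ k[t] ⊗ D`. -/
noncomputable def shiftHomotopy (F : PreWtr k) :
    (PreWtr.shift.obj D).obj F ⟶ (PreWtr.shift.obj (affineLine k)).obj
      ((PreWtr.shift.obj D).obj F) :=
  ObjectProperty.homMk (Functor.whiskerRight (NatTrans.op (WCor.prodProdMap c)) F.obj)

theorem shiftHomotopy_shiftSec (t : k) (s : D ⟶ D)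
    (h : c ≫ SmAlg.desc (affineLinePoint k t ≫ SmAlg.unit D) (𝟙 D) = s) (F : PreWtr k) :
    shiftHomotopy c F ≫ (shiftSec (affineLine k) (affineLinePoint k t)).app _ =
      (PreWtr.shift.map s).app F := by
  refine hom_ext fun X => ?_
  obtain ⟨A⟩ := X
  refine (F.obj.map_comp _ _).symm.trans ?_
  let P : WCor k := ⟨A.tensor D⟩
  refine congrArg (fun f : P ⟶ P => F.obj.map f.op) ?_
  refine (congrArg₂ (· ≫ ·) ((congrArg ((WCor.prod D).map ·) (WCor.sec_app _ _ A)).trans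
    (WCor.prod_map_graph _ D)) (WCor.prodProdMap_app c A)).trans ?_
  refine (WCor.graph_comp _ _).symm.trans (Eq.trans (congrArg WCor.graph ?_)
    (WCor.prodMap_app _ A).symm)
  refine SmAlg.coprod_hom_ext (by simp) ?_
  rw [SmAlg.inr_desc_assoc, SmAlg.inr_desc, ← h, Category.assoc, Category.assoc]
  refine congrArg (c ≫ ·) (SmAlg.coprod_hom_ext ?_ (by simp))
  simp only [SmAlg.inl_desc_assoc, Category.assoc, SmAlg.inl_desc, SmAlg.inr_desc_assoc]
  exact congrArg (_ ≫ ·) (SmAlg.point_hom_ext _ _)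

/-- The homotopy moves only `Spec D` and lies over the base `X`. Hence it preserves the sections
pulled back from `X` and descends to the quotient of `F(- × Spec D)` by `F`. -/
theorem shiftProj_shiftHomotopy (F : PreWtr k) :
    (shiftProj D).app F ≫ shiftHomotopy c F = (shiftProj (affineLine k)).app F ≫
      (PreWtr.shift.obj (affineLine k)).map ((shiftProj D).app F) := by
  refine hom_ext fun X => ?_
  obtain ⟨A⟩ := X
  refine (F.obj.map_comp _ _).symm.trans (Eq.trans ?_ (F.obj.map_comp _ _))
  let P : WCor k := ⟨(A.tensor (affineLine k)).tensor D⟩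
  refine congrArg (fun f : P ⟶ ⟨A⟩ => F.obj.map f.op) ?_
  refine (congrArg (· ≫ WCor.graph (SmAlg.inl A D)) (WCor.prodProdMap_app c A)).trans ?_
  refine (WCor.graph_comp _ _).symm.trans (Eq.trans (congrArg WCor.graph ?_)
    (WCor.graph_comp _ _))
  exact SmAlg.inl_desc _ _

/-- An endomorphism of `Spec D` which is constant at a rational point acts through `F`, so it
becomes zero in the quotient of `F(- × Spec D)` by `F`. -/
theorem shift_map_comp_unit (v : D ⟶ SmAlg.point k) (F : PreWtr k) :
    (PreWtr.shift.map (v ≫ SmAlg.unit D)).app F =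
      (shiftSec D v).app F ≫ (shiftProj D).app F := by
  refine hom_ext fun X => ?_
  obtain ⟨A⟩ := X
  refine Eq.trans ?_ (F.obj.map_comp _ _)
  let P : WCor k := ⟨A.tensor D⟩
  refine congrArg (fun f : P ⟶ P => F.obj.map f.op) ?_
  refine (WCor.prodMap_app _ A).trans (Eq.trans ?_
    (congrArg (WCor.graph (SmAlg.inl A D) ≫ ·) (WCor.sec_app D v A)).symm)
  refine Eq.trans (congrArg WCor.graph ?_) (WCor.graph_comp _ _)
  refine SmAlg.coprod_hom_ext (by simp) ?_
  rw [SmAlg.inr_desc, SmAlg.inr_desc_assoc, Category.assoc, Category.assoc]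
  exact congrArg (_ ≫ ·) (SmAlg.point_hom_ext _ _)

/-- If `D` contracts to a rational point, then the quotient of `F (- × Spec D)` by `F` is
contractible. -/
theorem isContractible_of_exact {v : D ⟶ SmAlg.point k}
    (h₀ : c ≫ SmAlg.desc (affineLinePoint k 0 ≫ SmAlg.unit D) (𝟙 D) = 𝟙 D)
    (h₁ : c ≫ SmAlg.desc (affineLinePoint k 1 ≫ SmAlg.unit D) (𝟙 D) = v ≫ SmAlg.unit D)
    {F E : PreWtr k} (g : (PreWtr.shift.obj D).obj F ⟶ E) (w : (shiftProj D).app F ≫ g = 0)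
    (hS : (ShortComplex.mk _ g w).ShortExact) : IsContractible E := by
  have : Epi g := hS.epi_g
  let T := PreWtr.shift.obj (affineLine k)
  -- The homotopy maps the image of `F` to that of `F(- × 𝔸¹)`, so it induces the contraction `h` of
  -- the quotient.
  have hw : (shiftProj D).app F ≫ (shiftHomotopy c F ≫ T.map g) = 0 := by
    rw [← Category.assoc, shiftProj_shiftHomotopy, Category.assoc, ← T.map_comp, w, T.map_zero,
      comp_zero]
  obtain ⟨h, hh⟩ : ∃ h, g ≫ h = shiftHomotopy c F ≫ T.map g :=
    ⟨hS.exact.desc _ hw, hS.exact.g_desc _ hw⟩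
  have key (t : k) : g ≫ h ≫ (shiftSec (affineLine k) (affineLinePoint k t)).app E =
      shiftHomotopy c F ≫ (shiftSec (affineLine k) (affineLinePoint k t)).app _ ≫ g := by
    rw [← Category.assoc, hh, Category.assoc]
    exact congrArg (shiftHomotopy c F ≫ ·)
      ((shiftSec (affineLine k) (affineLinePoint k t)).naturality g)
  refine ⟨h, ?_, ?_⟩ <;> rw [← cancel_epi g, key, ← Category.assoc]
  · rw [shiftHomotopy_shiftSec c 0 _ h₀, CategoryTheory.Functor.map_id]
    exact (Category.id_comp _).trans (Category.comp_id _).symm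
  · rw [shiftHomotopy_shiftSec c 1 _ h₁, shift_map_comp_unit, Category.assoc, w, comp_zero,
      comp_zero]

end

section

variable (k) (n : ℕ)

variable {n} in
/-- The coordinates of `Δⁿ`. -/
noncomputable def simplexCoord (i : Fin (n + 1)) : (simplices k).obj (op ⦋n⦌) :=
  (SimplexAlg.x k i : SimplexAlg k n)

variable {n} in
/-- The coordinates of the contraction of `Δⁿ` to its first vertex. -/
noncomputable def simplexContractCoord (i : Fin (n + 1)) :
    (affineLine k).tensor ((simplices k).obj (op ⦋n⦌)) :=
  (1 - SmAlg.toAlgHom (SmAlg.inl _ _) (SmAlg.coord k)) *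
    SmAlg.toAlgHom (SmAlg.inr _ _) (simplexCoord k i) +
      if i = 0 then SmAlg.toAlgHom (SmAlg.inl _ _) (SmAlg.coord k) else 0

/-- The path `(1 - t) x + t e₀` stays in the hyperplane where the coordinates have sum one. -/
theorem sum_simplexContractCoord : ∑ i, simplexContractCoord k (n := n) i = 1 := by
  have : ∑ i, SmAlg.toAlgHom (SmAlg.inr (affineLine k) ((simplices k).obj (op ⦋n⦌)))
      (simplexCoord k i) = 1 := by
    refine (map_sum _ _ _).symm.trans ?_
    exact (congrArg _ (SimplexAlg.sum_x k n)).trans (map_one _)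
  simp only [simplexContractCoord]
  rw [Finset.sum_add_distrib, ← Finset.mul_sum, this, Finset.sum_ite_eq']
  simp

/-- The contraction of `Δⁿ` to its first vertex. -/
noncomputable def simplexContract :
    (simplices k).obj (op ⦋n⦌) ⟶ (affineLine k).tensor ((simplices k).obj (op ⦋n⦌)) :=
  SimplexAlg.lift (simplexContractCoord k) (sum_simplexContractCoord k n)

theorem sum_firstVertex : ∑ i : Fin (n + 1), (if i = 0 then 1 else 0 : k) = 1 := by simp

/-- The first vertex of `Δⁿ`. -/
noncomputable def firstVertex : (simplices k).obj (op ⦋n⦌) ⟶ SmAlg.point k :=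
  SimplexAlg.lift (A := k) (fun i => if i = 0 then 1 else 0) (sum_firstVertex k n)

variable {k n} in
theorem simplices_hom_ext {A : SmAlg k} {f g : (simplices k).obj (op ⦋n⦌) ⟶ A}
    (h : ∀ i, SmAlg.toAlgHom f (simplexCoord k i) =
      SmAlg.toAlgHom g (simplexCoord k i)) : f = g :=
  SimplexAlg.hom_ext h

theorem toAlgHom_simplexContract (t : k) (i : Fin (n + 1)) :
    SmAlg.toAlgHom (simplexContract k n ≫
      SmAlg.desc (affineLinePoint k t ≫ SmAlg.unit _) (𝟙 _)) (simplexCoord k i) =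
      (1 - algebraMap k ((simplices k).obj (op ⦋n⦌)) t) * simplexCoord k i +
        if i = 0 then algebraMap k ((simplices k).obj (op ⦋n⦌)) t else 0 := by
  rw [SmAlg.toAlgHom_comp]
  refine (congrArg _ (SimplexAlg.lift_x _ (sum_simplexContractCoord k n) i)).trans ?_
  rw [simplexContractCoord]
  rw [map_add, map_mul, map_sub, map_one, apply_ite (SmAlg.toAlgHom _), map_zero,
    ← SmAlg.toAlgHom_comp, ← SmAlg.toAlgHom_comp, SmAlg.inl_desc, SmAlg.inr_desc,
    SmAlg.affineLinePoint_unit, SmAlg.toAlgHom_ofElem]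
  rfl

theorem simplexContract_zero : simplexContract k n ≫
    SmAlg.desc (affineLinePoint k 0 ≫ SmAlg.unit _) (𝟙 _) = 𝟙 _ := by
  refine simplices_hom_ext fun i => (toAlgHom_simplexContract k n 0 i).trans ?_
  simp
  rfl

theorem simplexContract_one : simplexContract k n ≫
    SmAlg.desc (affineLinePoint k 1 ≫ SmAlg.unit _) (𝟙 _) = firstVertex k n ≫ SmAlg.unit _ := by
  refine simplices_hom_ext fun i => (toAlgHom_simplexContract k n 1 i).trans ?_
  rw [SmAlg.toAlgHom_comp]
  refine Eq.trans ?_ (congrArg (algebraMap k ((simplices k).obj (op ⦋n⦌))) (SimplexAlg.lift_x (A := k)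
    _ (sum_firstVertex k n) i)).symm
  rw [apply_ite (algebraMap k ((simplices k).obj (op ⦋n⦌)))]
  simp

end

theorem isContractible_of_isZero {F : PreWtr k} (h : IsZero F) : IsContractible F :=
  ⟨0, h.eq_of_src _ _, h.eq_of_src _ _⟩

theorem IsContractible.of_retract {F G : PreWtr k} (hF : IsContractible F) (i : G ⟶ F) (r : F ⟶ G)
    (h : i ≫ r = 𝟙 G) : IsContractible G := by
  obtain ⟨c, h₀, h₁⟩ := hF
  let T := PreWtr.shift.obj (affineLine k)
  have key (t : k) : (i ≫ c ≫ T.map r) ≫ (shiftSec (affineLine k) (affineLinePoint k t)).app G =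
      i ≫ (c ≫ (shiftSec (affineLine k) (affineLinePoint k t)).app F) ≫ r := by
    simp only [Category.assoc]
    exact congrArg (i ≫ c ≫ ·) ((shiftSec (affineLine k) (affineLinePoint k t)).naturality r)
  refine ⟨i ≫ c ≫ T.map r, ?_, ?_⟩
  · rw [key, h₀]
    exact (congrArg (i ≫ ·) (Category.id_comp r)).trans h
  · rw [key, h₁, zero_comp, comp_zero]

/-- Contractions of the summands define one on the direct sum, because the sections of `𝔸¹` are
natural in the presheaf. The functor `F ↦ F(- × 𝔸¹)` is not required to commute with the sum. -/
theorem isContractible_total (M : HomologicalComplex₂ (PreWtr k) (ComplexShape.up ℤ)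
    (ComplexShape.up ℤ)) (hM : ∀ p q, IsContractible ((M.X p).X q)) (n : ℤ) :
    IsContractible ((M.total (ComplexShape.up ℤ)).X n) := by
  choose c h₀ h₁ using hM
  let T := PreWtr.shift.obj (affineLine k)
  let h : (M.total (ComplexShape.up ℤ)).X n ⟶ T.obj ((M.total (ComplexShape.up ℤ)).X n) :=
    M.totalDesc fun p q hpq => c p q ≫ T.map (M.ιTotal _ p q n hpq)
  have key (t : k) (p q : ℤ) (hpq) : M.ιTotal (ComplexShape.up ℤ) p q n hpq ≫ h ≫
      (shiftSec (affineLine k) (affineLinePoint k t)).app _ =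
      (c p q ≫ (shiftSec (affineLine k) (affineLinePoint k t)).app _) ≫
        M.ιTotal (ComplexShape.up ℤ) p q n hpq := by
    dsimp only [h]
    rw [HomologicalComplex₂.ι_totalDesc_assoc, Category.assoc, Category.assoc]
    exact congrArg (c p q ≫ ·) ((shiftSec (affineLine k) (affineLinePoint k t)).naturality _)
  refine ⟨h, ?_, ?_⟩ <;> refine HomologicalComplex₂.total.hom_ext _ fun p q hpq => ?_ <;>
    refine (key _ _ _ _).trans ?_
  · rw [h₀]
    exact (Category.id_comp _).trans (Category.comp_id _).symm
  · rw [h₁, zero_comp, comp_zero]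

end WittMotives

/-! ### Comparison with the Suslin complex through the constant simplicial objects -/

namespace WittMotives

open Limits HomologicalComplex

section

variable {C : Type u} [Category.{v} C] [Abelian C] {G G' : C ⥤ CochainComplex C ℤ}

instance additive_cokernel [G'.Additive] (α : G ⟶ G') : (cokernel α).Additive where
  map_add {X Y f g} := by
    rw [← cancel_epi ((cokernel.π α).app X), ← (cokernel.π α).naturality, Preadditive.comp_add,
      ← (cokernel.π α).naturality, ← (cokernel.π α).naturality, G'.map_add, Preadditive.add_comp]

theorem isStrictlyLE_cokernel (α : G ⟶ G') {n : ℤ} {F : C} (h : (G'.obj F).IsStrictlyLE n) :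
    ((cokernel α).obj F).IsStrictlyLE n := by
  rw [CochainComplex.isStrictlyLE_iff] at h ⊢
  intro i hi
  rw [IsZero.iff_id_eq_zero, ← cancel_epi (((cokernel.π α).app F).f i)]
  exact (h i hi).eq_of_src _ _

/-- Cokernels of functors and of complexes are computed pointwise, so retractions of the components
suffice; they need be neither natural nor compatible with the differentials. -/
theorem degreewiseSplit_cokernel (α : G ⟶ G') (hα : ∀ F i, ∃ r, (α.app F).f i ≫ r = 𝟙 _) (F : C) :
    DegreewiseSplit (ShortComplex.mk (α.app F) ((cokernel.π α).app F)
      (congrArg (NatTrans.app · F) (cokernel.condition α))) := by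
  have (F : C) (i : ℤ) : Mono ((α.app F).f i) := by
    obtain ⟨r, hr⟩ := hα F i
    exact mono_of_mono_fac hr
  have (F : C) : Mono (α.app F) := mono_of_mono_f _ (this F)
  have : Mono α := NatTrans.mono_of_mono_app α
  have hS : (ShortComplex.mk α (cokernel.π α) (cokernel.condition α)).ShortExact :=
    { exact := ShortComplex.exact_of_g_is_cokernel _ (cokernelIsCokernel α) }
  have hF := hS.map_of_exact ((evaluation C _).obj F)
  have hi := (shortExact_iff_degreewise_shortExact _).1 hF
  intro i
  obtain ⟨r, hr⟩ := hα F i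
  exact ⟨ShortComplex.Splitting.ofExactOfRetraction _ (hi i).exact r hr (hi i).epi_g⟩

variable [∀ K : HomologicalComplex₂ C (ComplexShape.up ℤ) (ComplexShape.up ℤ),
    K.HasTotal (ComplexShape.up ℤ)] [G.Additive] [G'.Additive]

/-- The functoriality of `totalOf G` in `G`. -/
noncomputable def totalOfMap (α : G ⟶ G') : totalOf G ⟶ totalOf G' :=
  Functor.whiskerRight (NatTrans.mapHomologicalComplex α (ComplexShape.up ℤ)) _

theorem totalOfMap_comp_cokernel (α : G ⟶ G') (K : CochainComplex C ℤ) :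
    (totalOfMap α).app K ≫ (totalOfMap (cokernel.π α)).app K = 0 := by
  let T := HomologicalComplex₂.totalFunctor C (ComplexShape.up ℤ) (ComplexShape.up ℤ)
    (ComplexShape.up ℤ)
  refine (T.map_comp _ _).symm.trans ((congrArg T.map ?_).trans (T.map_zero _ _))
  ext p : 1
  exact congrArg (NatTrans.app · (K.X p)) (cokernel.condition α)

theorem degreewiseSplit_totalOf_cokernel (α : G ⟶ G')
    (hα : ∀ F i, ∃ r, (α.app F).f i ≫ r = 𝟙 _) (K : CochainComplex C ℤ) :
    DegreewiseSplit (ShortComplex.mk _ _ (totalOfMap_comp_cokernel α K)) :=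
  degreewiseSplit_total (ShortComplex.mk ((NatTrans.mapHomologicalComplex α _).app K)
    ((NatTrans.mapHomologicalComplex (cokernel.π α) _).app K) (by
      ext p : 1
      exact congrArg (NatTrans.app · (K.X p)) (cokernel.condition α)))
    fun p => degreewiseSplit_cokernel α hα (K.X p)

/-- The cokernel of `α` is acyclic on each object. The induction on top terms, applied to the class
of zero objects, makes its total complex acyclic, and the long exact sequence concludes. Degreewise
splitting is what keeps the sequence of total complexes exact. -/
theorem quasiIso_totalOfMap (α : G ⟶ G') (hα : ∀ F i, ∃ r, (α.app F).f i ≫ r = 𝟙 _)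
    (hα' : ∀ F, QuasiIso (α.app F)) (h : ∀ F, (G'.obj F).IsStrictlyLE 0)
    (K : CochainComplex C ℤ) (n : ℤ) (hK : K.IsStrictlyLE n) :
    QuasiIso ((totalOfMap α).app K) := by
  have hT := (degreewiseSplit_totalOf_cokernel α hα K).shortExact
  have hE (i : ℤ) : IsZero (((totalOf (cokernel α)).obj K).homology i) := by
    let R : ObjectProperty C := fun X => IsZero X
    have : R.IsClosedUnderIsomorphisms := ⟨fun e h => h.of_iso e.symm⟩
    refine prop_homology_totalOf (cokernel α) (fun F => isStrictlyLE_cokernel α (h F)) R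
      (fun F h => h) (fun S hS h₁ h₃ => hS.isZero_X₂ (h₁.eq_of_src _ _)
        (h₃.eq_of_tgt _ _)) (fun F i => ?_) K n hK i
    have hF := (degreewiseSplit_cokernel α hα F).shortExact
    exact (hF.acyclic_X₃ (hα' F) i).isZero_homology
  rw [quasiIso_iff]
  intro i
  rw [quasiIsoAt_iff_isIso_homologyMap]
  have h₁ : Mono (homologyMap ((totalOfMap α).app K) i) :=
    (hT.homology_exact₁ (i - 1) i (by simp)).mono_g ((hE (i - 1)).eq_of_src _ _)
  have h₂ : Epi (homologyMap ((totalOfMap α).app K) i) :=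
    (hT.homology_exact₂ i).epi_f ((hE i).eq_of_tgt _ _)
  exact isIso_of_mono_of_epi _

end

open Opposite Simplicial PreWtr

section

variable (C : Type u) [Category.{v} C] [Abelian C]

/-- The functor sending `F` to the complex `⋯ ⟶ F ⟶ F ⟶ F` associated to the constant simplicial
object. -/
noncomputable def constChain : C ⥤ ChainComplex C ℕ :=
  Functor.const _ ⋙ AlgebraicTopology.alternatingFaceMapComplex C

instance : (constChain C).Additive where
  map_add := rfl

/-- The inclusion of the term of degree zero. -/
noncomputable def singleToConstChain : ChainComplex.single₀ C ⟶ constChain C where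
  app F := (ChainComplex.fromSingle₀Equiv ((constChain C).obj F) F).symm (𝟙 F)
  naturality F G f := by
    refine from_single_hom_ext ?_
    have h (X : C) : ((ChainComplex.fromSingle₀Equiv ((constChain C).obj X) X).symm (𝟙 X)).f 0 =
      𝟙 X := ChainComplex.fromSingle₀Equiv_symm_apply_f_zero _
    refine (congrArg (_ ≫ ·) (h G)).trans (Eq.trans ?_ (congrArg (· ≫ f) (h F)).symm)
    exact (Category.comp_id _).trans (Eq.trans (ChainComplex.single₀_map_f_zero f)
      (Category.id_comp f).symm)

variable {C}

/-- The constant simplicial object has an extra degeneracy. -/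
instance (F : C) : QuasiIso ((singleToConstChain C).app F) :=
  inferInstanceAs (QuasiIso (SimplicialObject.Augmented.ExtraDegeneracy.const F).homotopyEquiv.inv)

theorem exists_retraction_singleToConstChain (F : C) (n : ℕ) :
    ∃ r, ((singleToConstChain C).app F).f n ≫ r = 𝟙 _ := by
  cases n with
  | zero =>
    refine ⟨𝟙 _, (Category.comp_id _).trans ?_⟩
    exact ChainComplex.fromSingle₀Equiv_symm_apply_f_zero (C := (constChain C).obj F) (𝟙 F)
  | succ n => exact ⟨0, (isZero_single_obj_X _ _ _ _ (by simp)).eq_of_src _ _⟩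

theorem exists_retraction_extendMap {K L : ChainComplex C ℕ} (f : K ⟶ L)
    (h : ∀ n, ∃ r, f.f n ≫ r = 𝟙 _) (i : ℤ) :
    ∃ r, (extendMap f ComplexShape.embeddingDownNat).f i ≫ r = 𝟙 _ := by
  by_cases hi : ∃ n, ComplexShape.embeddingDownNat.f n = i
  · obtain ⟨n, hn⟩ := hi
    obtain ⟨r, hr⟩ := h n
    rw [extendMap_f _ _ hn]
    exact ⟨(L.extendXIso _ hn).hom ≫ r ≫ (K.extendXIso _ hn).inv, by simp [reassoc_of% hr]⟩
  · exact ⟨0, (K.isZero_extend_X _ _ (by simpa using hi)).eq_of_src _ _⟩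

end

variable (k : Type u) [Field k]

/-- The projections `F ⟶ F (- × Δⁿ)`. -/
noncomputable def constToShiftSimplices :
    Functor.const SimplexCategoryᵒᵖ ⟶ (simplices k ⋙ PreWtr.shift).flip where
  app F :=
    { app n := (shiftProj ((simplices k).obj n)).app F
      naturality m n φ := by
        refine (Category.id_comp _).trans (hom_ext fun X => ?_)
        obtain ⟨A⟩ := X
        refine Eq.trans ?_ (F.obj.map_comp _ _)
        let P : WCor k := ⟨A.tensor ((simplices k).obj n)⟩
        refine congrArg (fun f : P ⟶ ⟨A⟩ => F.obj.map f.op) ?_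
        refine Eq.trans ?_ (congrArg (· ≫ WCor.graph (SmAlg.inl A ((simplices k).obj m)))
          (WCor.prodMap_app ((simplices k).map φ) A)).symm
        refine Eq.trans (congrArg WCor.graph ?_) (WCor.graph_comp _ _)
        exact (SmAlg.inl_desc (SmAlg.inl A ((simplices k).obj n))
          ((simplices k).map φ ≫ SmAlg.inr A _)).symm }
  naturality F G f := by
    refine NatTrans.ext (funext fun n => ?_)
    exact (shiftProj ((simplices k).obj n)).naturality f


section

variable {C : Type u} [Category.{v} C] [Abelian C]
  [∀ K : HomologicalComplex₂ C (ComplexShape.up ℤ) (ComplexShape.up ℤ),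
    K.HasTotal (ComplexShape.up ℤ)]

/-- Each term of the total complex has a single nonzero summand, the one in row `0`. -/
theorem isIso_toTotal {K : CochainComplex C ℤ}
    {M : HomologicalComplex₂ C (ComplexShape.up ℤ) (ComplexShape.up ℤ)}
    (a : ∀ q, K.X q ⟶ (M.X q).X 0)
    (h₁ : ∀ i j, K.d i j ≫ a j = a i ≫ (M.d i j).f 0) (h₂ : ∀ q, a q ≫ (M.X q).d 0 1 = 0)
    (ha : ∀ q, IsIso (a q)) (hM : ∀ p q, q ≠ 0 → IsZero ((M.X p).X q)) :
    IsIso (toTotal M a h₁ h₂) := by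
  have h (n : ℤ) : IsIso ((toTotal M a h₁ h₂).f n) := by
    let ψ : (M.total (ComplexShape.up ℤ)).X n ⟶ K.X n :=
      HomologicalComplex₂.totalDesc _ fun p q hpq =>
        if h : q = 0 then (M.XXIsoOfEq _ _ _ (show p = n by
          have : p + q = n := hpq
          lia) h).hom ≫ inv (a n) else 0
    refine ⟨ψ, ?_, ?_⟩
    · dsimp only [ψ, toTotal]
      rw [Category.assoc, HomologicalComplex₂.ι_totalDesc, dif_pos rfl]
      simp
    · refine HomologicalComplex₂.total.hom_ext _ fun p q hpq => ?_
      by_cases hq : q = 0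
      · subst hq
        obtain rfl : p = n := by
          have : p + 0 = n := hpq
          lia
        dsimp only [ψ, toTotal]
        rw [HomologicalComplex₂.ι_totalDesc_assoc, dif_pos rfl, Category.comp_id]
        simp
      · exact (hM p q hq).eq_of_src _ _
  exact Hom.isIso_of_components _

end

/-- The functor sending `F` to the complex `F` concentrated in degree zero. -/
noncomputable def singleCochain : PreWtr k ⥤ CochainComplex (PreWtr k) ℤ :=
  ChainComplex.single₀ (PreWtr k) ⋙ ComplexShape.embeddingDownNat.extendFunctor (PreWtr k)

/-- The functor sending `F` to the complex `⋯ ⟶ F ⟶ F ⟶ F` associated to the constant simplicial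
object. -/
noncomputable def constCochain : PreWtr k ⥤ CochainComplex (PreWtr k) ℤ :=
  constChain (PreWtr k) ⋙ ComplexShape.embeddingDownNat.extendFunctor (PreWtr k)

instance : (singleCochain k).Additive := by
  unfold singleCochain
  infer_instance

instance : (constCochain k).Additive := by
  unfold constCochain
  infer_instance

/-- The inclusion of the term of degree zero. -/
noncomputable def singleToConst : singleCochain k ⟶ constCochain k :=
  Functor.whiskerRight (singleToConstChain (PreWtr k)) _

/-- The morphism from the constant complex to the Suslin complex. -/
noncomputable def constToSuslin : constCochain k ⟶ suslinPresheaf k :=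
  Functor.whiskerRight (constToShiftSimplices k)
    (AlgebraicTopology.alternatingFaceMapComplex (PreWtr k) ⋙
      ComplexShape.embeddingDownNat.extendFunctor (PreWtr k))

variable {k}

theorem exists_retraction_singleToConst (F : PreWtr k) (i : ℤ) :
    ∃ r, ((singleToConst k).app F).f i ≫ r = 𝟙 _ :=
  exists_retraction_extendMap _ (exists_retraction_singleToConstChain F) i

theorem quasiIso_singleToConst (F : PreWtr k) : QuasiIso ((singleToConst k).app F) :=
  inferInstanceAs (QuasiIso (extendMap ((singleToConstChain _).app F) _))

/-- In each degree, restriction to a vertex of the simplex retracts the pullback along the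
projection. Compatibility with the faces is not needed. -/
theorem exists_retraction_constToSuslin (F : PreWtr k) (i : ℤ) :
    ∃ r, ((constToSuslin k).app F).f i ≫ r = 𝟙 _ :=
  exists_retraction_extendMap ((AlgebraicTopology.alternatingFaceMapComplex (PreWtr k)).map
    ((constToShiftSimplices k).app F)) (fun n => ⟨(shiftSec _ (firstVertex k n)).app F,
      shiftProj_shiftSec_app _ _ _⟩) i

/-- The identification of the term of degree zero of `singleCochain`. -/
noncomputable def singleCochainXIso (F : PreWtr k) : ((singleCochain k).obj F).X 0 ≅ F :=
  extendXIso ((ChainComplex.single₀ (PreWtr k)).obj F) ComplexShape.embeddingDownNat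
    (i := 0) (i' := 0) (by simp)

theorem isZero_singleCochain_X (F : PreWtr k) (q : ℤ) (hq : q ≠ 0) :
    IsZero (((singleCochain k).obj F).X q) := by
  by_cases hi : ∃ n, ComplexShape.embeddingDownNat.f n = q
  · obtain ⟨n, hn⟩ := hi
    refine IsZero.of_iso ?_ (extendXIso ((ChainComplex.single₀ (PreWtr k)).obj F) _ hn)
    refine isZero_single_obj_X _ _ _ _ ?_
    rintro rfl
    exact hq (hn.symm.trans (by simp))
  · exact isZero_extend_X _ _ _ (by simpa using hi)

theorem singleCochainXIso_inv_naturality {F G : PreWtr k} (f : F ⟶ G) :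
    f ≫ (singleCochainXIso G).inv =
      (singleCochainXIso F).inv ≫ ((singleCochain k).map f).f 0 := by
  have h : ComplexShape.embeddingDownNat.f 0 = 0 := by simp
  have e : ((singleCochain k).map f).f 0 = (singleCochainXIso F).hom ≫ f ≫
      (singleCochainXIso G).inv := (extendMap_f ((ChainComplex.single₀ (PreWtr k)).map f) _ h).trans
    (congrArg (fun t => (singleCochainXIso F).hom ≫ t ≫ (singleCochainXIso G).inv)
      (ChainComplex.single₀_map_f_zero f))
  rw [e, Iso.inv_hom_id_assoc]

theorem singleCochainXIso_inv_f (F : PreWtr k) : (singleCochainXIso F).inv ≫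
    ((singleToConst k ≫ constToSuslin k).app F).f 0 = suslinUnitZero F := by
  have h : ComplexShape.embeddingDownNat.f 0 = 0 := by simp
  let d := ((constChain (PreWtr k)).obj F).extendXIso ComplexShape.embeddingDownNat h
  let d' := (((AlgebraicTopology.alternatingFaceMapComplex (PreWtr k)).obj
    (shiftSimplices F)).extendXIso ComplexShape.embeddingDownNat h)
  have e₁ : ((singleToConst k).app F).f 0 = (singleCochainXIso F).hom ≫ d.inv :=
    (extendMap_f ((singleToConstChain _).app F) _ h).trans (congrArg ((singleCochainXIso F).hom ≫ ·)
      ((congrArg (· ≫ d.inv) (ChainComplex.fromSingle₀Equiv_symm_apply_f_zero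
        (C := (constChain (PreWtr k)).obj F) (𝟙 F))).trans (Category.id_comp d.inv)))
  have e₂ : ((constToSuslin k).app F).f 0 = d.hom ≫ (shiftProj ((simplices k).obj (op ⦋0⦌))).app F ≫
    d'.inv := extendMap_f ((AlgebraicTopology.alternatingFaceMapComplex (PreWtr k)).map
      ((constToShiftSimplices k).app F)) _ h
  refine (congrArg (_ ≫ ·) (congrArg₂ (· ≫ ·) e₁ e₂)).trans ?_
  have key {X Y Z W : PreWtr k} (a : X ≅ Y) (b : Z ≅ Y) (t : Y ⟶ W) :
      a.inv ≫ (a.hom ≫ b.inv) ≫ b.hom ≫ t = t := by simp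
  exact key (Y := F) (singleCochainXIso F) d _

/-- The detour through constant simplicial objects is essential. The cokernel of the unit itself has
terms `F(- × Δⁿ)` in negative degrees, not contractible in general, whereas the cokernel of the
second factor involves the quotients `F(- × Δⁿ) / F`. -/
theorem suslinUnit_app_eq (K : CochainComplex (PreWtr k) ℤ) :
    ∃ f : K ⟶ (totalOf (singleCochain k)).obj K, IsIso f ∧
    (suslinUnit k).app K =
      f ≫ (totalOfMap (singleToConst k)).app K ≫ (totalOfMap (constToSuslin k)).app K := by
  let M : HomologicalComplex₂ (PreWtr k) (ComplexShape.up ℤ) (ComplexShape.up ℤ) :=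
    ((singleCochain k).mapHomologicalComplex (ComplexShape.up ℤ)).obj K
  let M' : HomologicalComplex₂ (PreWtr k) (ComplexShape.up ℤ) (ComplexShape.up ℤ) :=
    (suslinBicomplex k).obj K
  let φ : M ⟶ M' := (NatTrans.mapHomologicalComplex (singleToConst k ≫ constToSuslin k) _).app K
  have h₁ (i j : ℤ) : K.d i j ≫ (singleCochainXIso (K.X j)).inv =
    (singleCochainXIso (K.X i)).inv ≫ (M.d i j).f 0 := singleCochainXIso_inv_naturality _
  have h₂ (q : ℤ) : (singleCochainXIso (K.X q)).inv ≫ (M.X q).d 0 1 = 0 :=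
    (isZero_singleCochain_X _ 1 (by simp)).eq_of_tgt _ _
  let f : K ⟶ M.total (ComplexShape.up ℤ) := toTotal M (fun q => (singleCochainXIso _).inv) h₁ h₂
  refine ⟨f, isIso_toTotal _ _ _ (fun q => Iso.isIso_inv _)
    fun p q hq => isZero_singleCochain_X _ _ hq, ?_⟩
  have := toTotal_naturality (𝟙 K) φ _ h₁ h₂ (fun q => suslinUnitZero (K.X q))
    (fun i j => suslinUnitZero_naturality (K.d i j))
    (fun q => suslinUnitZero_d (K.X q) 1 (by simp))
    (fun q => (Category.id_comp _).trans (singleCochainXIso_inv_f (K.X q)).symm)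
  refine (Category.id_comp _).symm.trans (this.trans (congrArg (f ≫ ·) ?_))
  let T := HomologicalComplex₂.totalFunctor (PreWtr k) (ComplexShape.up ℤ) (ComplexShape.up ℤ)
    (ComplexShape.up ℤ)
  exact T.map_comp ((NatTrans.mapHomologicalComplex (singleToConst k) _).app K)
    ((NatTrans.mapHomologicalComplex (constToSuslin k) _).app K)

/-- The cokernel of `constToSuslin k` has contractible terms. -/
theorem isContractible_cokernel_constToSuslin (F : PreWtr k) (i : ℤ) :
    IsContractible (((cokernel (constToSuslin k)).obj F).X i) := by
  have hS := (degreewiseSplit_cokernel (constToSuslin k) exists_retraction_constToSuslin F i).some.shortExact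
  let π : ((suslinPresheaf k).obj F).X i ⟶ ((cokernel (constToSuslin k)).obj F).X i :=
    ((cokernel.π (constToSuslin k)).app F).f i
  by_cases hi : ∃ n, ComplexShape.embeddingDownNat.f n = i
  · obtain ⟨n, hn⟩ := hi
    let d := ((constChain (PreWtr k)).obj F).extendXIso ComplexShape.embeddingDownNat hn
    let d' := (((AlgebraicTopology.alternatingFaceMapComplex (PreWtr k)).obj
      (shiftSimplices F)).extendXIso ComplexShape.embeddingDownNat hn)
    have e : ((constToSuslin k).app F).f i = d.hom ≫ (shiftProj ((simplices k).obj (op ⦋n⦌))).app F ≫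
      d'.inv := extendMap_f ((AlgebraicTopology.alternatingFaceMapComplex (PreWtr k)).map
        ((constToShiftSimplices k).app F)) _ hn
    have w : (d.hom ≫ (shiftProj ((simplices k).obj (op ⦋n⦌))).app F ≫ d'.inv) ≫ π = 0 :=
      (congrArg (· ≫ π) e).symm.trans (congrArg (fun t => (t.app F).f i)
        (cokernel.condition (constToSuslin k)))
    have w' : (shiftProj ((simplices k).obj (op ⦋n⦌))).app F ≫ d'.inv ≫ π = 0 := by
      have key {X Y Z W V : PreWtr k} (d : X ≅ Y) (p : Y ⟶ Z) (q : Z ⟶ W) (π : W ⟶ V)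
        (h : (d.hom ≫ p ≫ q) ≫ π = 0) : p ≫ q ≫ π = 0 := by
        rw [← cancel_epi d.hom, comp_zero, ← h]
        simp
      exact key (Y := F) d _ _ _ w
    -- In degree `-n` the sequence is `F → F(- × Δⁿ)` followed by the quotient, and `Δⁿ` contracts
    -- to its first vertex.
    refine isContractible_of_exact (simplexContract k n) (simplexContract_zero k n)
      (simplexContract_one k n) (d'.inv ≫ π) w' (ShortComplex.shortExact_of_iso ?_ hS)
    refine ShortComplex.isoMk d d' (Iso.refl _) ?_ ?_
    · have key {X Y Z W : PreWtr k} (d : X ≅ Y) (d' : W ≅ Z) (p : Y ⟶ Z) (s : X ⟶ W)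
          (h : s = d.hom ≫ p ≫ d'.inv) : d.hom ≫ p = s ≫ d'.hom := by simp [h]
      exact key (Y := F) d d' _ _ e
    · exact (Iso.hom_inv_id_assoc d' π).trans (Category.comp_id _).symm
  · have : Epi π := hS.epi_g
    refine isContractible_of_isZero ?_
    rw [IsZero.iff_id_eq_zero, ← cancel_epi π]
    exact (isZero_extend_X _ _ _ (by simpa using hi)).eq_of_src _ _


theorem distinguished_of_iso_obj₁ {T : Type*} [Category* T] [HasZeroObject T] [HasShift T ℤ]
    [Preadditive T] [∀ n : ℤ, (shiftFunctor T n).Additive] [Pretriangulated T] {t : Triangle T}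
    (ht : t ∈ distTriang T) {X : T} (e : X ≅ t.obj₁) :
    Triangle.mk (e.hom ≫ t.mor₁) t.mor₂ (t.mor₃ ≫ e.inv⟦(1 : ℤ)⟧') ∈ distTriang T :=
  isomorphic_distinguished _ ht _ (Triangle.isoMk _ _ e (Iso.refl _) (Iso.refl _)
    (Category.comp_id _) ((Category.comp_id _).trans (Category.id_comp _).symm) (by
      refine (Category.assoc _ _ _).trans (Eq.trans ?_ (Category.id_comp _).symm)
      refine (congrArg (t.mor₃ ≫ ·) (((shiftFunctor T (1 : ℤ)).map_comp _ _).symm.trans ?_)).trans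
        (Category.comp_id _)
      exact (congrArg _ e.inv_hom_id).trans ((shiftFunctor T (1 : ℤ)).map_id _)))

section

variable [HasDerivedCategory.{w} (PreWtr k)]

/-- The canonical morphism `K ⟶ C^* K` fits in a distinguished triangle with a complex of
contractible presheaves. -/
theorem exists_distinguished_suslinUnit (K : (boundedAbove k).FullSubcategory) :
    ∃ (B : DMinus k) (_ : contractiblePart k B) (f : B.obj ⟶ DerivedCategory.Q.obj K.obj)
      (h : DerivedCategory.Q.obj ((suslin k).obj K.obj) ⟶ B.obj⟦(1 : ℤ)⟧),
      Triangle.mk f (DerivedCategory.Q.map ((suslinUnit k).app K.obj)) h ∈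
        distTriang (DerivedCategory (PreWtr k)) := by
  obtain ⟨n, hn⟩ := K.property
  obtain ⟨f, hf, hK⟩ := suslinUnit_app_eq K.obj
  have hj := quasiIso_totalOfMap (singleToConst k) exists_retraction_singleToConst
    quasiIso_singleToConst (fun F => isStrictlyLE_extend _) K.obj n hn
  let φ := (totalOfMap (constToSuslin k)).app K.obj
  let E := (totalOf (cokernel (constToSuslin k))).obj K.obj
  have hS := (degreewiseSplit_totalOf_cokernel (constToSuslin k) exists_retraction_constToSuslin
    K.obj).shortExact
  have hE : E.IsStrictlyLE n := isStrictlyLE_totalOf (cokernel (constToSuslin k))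
    (fun F => isStrictlyLE_cokernel (constToSuslin k) (isStrictlyLE_extend _)) K.obj n
  have hE' (i : ℤ) : IsContractible (E.X i) := isContractible_total _
    (fun p q => isContractible_cokernel_constToSuslin _ _) i
  let i : K.obj ⟶ (totalOf (constCochain k)).obj K.obj := f ≫ (totalOfMap (singleToConst k)).app K.obj
  have hi : QuasiIso i := inferInstance
  have hT := DerivedCategory.triangleOfSES_distinguished hS
  have : IsIso (DerivedCategory.Q.map i) :=
    (DerivedCategory.isIso_Q_map_iff_quasiIso _ i).2 hi
  let ei := asIso (DerivedCategory.Q.map i)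
  -- The complex of constant simplicial objects is replaced by `K`, along the invertible `ei`, as
  -- first vertex of the triangle of the split sequence.
  have hT' : Triangle.mk (DerivedCategory.Q.map ((suslinUnit k).app K.obj))
      (DerivedCategory.triangleOfSES hS).mor₂ ((DerivedCategory.triangleOfSES hS).mor₃ ≫
        ei.inv⟦(1 : ℤ)⟧') ∈ distTriang (DerivedCategory (PreWtr k)) := by
    refine isomorphic_distinguished _ hT _ (Triangle.isoMk _ _ ei
      (Iso.refl _) (Iso.refl _) ?_ ?_ ?_)
    · refine (Category.comp_id _).trans (Eq.trans ?_ (DerivedCategory.Q.map_comp i φ))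
      exact congrArg DerivedCategory.Q.map (hK.trans (Category.assoc _ _ _).symm)
    · exact (Category.comp_id _).trans (Category.id_comp _).symm
    · refine (Category.assoc _ _ _).trans (Eq.trans ?_ ((Category.comp_id _).trans
        (Category.id_comp _).symm))
      refine congrArg (_ ≫ ·) (((shiftFunctor _ (1 : ℤ)).map_comp _ _).symm.trans ?_)
      exact (congrArg _ ei.inv_hom_id).trans ((shiftFunctor _ (1 : ℤ)).map_id _)
  -- The fibre is the cokernel complex shifted by `-1`, which raises its upper bound by one.
  let B : (boundedAbove k).FullSubcategory := ⟨E⟦(-1 : ℤ)⟧, n + 1,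
    E.isStrictlyLE_shift n (-1) (n + 1) (by lia)⟩
  let e : DerivedCategory.Q.obj B.obj ≅ (DerivedCategory.Q.obj E)⟦(-1 : ℤ)⟧ :=
    (DerivedCategory.Q.commShiftIso (-1 : ℤ)).app E
  exact ⟨(QMinus k).obj B, ⟨B, fun n => hE' (n + -1), ⟨Iso.refl _⟩⟩, _, _,
    distinguished_of_iso_obj₁ (inv_rot_of_distTriang _ hT') e⟩

end

end WittMotives

/-! ### Orthogonality of contractible and homotopy invariant objects -/

namespace WittMotives

open Limits HomologicalComplex PreWtr

section

variable {T : Type*} [Category* T] [HasZeroMorphisms T] (P : ObjectProperty T) (J : Type*)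
  [Category* J]

instance : P.rightOrthogonal.IsClosedUnderLimitsOfShape J where
  limitsOfShape_le := by
    rintro A ⟨h⟩ X f hX
    exact h.isLimit.hom_ext fun j => (h.prop_diag_obj j _ hX).trans zero_comp.symm

instance : P.leftOrthogonal.IsClosedUnderColimitsOfShape J where
  colimitsOfShape_le := by
    rintro A ⟨h⟩ X f hX
    exact h.isColimit.hom_ext fun j => (h.prop_diag_obj j _ hX).trans comp_zero.symm

end

variable {k : Type u} [Field k]

/-- Precomposition is exact pointwise. With the corresponding statement for colimits, `shiftComplex`
preserves quasi-isomorphisms. -/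
instance (D : SmAlg k) : PreservesFiniteLimits (PreWtr.shift.obj D) := by
  have : PreservesFiniteLimits (PreWtr.shift.obj D ⋙ toFunctor) :=
    inferInstanceAs (PreservesFiniteLimits (toFunctor ⋙
      (Functor.whiskeringLeft _ _ AddCommGrpCat).obj (WCor.prod D).op))
  exact ⟨fun J _ _ => ⟨fun {K} => preservesLimit_of_reflects_of_preserves _ toFunctor⟩⟩

instance (D : SmAlg k) : PreservesFiniteColimits (PreWtr.shift.obj D) := by
  have : PreservesFiniteColimits (PreWtr.shift.obj D ⋙ toFunctor) :=
    inferInstanceAs (PreservesFiniteColimits (toFunctor ⋙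
      (Functor.whiskeringLeft _ _ AddCommGrpCat).obj (WCor.prod D).op))
  exact ⟨fun J _ _ => ⟨fun {K} => preservesColimit_of_reflects_of_preserves _ toFunctor⟩⟩

/-- The functor sending a complex `K` to `K (- × 𝔸¹)`. -/
noncomputable abbrev shiftComplex (D : SmAlg k) :
    CochainComplex (PreWtr k) ℤ ⥤ CochainComplex (PreWtr k) ℤ :=
  (PreWtr.shift.obj D).mapHomologicalComplex (ComplexShape.up ℤ)

/-- The projection `K ⟶ K (- × D)`. -/
noncomputable def complexProj (D : SmAlg k) : 𝟭 _ ⟶ shiftComplex D where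
  app K := { f := fun i => (shiftProj D).app (K.X i)
             comm' := fun i j _ => ((shiftProj D).naturality (K.d i j)).symm }
  naturality K L f := by
    ext i : 1
    exact (shiftProj D).naturality (f.f i)

/-- The restriction `K (- × D) ⟶ K` along a rational point of `D`. -/
noncomputable def complexSec (D : SmAlg k) (x : D ⟶ SmAlg.point k) : shiftComplex D ⟶ 𝟭 _ where
  app K := { f := fun i => (shiftSec D x).app (K.X i)
             comm' := fun i j _ => ((shiftSec D x).naturality (K.d i j)).symm }
  naturality K L f := by
    ext i : 1
    exact (shiftSec D x).naturality (f.f i)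

theorem complexProj_complexSec (D : SmAlg k) (x : D ⟶ SmAlg.point k)
    (K : CochainComplex (PreWtr k) ℤ) :
    (complexProj D).app K ≫ (complexSec D x).app K = 𝟙 K := by
  ext i : 1
  exact shiftProj_shiftSec_app D x (K.X i)

theorem isContractible_single_X {F : PreWtr k} (hF : IsContractible F) (a i : ℤ) :
    IsContractible (((single _ (ComplexShape.up ℤ) a).obj F).X i) := by
  by_cases hi : i = a
  · subst hi
    let e := singleObjXSelf (ComplexShape.up ℤ) i F
    exact hF.of_retract e.hom e.inv e.hom_inv_id
  · exact isContractible_of_isZero (isZero_single_obj_X _ _ _ _ hi)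

section

variable [HasDerivedCategory.{w} (PreWtr k)]

open DerivedCategory

/-- After writing `f` as a fraction, one may replace `Y` by a quasi-isomorphic `Y'`. In the derived
category both sections of `Y'(- × 𝔸¹)` invert the projection, hence coincide. The numerator is its
composite with `s₀` through the contraction, so also the composite with `s₁`, which is zero. -/
theorem eq_zero_of_contraction {X Y : CochainComplex (PreWtr k) ℤ}
    (h : X ⟶ (shiftComplex (affineLine k)).obj X)
    (h₀ : h ≫ (complexSec (affineLine k) (affineLinePoint k 0)).app X = 𝟙 X)
    (h₁ : h ≫ (complexSec (affineLine k) (affineLinePoint k 1)).app X = 0)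
    (hY : QuasiIso ((complexProj (affineLine k)).app Y)) (f : Q.obj X ⟶ Q.obj Y) : f = 0 := by
  obtain ⟨Y', g, s, hs, rfl⟩ := left_fac f
  rw [isIso_Q_map_iff_quasiIso] at hs
  let S := shiftComplex (affineLine k)
  have hs' : QuasiIso (S.map s) := inferInstance
  have hY' : QuasiIso ((complexProj (affineLine k)).app Y') := by
    have e := (complexProj (affineLine k)).naturality s
    have e' : s ≫ (complexProj (affineLine k)).app Y' =
        (complexProj (affineLine k)).app Y ≫ S.map s := e
    have : QuasiIso (s ≫ (complexProj (affineLine k)).app Y') := by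
      rw [e']
      exact quasiIso_comp _ _
    exact quasiIso_of_comp_left s _
  have hY'' : IsIso (Q.map ((complexProj (affineLine k)).app Y')) :=
    (isIso_Q_map_iff_quasiIso _ _).2 hY'
  let σ (t : k) : S.obj Y' ⟶ Y' := (complexSec (affineLine k) (affineLinePoint k t)).app Y'
  have e₁ (t : k) : Q.map ((complexProj (affineLine k)).app Y') ≫ Q.map (σ t) = 𝟙 _ :=
    (Q.map_comp _ _).symm.trans ((congrArg Q.map (complexProj_complexSec _ _ Y')).trans
      (Q.map_id Y'))
  have e₂ : Q.map (σ 0) = Q.map (σ 1) :=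
    (cancel_epi (Q.map ((complexProj (affineLine k)).app Y'))).1 ((e₁ 0).trans (e₁ 1).symm)
  have e₃ (t : k) : h ≫ S.map g ≫ σ t =
      (h ≫ (complexSec (affineLine k) (affineLinePoint k t)).app X) ≫ g :=
    (congrArg (h ≫ ·) ((complexSec (affineLine k) (affineLinePoint k t)).naturality g)).trans
      (Category.assoc _ _ _).symm
  have e₄ : Q.map g = 0 := by
    have a₀ : h ≫ S.map g ≫ σ 0 = g := by rw [e₃, h₀]; exact Category.id_comp g
    have a₁ : h ≫ S.map g ≫ σ 1 = 0 := by rw [e₃, h₁, zero_comp]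
    rw [← a₀, ← Category.assoc, Q.map_comp, e₂, ← Q.map_comp, Category.assoc, a₁, Q.map_zero]
  rw [e₄, zero_comp]

/-- Contractions of the terms of a complex need not commute with the differentials. For an object in
one degree there is no condition, so a contraction of complexes is available. -/
theorem eq_zero_of_isContractible_single {F G : PreWtr k} (hF : IsContractible F)
    (hG : IsHomotopyInvariant G) (a b : ℤ)
    (f : Q.obj ((single _ (ComplexShape.up ℤ) a).obj F) ⟶
      Q.obj ((single _ (ComplexShape.up ℤ) b).obj G)) : f = 0 := by
  let X := (single (PreWtr k) (ComplexShape.up ℤ) a).obj F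
  let Y := (single (PreWtr k) (ComplexShape.up ℤ) b).obj G
  have hX (i : ℤ) : IsContractible (X.X i) := isContractible_single_X hF a i
  have hY (i : ℤ) : IsHomotopyInvariant (Y.X i) := by
    by_cases hi : i = b
    · subst hi
      exact isHomotopyInvariant_of_iso (singleObjXSelf (ComplexShape.up ℤ) i G).symm hG
    · exact isHomotopyInvariant_of_isZero (isZero_single_obj_X _ _ _ _ hi)
  choose c h₀ h₁ using hX
  let h : X ⟶ (shiftComplex (affineLine k)).obj X :=
    { f := c
      comm' := fun i j _ => by
        have hd : X.d i j = 0 := rfl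
        have hd' : ((shiftComplex (affineLine k)).obj X).d i j = 0 :=
          (PreWtr.shift.obj (affineLine k)).map_zero _ _
        exact (congrArg (c i ≫ ·) hd').trans (comp_zero.trans
          (zero_comp.symm.trans (congrArg (· ≫ c j) hd.symm))) }
  have hY' (i : ℤ) : IsIso (((complexProj (affineLine k)).app Y).f i) := hY i
  have := Hom.isIso_of_components ((complexProj (affineLine k)).app Y)
  refine eq_zero_of_contraction h ?_ ?_ inferInstance f
  · exact HomologicalComplex.hom_ext _ _ h₀
  · exact HomologicalComplex.hom_ext _ _ h₁

/-- A complex in degrees at most `-1` has no morphism to `G` in degree `0`, whether or not it is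
bounded below. So only finitely many top terms of `K` matter, and they are removed one at a time. -/
theorem eq_zero_of_isContractible (G : PreWtr k) (hG : IsHomotopyInvariant G) (m : ℕ) :
    ∀ (K : CochainComplex (PreWtr k) ℤ) (_ : K.IsStrictlyLE (-1 + m))
      (_ : ∀ i, IsContractible (K.X i)) (f : Q.obj K ⟶ (singleFunctor _ 0).obj G), f = 0 := by
  induction m with
  | zero =>
    intro K hK _ f
    have : IsLE (Q.obj K) (-1 + (0 : ℕ)) := inferInstance
    exact TStructure.t.zero_of_isLE_of_isGE f (-1 + (0 : ℕ)) 0 (by simp) this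
      (inferInstanceAs (IsGE ((singleFunctor _ 0).obj G) 0))
  | succ m hm =>
    intro K hK hK' f
    obtain ⟨L, i, p, w, hL, hS⟩ := exists_degreewiseSplit_top K (-1 + (m + 1 : ℕ))
    have hT := triangleOfSES_distinguished hS.shortExact
    have hi : Q.map i ≫ f = 0 := eq_zero_of_isContractible_single (hK' _) hG _ 0 _
    obtain ⟨g, rfl⟩ := Triangle.yoneda_exact₂ _ hT f hi
    have hg : g = 0 := by
      refine hm L ?_ (fun n => ?_) g
      · have e : (-1 + (m + 1 : ℕ) - 1 : ℤ) = -1 + m := by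
          push_cast
          ring
        rwa [e] at hL
      -- The terms of the quotient `L` are retracts of those of `K`, by the degreewise splitting.
      · have s := (hS n).some
        exact (hK' n).of_retract s.s (p.f n) s.s_g
    rw [hg]
    exact comp_zero

instance : (contractiblePart k).IsClosedUnderIsomorphisms where
  of_iso := by
    rintro X Y e ⟨K, hK, ⟨i⟩⟩
    exact ⟨K, hK, ⟨i ≪≫ e⟩⟩

instance : (contractiblePart k).IsStableUnderShift ℤ where
  isStableUnderShiftBy a := ⟨by
    rintro X ⟨K, hK, ⟨i⟩⟩
    obtain ⟨n, hn⟩ := K.property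
    let K' : (boundedAbove k).FullSubcategory := ⟨K.obj⟦a⟧, n - a,
      K.obj.isStrictlyLE_shift n a (n - a) (by lia)⟩
    refine ⟨K', fun n => hK (n + a), ⟨Minus.ι.preimageIso ?_⟩⟩
    exact (Q.commShiftIso a).app K.obj ≪≫ (shiftFunctor _ a).mapIso (Minus.ι.mapIso i) ≪≫
      ((Minus.ι.commShiftIso a).app X).symm⟩

theorem invariantPart_eq : invariantPart k = homologyProp (homZero (reprQuotient (k := k))) := by
  ext X
  exact forall_congr' fun n => (homZero_reprQuotient_iff _).symm

instance : (homZero (reprQuotient (k := k))).ContainsZero where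
  exists_zero := ⟨_, isZero_zero _, fun _ _ => (isZero_zero _).eq_of_tgt _ _⟩

/-- There are no nonzero morphisms from contractible objects to homotopy invariant objects. -/
theorem rightOrthogonal_contractiblePart {X : DMinus k} (hX : invariantPart k X) :
    (contractiblePart k).rightOrthogonal X := by
  rw [invariantPart_eq] at hX
  -- The right orthogonal is triangulated and closed under products, so it contains `X` as soon as
  -- it contains the homotopy invariant presheaves in degree `0`.
  refine prop_of_homologyProp _ _ (fun F hF => ?_) hX
  rintro Y f ⟨K, hK, ⟨i⟩⟩
  rw [← cancel_epi i.hom, comp_zero]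
  ext
  obtain ⟨n, hn⟩ := K.property
  have := K.obj.isStrictlyLE_of_le n (-1 + (n + 1).toNat) (by lia)
  exact eq_zero_of_isContractible F ((homZero_reprQuotient_iff F).1 hF) _ K.obj this hK _

end

end WittMotives

/-! ### Semi-orthogonal decomposition, adjoint and generators -/

namespace WittMotives

open Limits

section

variable {T : Type*} [Category* T] [HasZeroObject T] [HasShift T ℤ] [Preadditive T]
  [∀ n : ℤ, (shiftFunctor T n).Additive] [Pretriangulated T] {A B : ObjectProperty T}

/-- If `Z` has no morphism to `A`, then `Z → X` is zero in its triangle, so the identity of `X`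
factors through a shift of `Y`. There is no nonzero morphism from such a shift to `X`, hence `X = 0`
and `Z ≅ Y`. -/
theorem leftOrthogonal_le_of_triangles [B.IsStableUnderShift ℤ] [B.IsClosedUnderIsomorphisms]
    (hBA : ∀ ⦃X⦄, A X → B.rightOrthogonal X)
    (h : ∀ Z : T, ∃ (Y X : T) (_ : B Y) (_ : A X) (f : Y ⟶ Z) (g : Z ⟶ X) (h : X ⟶ Y⟦(1 : ℤ)⟧),
      Triangle.mk f g h ∈ distTriang T) : A.leftOrthogonal ≤ B := fun Z hZ => by
  obtain ⟨Y, X, hY, hX, f, g, h, hT⟩ := h Z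
  have hX' : IsZero X := by
    obtain ⟨φ, hφ⟩ := Triangle.yoneda_exact₃ _ hT (𝟙 X) ((congrArg (· ≫ _) (hZ g hX)).trans zero_comp)
    rw [IsZero.iff_id_eq_zero]
    refine hφ.trans ?_
    rw [hBA hX φ (B.le_shift _ _ hY)]
    exact comp_zero
  have : IsIso f := (Triangle.isZero₃_iff_isIso₁ _ hT).1 hX'
  exact B.prop_of_iso (asIso f) hY

theorem rightOrthogonal_le_of_triangles [B.IsStableUnderShift ℤ] [A.IsStableUnderShift ℤ]
    [A.IsClosedUnderIsomorphisms] (hBA : ∀ ⦃X⦄, A X → B.rightOrthogonal X)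
    (h : ∀ Z : T, ∃ (Y X : T) (_ : B Y) (_ : A X) (f : Y ⟶ Z) (g : Z ⟶ X) (h : X ⟶ Y⟦(1 : ℤ)⟧),
      Triangle.mk f g h ∈ distTriang T) : B.rightOrthogonal ≤ A := fun Z hZ => by
  obtain ⟨Y, X, hY, hX, f, g, h, hT⟩ := h Z
  have hX' : IsZero Y := by
    obtain ⟨φ, hφ⟩ := Triangle.coyoneda_exact₂ _ (inv_rot_of_distTriang _ hT) (𝟙 Y)
      ((Category.id_comp _).trans (hZ f hY))
    rw [IsZero.iff_id_eq_zero]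
    refine hφ.trans ?_
    rw [hBA (A.le_shift (-1) _ hX) φ hY]
    exact zero_comp
  have : IsIso g := (Triangle.isZero₁_iff_isIso₂ _ hT).1 hX'
  exact A.prop_of_iso (asIso g).symm hX

/-- The long exact sequence of `Hom(-, W)`, where the terms at `Y` and at its shift vanish. -/
theorem bijective_comp_of_distinguished [B.IsStableUnderShift ℤ]
    {Y Z X : T} (hY : B Y) {f : Y ⟶ Z} {g : Z ⟶ X} {h : X ⟶ Y⟦(1 : ℤ)⟧}
    (hT : Triangle.mk f g h ∈ distTriang T) {W : T} (hW : B.rightOrthogonal W) :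
    Function.Bijective (fun φ : X ⟶ W => g ≫ φ) := by
  constructor
  · intro φ ψ hφψ
    rw [← sub_eq_zero]
    obtain ⟨χ, hχ⟩ := Triangle.yoneda_exact₃ _ hT (φ - ψ) (by
      exact (Preadditive.comp_sub _ _ _).trans (sub_eq_zero.2 hφψ))
    rw [hχ, hW χ (B.le_shift _ _ hY)]
    exact comp_zero
  · intro φ
    obtain ⟨ψ, hψ⟩ := Triangle.yoneda_exact₂ _ hT φ (hW (f ≫ φ) hY)
    exact ⟨ψ, hψ.symm⟩

theorem isRightAdjoint_ι_of_bijective {C : Type*} [Category* C] (A : ObjectProperty C)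
    (h : ∀ Z : C, ∃ (X : C) (_ : A X) (g : Z ⟶ X),
      ∀ W, A W → Function.Bijective (fun φ : X ⟶ W => g ≫ φ)) :
    A.ι.IsRightAdjoint := by
  choose X hX g hg using h
  let e (Z : C) (W : A.FullSubcategory) :
      ((⟨X Z, hX Z⟩ : A.FullSubcategory) ⟶ W) ≃ (Z ⟶ A.ι.obj W) :=
    (A.fullyFaithfulι.homEquiv).trans (Equiv.ofBijective _ (hg Z W.obj W.property))
  exact (Adjunction.adjunctionOfEquivLeft e fun Z W W' f φ =>
    (Category.assoc (g Z) φ.hom f.hom).symm).isRightAdjoint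

end


theorem isStrictlyLE_suslin {k : Type u} [Field k] (K : CochainComplex (PreWtr k) ℤ) (n : ℤ)
    (h : K.IsStrictlyLE n) : ((suslin k).obj K).IsStrictlyLE n :=
  isStrictlyLE_totalOf (suslinPresheaf k) (fun _ => isStrictlyLE_extend _) K n

section

variable {k : Type u} [Field k] [HasDerivedCategory.{w} (PreWtr k)]

open DerivedCategory

instance : (invariantPart k).IsStableUnderShift ℤ := by
  rw [invariantPart_eq]
  infer_instance

instance : (invariantPart k).IsClosedUnderIsomorphisms := by
  rw [invariantPart_eq]
  infer_instance

variable (k) in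
/-- The Suslin complex as an object of `D⁻`. -/
noncomputable def suslinMinus : (boundedAbove k).FullSubcategory ⥤ DMinus k :=
  ObjectProperty.lift _ ((boundedAbove k).ι ⋙ suslin k ⋙ Q) fun K => by
    obtain ⟨n, hn⟩ := K.property
    have := isStrictlyLE_suslin K.obj n hn
    exact ⟨n, inferInstanceAs (IsLE (Q.obj ((suslin k).obj K.obj)) n)⟩

variable (k) in
/-- The canonical morphism `K ⟶ C^* K` in `D⁻`. -/
noncomputable def suslinMinusUnit : QMinus k ⟶ suslinMinus k where
  app K := ObjectProperty.homMk (Q.map ((suslinUnit k).app K.obj))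
  naturality K L f := by
    ext
    exact (Q.map_comp _ _).symm.trans ((congrArg Q.map ((suslinUnit k).naturality f.hom)).trans
      (Q.map_comp _ _))

theorem invariantPart_suslinMinus (K : (boundedAbove k).FullSubcategory) :
    invariantPart k ((suslinMinus k).obj K) := fun i => by
  obtain ⟨n, hn⟩ := K.property
  exact isHomotopyInvariant_of_iso ((homologyFunctorFactors (PreWtr k) i).app
    ((suslin k).obj K.obj)).symm (isHomotopyInvariant_homology_suslin K.obj n hn i)

theorem exists_distinguished_suslinMinusUnit (K : (boundedAbove k).FullSubcategory) :
    ∃ (B : DMinus k) (_ : contractiblePart k B) (f : B ⟶ (QMinus k).obj K)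
      (h : (suslinMinus k).obj K ⟶ B⟦(1 : ℤ)⟧),
      Triangle.mk f ((suslinMinusUnit k).app K) h ∈ distTriang (DMinus k) := by
  obtain ⟨B, hB, f, h, hT⟩ := exists_distinguished_suslinUnit K
  obtain ⟨h', hT'⟩ := exists_distinguished_minus (X := B) (Y := (QMinus k).obj K)
    (Z := (suslinMinus k).obj K) (ObjectProperty.homMk f) ((suslinMinusUnit k).app K) h hT
  exact ⟨B, hB, _, h', hT'⟩

theorem exists_iso_QMinus (Z : DMinus k) :
    ∃ K : (boundedAbove k).FullSubcategory, Nonempty ((QMinus k).obj K ≅ Z) := by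
  obtain ⟨n, hn⟩ := exists_isLE Z
  obtain ⟨L, hL, ⟨i⟩⟩ := exists_iso_Q_obj_of_isLE Z.obj n
  exact ⟨⟨L, n, hL⟩, ⟨Minus.ι.preimageIso (X := (QMinus k).obj ⟨L, n, hL⟩) i.symm⟩⟩

theorem exists_distinguished_contractible_invariant (Z : DMinus k) :
    ∃ (Y X : DMinus k) (_ : contractiblePart k Y) (_ : invariantPart k X) (f : Y ⟶ Z)
      (g : Z ⟶ X) (h : X ⟶ Y⟦(1 : ℤ)⟧), Triangle.mk f g h ∈ distTriang (DMinus k) := by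
  obtain ⟨K, ⟨i⟩⟩ := exists_iso_QMinus Z
  obtain ⟨B, hB, f, h, hT⟩ := exists_distinguished_suslinMinusUnit K
  refine ⟨B, _, hB, invariantPart_suslinMinus K, f ≫ i.hom, i.inv ≫ (suslinMinusUnit k).app K, h,
    isomorphic_distinguished _ hT _ (Triangle.isoMk _ _ (Iso.refl _) i.symm (Iso.refl _) ?_ ?_ ?_)⟩
  · refine (Category.assoc _ _ _).trans (Eq.trans ?_ (Category.id_comp _).symm)
    exact (congrArg (f ≫ ·) i.hom_inv_id).trans (Category.comp_id f)
  · exact Category.comp_id _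
  · refine Eq.trans ?_ (Category.id_comp _).symm
    exact (congrArg (h ≫ ·) ((shiftFunctor _ (1 : ℤ)).map_id _)).trans (Category.comp_id h)

/-- The class of objects having a representative with contractible terms is not visibly closed under
cones or sums; as a left orthogonal it is both. -/
theorem contractiblePart_eq : contractiblePart k = (invariantPart k).leftOrthogonal :=
  le_antisymm (fun _ hX _ f hY => rightOrthogonal_contractiblePart hY f hX)
    (leftOrthogonal_le_of_triangles (fun _ => rightOrthogonal_contractiblePart)
      exists_distinguished_contractible_invariant)

theorem invariantPart_eq_rightOrthogonal :
    invariantPart k = (contractiblePart k).rightOrthogonal :=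
  le_antisymm (fun _ => rightOrthogonal_contractiblePart)
    (rightOrthogonal_le_of_triangles (fun _ => rightOrthogonal_contractiblePart)
      exists_distinguished_contractible_invariant)

instance : (invariantPart k).IsTriangulated := by
  rw [invariantPart_eq_rightOrthogonal]
  infer_instance

instance : (contractiblePart k).IsTriangulated := by
  rw [contractiblePart_eq]
  infer_instance

theorem isSemiorthogonalDecomposition :
    IsSemiorthogonalDecomposition (invariantPart k) (contractiblePart k) where
  isTriangulated_left := inferInstance
  isTriangulated_right := inferInstance
  isClosedUnderIsomorphisms_left := inferInstance
  isClosedUnderIsomorphisms_right := inferInstance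
  hom_eq_zero _ _ hY hX f := rightOrthogonal_contractiblePart hX f hY
  exists_triangle := exists_distinguished_contractible_invariant

theorem bijective_suslinMinusUnit_comp (K : (boundedAbove k).FullSubcategory) {W : DMinus k}
    (hW : invariantPart k W) : Function.Bijective
      (fun φ : (suslinMinus k).obj K ⟶ W => (suslinMinusUnit k).app K ≫ φ) := by
  obtain ⟨B, hB, f, h, hT⟩ := exists_distinguished_suslinMinusUnit K
  exact bijective_comp_of_distinguished hB hT (rightOrthogonal_contractiblePart hW)

instance : (invariantPart k).ι.IsRightAdjoint :=
  isRightAdjoint_ι_of_bijective _ fun Z => by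
    obtain ⟨Y, X, hY, hX, f, g, h, hT⟩ := exists_distinguished_contractible_invariant Z
    exact ⟨X, hX, g, fun W hW => bijective_comp_of_distinguished hY hT
      (rightOrthogonal_contractiblePart hW)⟩

variable {L : DMinus k ⥤ (invariantPart k).FullSubcategory} (adj : L ⊣ (invariantPart k).ι)

theorem unit_comp_injective {Z W : DMinus k} (hW : invariantPart k W)
    {a b : (L.obj Z).obj ⟶ W} (h : adj.unit.app Z ≫ a = adj.unit.app Z ≫ b) : a = b := by
  let a' : L.obj Z ⟶ ⟨W, hW⟩ := ObjectProperty.homMk a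
  let b' : L.obj Z ⟶ ⟨W, hW⟩ := ObjectProperty.homMk b
  have : a' = b' := (adj.homEquiv Z ⟨W, hW⟩).injective
    ((adj.homEquiv_unit _ _ a').trans (Eq.trans h (adj.homEquiv_unit _ _ b').symm))
  exact congrArg (fun f => f.hom) this

/-- The comparison of a left adjoint of the inclusion of `invariantPart k` and the Suslin complex. -/
noncomputable def adjointToSuslinApp (K : (boundedAbove k).FullSubcategory) :
    (L.obj ((QMinus k).obj K)).obj ⟶ (suslinMinus k).obj K :=
  ((adj.homEquiv ((QMinus k).obj K) ⟨_, invariantPart_suslinMinus K⟩).symm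
    ((suslinMinusUnit k).app K)).hom

theorem unit_adjointToSuslinApp (K : (boundedAbove k).FullSubcategory) :
    adj.unit.app ((QMinus k).obj K) ≫ adjointToSuslinApp adj K = (suslinMinusUnit k).app K :=
  (adj.homEquiv_unit _ ⟨_, invariantPart_suslinMinus K⟩ _).symm.trans
    (Equiv.apply_symm_apply (adj.homEquiv _ ⟨_, invariantPart_suslinMinus K⟩)
      ((suslinMinusUnit k).app K))

/-- Both the unit of the adjunction and `K → C^*(K)` are universal among morphisms from `K` to
homotopy invariant objects, so the comparison between them is invertible. -/
instance (K : (boundedAbove k).FullSubcategory) : IsIso (adjointToSuslinApp adj K) := by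
  let η : (QMinus k).obj K ⟶ (L.obj ((QMinus k).obj K)).obj := adj.unit.app ((QMinus k).obj K)
  have h : η ≫ adjointToSuslinApp adj K = (suslinMinusUnit k).app K :=
    unit_adjointToSuslinApp adj K
  obtain ⟨ψ, hψ⟩ := (bijective_suslinMinusUnit_comp K (L.obj ((QMinus k).obj K)).property).2 η
  refine ⟨ψ, unit_comp_injective adj (L.obj ((QMinus k).obj K)).property ?_,
    (bijective_suslinMinusUnit_comp K (invariantPart_suslinMinus K)).1 ?_⟩
  · change η ≫ adjointToSuslinApp adj K ≫ ψ = η ≫ 𝟙 _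
    rw [← Category.assoc, h, Category.comp_id]
    exact hψ
  · change (suslinMinusUnit k).app K ≫ ψ ≫ adjointToSuslinApp adj K =
      (suslinMinusUnit k).app K ≫ 𝟙 _
    rw [← Category.assoc, Category.comp_id]
    exact (congrArg (· ≫ _) hψ).trans h

theorem adjointToSuslinApp_naturality {K K' : (boundedAbove k).FullSubcategory} (f : K ⟶ K') :
    (L.map ((QMinus k).map f)).hom ≫ adjointToSuslinApp adj K' =
      adjointToSuslinApp adj K ≫ (suslinMinus k).map f := by
  refine unit_comp_injective adj (invariantPart_suslinMinus K') ?_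
  refine (Category.assoc _ _ _).symm.trans ((congrArg (· ≫ adjointToSuslinApp adj K')
    (adj.unit.naturality ((QMinus k).map f)).symm).trans ((Category.assoc _ _ _).trans ?_))
  refine (congrArg ((QMinus k).map f ≫ ·) (unit_adjointToSuslinApp adj K')).trans ?_
  refine ((suslinMinusUnit k).naturality f).trans (Eq.trans ?_ (Category.assoc _ _ _))
  exact congrArg (· ≫ (suslinMinus k).map f) (unit_adjointToSuslinApp adj K).symm

variable (L) in
/-- A left adjoint of the inclusion of `invariantPart k` is given by the Suslin complex. -/
noncomputable def adjointIsoSuslin : QMinus k ⋙ L ⋙ (invariantPart k).ι ⋙ Minus.ι ≅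
    (boundedAbove k).ι ⋙ suslin k ⋙ Q :=
  NatIso.ofComponents (fun K => Minus.ι.mapIso (asIso (adjointToSuslinApp adj K)))
    fun f => congrArg (Minus.ι.map ·) (adjointToSuslinApp_naturality adj f)

theorem boundedPart_singleMinus (F : PreWtr k) : boundedPart k ((singleMinus k).obj F) :=
  ⟨0, inferInstanceAs (IsGE ((singleFunctor _ 0).obj F) 0)⟩

theorem invariantPart_singleMinus {F : PreWtr k} (hF : IsHomotopyInvariant F) :
    invariantPart k ((singleMinus k).obj F) := fun n => by
  by_cases hn : n = 0
  · subst hn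
    exact isHomotopyInvariant_of_iso (nonempty_homology_single_iso F 0).some.symm hF
  · exact isHomotopyInvariant_of_isZero (isZero_homology_single F hn)

theorem contractiblePart_singleMinus {F : PreWtr k} (hF : IsContractible F) :
    contractiblePart k ((singleMinus k).obj F) := by
  refine ⟨⟨(HomologicalComplex.single _ (ComplexShape.up ℤ) 0).obj F, 0, inferInstance⟩,
    fun n => ?_, ⟨Iso.refl _⟩⟩
  exact isContractible_single_X hF 0 n

/-- The bounded part of `invariantPart k` is generated by the homotopy invariant presheaves. -/
theorem isLeast_invariantPart_inf_boundedPart :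
    IsLeast {P : ObjectProperty (DMinus k) | P.IsTriangulated ∧ P.IsClosedUnderIsomorphisms ∧
      ∀ F : PreWtr k, IsHomotopyInvariant F → P ((singleMinus k).obj F)}
      (invariantPart k ⊓ boundedPart k) := by
  have : (boundedPart k).IsTriangulated :=
    inferInstanceAs ((TStructure.t (C := PreWtr k)).plus.inverseImage Minus.ι).IsTriangulated
  have : (boundedPart k).IsClosedUnderIsomorphisms := inferInstanceAs
    ((TStructure.t (C := PreWtr k)).plus.inverseImage Minus.ι).IsClosedUnderIsomorphisms
  refine ⟨⟨inferInstance, inferInstance, fun F hF =>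
    ⟨invariantPart_singleMinus hF, boundedPart_singleMinus F⟩⟩, ?_⟩
  rintro P ⟨_, _, hP⟩ X ⟨hX, hX'⟩
  rw [invariantPart_eq] at hX
  exact prop_of_minusPlus _ P (fun F hF => hP F ((homZero_reprQuotient_iff F).1 hF)) hX hX'

/-- `invariantPart k` is generated by the homotopy invariant presheaves under products. -/
theorem isLeast_invariantPart :
    IsLeast {P : ObjectProperty (DMinus k) | P.IsTriangulated ∧ P.IsClosedUnderIsomorphisms ∧
      (∀ J : Type (u + 1), P.IsClosedUnderLimitsOfShape (Discrete J)) ∧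
      ∀ F : PreWtr k, IsHomotopyInvariant F → P ((singleMinus k).obj F)} (invariantPart k) := by
  refine ⟨⟨inferInstance, inferInstance, fun J => ?_, fun F => invariantPart_singleMinus⟩, ?_⟩
  · rw [invariantPart_eq_rightOrthogonal]
    infer_instance
  · rintro P ⟨_, _, hJ, hP⟩ X hX
    -- Countable families are indexed by a type of the universe in which closure is assumed; the
    -- equivalence below transports closure to `ℕ`.
    have := hJ (ULift ℕ)
    have := ObjectProperty.IsClosedUnderLimitsOfShape.of_equivalence (P := P)
      (Discrete.equivalence (Equiv.ulift (α := ℕ)))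
    rw [invariantPart_eq] at hX
    exact prop_of_homologyProp _ P (fun F hF => hP F ((homZero_reprQuotient_iff F).1 hF)) hX

/-- `contractiblePart k` is generated by the presheaves `ℤ(𝔸¹ × X) / ℤ(X)` under direct sums. -/
theorem isLeast_contractiblePart :
    IsLeast {P : ObjectProperty (DMinus k) | P.IsTriangulated ∧ P.IsClosedUnderIsomorphisms ∧
      (∀ J : Type (u + 1), P.IsClosedUnderColimitsOfShape (Discrete J)) ∧
      ∀ X : WCor k, P ((singleMinus k).obj (reprQuotient X))} (contractiblePart k) := by
  refine ⟨⟨inferInstance, inferInstance, fun J => ?_,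
    fun X => contractiblePart_singleMinus (isContractible_reprQuotient X)⟩, ?_⟩
  · rw [contractiblePart_eq]
    infer_instance
  · rintro P ⟨_, _, hJ, hP⟩ X hX
    have := hJ (ULift ℕ)
    have := ObjectProperty.IsClosedUnderColimitsOfShape.of_equivalence (P := P)
      (Discrete.equivalence (Equiv.ulift (α := ℕ)))
    -- The object is now orthogonal to everything whose cohomology has no morphism from the
    -- generators, the situation of `prop_of_leftOrthogonal`.
    rw [contractiblePart_eq, invariantPart_eq] at hX
    exact prop_of_leftOrthogonal _ P hP hX

end

end WittMotives

theorem mainTheorem5 (k : Type u) [Field k] [PerfectField k] (h2 : (2 : k) ≠ 0)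
    [HasDerivedCategory.{w} (PreWtr k)] :
    IsSemiorthogonalDecomposition (invariantPart k) (contractiblePart k) ∧
    (∃ (L : DMinus k ⥤ (invariantPart k).FullSubcategory) (adj : L ⊣ (invariantPart k).ι)
      (e : QMinus k ⋙ L ⋙ (invariantPart k).ι ⋙ DerivedCategory.Minus.ι ≅
        (boundedAbove k).ι ⋙ suslin k ⋙ DerivedCategory.Q),
      ∀ K : (boundedAbove k).FullSubcategory,
        (adj.unit.app ((QMinus k).obj K)).hom ≫ e.hom.app K =
          DerivedCategory.Q.map ((suslinUnit k).app K.obj)) ∧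
    (∀ K : (boundedAbove k).FullSubcategory, ∃ (B : DMinus k) (_ : contractiblePart k B)
      (f : B.obj ⟶ DerivedCategory.Q.obj K.obj)
      (h : DerivedCategory.Q.obj ((suslin k).obj K.obj) ⟶ B.obj⟦(1 : ℤ)⟧),
      Triangle.mk f (DerivedCategory.Q.map ((suslinUnit k).app K.obj)) h ∈
        distinguishedTriangles) ∧
    IsLeast {P : ObjectProperty (DMinus k) | P.IsTriangulated ∧ P.IsClosedUnderIsomorphisms ∧
        ∀ F : PreWtr k, IsHomotopyInvariant F → P ((singleMinus k).obj F)}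
      (invariantPart k ⊓ boundedPart k) ∧
    IsLeast {P : ObjectProperty (DMinus k) | P.IsTriangulated ∧ P.IsClosedUnderIsomorphisms ∧
        (∀ J : Type (u + 1), P.IsClosedUnderLimitsOfShape (Discrete J)) ∧
        ∀ F : PreWtr k, IsHomotopyInvariant F → P ((singleMinus k).obj F)}
      (invariantPart k) ∧
    IsLeast {P : ObjectProperty (DMinus k) | P.IsTriangulated ∧ P.IsClosedUnderIsomorphisms ∧
        (∀ J : Type (u + 1), P.IsClosedUnderColimitsOfShape (Discrete J)) ∧
        ∀ X : WCor k, P ((singleMinus k).obj (reprQuotient X))}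
      (contractiblePart k) := by
  refine ⟨isSemiorthogonalDecomposition, ⟨_, Adjunction.ofIsRightAdjoint (invariantPart k).ι,
    adjointIsoSuslin _ (Adjunction.ofIsRightAdjoint (invariantPart k).ι), fun K => ?_⟩,
    exists_distinguished_suslinUnit, isLeast_invariantPart_inf_boundedPart, isLeast_invariantPart,
    isLeast_contractiblePart⟩
  exact congrArg (DerivedCategory.Minus.ι.map ·) (unit_adjointToSuslinApp _ K)
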